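/- **Conventions.** For $\varphi\in(0,\pi)$ let $S_\varphi=\{z\neq 0: |\arg z|<\varphi\}$, and $S_0=(0,\infty)$. For $\omega\in(0,\pi/2]$, $a\ge 0$ let $BS_{\omega,a}=(-a+S_{\pi-\omega})\cap(a-S_{\pi-\omega})$, except that $BS_{\pi/2,0}=i\mathbb R$. For a closed operator $A$ on a complex Banach space $X$ let $R(\lambda,A)=(\lambda I-A)^{-1}$ for $\lambda\in\rho(A)$, and let $\widetilde\sigma(A)=\sigma(A)$ if $A$ is bounded with domain $X$, $\widetilde\sigma(A)=\sigma(A)\cup\{\infty\}$ otherwise. A closed operator $B$ is *sectorial of angle* $\beta\in[0,\pi)$ if $\sigma(B)\subset\overline{S_\beta}$ and $\sup_{\lambda\notin S_{\beta'}}\|\lambda R(\lambda,B)\|<\infty$ for all $\beta'\in(\beta,\pi)$ (the point $\lambda=0$ is disregarded). A closed operator $A$ is *bisectorial of angle $\omega$ and half-width $a$* if $\sigma(A)\subset\overline{BS_{\omega,a}}$ and $\sup\{\min\{|\lambda-a|,|\lambda+a|\}\,\|R(\lambda,A)\|:\lambda\notin\overline{BS_{\omega',a}}\}<\infty$ for all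 $\omega'\in(0,\omega)$. Put $M_A=\{-a,a,\infty\}\cap\widetilde\sigma(A)$. *Regions.* An admissible region is a set $\Omega=\Omega_{\varphi,\varepsilon,R}$ obtained from $BS_{\varphi,a}$, $0<\varphi<\omega$, by removing the closed disc $\overline{B_\varepsilon(d)}$ for each $d\in\{-a,a\}\setminus M_A$ and, if $\infty\notin M_A$, intersecting with $\{|z|<R\}$; here $\varepsilon>0$, $\varepsilon<a$ if $a>0$, $\overline{B_\varepsilon(d)}\subset\rho(A)$ for these $d$, $R>a$, and $\sigma(A)\subset\{|z|<R\}$ if $\infty\notin M_A$. If $M_A=\{-a,a,\infty\}$ then $\Omega=BS_{\varphi,a}$. *Natural functional calculus of $A$.* $\mathcal E_0(\Omega)$ is the set of bounded holomorphic $f$ on $\Omega$ that tend to $0$ at each point of $M_A$ and satisfy $\int_{\partial BS_{\theta,a}\cap\Omega}\frac{|f(z)|}{\min\{|z-a|,|z+a|\}}|dz|<\infty$ for all $\theta\in(\varphi,\pi/2]$; for such $f$, $f(A)=\frac1{2\pi i}\int_{\partial\Omega'}f(z)R(z,A)\,dz$ with $\Omega'=\Omega_{\varphi',\varepsilon',R'}$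 admissible, $\varphi'>\varphi$, $\varepsilon'>\varepsilon$, $R'<R$, and $\partial\Omega'$ positively oriented. Let $\mathcal E(\Omega)=\mathcal E_0(\Omega)+\mathbb C\frac1{b+z}+\mathbb C\frac1{b-z}$ with $b>a$, and extend $f\mapsto f(A)$ linearly by $\frac1{b+z}\mapsto -R(-b,A)$, $\frac1{b-z}\mapsto R(b,A)$. A function $g$ that is meromorphic on some admissible $\Omega$ belongs to the natural functional calculus of $A$ if, for such an $\Omega$, there is $e\in\mathcal E(\Omega)$ with $e(A)$ injective and $eg\in\mathcal E(\Omega)$; then $g(A)=e(A)^{-1}(eg)(A)$. *Limits.* All limits at $d\in M_A$ are taken within $BS_{\varphi,a}$ for some $\varphi<\omega$. A function $f$ is *regular* at $d$ if $f(z)\to c\in\mathbb C$ as $z\to d$ and, for some neighbourhood $U$ of $d$ and some $\varphi<\omega$, $\int_{\partial BS_{\theta,a}\cap U}\frac{|f(z)-c|}{|z-d|}|dz|<\infty$ for all $\theta\in(\varphi,\pi/2)$ (with $|z|$ in place of $|z-d|$ if $d=\infty$). It is *quasi-regular* at $d$ if $f$ or $1/f$ is regular at $d$. It *tends to $0$ exactly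 polynomially* at $d$ if for some $\alpha>0$ the function $|f(z)|$ is bounded above and below, near $d$, by positive multiples of $|z-d|^\alpha$ (of $|z|^{-\alpha}$ if $d=\infty$), and *tends to $\infty$ exactly polynomially* if $1/f$ tends to $0$ exactly polynomially. **Theorem.** Let $\omega\in(0,\pi/2]$, $a\ge0$, $\beta\in[0,\pi)$, let $A$ be bisectorial of angle $\omega$ and half-width $a$ on a complex Banach space $X$, and let $g$ belong to the natural functional calculus of $A$. Assume: (a) for every $\gamma\in(\beta,\pi)$ there is an admissible region $\Omega$ with $g(\Omega)\subset\overline{S_\gamma}\cup\{\infty\}$ (if $M_A=\{-a,a,\infty\}$: there is $\varphi\in(0,\omega)$ with $g(BS_{\varphi,a})\subset\overline{S_\gamma}\cup\{\infty\}$); (b) $g$ is quasi-regular at every point of $M_A$; (c) at every point of $M_A$ where $g$ tends to $0$ or to $\infty$, it does so exactly polynomially. Then $g(A)$ is a sectorial operator of angle $\beta$. -/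

import Mathlib

open Filter Topology Set MeasureTheory

namespace BisectorialNFC

/-! ### Closed operators, spectrum, resolvent -/

section Operators

variable {X : Type*} [NormedAddCommGroup X] [NormedSpace ℂ X]

/-- `T` is a bounded two-sided inverse of `lam I - A : D(A) → X`. -/
def IsResolventAt (A : X →ₗ.[ℂ] X) (lam : ℂ) (T : X →L[ℂ] X) : Prop :=
  (∀ y : X, ∃ h : T y ∈ A.domain, lam • T y - A ⟨T y, h⟩ = y) ∧
    ∀ x : A.domain, T (lam • (x : X) - A x) = x

theorem IsResolventAt.unique {A : X →ₗ.[ℂ] X} {lam : ℂ} {T S : X →L[ℂ] X}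
    (hT : IsResolventAt A lam T) (hS : IsResolventAt A lam S) : T = S := by
  ext y
  obtain ⟨h, hy⟩ := hT.1 y
  have h2 := hS.2 ⟨T y, h⟩
  rw [hy] at h2
  exact h2.symm

/-- The resolvent set `ρ(A)`. -/
def resolventSet (A : X →ₗ.[ℂ] X) : Set ℂ := {lam | ∃ T, IsResolventAt A lam T}

/-- The spectrum `σ(A)`. -/
def spectrumSet (A : X →ₗ.[ℂ] X) : Set ℂ := (resolventSet A)ᶜ

open Classical in
/-- The resolvent `R(lam, A) = (lam I - A)⁻¹` (the value `0` is used off `ρ(A)`). -/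
noncomputable def res (A : X →ₗ.[ℂ] X) (lam : ℂ) : X →L[ℂ] X :=
  if h : ∃ T, IsResolventAt A lam T then h.choose else 0

theorem isResolventAt_res {A : X →ₗ.[ℂ] X} {lam : ℂ} (h : lam ∈ resolventSet A) :
    IsResolventAt A lam (res A lam) := by
  have h' : ∃ T, IsResolventAt A lam T := h
  rw [res, dif_pos h']
  exact h'.choose_spec

/-- The extended spectrum in the Riemann sphere: `∞` belongs to it exactly when `A` is not an
everywhere defined (hence, for closed `A`, bounded) operator. -/
def extSpectrum (A : X →ₗ.[ℂ] X) : Set (OnePoint ℂ) :=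
  (fun z : ℂ => (z : OnePoint ℂ)) '' spectrumSet A ∪
    {d | d = OnePoint.infty ∧ A.domain ≠ ⊤}

end Operators

/-! ### Sectors, bisectors, sectorial and bisectorial operators -/

/-- The open sector `S_φ` of half-angle `φ`, with `S_0 = (0, ∞)`. -/
def sector (φ : ℝ) : Set ℂ :=
  {z | (φ = 0 ∧ 0 < z.re ∧ z.im = 0) ∨ (φ ≠ 0 ∧ z ≠ 0 ∧ |z.arg| < φ)}

/-- The bisector `BS_{ω,a} = (-a + S_{π-ω}) ∩ (a - S_{π-ω})`, with `BS_{π/2,0} = iℝ`. -/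
def bisector (ω a : ℝ) : Set ℂ :=
  {z | (ω = Real.pi / 2 ∧ a = 0 ∧ z.re = 0) ∨
    (¬ (ω = Real.pi / 2 ∧ a = 0) ∧
      z + a ∈ sector (Real.pi - ω) ∧ a - z ∈ sector (Real.pi - ω))}

section Operators

variable {X : Type*} [NormedAddCommGroup X] [NormedSpace ℂ X]

/-- `A` is sectorial of angle `φ`. -/
def IsSectorial (A : X →ₗ.[ℂ] X) (φ : ℝ) : Prop :=
  A.IsClosed ∧ spectrumSet A ⊆ closure (sector φ) ∧
    ∀ φ' ∈ Ioo φ Real.pi, ∃ M > 0, ∀ lam ∉ sector φ', ‖lam • res A lam‖ ≤ M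

/-- `A` is bisectorial of angle `ω` and half-width `a`. -/
def IsBisectorial (A : X →ₗ.[ℂ] X) (ω a : ℝ) : Prop :=
  A.IsClosed ∧ spectrumSet A ⊆ closure (bisector ω a) ∧
    ∀ ω' ∈ Ioo 0 ω, ∃ M : ℝ, ∀ lam ∉ closure (bisector ω' a),
      min ‖lam - a‖ ‖lam + a‖ * ‖res A lam‖ ≤ M

/-- `M_A = {-a, a, ∞} ∩ σ̃(A)`. -/
def singPts (A : X →ₗ.[ℂ] X) (a : ℝ) : Set (OnePoint ℂ) :=
  {((-a : ℂ) : OnePoint ℂ), ((a : ℂ) : OnePoint ℂ), OnePoint.infty} ∩ extSpectrum A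

end Operators

/-! ### Regions and contours of the functional calculus -/

/-- Parameters of a region: an angle `φ`, a radius `ε` of the discs that are removed around those
of the points `±a` that are not in `M_A`, and a radius `R` of the disc around `0` to which the
region is restricted when `∞` is not in `M_A`. -/
structure Params where
  φ : ℝ
  ε : ℝ
  R : ℝ

section Regions

variable {X : Type*} [NormedAddCommGroup X] [NormedSpace ℂ X]

/-- The parameters are admissible for `A`, a bisectorial operator of angle `ω` and half-width `a`:
`0 < φ < ω`, the closed discs of radius `ε` around the points `d ∈ {a, -a} \ M_A` lie in `ρ(A)` and
`ε < a` if `a > 0`, and `R > max {a, r(A)}` if `A` is bounded (`r(A)` is the spectral radius). -/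
def Admissible (A : X →ₗ.[ℂ] X) (ω a : ℝ) (p : Params) : Prop :=
  (0 < p.φ ∧ p.φ < ω) ∧
  (0 < p.ε ∧ (0 < a → p.ε < a) ∧
    ∀ d ∈ ({(a : ℂ), -(a : ℂ)} : Set ℂ), (d : OnePoint ℂ) ∉ singPts A a →
      Metric.closedBall d p.ε ⊆ resolventSet A) ∧
  (a < p.R ∧ (OnePoint.infty ∉ singPts A a → spectrumSet A ⊆ Metric.ball 0 p.R))

/-- The points outside the closed discs around the points of `{a, -a} \ M_A`. -/
def offDiscs (A : X →ₗ.[ℂ] X) (a ε : ℝ) : Set ℂ :=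
  {z | ∀ d ∈ ({(a : ℂ), -(a : ℂ)} : Set ℂ), (d : OnePoint ℂ) ∉ singPts A a → ε < ‖z - d‖}

/-- The open disc of radius `R` around `0` if `∞ ∉ M_A`, the whole plane otherwise. -/
def inDisc (A : X →ₗ.[ℂ] X) (a R : ℝ) : Set ℂ :=
  {z | OnePoint.infty ∉ singPts A a → ‖z‖ < R}

/-- The open set on which the functions of the calculus live: the bisector `BS_{φ,a}`, cut off
near each of the points `a, -a, ∞` that is not in `M_A`. -/
def region (A : X →ₗ.[ℂ] X) (a : ℝ) (p : Params) : Set ℂ :=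
  bisector p.φ a ∩ (offDiscs A a p.ε ∩ inDisc A a p.R)

/-- The four rays `± (a + t e^{± iθ})`, `t > 0`, that form `∂ BS_{θ,a}`; `s` is the outer sign and
`τ` the sign in the exponent. -/
noncomputable def ray (a θ : ℝ) (s τ : ℤˣ) (t : ℝ) : ℂ :=
  ((s : ℤ) : ℂ) * ((a : ℂ) + t * Complex.exp (((τ : ℤ) : ℂ) * θ * Complex.I))

open Classical in
/-- The points of `{a, -a}` not in `M_A` (a single point at most when `a = 0`). -/
noncomputable def removedPts (A : X →ₗ.[ℂ] X) (a : ℝ) : Finset ℂ :=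
  ({(a : ℂ), -(a : ℂ)} : Finset ℂ).filter fun d => (d : OnePoint ℂ) ∉ singPts A a

open Classical in
/-- The integral `∫ F(z) dz` along the positively oriented boundary of `region A a p`. It consists
of the parts of the four rays inside the cut-offs (outwards for `τ = 1`, inwards for `τ = -1`), the
parts in `BS_{φ,a}` of the removed circles (clockwise), and, if `∞ ∉ M_A`, the parts in `BS_{φ,a}`
of the circle of radius `R` around `0` (anticlockwise). -/
noncomputable def contourIntegral {E : Type*} [NormedAddCommGroup E] [NormedSpace ℂ E]
    (A : X →ₗ.[ℂ] X) (a : ℝ) (p : Params) (F : ℂ → E) : E :=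
  (∑ s : ℤˣ, ∑ τ : ℤˣ,
    ∫ t in {t : ℝ | 0 < t ∧ ray a p.φ s τ t ∈ offDiscs A a p.ε ∩ inDisc A a p.R},
      (((τ : ℤ) : ℂ) * ((s : ℤ) : ℂ) * Complex.exp (((τ : ℤ) : ℂ) * p.φ * Complex.I)) •
        F (ray a p.φ s τ t))
  - (∑ d ∈ removedPts A a,
    ∫ θ in {θ : ℝ | θ ∈ Ioc (-Real.pi) Real.pi ∧
        circleMap d p.ε θ ∈ bisector p.φ a ∩ inDisc A a p.R},
      (p.ε * Complex.exp (θ * Complex.I) * Complex.I) • F (circleMap d p.ε θ))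
  + (if OnePoint.infty ∈ singPts A a then 0 else
    ∫ θ in {θ : ℝ | θ ∈ Ioc (-Real.pi) Real.pi ∧
        circleMap 0 p.R θ ∈ bisector p.φ a ∩ offDiscs A a p.ε},
      (p.R * Complex.exp (θ * Complex.I) * Complex.I) • F (circleMap 0 p.R θ))

/-- The filter of points `z ∈ Ω` with `z → d`, for `d` in the Riemann sphere. -/
noncomputable def towards (d : OnePoint ℂ) (Ω : Set ℂ) : Filter ℂ :=
  comap (fun z : ℂ => (z : OnePoint ℂ)) (𝓝 d) ⊓ 𝓟 Ω

/-! ### The primary calculus -/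

/-- The algebra `𝓔₀` on `region A a p`: bounded holomorphic functions that tend to `0` at the points
of `M_A` and are integrable along `∂ BS_{θ,a}`, within the region, for all `θ ∈ (φ, π/2]`, with
respect to `|dz| / min {|z - a|, |z + a|}`. (On circular arcs that cut off the points outside `M_A`
integrability is automatic for bounded functions.) -/
structure MemE0 (A : X →ₗ.[ℂ] X) (a : ℝ) (p : Params) (f : ℂ → ℂ) : Prop where
  holo : DifferentiableOn ℂ f (region A a p)
  bdd : ∃ C : ℝ, ∀ z ∈ region A a p, ‖f z‖ ≤ C
  lim : ∀ d ∈ singPts A a, Tendsto f (towards d (region A a p)) (𝓝 0)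
  int : ∀ θ ∈ Ioc p.φ (Real.pi / 2), ∀ s τ : ℤˣ,
    IntegrableOn (fun t => ‖f (ray a θ s τ t)‖ / min ‖ray a θ s τ t - a‖ ‖ray a θ s τ t + a‖)
      {t : ℝ | 0 < t ∧ ray a θ s τ t ∈ region A a p}

/-- The Cauchy integral `(2πi)⁻¹ ∫ f(z) R(z, A) dz` over the boundary of `region A a q`. -/
noncomputable def cauchyOp (A : X →ₗ.[ℂ] X) (a : ℝ) (q : Params) (f : ℂ → ℂ) : X →L[ℂ] X :=
  (2 * Real.pi * Complex.I : ℂ)⁻¹ • contourIntegral A a q fun z => f z • res A z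

/-- `f` belongs to the algebra `𝓔 = 𝓔₀ + ℂ (b + z)⁻¹ + ℂ (b - z)⁻¹`, `b > a`, on `region A a p`,
and `T = f(A)`. The contour is the boundary of a region `q` that is strictly inside `p`. -/
def IsPrimary (A : X →ₗ.[ℂ] X) (ω a : ℝ) (p : Params) (f : ℂ → ℂ) (T : X →L[ℂ] X) : Prop :=
  ∃ (f₀ : ℂ → ℂ) (c₁ c₂ : ℂ) (b : ℝ) (q : Params),
    MemE0 A a p f₀ ∧ a < b ∧
    (∀ z ∈ region A a p, f z = f₀ z + c₁ * (b + z)⁻¹ + c₂ * (b - z)⁻¹) ∧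
    Admissible A ω a q ∧ p.φ < q.φ ∧ p.ε < q.ε ∧ q.R < p.R ∧
    T = cauchyOp A a q f₀ + c₁ • (-res A (-(b : ℂ))) + c₂ • res A (b : ℂ)

/-! ### The natural functional calculus -/

/-- For an injective `T`, the operator `T⁻¹ S` with domain `{x | S x ∈ range T}`. -/
noncomputable def invComp (T S : X →L[ℂ] X) : X →ₗ.[ℂ] X :=
  Submodule.toLinearPMap
    (LinearMap.ker ((S : X →ₗ[ℂ] X) ∘ₗ LinearMap.fst ℂ X X
      - (T : X →ₗ[ℂ] X) ∘ₗ LinearMap.snd ℂ X X))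

theorem mem_graph_invComp {T S : X →L[ℂ] X} (hT : Function.Injective T) (x y : X) :
    (x, y) ∈ (invComp T S).graph ↔ T y = S x := by
  rw [invComp, Submodule.toLinearPMap_graph_eq]
  · simp only [LinearMap.mem_ker, LinearMap.sub_apply, LinearMap.comp_apply, LinearMap.fst_apply,
      LinearMap.snd_apply, ContinuousLinearMap.coe_coe]
    rw [sub_eq_zero, eq_comm]
  · rintro ⟨x, y⟩ h (rfl : x = 0)
    apply hT
    simpa [sub_eq_zero, eq_comm] using h

/-- `g ∈ 𝓜_A`, i.e. the meromorphic function `g` is defined by the natural functional calculus of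
`A`, and `B = g(A)`: for some admissible region `Ω`, `g` is meromorphic on `Ω` and there is
`e ∈ 𝓔(Ω)` such that `e(A)` is injective, `h = e g ∈ 𝓔(Ω)` and `B = e(A)⁻¹ (e g)(A)`. The product
`e g` is that of meromorphic functions, so it is compared with `h` off a discrete subset of `Ω`. -/
def IsNFC (A : X →ₗ.[ℂ] X) (ω a : ℝ) (g : ℂ → ℂ) (B : X →ₗ.[ℂ] X) : Prop :=
  ∃ p : Params, Admissible A ω a p ∧ MeromorphicOn g (region A a p) ∧
    ∃ (e h : ℂ → ℂ) (T S : X →L[ℂ] X), IsPrimary A ω a p e T ∧ IsPrimary A ω a p h S ∧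
      Function.Injective T ∧ h =ᶠ[codiscreteWithin (region A a p)] e * g ∧ B = invComp T S

end Regions

/-! ### Limit behaviour at the points of `M_A` -/

/-- `|z - d|` for finite `d`, and `|z|` for `d = ∞`. -/
noncomputable def absAt (d : OnePoint ℂ) (z : ℂ) : ℝ :=
  d.elim ‖z‖ fun d' => ‖z - d'‖

/-- `f(z) → c` as `z → d` in some bisector `BS_{φ,a}` with `φ < ω`. -/
def TendsAt (f : ℂ → ℂ) (ω a : ℝ) (d : OnePoint ℂ) (c : ℂ) : Prop :=
  ∃ φ ∈ Ioo 0 ω, Tendsto f (towards d (bisector φ a)) (𝓝 c)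

/-- `f` is regular at `d`: it has a limit `c ∈ ℂ` at `d` and, near `d`, `|f - c|` is integrable with
respect to `|dz| / |z - d|` (`|dz| / |z|` if `d = ∞`) along `∂ BS_{θ,a}` for all
`θ ∈ (φ, π/2)`, with some `φ < ω`. -/
def RegularAt (f : ℂ → ℂ) (ω a : ℝ) (d : OnePoint ℂ) : Prop :=
  ∃ c : ℂ, TendsAt f ω a d c ∧ ∃ φ ∈ Ioo 0 ω,
    ∃ U ∈ comap (fun z : ℂ => (z : OnePoint ℂ)) (𝓝 d),
      ∀ θ ∈ Ioo φ (Real.pi / 2), ∀ s τ : ℤˣ,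
        IntegrableOn (fun t => ‖f (ray a θ s τ t) - c‖ / absAt d (ray a θ s τ t))
          {t : ℝ | 0 < t ∧ ray a θ s τ t ∈ U}

/-- `f` is quasi-regular at `d`: `f` or `1/f` is regular at `d`. -/
def QuasiRegularAt (f : ℂ → ℂ) (ω a : ℝ) (d : OnePoint ℂ) : Prop :=
  RegularAt f ω a d ∨ RegularAt f⁻¹ ω a d

/-- `f(z) → 0` exactly polynomially as `z → d`: for some `α > 0`, `|f(z)| ∼ |z - d|^α`
(`|f(z)| ∼ |z|^{-α}` if `d = ∞`). -/
def ExactPolyZeroAt (f : ℂ → ℂ) (ω a : ℝ) (d : OnePoint ℂ) : Prop :=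
  ∃ φ ∈ Ioo 0 ω, ∃ α > (0 : ℝ),
    f =Θ[towards d (bisector φ a)] fun z => d.elim (‖z‖ ^ (-α)) fun d' => ‖z - d'‖ ^ α

end BisectorialNFC

open BisectorialNFC

namespace BisectorialNFC

open scoped Real
open Complex (I exp norm_real exp_mul_I coe_smul normSq_apply normSq_eq_norm_sq abs_arg_le_pi norm_exp_ofReal_mul_I continuous_re norm_mul_cos_arg ofReal_zero arg_ofReal_of_nonneg slitPlane continuous_ofReal ofReal_cos ofReal_sin)
open Real (sin cos norm_of_nonneg pi_pos sin_pos_of_pos_of_lt_pi norm_eq_abs cos_abs sin_sq_add_cos_sq rpow_neg inv_rpow)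
open OnePoint (infty coe_ne_infty elim_some coe_eq_coe elim_infty)
open Lagrange (nodal)
open Ring (inverse)
open Int (units_eq_one_or)
open Metric (mem_ball mem_closedBall closedBall ball_mem_nhds cobounded_eq_cocompact closedBall_subset_closedBall)
open Finset (sum_nonneg sum_le_sum sum_mul single_le_sum sum_congr)

variable {X : Type*} [NormedAddCommGroup X] [NormedSpace ℂ X] {A : X →ₗ.[ℂ] X} {ω a : ℝ}
  {p q : Params} {f : ℂ → ℂ} {z : ℂ} {d : OnePoint ℂ} {δ φ : ℝ}

lemma res_mem_domain {l : ℂ} (h : l ∈ resolventSet A) (y : X) :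
    ∃ h : res A l y ∈ A.domain, l • res A l y - A ⟨res A l y, h⟩ = y :=
  (isResolventAt_res h).1 y

lemma res_apply {l : ℂ} (h : l ∈ resolventSet A) (x : A.domain) : res A l (l • (x : X) - A x) = x :=
  (isResolventAt_res h).2 x

lemma IsResolventAt.res_eq {l : ℂ} {T : X →L[ℂ] X} (h : IsResolventAt A l T) : res A l = T :=
  (isResolventAt_res ⟨T, h⟩).unique h

lemma res_injective {l : ℂ} (h : l ∈ resolventSet A) : Function.Injective (res A l) := by
  refine (injective_iff_map_eq_zero _).2 fun y hy => ?_
  obtain ⟨h1, h2⟩ := res_mem_domain h y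
  rw [← h2]
  have : (⟨res A l y, h1⟩ : A.domain) = 0 := Subtype.ext hy
  rw [this, hy]; simp

/-- The resolvent identity. -/
lemma res_sub_res {l m : ℂ} (hl : l ∈ resolventSet A)
    (hm : m ∈ resolventSet A) : res A l - res A m = (m - l) • (res A l * res A m) := by
  ext y
  obtain ⟨h1, h2⟩ := res_mem_domain hm y
  have h3 := res_apply hl ⟨_, h1⟩
  have h4 : l • res A m y - A ⟨res A m y, h1⟩ = y - (m - l) • res A m y := by
    rw [sub_smul]; linear_combination (norm := module) h2
  simp only at h3
  rw [h4, map_sub, map_smul, sub_eq_iff_eq_add'] at h3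
  simp_all

lemma res_mul_comm (A : X →ₗ.[ℂ] X) (l m : ℂ) : res A l * res A m = res A m * res A l := by
  by_cases hl : l ∈ resolventSet A
  · by_cases hm : m ∈ resolventSet A
    · by_cases h : l = m
      · rw [h]
      · have h1 := res_sub_res hl hm
        have h2 := res_sub_res hm hl
        rw [← neg_sub, h1, ← neg_smul, neg_sub] at h2
        exact smul_right_injective _ (sub_ne_zero.2 h) h2
    · have : res A m = 0 := dif_neg hm
      simp [this]
  · have : res A l = 0 := dif_neg hl
    simp [this]

lemma isResolventAt_mul_inverse [CompleteSpace X] {l m : ℂ}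
    (hl : l ∈ resolventSet A) (h : ‖(l - m) • res A l‖ < 1) :
    IsResolventAt A m (res A l * inverse (1 - (l - m) • res A l)) := by
  set K : X →L[ℂ] X := (l - m) • res A l with hK
  have h1 : (1 - K) * inverse (1 - K) = 1 :=
    Ring.mul_inverse_cancel _ (isUnit_one_sub_of_norm_lt_one h)
  have h2 : inverse (1 - K) * (1 - K) = 1 :=
    Ring.inverse_mul_cancel _ (isUnit_one_sub_of_norm_lt_one h)
  have h3 : res A l * inverse (1 - K) = inverse (1 - K) * res A l := by
    have : Commute (res A l) (1 - K) := by
      rw [hK]; exact (Commute.one_right _).sub_right ((Commute.refl _).smul_right _)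
    calc res A l * inverse (1 - K)
        = (inverse (1 - K) * (1 - K)) * res A l * inverse (1 - K) := by rw [h2, one_mul]
      _ = inverse (1 - K) * (res A l * (1 - K)) * inverse (1 - K) := by grind
      _ = inverse (1 - K) * res A l := by rw [mul_assoc, mul_assoc (res A l), h1, mul_one]
  refine ⟨fun y => ?_, fun x => ?_⟩
  · obtain ⟨h4, h5⟩ := res_mem_domain hl (inverse (1 - K) y)
    refine ⟨h4, ?_⟩
    have h6 : inverse (1 - K) y - (l - m) • res A l (inverse (1 - K) y) = y :=
      congrArg (fun T : X →L[ℂ] X => T y) h1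
    change m • res A l (inverse (1 - K) y) - A ⟨res A l (inverse (1 - K) y), h4⟩ = y
    rw [sub_smul] at h6
    grind
  · rw [h3]
    change inverse (1 - K) (res A l (m • (x : X) - A x)) = x
    have h4 := res_apply hl x
    have h5 : m • (x : X) - A x = (l • (x : X) - A x) - (l - m) • (x : X) := by rw [sub_smul]; abel
    have h6 : res A l (m • (x : X) - A x) = (1 - K) x := by simp_all
    grind

lemma eventually_mem_resolventSet [CompleteSpace X] {l : ℂ} :
    ∀ᶠ m in 𝓝 l, ‖(l - m) • res A l‖ < 1 := by
  have : Tendsto (fun m : ℂ => ‖(l - m) • res A l‖) (𝓝 l) (𝓝 ‖(l - l) • res A l‖) := by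
    apply Continuous.tendsto; fun_prop
  rw [sub_self, zero_smul, norm_zero] at this
  exact this.eventually (gt_mem_nhds one_pos)

lemma isOpen_resolventSet [CompleteSpace X] (A : X →ₗ.[ℂ] X) : IsOpen (resolventSet A) := by
  rw [isOpen_iff_eventually]
  intro l hl
  filter_upwards [eventually_mem_resolventSet (A := A)] with m hm
  exact ⟨_, isResolventAt_mul_inverse hl hm⟩

lemma differentiableAt_res [CompleteSpace X] {l : ℂ}
    (hl : l ∈ resolventSet A) : DifferentiableAt ℂ (res A) l := by
  have h1 : res A =ᶠ[𝓝 l] fun m => res A l * inverse (1 - (l - m) • res A l) := by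
    filter_upwards [eventually_mem_resolventSet (A := A)] with m hm
    exact (isResolventAt_mul_inverse hl hm).res_eq
  refine DifferentiableAt.congr_of_eventuallyEq ?_ h1
  have h2 : DifferentiableAt ℂ (inverse : (X →L[ℂ] X) → _) (1 - (l - l) • res A l) := by
    rw [sub_self, zero_smul, sub_zero]
    exact differentiableAt_inverse isUnit_one
  fun_prop

lemma analyticAt_res [CompleteSpace X] {l : ℂ} (hl : l ∈ resolventSet A) : AnalyticAt ℂ (res A) l :=
  DifferentiableOn.analyticAt (s := resolventSet A)
    (fun m hm => (differentiableAt_res hm).differentiableWithinAt)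
    ((isOpen_resolventSet A).mem_nhds hl)

lemma continuousAt_res [CompleteSpace X] {l : ℂ}
    (hl : l ∈ resolventSet A) : ContinuousAt (res A) l :=
  (differentiableAt_res hl).continuousAt

lemma exists_norm_res_le_of_isCompact [CompleteSpace X] {K : Set ℂ}
    (hK : IsCompact K) (h : K ⊆ resolventSet A) : ∃ C : ℝ, 0 ≤ C ∧ ∀ z ∈ K, ‖res A z‖ ≤ C := by
  obtain ⟨C, hC⟩ := hK.exists_bound_of_continuousOn fun z hz =>
    (continuousAt_res (h hz)).continuousWithinAt
  exact ⟨max C 0, le_max_right _ _, fun z hz => (hC z hz).trans (le_max_left _ _)⟩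

/-- An everywhere defined closed operator, as a bounded operator. -/
lemma exists_bounded_of_domain_eq_top [CompleteSpace X] (hA : A.IsClosed)
    (h : A.domain = ⊤) : ∃ A' : X →L[ℂ] X, ∀ x : A.domain, A x = A' x := by
  let f : X →ₗ[ℂ] X := A.toFun ∘ₗ (LinearMap.codRestrict A.domain LinearMap.id fun x => by
    rw [h]; trivial)
  have hcl : _root_.IsClosed (f.graph : Set (X × X)) := by
    have : (f.graph : Set (X × X)) = A.graph := by
      ext ⟨x, y⟩
      aesop
    rw [this]; exact hA
  exact ⟨⟨f, f.continuous_of_isClosed_graph hcl⟩, fun x => rfl⟩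

lemma isResolventAt_of_bounded (h : A.domain = ⊤) {A' : X →L[ℂ] X}
    (hA' : ∀ x : A.domain, A x = A' x) {l : ℂ} (hl : l ∈ _root_.resolventSet ℂ A') :
    IsResolventAt A l (resolvent A' l) := by
  have h1 : (algebraMap ℂ (X →L[ℂ] X) l - A') * resolvent A' l = 1 := Ring.mul_inverse_cancel _ hl
  have h2 : resolvent A' l * (algebraMap ℂ (X →L[ℂ] X) l - A') = 1 := Ring.inverse_mul_cancel _ hl
  refine ⟨fun y => ⟨by rw [h]; trivial, ?_⟩, fun x => ?_⟩
  · rw [hA']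
    have := congrArg (fun T : X →L[ℂ] X => T y) h1
    assumption
  · rw [hA']
    have := congrArg (fun T : X →L[ℂ] X => T x) h2
    assumption

lemma spectrumSet_nonempty [CompleteSpace X] [Nontrivial X] (hA : A.IsClosed)
    (h : A.domain = ⊤) : (spectrumSet A).Nonempty := by
  obtain ⟨A', hA'⟩ := exists_bounded_of_domain_eq_top hA h
  obtain ⟨l, hl⟩ := spectrum.nonempty A'
  refine ⟨l, fun ⟨T, hT⟩ => hl ?_⟩
  have h1 : (algebraMap ℂ (X →L[ℂ] X) l - A') * T = 1 := by
    ext y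
    obtain ⟨h1, h2⟩ := hT.1 y
    simp_all
  have h2 : T * (algebraMap ℂ (X →L[ℂ] X) l - A') = 1 := by
    ext y
    have h2 := hT.2 ⟨y, by rw [h]; trivial⟩
    simp_all
  exact isUnit_iff_exists_and_exists.2 ⟨⟨T, h1⟩, ⟨T, h2⟩⟩

/-- The resolvent of a bounded operator decays at infinity. -/
lemma exists_norm_mul_norm_res_le [CompleteSpace X] (hA : A.IsClosed)
    (h : A.domain = ⊤) : ∃ C r : ℝ, ∀ z : ℂ, r ≤ ‖z‖ →
      z ∈ resolventSet A ∧ ‖z‖ * ‖res A z‖ ≤ C := by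
  obtain ⟨A', hA'⟩ := exists_bounded_of_domain_eq_top hA h
  obtain ⟨C, hC⟩ := (spectrum.resolvent_isBigO_inv (𝕜 := ℂ) A').bound
  have hres := spectrum.eventually_isUnit_resolvent (𝕜 := ℂ) A'
  obtain ⟨r, -, hr⟩ := hasBasis_cobounded_norm.eventually_iff.1 (hC.and hres)
  refine ⟨C, max r 1, fun z hz => ?_⟩
  obtain ⟨h1, h2⟩ := hr (le_trans (le_max_left r 1) hz)
  have hz1 : 0 < ‖z‖ := one_pos.trans_le (le_trans (le_max_right r 1) hz)
  have h3 := isResolventAt_of_bounded h hA' (spectrum.isUnit_resolvent.2 h2)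
  refine ⟨⟨_, h3⟩, ?_⟩
  rw [h3.res_eq]
  rw [norm_inv] at h1
  calc ‖z‖ * ‖resolvent A' z‖ ≤ ‖z‖ * (C * ‖z‖⁻¹) := by gcongr
    _ = C := by field_simp

/-- Twice the Wirtinger derivative `∂u/∂z̄` of a real-valued function. -/
noncomputable def db (u : ℂ → ℝ) (z : ℂ) : ℂ :=
  (fderiv ℝ u z 1 : ℂ) + (fderiv ℝ u z I : ℂ) * I

lemma db_congr {u v : ℂ → ℝ} (h : u =ᶠ[𝓝 z] v) : db u z = db v z := by rw [db, db, h.fderiv_eq]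

lemma db_eq_zero_of_eventually_const {u : ℂ → ℝ} {c : ℝ} (h : u =ᶠ[𝓝 z] fun _ => c) :
    db u z = 0 := by
  rw [db_congr h, db]; simp

lemma HasFDerivAt.db_eq {u : ℂ → ℝ} {L : ℂ →L[ℝ] ℝ} (h : HasFDerivAt u L z) :
    db u z = (L 1 : ℂ) + (L I : ℂ) * I := by
  rw [db, h.fderiv]

lemma db_mul {u v : ℂ → ℝ} (hu : DifferentiableAt ℝ u z) (hv : DifferentiableAt ℝ v z) :
    db (fun z => u z * v z) z = u z * db v z + v z * db u z := by
  rw [HasFDerivAt.db_eq (u := fun z => u z * v z) (hu.hasFDerivAt.mul hv.hasFDerivAt)]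
  simp [db]; ring

lemma db_add {u v : ℂ → ℝ} (hu : DifferentiableAt ℝ u z) (hv : DifferentiableAt ℝ v z) :
    db (fun z => u z + v z) z = db u z + db v z := by
  rw [HasFDerivAt.db_eq (u := fun z => u z + v z) (hu.hasFDerivAt.add hv.hasFDerivAt)]
  simp [db]; ring

lemma db_sub {u v : ℂ → ℝ} (hu : DifferentiableAt ℝ u z) (hv : DifferentiableAt ℝ v z) :
    db (fun z => u z - v z) z = db u z - db v z := by
  rw [HasFDerivAt.db_eq (u := fun z => u z - v z) (hu.hasFDerivAt.sub hv.hasFDerivAt)]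
  simp [db]; ring

lemma db_sub_const (u : ℂ → ℝ) (c : ℝ) (z : ℂ) : db (fun z => u z - c) z = db u z := by
  rw [db, db, fderiv_sub_const]

lemma db_const_sub (u : ℂ → ℝ) (c : ℝ) (z : ℂ) : db (fun z => c - u z) z = - db u z := by
  rw [db, db, fderiv_const_sub]; simp; ring

lemma db_sum {ι : Type*} {t : Finset ι} {u : ι → ℂ → ℝ} (hu : ∀ i ∈ t, DifferentiableAt ℝ (u i) z) :
    db (fun z => ∑ i ∈ t, u i z) z = ∑ i ∈ t, db (u i) z := by
  rw [HasFDerivAt.db_eq (HasFDerivAt.fun_sum fun i hi => (hu i hi).hasFDerivAt)]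
  simp [db, Finset.sum_add_distrib, sum_mul]

lemma db_comp {S : ℝ → ℝ} {u : ℂ → ℝ} (hS : DifferentiableAt ℝ S (u z))
    (hu : DifferentiableAt ℝ u z) : db (fun z => S (u z)) z = deriv S (u z) * db u z := by
  rw [HasFDerivAt.db_eq (u := fun z => S (u z)) (hS.hasDerivAt.comp_hasFDerivAt z hu.hasFDerivAt)]
  simp [db]; ring

lemma db_eq_zero_of_isLocalExtr {u : ℂ → ℝ} (h : IsLocalExtr u z) : db u z = 0 := by
  rw [db, h.fderiv_eq_zero]; simp

lemma db_norm_sq (c z : ℂ) : db (fun z => ‖z - c‖ ^ 2) z = 2 * (z - c) := by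
  have h1 : HasFDerivAt (fun z : ℂ => z - c) (ContinuousLinearMap.id ℝ ℂ) z :=
    (hasFDerivAt_id z).sub_const c
  rw [HasFDerivAt.db_eq h1.norm_sq]
  apply Complex.ext <;> simp [Complex.inner]

lemma db_norm_sub {c z : ℂ} (h : z ≠ c) : db (fun z => ‖z - c‖) z = (z - c) / ‖z - c‖ := by
  have h0 : z - c ≠ 0 := sub_ne_zero.2 h
  have hd : DifferentiableAt ℝ (fun z : ℂ => ‖z - c‖) z :=
    (differentiableAt_id.sub_const c).norm ℝ h0
  have h1 := db_norm_sq c z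
  have h2 : db (fun z => ‖z - c‖ ^ 2) z = 2 * ‖z - c‖ * db (fun z => ‖z - c‖) z := by
    have := db_comp (S := fun x => x ^ 2) (u := fun z => ‖z - c‖) (z := z) (by fun_prop) hd
    rw [this]; simp
  grind

lemma db_arg (h : z ∈ slitPlane) : db Complex.arg z = I * z / ‖z‖ ^ 2 := by
  have h1 : HasFDerivAt Complex.log ((ContinuousLinearMap.toSpanSingleton ℂ z⁻¹).restrictScalars ℝ)
    z := ((Complex.hasStrictDerivAt_log h).hasDerivAt.hasFDerivAt).restrictScalars ℝ
  have h2 : HasFDerivAt Complex.arg (Complex.imCLM.comp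
      ((ContinuousLinearMap.toSpanSingleton ℂ z⁻¹).restrictScalars ℝ)) z := by
    have := (Complex.imCLM.hasFDerivAt (x := Complex.log z)).comp z h1
    exact this.congr_of_eventuallyEq (Eventually.of_forall fun w => by simp [Complex.log_im])
  rw [HasFDerivAt.db_eq h2]
  have h3 : (‖z‖ : ℝ) ^ 2 = Complex.normSq z := (normSq_eq_norm_sq z).symm
  have h4 : ((‖z‖ : ℂ)) ^ 2 = (Complex.normSq z : ℝ) := by rw [← h3]; push_cast; ring
  rw [h4]
  apply Complex.ext <;> simp [Complex.inv_im, Complex.inv_re, Complex.div_re, Complex.div_im,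
    normSq_apply]

lemma contDiffAt_arg (h : z ∈ slitPlane) : ContDiffAt ℝ 1 Complex.arg z := by
  have h1 : ContDiffAt ℝ 1 Complex.log z := (Complex.contDiffAt_log h).restrict_scalars ℝ
  have := (Complex.imCLM.contDiff (n := 1)).contDiffAt.comp z h1
  exact this.congr_of_eventuallyEq (Eventually.of_forall fun w => by simp [Complex.log_im])

lemma deriv_smoothTransition_eq_zero {x : ℝ} (h : x ≤ 0 ∨ 1 ≤ x) :
    deriv Real.smoothTransition x = 0 := by
  rcases h with h | h
  · apply IsLocalMin.deriv_eq_zero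
    refine Eventually.of_forall fun y => ?_
    rw [Real.smoothTransition.zero_of_nonpos h]
    exact Real.smoothTransition.nonneg y
  · apply IsLocalMax.deriv_eq_zero
    refine Eventually.of_forall fun y => ?_
    rw [Real.smoothTransition.one_of_one_le h]
    exact Real.smoothTransition.le_one y

lemma continuous_deriv_smoothTransition : Continuous (deriv Real.smoothTransition) :=
  (Real.smoothTransition.contDiff (n := 1)).continuous_deriv le_rfl

lemma deriv_smoothTransition_nonneg (x : ℝ) : 0 ≤ deriv Real.smoothTransition x :=
  Real.smoothTransition.monotone.deriv_nonneg

lemma differentiableAt_smoothTransition (x : ℝ) : DifferentiableAt ℝ Real.smoothTransition x :=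
  (Real.smoothTransition.contDiff (n := 1)).differentiable one_ne_zero x

lemma exists_deriv_smoothTransition_le : ∃ B > 0, ∀ x, deriv Real.smoothTransition x ≤ B := by
  obtain ⟨B, hB⟩ := (isCompact_Icc (a := (0 : ℝ)) (b := 1)).exists_bound_of_continuousOn
    continuous_deriv_smoothTransition.continuousOn
  refine ⟨max B 1, by positivity, fun x => ?_⟩
  by_cases hx : x ∈ Icc (0 : ℝ) 1
  · exact (le_abs_self _).trans ((hB x hx).trans (le_max_left _ _))
  · rw [deriv_smoothTransition_eq_zero]
    · positivity
    · grind

section Stokes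

variable {E : Type*} [NormedAddCommGroup E] [NormedSpace ℂ E] [CompleteSpace E]

lemma tsupport_smul_subset {M F : Type*} [Zero M] [Zero F] [SMulWithZero M F] (f : ℂ → M)
    (g : ℂ → F) : tsupport (fun z => f z • g z) ⊆ tsupport f :=
  closure_mono fun z hz h => hz (by simp [show f z = 0 from h])

lemma continuous_of_tsupport {F : Type*} [TopologicalSpace F] [Zero F] {f : ℂ → F}
    (h : ∀ z ∈ tsupport f, ContinuousAt f z) : Continuous f := by
  rw [continuous_iff_continuousAt]
  intro z
  by_cases hz : z ∈ tsupport f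
  · exact h z hz
  · exact (continuousAt_const (y := (0 : F))).congr (notMem_tsupport_iff_eventuallyEq.1 hz).symm

/-- Cauchy's theorem for a compactly supported cut-off function. -/
lemma integral_db_smul_eq_zero_of_hasCompactSupport {U : ℂ → ℝ} {k : ℂ → E}
    (hU : ContDiff ℝ 1 U) (hc : HasCompactSupport U) (hk : ∀ z ∈ tsupport U, AnalyticAt ℂ k z) :
    Integrable (fun z => db U z • k z) ∧ ∫ z, db U z • k z = 0 := by
  have hkd : ∀ z ∈ tsupport U, DifferentiableAt ℝ k z := fun z hz =>
    (hk z hz).differentiableAt.restrictScalars ℝ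
  have hfd : ∀ z ∈ tsupport U, ∀ v : ℂ, fderiv ℝ k z v = v • deriv k z := by
    intro z hz v
    rw [(hk z hz).differentiableAt.hasFDerivAt.restrictScalars ℝ |>.fderiv]
    simp [fderiv_eq_smul_deriv]
  have h1 : ∀ v : ℂ, Integrable (fun z => fderiv ℝ U z v • k z) := by
    intro v
    have hs : tsupport (fun z => fderiv ℝ U z v • k z) ⊆ tsupport U := by
      exact (tsupport_smul_subset _ _).trans (tsupport_fderiv_apply_subset ℝ v)
    refine (continuous_of_tsupport fun z hz => ?_).integrable_of_hasCompactSupport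
      (hc.mono' ((subset_tsupport _).trans hs))
    exact ((hU.continuous_fderiv_apply one_ne_zero).comp
      (continuous_id.prodMk continuous_const)).continuousAt.smul (hk z (hs hz)).continuousAt
  have h2 : Integrable (fun z => U z • deriv k z) := by
    have hs : tsupport (fun z => U z • deriv k z) ⊆ tsupport U := tsupport_smul_subset _ _
    refine (continuous_of_tsupport fun z hz => ?_).integrable_of_hasCompactSupport
      (hc.mono' ((subset_tsupport _).trans hs))
    exact hU.continuous.continuousAt.smul (hk z (hs hz)).deriv.continuousAt
  have h2' : ∀ v : ℂ, (fun z => U z • fderiv ℝ k z v) = fun z => v • (U z • deriv k z) := by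
    intro v
    ext z
    by_cases hz : z ∈ tsupport U
    · rw [hfd z hz, smul_comm]
    · rw [image_eq_zero_of_notMem_tsupport hz]; simp
  have h3 : Integrable (fun z => U z • k z) := by
    have hs : tsupport (fun z => U z • k z) ⊆ tsupport U := tsupport_smul_subset _ _
    refine (continuous_of_tsupport fun z hz => ?_).integrable_of_hasCompactSupport
      (hc.mono' ((subset_tsupport _).trans hs))
    exact hU.continuous.continuousAt.smul (hk z (hs hz)).continuousAt
  have h4 : ∀ v : ℂ, ∫ z, fderiv ℝ U z v • k z = - (v • ∫ z, U z • deriv k z) := by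
    intro v
    have := integral_smul_fderiv_eq_neg_fderiv_smul_of_integrable (v := v) (μ := volume) (h1 v)
      (by rw [h2' v]; exact h2.smul v) h3 (fun z _ => (hU.differentiable one_ne_zero) z) hkd
    rw [h2' v, integral_smul] at this
    rw [this, neg_neg]
  have h5 : (fun z => db U z • k z) =
      fun z => fderiv ℝ U z 1 • k z + I • (fderiv ℝ U z I • k z) := by
    ext z
    rw [db, add_smul, mul_comm, mul_smul]
    simp only [coe_smul]
  rw [h5]
  have h6 : Integrable (fun z => I • (fderiv ℝ U z I • k z)) := (h1 _).smul _
  refine ⟨(h1 1).add h6, ?_⟩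
  rw [integral_add (h1 1) h6, integral_smul, h4, h4, smul_neg, smul_smul, Complex.I_mul_I]
  simp

lemma integrable_norm_inv_mul (c : ℂ) : Integrable fun z : ℂ => ‖z - c‖⁻¹ * ((1 + ‖z‖) ^ 2)⁻¹ := by
  have h1 : Integrable fun z : ℂ => ‖z‖⁻¹ * ((1 + ‖z‖) ^ 2)⁻¹ := by
    rw [integrable_fun_norm_addHaar (μ := (volume : Measure ℂ))
      (f := fun r : ℝ => r⁻¹ * ((1 + r) ^ 2)⁻¹), Complex.finrank_real_complex]
    have h2 : IntegrableOn (fun r : ℝ => (1 + r ^ 2)⁻¹) (Ioi 0) := integrable_inv_one_add_sq.integrableOn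
    refine h2.mono' (by fun_prop) ?_
    refine (ae_restrict_iff' measurableSet_Ioi).2 (Eventually.of_forall fun r (hr : 0 < r) => ?_)
    have : r ^ (2 - 1) • (r⁻¹ * ((1 + r) ^ 2)⁻¹) = ((1 + r) ^ 2)⁻¹ := by simp; field_simp
    rw [this, norm_of_nonneg (by positivity)]
    gcongr; nlinarith
  have h2 := (h1.comp_sub_right c).const_mul ((1 + ‖c‖) ^ 2)
  refine h2.mono' (by fun_prop) (Eventually.of_forall fun z => ?_)
  rw [norm_of_nonneg (by positivity), mul_left_comm]
  gcongr
  rw [← div_eq_mul_inv, le_div_iff₀ (by positivity), inv_mul_le_iff₀ (by positivity), ← mul_pow]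
  gcongr
  have : ‖z - c‖ ≤ ‖z‖ + ‖c‖ := norm_sub_le z c
  nlinarith [norm_nonneg z, norm_nonneg c, mul_nonneg (norm_nonneg z) (norm_nonneg c)]

/-- The integrable weight that dominates all area integrals. -/
noncomputable def wt (a : ℝ) (z : ℂ) : ℝ := (‖z - a‖⁻¹ + ‖z + a‖⁻¹) * ((1 + ‖z‖) ^ 2)⁻¹

lemma integrable_wt (a : ℝ) : Integrable (wt a) := by
  have h := (integrable_norm_inv_mul (a : ℂ)).add (integrable_norm_inv_mul (-a : ℂ))
  refine h.congr (Eventually.of_forall fun z => ?_)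
  simp [wt, add_mul]

/-- A smooth function of `‖z - c‖ ^ 2`. -/
noncomputable def sqCut (c : ℂ) (p q : ℝ) (z : ℂ) : ℝ := Real.smoothTransition (p * ‖z - c‖ ^ 2 + q)

lemma contDiff_sqCut (c : ℂ) (p q : ℝ) : ContDiff ℝ 1 (sqCut c p q) :=
  (Real.smoothTransition.contDiff (n := 1)).comp
    ((contDiff_const.mul ((contDiff_id.sub contDiff_const).norm_sq ℝ)).add contDiff_const)

lemma db_sqCut (c : ℂ) (p q : ℝ) (z : ℂ) :
    db (sqCut c p q) z = deriv Real.smoothTransition (p * ‖z - c‖ ^ 2 + q) * (2 * p * (z - c)) := by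
  have hd : DifferentiableAt ℝ (fun z : ℂ => ‖z - c‖ ^ 2) z :=
    ((contDiff_id.sub contDiff_const).norm_sq ℝ).differentiable one_ne_zero z
  have h1 := db_comp (S := fun x => Real.smoothTransition (p * x + q)) (u := fun z => ‖z - c‖ ^ 2)
    (z := z) ((differentiableAt_smoothTransition _).comp _ (by fun_prop)) hd
  have h2 : deriv (fun x => Real.smoothTransition (p * x + q)) (‖z - c‖ ^ 2)
      = deriv Real.smoothTransition (p * ‖z - c‖ ^ 2 + q) * p := by
    have h3 : HasDerivAt (fun x => p * x + q) p (‖z - c‖ ^ 2) := by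
      simpa using ((hasDerivAt_id (‖z - c‖ ^ 2)).const_mul p).add_const q
    exact ((differentiableAt_smoothTransition _).hasDerivAt.comp _ h3).deriv
  unfold sqCut
  rw [h1, h2, db_norm_sq]
  push_cast; ring

lemma norm_db_sqCut {B : ℝ} (hB : ∀ x, deriv Real.smoothTransition x ≤ B) (c : ℂ) (p q : ℝ)
    (z : ℂ) (h : 0 < p * ‖z - c‖ ^ 2 + q → p * ‖z - c‖ ^ 2 + q < 1 → |p| * ‖z - c‖ ^ 2 ≤ 2) :
    ‖db (sqCut c p q) z‖ ≤ 4 * B * ‖z - c‖⁻¹ := by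
  have hB0 : 0 ≤ B := (deriv_smoothTransition_nonneg 0).trans (hB 0)
  by_cases hx : p * ‖z - c‖ ^ 2 + q ≤ 0 ∨ 1 ≤ p * ‖z - c‖ ^ 2 + q
  · rw [db_sqCut, deriv_smoothTransition_eq_zero hx]
    simp; positivity
  · push Not at hx
    have h1 := h hx.1 hx.2
    rw [db_sqCut, norm_mul, norm_mul, norm_mul]
    simp only [norm_real, Complex.norm_ofNat, norm_eq_abs]
    rw [abs_of_nonneg (deriv_smoothTransition_nonneg _)]
    by_cases hz : ‖z - c‖ = 0
    · simp [hz]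
    have hz' : 0 < ‖z - c‖ := lt_of_le_of_ne (norm_nonneg _) (Ne.symm hz)
    have h2 : |p| * ‖z - c‖ ≤ 2 * ‖z - c‖⁻¹ := by rw [← div_eq_mul_inv, le_div_iff₀ hz']; nlinarith
    calc _ ≤ B * (2 * |p| * ‖z - c‖) := by gcongr; exact hB _
      _ = 2 * B * (|p| * ‖z - c‖) := by ring
      _ ≤ 2 * B * (2 * ‖z - c‖⁻¹) := by gcongr
      _ = _ := by ring

/-- A smooth function that vanishes near `a`, `-a` and `∞`. -/
noncomputable def trunc (a m : ℝ) (z : ℂ) : ℝ :=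
  sqCut a (m ^ 2) (-1) z * sqCut (-a) (m ^ 2) (-1) z * sqCut 0 (-(m ^ 2)⁻¹) 2 z

lemma sqCut_nonneg (c : ℂ) (p q : ℝ) (z : ℂ) : 0 ≤ sqCut c p q z := Real.smoothTransition.nonneg _

lemma sqCut_le_one (c : ℂ) (p q : ℝ) (z : ℂ) : sqCut c p q z ≤ 1 := Real.smoothTransition.le_one _

lemma contDiff_trunc (a m : ℝ) : ContDiff ℝ 1 (trunc a m) :=
  ((contDiff_sqCut _ _ _).mul (contDiff_sqCut _ _ _)).mul (contDiff_sqCut _ _ _)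

lemma norm_trunc_le_one (a m : ℝ) (z : ℂ) : ‖trunc a m z‖ ≤ 1 := by
  rw [trunc, norm_of_nonneg (mul_nonneg (mul_nonneg (sqCut_nonneg _ _ _ _) (sqCut_nonneg _ _ _ _))
    (sqCut_nonneg _ _ _ _))]
  exact mul_le_one₀ (mul_le_one₀ (sqCut_le_one _ _ _ _) (sqCut_nonneg _ _ _ _)
    (sqCut_le_one _ _ _ _)) (sqCut_nonneg _ _ _ _) (sqCut_le_one _ _ _ _)

lemma norm_inv_one_add_le (a : ℝ) (hz : z ≠ a) : (1 + ‖z‖)⁻¹ ≤ (1 + |a|) * ‖z - a‖⁻¹ := by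
  have h0 : 0 < ‖z - a‖ := norm_pos_iff.2 (sub_ne_zero.2 hz)
  rw [← div_eq_mul_inv, le_div_iff₀ h0, inv_mul_le_iff₀ (by positivity)]
  have : ‖z - a‖ ≤ ‖z‖ + |a| := by simpa using norm_sub_le z (a : ℂ)
  nlinarith [norm_nonneg z, abs_nonneg a, mul_nonneg (norm_nonneg z) (abs_nonneg a)]

lemma exists_norm_db_trunc_le (a : ℝ) : ∃ C, ∀ m : ℝ, 1 ≤ m → ∀ z : ℂ, z ≠ a → z ≠ -a →
    ‖db (trunc a m) z‖ ≤ C * (‖z - a‖⁻¹ + ‖z + a‖⁻¹) := by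
  obtain ⟨B, hB0, hB⟩ := exists_deriv_smoothTransition_le
  refine ⟨4 * B + 8 * B * (1 + |a|), fun m hm z hz1 hz2 => ?_⟩
  have h0 : 0 < ‖z - a‖ := norm_pos_iff.2 (sub_ne_zero.2 hz1)
  have h0' : 0 < ‖z + a‖ := norm_pos_iff.2 (by rwa [Ne, add_eq_zero_iff_eq_neg])
  have hd : ∀ (c : ℂ) (p q : ℝ), DifferentiableAt ℝ (sqCut c p q) z := fun c p q =>
    (contDiff_sqCut c p q).differentiable one_ne_zero z
  have e : db (trunc a m) z = sqCut a (m ^ 2) (-1) z * sqCut (-a) (m ^ 2) (-1) z *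
      db (sqCut 0 (-(m ^ 2)⁻¹) 2) z + sqCut 0 (-(m ^ 2)⁻¹) 2 z *
      (sqCut a (m ^ 2) (-1) z * db (sqCut (-a) (m ^ 2) (-1)) z
        + sqCut (-a) (m ^ 2) (-1) z * db (sqCut a (m ^ 2) (-1)) z) := by
    unfold trunc
    rw [db_mul (u := fun z => sqCut a (m ^ 2) (-1) z * sqCut (-a) (m ^ 2) (-1) z)
      ((hd _ _ _).mul (hd _ _ _)) (hd _ _ _), db_mul (hd _ _ _) (hd _ _ _)]
    push_cast; ring
  have b1 : ∀ c : ℂ, ‖db (sqCut c (m ^ 2) (-1)) z‖ ≤ 4 * B * ‖z - c‖⁻¹ := fun c =>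
    norm_db_sqCut hB _ _ _ _ fun _ h => by rw [abs_of_nonneg (by positivity)]; linarith
  have b3 : ‖db (sqCut 0 (-(m ^ 2)⁻¹) 2) z‖ ≤ 8 * B * (1 + |a|) * ‖z - a‖⁻¹ := by
    have hm2 : 1 ≤ m ^ 2 := by nlinarith
    by_cases hz : 1 ≤ ‖z‖
    · have h1 := norm_db_sqCut hB 0 (-(m ^ 2)⁻¹) 2 z fun h _ => by
        rw [abs_neg, abs_of_nonneg (by positivity)]; linarith
      rw [sub_zero] at h1
      have h2 : ‖z‖⁻¹ ≤ 2 * (1 + ‖z‖)⁻¹ := by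
        rw [← div_eq_mul_inv, le_div_iff₀ (by positivity), inv_mul_le_iff₀ (by positivity)]
        linarith
      have h3 := norm_inv_one_add_le a hz1
      calc _ ≤ _ := h1
        _ ≤ 4 * B * (2 * ((1 + |a|) * ‖z - a‖⁻¹)) := by gcongr; linarith
        _ = _ := by ring
    · rw [db_sqCut, deriv_smoothTransition_eq_zero]
      · simp; positivity
      · right
        push Not at hz
        have : (m ^ 2)⁻¹ * ‖z - 0‖ ^ 2 ≤ 1 := by
          rw [sub_zero, inv_mul_le_iff₀ (by positivity)]
          nlinarith [norm_nonneg z]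
        linarith
  have n1 : ∀ (c : ℂ) (p q : ℝ), ‖(sqCut c p q z : ℂ)‖ ≤ 1 := fun c p q => by
    rw [norm_real, norm_of_nonneg (sqCut_nonneg _ _ _ _)]
    exact sqCut_le_one _ _ _ _
  have b2 := b1 (-a)
  rw [sub_neg_eq_add] at b2
  have mb : ∀ x y : ℂ, ‖x‖ ≤ 1 → ‖x * y‖ ≤ ‖y‖ := fun x y hx => by
    rw [norm_mul]; exact mul_le_of_le_one_left (norm_nonneg _) hx
  rw [e]
  calc _ ≤ 8 * B * (1 + |a|) * ‖z - a‖⁻¹ + (4 * B * ‖z + a‖⁻¹ + 4 * B * ‖z - a‖⁻¹) := by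
        refine (norm_add_le _ _).trans (add_le_add ?_ ?_)
        · grind
        · refine (mb _ _ (n1 _ _ _)).trans ((norm_add_le _ _).trans (add_le_add ?_ ?_))
          · exact (mb _ _ (n1 _ _ _)).trans b2
          · grind
    _ ≤ _ := by
      have : 0 ≤ 8 * B * (1 + |a|) * ‖z + a‖⁻¹ := by positivity
      linarith

lemma eventually_trunc_eq_one (h1 : z ≠ a) (h2 : z ≠ -a) :
    ∀ᶠ m : ℝ in atTop, trunc a m z = 1 ∧ db (trunc a m) z = 0 := by
  have h0 : 0 < ‖z - a‖ := norm_pos_iff.2 (sub_ne_zero.2 h1)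
  have h0' : 0 < ‖z - (-a)‖ := norm_pos_iff.2 (sub_ne_zero.2 h2)
  have hsq : Tendsto (fun m : ℝ => m ^ 2) atTop atTop := tendsto_pow_atTop two_ne_zero
  filter_upwards [hsq.eventually_ge_atTop (2 / ‖z - a‖ ^ 2),
    hsq.eventually_ge_atTop (2 / ‖z - (-a)‖ ^ 2), hsq.eventually_ge_atTop (‖z‖ ^ 2),
    eventually_gt_atTop 0] with m e1 e2 e3 hm
  rw [div_le_iff₀ (by positivity)] at e1 e2
  have f1 : 1 ≤ m ^ 2 * ‖z - a‖ ^ 2 + -1 := by linarith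
  have f2 : 1 ≤ m ^ 2 * ‖z - (-a)‖ ^ 2 + -1 := by linarith
  have f3 : 1 ≤ -(m ^ 2)⁻¹ * ‖z - 0‖ ^ 2 + 2 := by
    have : (m ^ 2)⁻¹ * ‖z - 0‖ ^ 2 ≤ 1 := by
      rw [sub_zero, inv_mul_le_iff₀ (by positivity)]; linarith
    linarith
  have hone : trunc a m z = 1 := by
    simp only [trunc, sqCut]
    rw [Real.smoothTransition.one_of_one_le f1, Real.smoothTransition.one_of_one_le f2,
      Real.smoothTransition.one_of_one_le f3]; norm_num
  refine ⟨hone, db_eq_zero_of_isLocalExtr (.inr (Eventually.of_forall fun w => ?_))⟩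
  rw [hone]
  exact (le_abs_self _).trans (norm_trunc_le_one a m w)

lemma trunc_eventually_zero_left {a m : ℝ} :
    trunc a m =ᶠ[𝓝 (a : ℂ)] 0 ∧ trunc a m =ᶠ[𝓝 (-a : ℂ)] 0 := by
  have key : ∀ c : ℂ, ∀ᶠ z in 𝓝 c, sqCut c (m ^ 2) (-1) z = 0 := by
    intro c
    have h : Tendsto (fun z : ℂ => m ^ 2 * ‖z - c‖ ^ 2 + -1) (𝓝 c)
        (𝓝 (m ^ 2 * ‖c - c‖ ^ 2 + -1)) := by
      apply Continuous.tendsto; fun_prop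
    have := h.eventually (gt_mem_nhds (show m ^ 2 * ‖c - c‖ ^ 2 + -1 < 0 by simp))
    filter_upwards [this] with z hz
    exact Real.smoothTransition.zero_of_nonpos hz.le
  constructor
  · filter_upwards [key a] with z hz
    simp [trunc, hz]
  · filter_upwards [key (-a)] with z hz
    simp [trunc, hz]

lemma hasCompactSupport_trunc {a m : ℝ} (hm : 0 < m) : HasCompactSupport (trunc a m) := by
  refine HasCompactSupport.of_support_subset_isCompact
    (isCompact_closedBall (0 : ℂ) (2 * m)) fun z hz => ?_
  by_contra h
  rw [mem_closedBall, dist_zero_right, not_le] at h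
  apply hz
  have : -(m ^ 2)⁻¹ * ‖z - 0‖ ^ 2 + 2 ≤ 0 := by
    have : 2 ≤ (m ^ 2)⁻¹ * ‖z - 0‖ ^ 2 := by
      rw [sub_zero, le_inv_mul_iff₀ (by positivity)]; nlinarith
    linarith
  have h3 : sqCut 0 (-(m ^ 2)⁻¹) 2 z = 0 := Real.smoothTransition.zero_of_nonpos this
  simp [trunc, h3]

/-- Cauchy's theorem for cut-off functions that are smooth off `a` and `-a`. -/
lemma integral_db_smul_eq_zero {u : ℂ → ℝ} {k : ℂ → E} {C : ℝ}
    (hu : ∀ z : ℂ, z ≠ a ∧ z ≠ -a → ContDiffAt ℝ 1 u z)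
    (hk : ∀ z : ℂ, z ≠ a ∧ z ≠ -a → u =ᶠ[𝓝 z] 0 ∨ AnalyticAt ℂ k z)
    (hb : ∀ z : ℂ, z ≠ a ∧ z ≠ -a → ‖u z‖ * ‖k z‖ ≤ C * ((1 + ‖z‖) ^ 2)⁻¹)
    (hi : Integrable fun z => db u z • k z) : ∫ z, db u z • k z = 0 := by
  have hae : ∀ᵐ z : ℂ, z ≠ a ∧ z ≠ -a := by
    have h := ((Set.finite_singleton (-a : ℂ)).insert (a : ℂ)).countable.ae_notMem volume
    simp_all
  have hne : ∀ {m : ℝ}, 0 < m → ∀ z ∈ tsupport (fun z => trunc a m z * u z), z ≠ a ∧ z ≠ -a := by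
    intro m hm z hz
    have hz' : z ∈ tsupport (trunc a m) := tsupport_smul_subset (trunc a m) u hz
    obtain ⟨t1, t2⟩ := trunc_eventually_zero_left (a := a) (m := m)
    constructor
    · rintro rfl
      exact notMem_tsupport_iff_eventuallyEq.2 t1 hz'
    · rintro rfl
      exact notMem_tsupport_iff_eventuallyEq.2 t2 hz'
  have hU : ∀ {m : ℝ}, 0 < m → ContDiff ℝ 1 fun z => trunc a m z * u z := by
    intro m hm
    rw [contDiff_iff_contDiffAt]
    intro z
    by_cases hz : z ∈ tsupport (fun z => trunc a m z * u z)
    · exact (contDiff_trunc a m).contDiffAt.mul (hu z (hne hm z hz))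
    · exact (contDiffAt_const (c := (0 : ℝ))).congr_of_eventuallyEq
        (notMem_tsupport_iff_eventuallyEq.1 hz)
  have hS : ∀ {m : ℝ}, 0 < m → Integrable (fun z => db (fun z => trunc a m z * u z) z • k z) ∧
      ∫ z, db (fun z => trunc a m z * u z) z • k z = 0 := by
    intro m hm
    refine integral_db_smul_eq_zero_of_hasCompactSupport (hU hm)
      ((hasCompactSupport_trunc hm).mul_right) fun z hz => ?_
    refine (hk z (hne hm z hz)).resolve_left fun h => ?_
    refine notMem_tsupport_iff_eventuallyEq.2 ?_ hz
    filter_upwards [h] with w hw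
    simp [hw]
  have hT : ∀ {m : ℝ}, Integrable fun z => (trunc a m z : ℂ) • (db u z • k z) := by
    intro m
    refine hi.bdd_smul (C := 1) ?_ ?_
    · exact (Complex.continuous_ofReal.comp (contDiff_trunc a m).continuous).aestronglyMeasurable
    · refine Eventually.of_forall fun z => ?_
      rw [norm_real]; exact norm_trunc_le_one a m z
  have hsplit : ∀ {m : ℝ}, 0 < m → (fun z => (u z * db (trunc a m) z) • k z) =ᵐ[volume]
      fun z => db (fun z => trunc a m z * u z) z • k z - (trunc a m z : ℂ) • (db u z • k z) := by
    intro m hm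
    filter_upwards [hae] with z hz
    rw [db_mul ((contDiff_trunc a m).differentiable one_ne_zero z)
      ((hu z hz).differentiableAt one_ne_zero), add_smul, mul_smul, mul_smul]
    abel
  have hlim1 : Tendsto (fun m : ℝ => ∫ z, (trunc a m z : ℂ) • (db u z • k z)) atTop
      (𝓝 (∫ z, db u z • k z)) := by
    refine tendsto_integral_filter_of_dominated_convergence (fun z => ‖db u z • k z‖)
      (Eventually.of_forall fun m => hT.aestronglyMeasurable)
      (Eventually.of_forall fun m => Eventually.of_forall fun z => ?_) hi.norm ?_
    · rw [norm_smul, norm_real]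
      exact mul_le_of_le_one_left (norm_nonneg _) (norm_trunc_le_one a m z)
    · filter_upwards [hae] with z hz
      refine Tendsto.congr' ?_ tendsto_const_nhds
      filter_upwards [eventually_trunc_eq_one hz.1 hz.2] with m hm
      rw [hm.1]; simp
  obtain ⟨D, hD⟩ := exists_norm_db_trunc_le a
  have hlim2 : Tendsto (fun m : ℝ => ∫ z, (u z * db (trunc a m) z) • k z) atTop (𝓝 0) := by
    rw [← integral_zero (α := ℂ) (G := E) (μ := volume)]
    refine tendsto_integral_filter_of_dominated_convergence (fun z => |D| * |C| * wt a z)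
      ?_ ?_ ((integrable_wt a).const_mul _) ?_
    · filter_upwards [eventually_gt_atTop 0] with m hm
      exact (((hS hm).1.sub hT).congr (hsplit hm).symm).aestronglyMeasurable
    · filter_upwards [eventually_ge_atTop 1] with m hm
      filter_upwards [hae] with z hz
      rw [norm_smul, norm_mul, norm_real]
      have h1 := hD m hm z hz.1 hz.2
      have h2 := hb z hz
      calc ‖u z‖ * ‖db (trunc a m) z‖ * ‖k z‖ = ‖db (trunc a m) z‖ * (‖u z‖ * ‖k z‖) := by ring
        _ ≤ (|D| * (‖z - a‖⁻¹ + ‖z + a‖⁻¹)) * (|C| * ((1 + ‖z‖) ^ 2)⁻¹) := by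
          refine mul_le_mul (h1.trans ?_) (h2.trans ?_) (by positivity) (by positivity)
          · gcongr; exact le_abs_self D
          · gcongr; exact le_abs_self C
        _ = _ := by rw [wt]; ring
    · filter_upwards [hae] with z hz
      refine Tendsto.congr' ?_ tendsto_const_nhds
      filter_upwards [eventually_trunc_eq_one hz.1 hz.2] with m hm
      rw [hm.2]; simp
  have hlim3 : (fun m : ℝ => ∫ z, (u z * db (trunc a m) z) • k z) =ᶠ[atTop]
      fun m => - ∫ z, (trunc a m z : ℂ) • (db u z • k z) := by
    filter_upwards [eventually_gt_atTop 0] with m hm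
    rw [integral_congr_ae (hsplit hm), integral_sub (hS hm).1 hT, (hS hm).2, zero_sub]
  have := tendsto_nhds_unique (hlim2.congr' hlim3) hlim1.neg
  exact neg_eq_zero.1 this.symm

end Stokes

section Polar

variable {E : Type*} [NormedAddCommGroup E] [NormedSpace ℝ E]

/-- Polar coordinates around `c`. -/
noncomputable def polar (c : ℂ) (r θ : ℝ) : ℂ := c + r * exp (θ * I)

lemma polar_eq (c : ℂ) (p : ℝ × ℝ) : polar c p.1 p.2 = c + Complex.polarCoord.symm p := by
  rw [polar, Complex.polarCoord_symm_apply, exp_mul_I]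
  push_cast; ring

lemma norm_polar_sub (c : ℂ) (r θ : ℝ) : ‖polar c r θ - c‖ = |r| := by
  simp [polar, norm_exp_ofReal_mul_I]

lemma integral_polar (c : ℂ) (F : ℂ → E) :
    ∫ z, F z = ∫ p in Ioi (0 : ℝ) ×ˢ Ioo (-π) π, p.1 • F (polar c p.1 p.2) := by
  rw [← integral_add_left_eq_self (μ := (volume : Measure ℂ)) F c,
    ← Complex.integral_comp_polarCoord_symm, polarCoord_target]
  simp_rw [polar_eq]

lemma integrable_polar (c : ℂ) {F : ℂ → E} (hF : Integrable F) :
    Integrable (fun p : ℝ × ℝ => p.1 • F (polar c p.1 p.2))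
      ((volume.restrict (Ioi (0 : ℝ))).prod (volume.restrict (Ioo (-π) π))) := by
  have h1 : Integrable fun z => F (c + z) := hF.comp_add_left c
  have h2 : Integrable fun p : ℝ × ℝ => F (c + Complex.measurableEquivRealProd.symm p) :=
    (Complex.volume_preserving_equiv_real_prod.symm.integrable_comp_emb
      Complex.measurableEquivRealProd.symm.measurableEmbedding).2 h1
  have h3 := (integrableOn_image_iff_integrableOn_abs_det_fderiv_smul volume
    (polarCoord.open_target.measurableSet)
    (fun p _ => (hasFDerivAt_polarCoord_symm p).hasFDerivWithinAt)
    polarCoord.symm.injOn (fun p : ℝ × ℝ => F (c + Complex.measurableEquivRealProd.symm p))).1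
    h2.integrableOn
  rw [Measure.prod_restrict, ← Measure.volume_eq_prod]
  refine (integrableOn_congr_fun ?_ polarCoord.open_target.measurableSet).1 h3
  rintro ⟨r, θ⟩ hp
  rw [polarCoord_target] at hp
  have hr : 0 < r := hp.1
  simp only [det_fderivPolarCoordSymm, abs_of_pos hr, polar,
    Complex.measurableEquivRealProd_symm_polarCoord_symm_apply, Complex.polarCoord_symm_apply,
    exp_mul_I]
  push_cast; ring_nf

lemma integral_polar_radial (c : ℂ) {F : ℂ → E} (hF : Integrable F) :
    ∫ z, F z = ∫ r in Ioi (0 : ℝ), ∫ θ in Ioo (-π) π, r • F (polar c r θ) := by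
  rw [integral_polar c, Measure.volume_eq_prod, ← Measure.prod_restrict]
  exact integral_prod _ (integrable_polar c hF)

lemma integral_polar_angular (c : ℂ) {F : ℂ → E} (hF : Integrable F) :
    ∫ z, F z = ∫ θ in Ioo (-π) π, ∫ r in Ioi (0 : ℝ), r • F (polar c r θ) := by
  rw [integral_polar c, Measure.volume_eq_prod, ← Measure.prod_restrict]
  exact integral_prod_symm _ (integrable_polar c hF)

end Polar

section Mollifier

variable {E : Type*} [NormedAddCommGroup E] [NormedSpace ℝ E] [CompleteSpace E]

/-- An approximate identity supported in `[0, δ]`. -/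
noncomputable def mol (δ x : ℝ) : ℝ := deriv Real.smoothTransition (x / δ) / δ

lemma mol_nonneg (hδ : 0 < δ) (x : ℝ) : 0 ≤ mol δ x :=
  div_nonneg (deriv_smoothTransition_nonneg _) hδ.le

lemma mol_eq_zero (hδ : 0 < δ) {x : ℝ} (h : x ≤ 0 ∨ δ ≤ x) : mol δ x = 0 := by
  rw [mol, deriv_smoothTransition_eq_zero, zero_div]
  rcases h with h | h
  · exact .inl (div_nonpos_of_nonpos_of_nonneg h hδ.le)
  · exact .inr ((one_le_div hδ).2 h)

lemma continuous_mol (δ : ℝ) : Continuous (mol δ) :=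
  (continuous_deriv_smoothTransition.comp (continuous_id.div_const δ)).div_const δ

lemma integral_mol (hδ : 0 < δ) : ∫ x, mol δ x = 1 := by
  have h1 : ∀ x, HasDerivAt (fun x => Real.smoothTransition (x / δ)) (mol δ x) x := fun x => by
    have := (differentiableAt_smoothTransition (x / δ)).hasDerivAt.comp x
      ((hasDerivAt_id x).div_const δ)
    aesop
  have h2 : ∫ x in (0)..δ, mol δ x = 1 := by
    rw [intervalIntegral.integral_eq_sub_of_hasDerivAt (fun x _ => h1 x)
      ((continuous_mol δ).intervalIntegrable _ _)]
    simp [hδ.ne']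
  rw [← h2, intervalIntegral.integral_of_le hδ.le, setIntegral_eq_integral_of_forall_compl_eq_zero]
  intro x hx
  rw [mem_Ioc, not_and_or, not_lt, not_le] at hx
  exact mol_eq_zero hδ (hx.imp id le_of_lt)

lemma tendsto_integral_approx_identity {ρ : ℝ → ℝ → ℝ} {x₀ : ℝ} {g : ℝ → ℝ → E} {L : E}
    (h0 : ∀ δ > 0, ∀ x, 0 ≤ ρ δ x) (h1 : ∀ δ > 0, ∫ x, ρ δ x = 1)
    (hs : ∀ δ > 0, ∀ x, δ < |x - x₀| → ρ δ x = 0)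
    (hg : Tendsto (fun p : ℝ × ℝ => g p.1 p.2) (𝓝[>] 0 ×ˢ 𝓝 x₀) (𝓝 L))
    (hi : ∀ᶠ δ in 𝓝[>] (0 : ℝ), Integrable fun x => ρ δ x • g δ x) :
    Tendsto (fun δ => ∫ x, ρ δ x • g δ x) (𝓝[>] 0) (𝓝 L) := by
  rw [Metric.tendsto_nhds]
  intro e he
  obtain ⟨P, hP, Q, hQ, hPQ⟩ := eventually_prod_iff.1
    ((Metric.tendsto_nhds.1 hg) (e / 2) (half_pos he))
  obtain ⟨η, hη, hQη⟩ := Metric.eventually_nhds_iff.1 hQ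
  filter_upwards [hP, hi, self_mem_nhdsWithin,
    (Ioo_mem_nhdsGT hη : Ioo 0 η ∈ 𝓝[>] (0 : ℝ))] with δ hδP hδi hδ hδη
  have hδ0 : 0 < δ := hδ
  have hint : Integrable (ρ δ) := by
    by_contra h
    have := h1 δ hδ0
    rw [integral_undef h] at this
    exact zero_ne_one this
  have h2 : (∫ x, ρ δ x • g δ x) - L = ∫ x, ρ δ x • (g δ x - L) := by
    simp_rw [smul_sub]
    rw [integral_sub hδi (hint.smul_const L), integral_smul_const, h1 δ hδ0, one_smul]
  rw [dist_eq_norm, h2]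
  have h3 : ‖∫ x, ρ δ x • (g δ x - L)‖ ≤ ∫ x, ρ δ x * (e / 2) := by
    refine norm_integral_le_of_norm_le (hint.mul_const _) (Eventually.of_forall fun x => ?_)
    rw [norm_smul, norm_of_nonneg (h0 δ hδ0 x)]
    by_cases hx : δ < |x - x₀|
    · rw [hs δ hδ0 x hx]; simp
    · refine mul_le_mul_of_nonneg_left ?_ (h0 δ hδ0 x)
      have hxQ : Q x := hQη (by rw [Real.dist_eq]; exact lt_of_le_of_lt (not_lt.1 hx) hδη.2)
      have := hPQ hδP hxQ
      rw [dist_eq_norm] at this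
      exact this.le
  rw [integral_mul_const, h1 δ hδ0, one_mul] at h3
  linarith

end Mollifier

section Radial

/-- A smooth cut-off that vanishes on the disc of radius `ε` around `c` and is `1` at distance at
least `ε + δ`. -/
noncomputable def radCut (c : ℂ) (ε δ : ℝ) (z : ℂ) : ℝ := Real.smoothTransition ((‖z - c‖ - ε) / δ)

lemma contDiffAt_norm_sub {c z : ℂ} (h : z ≠ c) : ContDiffAt ℝ 1 (fun z => ‖z - c‖) z :=
  (contDiffAt_id.sub contDiffAt_const).norm ℝ (sub_ne_zero.2 h)

lemma radCut_eq_zero {c : ℂ} {ε δ : ℝ} (hδ : 0 < δ) (h : ‖z - c‖ ≤ ε) : radCut c ε δ z = 0 :=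
  Real.smoothTransition.zero_of_nonpos (div_nonpos_of_nonpos_of_nonneg (by linarith) hδ.le)

lemma radCut_eq_one {c : ℂ} {ε δ : ℝ} (hδ : 0 < δ) (h : ε + δ ≤ ‖z - c‖) : radCut c ε δ z = 1 :=
  Real.smoothTransition.one_of_one_le ((one_le_div hδ).2 (by linarith))

lemma contDiff_radCut (c : ℂ) {ε δ : ℝ} (hε : 0 < ε) (hδ : 0 < δ) :
    ContDiff ℝ 1 (radCut c ε δ) := by
  rw [contDiff_iff_contDiffAt]
  intro z
  by_cases h : z = c
  · refine (contDiffAt_const (c := (0 : ℝ))).congr_of_eventuallyEq ?_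
    rw [h]
    filter_upwards [ball_mem_nhds c hε] with w hw
    exact radCut_eq_zero hδ (by rw [← dist_eq_norm]; exact hw.le)
  · exact (Real.smoothTransition.contDiff (n := 1)).contDiffAt.comp z
      (((contDiffAt_norm_sub h).sub contDiffAt_const).div_const δ)

lemma db_radCut (c : ℂ) {ε δ : ℝ} (hε : 0 < ε) (hδ : 0 < δ) (z : ℂ) :
    db (radCut c ε δ) z = mol δ (‖z - c‖ - ε) * ((z - c) / ‖z - c‖) := by
  by_cases h : z = c
  · rw [db_eq_zero_of_eventually_const (c := 0)]
    · simp [h]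
    rw [h]
    filter_upwards [ball_mem_nhds c hε] with w hw
    exact radCut_eq_zero hδ (by rw [← dist_eq_norm]; exact hw.le)
  · have h1 := db_comp (S := fun x => Real.smoothTransition ((x - ε) / δ)) (u := fun z => ‖z - c‖)
      (z := z) ((differentiableAt_smoothTransition _).comp _ (by fun_prop))
      ((contDiffAt_norm_sub h).differentiableAt one_ne_zero)
    have h2 : deriv (fun x => Real.smoothTransition ((x - ε) / δ)) ‖z - c‖ =
        mol δ (‖z - c‖ - ε) := by
      have h3 : HasDerivAt (fun x => (x - ε) / δ) (1 / δ) ‖z - c‖ :=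
        ((hasDerivAt_id _).sub_const ε).div_const δ
      have h4 := ((differentiableAt_smoothTransition ((‖z - c‖ - ε) / δ)).hasDerivAt.comp
        (h := fun x => (x - ε) / δ) _ h3).deriv
      aesop
    unfold radCut
    rw [h1, h2, db_norm_sub h]

variable {E : Type*} [NormedAddCommGroup E] [NormedSpace ℂ E]

lemma polar_sub_div_norm (c : ℂ) {r : ℝ} (hr : 0 < r) (θ : ℝ) :
    (polar c r θ - c) / ‖polar c r θ - c‖ = exp (θ * I) := by
  rw [norm_polar_sub, abs_of_pos hr, polar, add_sub_cancel_left]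
  have : (r : ℂ) ≠ 0 := by exact_mod_cast hr.ne'
  field_simp

lemma continuous_polar (c : ℂ) : Continuous fun p : ℝ × ℝ => polar c p.1 p.2 := by
  unfold polar; fun_prop

lemma integral_radial_kernel (c : ℂ) (ρ : ℝ → ℝ) (G : ℂ → E)
    (hi : Integrable fun z => (ρ ‖z - c‖ * ((z - c) / ‖z - c‖) : ℂ) • G z) :
    ∫ z, (ρ ‖z - c‖ * ((z - c) / ‖z - c‖) : ℂ) • G z = ∫ r in Ioi (0 : ℝ), ρ r •
      ∫ θ in Ioo (-π) π, (r * exp (θ * I)) • G (polar c r θ) := by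
  rw [integral_polar_radial c hi]
  refine setIntegral_congr_fun measurableSet_Ioi fun r (hr : 0 < r) => ?_
  rw [← integral_smul]
  refine integral_congr_ae (Eventually.of_forall fun θ => ?_)
  beta_reduce
  rw [polar_sub_div_norm c hr, norm_polar_sub, abs_of_pos hr, ← coe_smul, ← coe_smul, smul_smul, smul_smul]
  ring_nf

lemma integral_circle_eq [CompleteSpace E] {c : ℂ} {r : ℝ} (hr : 0 < r) {G : ℂ → E}
    (hG : ∀ z ∈ closedBall c r, DifferentiableAt ℂ G z) :
    ∫ θ in Ioo (-π) π, G (polar c r θ) = (2 * π) • G c := by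
  have h1 : Real.circleAverage G c r = G c := by
    apply circleAverage_of_differentiable_on_off_countable (s := ∅) countable_empty
    · rw [abs_of_pos hr]
      exact fun z hz => (hG z hz).continuousAt.continuousWithinAt
    · rw [abs_of_pos hr]
      exact fun z hz => hG z (Metric.ball_subset_closedBall hz.1)
  have hper : Function.Periodic (fun θ => G (polar c r θ)) (2 * π) := by
    intro θ
    simp only [polar]
    congr 3
    rw [show ((θ + 2 * π : ℝ) : ℂ) * I = θ * I + 2 * π * I by
      push_cast; ring, Complex.exp_periodic]
  have h2 : ∫ θ in Ioo (-π) π, G (polar c r θ) = ∫ θ in (0)..(2 * π), G (polar c r θ) := by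
    rw [← integral_Ioc_eq_integral_Ioo,
      ← intervalIntegral.integral_of_le (by linarith [pi_pos])]
    have := hper.intervalIntegral_add_eq (-π) 0
    grind
  rw [h2]
  rw [Real.circleAverage_def] at h1
  have h3 : ∫ θ in (0)..(2 * π), G (polar c r θ) = ∫ θ in (0)..(2 * π), G (circleMap c r θ) := rfl
  rw [h3, ← h1]
  rw [smul_smul, mul_inv_cancel₀ (by positivity), one_smul]

/-- The residue at a simple pole, as an area integral. -/
lemma integral_db_radCut_residue [CompleteSpace E] {c : ℂ} {ε δ : ℝ} (hε : 0 < ε) (hδ : 0 < δ)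
    {G : ℂ → E} (hG : ∀ z ∈ closedBall c (ε + δ), DifferentiableAt ℂ G z) :
    Integrable (fun z => db (radCut c ε δ) z • (z - c)⁻¹ • G z) ∧
    ∫ z, db (radCut c ε δ) z • (z - c)⁻¹ • G z = (2 * π) • G c := by
  have hsup : tsupport (fun z => db (radCut c ε δ) z • (z - c)⁻¹ • G z) ⊆
      {z | ε ≤ ‖z - c‖ ∧ ‖z - c‖ ≤ ε + δ} := by
    refine closure_minimal (fun z hz => ?_) ?_
    · by_contra h
      rw [mem_setOf_eq, not_and_or, not_le, not_le] at h
      refine hz ?_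
      simp only
      rw [db_radCut c hε hδ, mol_eq_zero hδ (h.imp (fun h => by linarith) fun h => by linarith)]
      simp
    · have hn : Continuous fun z : ℂ => ‖z - c‖ := by fun_prop
      exact (isClosed_le continuous_const hn).inter (isClosed_le hn continuous_const)
  have hi : Integrable fun z => db (radCut c ε δ) z • (z - c)⁻¹ • G z := by
    refine (continuous_of_tsupport fun z hz => ?_).integrable_of_hasCompactSupport
      (HasCompactSupport.of_support_subset_isCompact (isCompact_closedBall c (ε + δ))
        ((subset_tsupport _).trans (hsup.trans fun z hz => ?_)))
    · obtain ⟨h1, h2⟩ := hsup hz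
      have hne : z - c ≠ 0 := norm_pos_iff.1 (hε.trans_le h1)
      refine ContinuousAt.smul ?_ (ContinuousAt.smul ?_ ?_)
      · have : db (radCut c ε δ) = fun z => mol δ (‖z - c‖ - ε) * ((z - c) / ‖z - c‖) :=
          funext (db_radCut c hε hδ)
        rw [this]
        refine ContinuousAt.mul ?_ (ContinuousAt.div (by fun_prop) (by fun_prop) (by simpa using hne))
        exact (Complex.continuous_ofReal.comp ((continuous_mol δ).comp (by fun_prop))).continuousAt
      · fun_prop
      · exact (hG z (by rwa [mem_closedBall, dist_eq_norm])).continuousAt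
    · rw [mem_closedBall, dist_eq_norm]; exact hz.2
  refine ⟨hi, ?_⟩
  simp_rw [db_radCut c hε hδ] at hi ⊢
  rw [integral_radial_kernel c (fun r => mol δ (r - ε)) (fun z => (z - c)⁻¹ • G z) hi]
  have h1 : ∀ r ∈ Ioi (0 : ℝ), mol δ (r - ε) • (∫ θ in Ioo (-π) π,
      (r * exp (θ * I)) • (polar c r θ - c)⁻¹ • G (polar c r θ)) =
      mol δ (r - ε) • ((2 * π) • G c) := by
    intro r hr
    by_cases h : r - ε ≤ 0 ∨ δ ≤ r - ε
    · rw [mol_eq_zero hδ h]; simp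
    · push Not at h
      rw [← integral_circle_eq hr (fun z hz => hG z (closedBall_subset_closedBall
        (by linarith) hz))]
      congr 1
      refine integral_congr_ae (Eventually.of_forall fun θ => ?_)
      simp only [polar, add_sub_cancel_left]
      rw [smul_smul, mul_inv_cancel₀, one_smul]
      aesop
  rw [setIntegral_congr_fun measurableSet_Ioi h1, integral_smul_const]
  have h2 : ∫ r in Ioi (0 : ℝ), mol δ (r - ε) = 1 := by
    rw [setIntegral_eq_integral_of_forall_compl_eq_zero]
    · rw [integral_sub_right_eq_self (fun r => mol δ r), integral_mol hδ]
    · intro r hr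
      exact mol_eq_zero hδ (.inl (by rw [mem_Ioi, not_lt] at hr; linarith))
  rw [h2, one_smul]

end Radial

lemma le_of_sq_le_sq_of_nonneg {x y : ℝ} (h : x ^ 2 ≤ y ^ 2) (hy : 0 ≤ y) : x ≤ y :=
  (le_abs_self x).trans (abs_le_of_sq_le_sq h hy)

lemma abs_arg_le_iff (h0 : 0 ≤ φ) (hπ : φ ≤ π) (w : ℂ) :
    |w.arg| ≤ φ ↔ ‖w‖ * cos φ ≤ w.re := by
  by_cases hw : w = 0
  · simp [hw, h0]
  have hn : 0 < ‖w‖ := norm_pos_iff.2 hw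
  have h1 : w.re = ‖w‖ * cos |w.arg| := by rw [cos_abs, norm_mul_cos_arg]
  rw [h1, mul_le_mul_iff_right₀ hn]
  exact (Real.strictAntiOn_cos.le_iff_ge ⟨h0, hπ⟩ ⟨abs_nonneg _, abs_arg_le_pi w⟩).symm

lemma lt_abs_arg_iff (h0 : 0 ≤ φ) (hπ : φ ≤ π) (w : ℂ) : φ < |w.arg| ↔ w.re < ‖w‖ * cos φ := by
  rw [← not_le, abs_arg_le_iff h0 hπ, not_le]

lemma abs_arg_lt_iff (h0 : 0 ≤ φ) (hπ : φ ≤ π) {w : ℂ} (hw : w ≠ 0) :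
    |w.arg| < φ ↔ ‖w‖ * cos φ < w.re := by
  have hn : 0 < ‖w‖ := norm_pos_iff.2 hw
  have h1 : w.re = ‖w‖ * cos |w.arg| := by rw [cos_abs, norm_mul_cos_arg]
  rw [h1, mul_lt_mul_iff_right₀ hn]
  exact (Real.strictAntiOn_cos.lt_iff_gt ⟨h0, hπ⟩ ⟨abs_nonneg _, abs_arg_le_pi w⟩).symm

/-- Points of two sectors separated by an angle `ψ - φ` are far from each other. -/
lemma sin_mul_norm_le_norm_sub {φ ψ : ℝ} (h : φ < ψ)
    {u v : ℂ} (hu : |u.arg| ≤ φ) (hv : ψ ≤ |v.arg|) :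
    sin (ψ - φ) * ‖u‖ ≤ ‖u - v‖ ∧ sin (ψ - φ) * ‖v‖ ≤ ‖u - v‖ := by
  set t := ψ - φ with ht
  have ht0 : 0 < t := sub_pos.2 h
  have hψ : ψ ≤ π := hv.trans (abs_arg_le_pi v)
  have e1 : ‖u - v‖ ^ 2 = ‖u‖ ^ 2 + ‖v‖ ^ 2 - 2 * (‖u‖ * ‖v‖ * cos (v.arg - u.arg)) := by
    rw [Real.cos_sub, ← normSq_eq_norm_sq, normSq_apply]
    have a1 := norm_mul_cos_arg u
    have a2 := Complex.norm_mul_sin_arg u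
    have a3 := norm_mul_cos_arg v
    have a4 := Complex.norm_mul_sin_arg v
    have a5 : ‖u‖ ^ 2 = u.re * u.re + u.im * u.im := by
      rw [← normSq_eq_norm_sq, normSq_apply]
    have a6 : ‖v‖ ^ 2 = v.re * v.re + v.im * v.im := by
      rw [← normSq_eq_norm_sq, normSq_apply]
    rw [show ‖u‖ * ‖v‖ * (cos v.arg * cos u.arg + sin v.arg * sin u.arg) =
      (‖v‖ * cos v.arg) * (‖u‖ * cos u.arg) +
      (‖v‖ * sin v.arg) * (‖u‖ * sin u.arg) by ring, a1, a2, a3, a4, a5, a6]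
    simp only [Complex.sub_re, Complex.sub_im]; ring
  have e2 : cos (v.arg - u.arg) ≤ cos t := by
    have hva := abs_arg_le_pi v
    rw [← cos_abs (v.arg - u.arg)]
    have l1 : t ≤ |v.arg - u.arg| := by
      have := abs_sub_abs_le_abs_sub v.arg u.arg
      linarith
    have l2 : |v.arg - u.arg| ≤ π + φ := by
      have := abs_sub v.arg u.arg
      linarith
    by_cases l3 : |v.arg - u.arg| ≤ π
    · exact Real.cos_le_cos_of_nonneg_of_le_pi ht0.le l3 l1
    · rw [← Real.cos_two_pi_sub]
      exact Real.cos_le_cos_of_nonneg_of_le_pi ht0.le (by linarith) (by linarith)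
  have e3 : ‖u‖ ^ 2 + ‖v‖ ^ 2 - 2 * (‖u‖ * ‖v‖ * cos t) ≤ ‖u - v‖ ^ 2 := by
    rw [e1]
    have := mul_le_mul_of_nonneg_left e2 (mul_nonneg (norm_nonneg u) (norm_nonneg v))
    linarith
  have e4 := sin_sq_add_cos_sq t
  constructor
  · refine le_of_sq_le_sq_of_nonneg ?_ (norm_nonneg _)
    nlinarith [sq_nonneg (‖v‖ - ‖u‖ * cos t)]
  · refine le_of_sq_le_sq_of_nonneg ?_ (norm_nonneg _)
    nlinarith [sq_nonneg (‖u‖ - ‖v‖ * cos t)]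

/-- The coordinate `s z - a` centred at the vertex `s a` of the bisector. -/
noncomputable def loc (a : ℝ) (s : ℤˣ) (z : ℂ) : ℂ := ((s : ℤ) : ℂ) * z - a

@[simp] theorem loc_one (a : ℝ) (z : ℂ) : loc a 1 z = z - a := by simp [loc]

@[simp] theorem loc_neg_one (a : ℝ) (z : ℂ) : loc a (-1) z = -(z + a) := by simp [loc]; ring

lemma unit_sq (s : ℤˣ) : ((s : ℤ) : ℂ) * ((s : ℤ) : ℂ) = 1 := by
  rcases units_eq_one_or s with rfl | rfl <;> simp

lemma norm_unit (s : ℤˣ) : ‖((s : ℤ) : ℂ)‖ = 1 := by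
  rcases units_eq_one_or s with rfl | rfl <;> simp

lemma loc_ray (a θ : ℝ) (s τ : ℤˣ) (t : ℝ) :
    loc a s (ray a θ s τ t) = t * exp (((τ : ℤ) : ℂ) * θ * I) := by
  rw [loc, ray, ← mul_assoc, unit_sq]; ring

lemma norm_ray_aux (τ : ℤˣ) (θ : ℝ) : ‖exp (((τ : ℤ) : ℂ) * θ * I)‖ = 1 := by
  have := norm_exp_ofReal_mul_I ((τ : ℤ) * θ)
  push_cast at this
  exact this

lemma norm_loc_ray (a θ : ℝ) (s τ : ℤˣ) {t : ℝ} (ht : 0 ≤ t) : ‖loc a s (ray a θ s τ t)‖ = t := by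
  rw [loc_ray, norm_mul, norm_ray_aux, mul_one, norm_real, norm_of_nonneg ht]

lemma abs_arg_loc_ray (a : ℝ) {θ : ℝ} (h0 : 0 ≤ θ) (hπ : θ < π) (s τ : ℤˣ) {t : ℝ}
    (ht : 0 < t) : |(loc a s (ray a θ s τ t)).arg| = θ := by
  rw [loc_ray]
  have : ((τ : ℤ) : ℂ) * θ * I = (((τ : ℤ) * θ : ℝ) : ℂ) * I := by push_cast; ring
  rw [this, Complex.arg_real_mul _ ht, exp_mul_I, Complex.arg_cos_add_sin_mul_I]
  · rcases units_eq_one_or τ with rfl | rfl <;> simp [abs_of_nonneg h0]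
  · rcases units_eq_one_or τ with rfl | rfl <;> simp <;> constructor <;> linarith

/-- `±a` is excluded. -/
def OffVertices (a : ℝ) (z : ℂ) : Prop := ∀ s : ℤˣ, loc a s z ≠ 0

lemma offVertices_iff : OffVertices a z ↔ z ≠ a ∧ z ≠ -a := by
  constructor
  · intro h
    have h1 := h 1
    have h2 := h (-1)
    rw [loc_one, sub_ne_zero] at h1
    rw [loc_neg_one, neg_ne_zero, Ne, add_eq_zero_iff_eq_neg] at h2
    exact ⟨h1, h2⟩
  · rintro ⟨h1, h2⟩ s
    rcases units_eq_one_or s with rfl | rfl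
    · rw [loc_one, sub_ne_zero]; exact h1
    · rw [loc_neg_one, neg_ne_zero, Ne, add_eq_zero_iff_eq_neg]; exact h2

lemma norm_loc_mul_norm_loc (a : ℝ) (s : ℤˣ) (z : ℂ) :
    ‖loc a s z‖ * ‖loc a (-s) z‖ = ‖z ^ 2 - a ^ 2‖ := by
  rw [← norm_mul]
  rcases units_eq_one_or s with rfl | rfl
  · rw [loc_one, loc_neg_one, ← norm_neg]; ring_nf
  · rw [neg_neg, loc_one, loc_neg_one, ← norm_neg]; ring_nf

lemma norm_loc_le (ha : 0 ≤ a) (s : ℤˣ) (z : ℂ) : ‖loc a s z‖ ≤ ‖z‖ + a := by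
  have := norm_sub_le (((s : ℤ) : ℂ) * z) (a : ℂ)
  rwa [norm_mul, norm_unit, one_mul, norm_real, norm_of_nonneg ha] at this

lemma re_loc_neg (a : ℝ) (s : ℤˣ) (z : ℂ) : (loc a (-s) z).re = -(loc a s z).re - 2 * a := by
  simp [loc]; ring

lemma norm_loc_le_norm_loc_neg (ha : 0 ≤ a) {s : ℤˣ}
    (h : 0 ≤ (loc a s z).re) : ‖loc a s z‖ ≤ ‖loc a (-s) z‖ := by
  refine le_of_sq_le_sq_of_nonneg ?_ (norm_nonneg _)
  rw [← normSq_eq_norm_sq, ← normSq_eq_norm_sq, normSq_apply,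
    normSq_apply, re_loc_neg]
  have : (loc a (-s) z).im = -(loc a s z).im := by simp [loc]
  rw [this]
  nlinarith

lemma re_nonneg_of_abs_arg_le {w : ℂ} (h : |w.arg| ≤ π / 2) : 0 ≤ w.re :=
  Complex.abs_arg_le_pi_div_two_iff.1 h

lemma pi_div_two_le_abs_arg_loc_neg (ha : 0 ≤ a) {s : ℤˣ} (h0 : loc a (-s) z ≠ 0)
    (h : |(loc a s z).arg| ≤ π / 2) : π / 2 ≤ |(loc a (-s) z).arg| := by
  by_contra! h2
  have h3 : 0 < (loc a (-s) z).re := by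
    rcases (Complex.abs_arg_lt_pi_div_two_iff.1 h2) with h | h
    · exact h
    · exact absurd h h0
  rw [re_loc_neg] at h3
  linarith [re_nonneg_of_abs_arg_le h]

lemma mem_bisector_iff (h0 : 0 < φ) (hφ : φ < π / 2) :
    z ∈ bisector φ a ↔ ∀ s : ℤˣ, φ < |(loc a s z).arg| := by
  have key : ∀ w : ℂ, -w ∈ sector (π - φ) ↔ φ < |w.arg| := by
    intro w
    have h1 : π - φ ≠ 0 := by linarith
    rw [lt_abs_arg_iff h0.le (by linarith)]
    simp only [sector, mem_setOf_eq, h1, false_and, false_or, ne_eq, not_false_eq_true, true_and]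
    by_cases hw : w = 0
    · simp [hw]
    · rw [abs_arg_lt_iff (by linarith) (by linarith) (neg_ne_zero.2 hw), norm_neg, Real.cos_pi_sub,
        Complex.neg_re]
      simp only [neg_eq_zero, hw, not_false_eq_true, true_and]
      constructor <;> intro h <;> linarith
  have h2 : φ ≠ π / 2 := hφ.ne
  simp only [bisector, mem_setOf_eq, h2, false_and, false_or, not_false_eq_true, true_and]
  constructor
  · rintro ⟨h3, h4⟩ s
    rw [← key]
    rcases units_eq_one_or s with rfl | rfl
    · rw [loc_one, neg_sub]; exact h4
    · rw [loc_neg_one, neg_neg]; exact h3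
  · intro h
    have h3 := (key _).2 (h 1)
    have h4 := (key _).2 (h (-1))
    rw [loc_one, neg_sub] at h3
    rw [loc_neg_one, neg_neg] at h4
    exact ⟨h4, h3⟩

lemma continuous_loc (a : ℝ) (s : ℤˣ) : Continuous (loc a s) := by unfold loc; fun_prop

lemma closure_bisector_subset (h0 : 0 < φ) (hφ : φ ≤ π / 2) :
    closure (bisector φ a) ⊆ {z | ∀ s : ℤˣ, (loc a s z).re ≤ ‖loc a s z‖ * cos φ} := by
  refine closure_minimal ?_ ?_
  · intro z hz s
    by_cases h : φ = π / 2 ∧ a = 0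
    · have hz' : z.re = 0 := by
        rcases hz with hz | hz
        · exact hz.2.2
        · exact absurd h hz.1
      rw [h.1, h.2, Real.cos_pi_div_two, mul_zero]
      simp [loc, hz']
    · have hz' := (hz.resolve_left fun h' => h ⟨h'.1, h'.2.1⟩).2
      have h1 : π - φ ≠ 0 := by linarith [pi_pos]
      have key : ∀ w : ℂ, -w ∈ sector (π - φ) → w.re ≤ ‖w‖ * cos φ := by
        intro w hw
        simp only [sector, mem_setOf_eq, h1, false_and, false_or, ne_eq, not_false_eq_true,
          true_and] at hw
        have := (abs_arg_le_iff (φ := π - φ) (by linarith [pi_pos]) (by linarith) (-w)).1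
          hw.2.le
        rw [norm_neg, Real.cos_pi_sub, Complex.neg_re] at this
        linarith
      apply key
      rcases units_eq_one_or s with rfl | rfl
      · rw [loc_one, neg_sub]; exact hz'.2
      · rw [loc_neg_one, neg_neg]; exact hz'.1
  · simp only [setOf_forall]
    refine isClosed_iInter fun s => ?_
    have := continuous_loc a s
    exact isClosed_le (Complex.continuous_re.comp this) (this.norm.mul continuous_const)

lemma isOpen_lt_abs_arg_loc (h0 : 0 ≤ φ) (hφ : φ ≤ π) (a : ℝ) (s : ℤˣ) :
    IsOpen {z | φ < |(loc a s z).arg|} := by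
  simp_rw [lt_abs_arg_iff h0 hφ]
  have := continuous_loc a s
  exact isOpen_lt (Complex.continuous_re.comp this) (this.norm.mul continuous_const)

lemma eventually_abs_arg_lt {w : ℂ} (h0 : 0 ≤ φ) (hφ : φ ≤ π) (hw : w ≠ 0)
    (h : |w.arg| < φ) : ∀ᶠ v in 𝓝 w, |v.arg| < φ := by
  rw [abs_arg_lt_iff h0 hφ hw] at h
  have h1 : ∀ᶠ v : ℂ in 𝓝 w, ‖v‖ * cos φ < v.re :=
    (isOpen_lt (f := fun v : ℂ => ‖v‖ * cos φ) (by fun_prop) continuous_re).mem_nhds h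
  filter_upwards [h1, isOpen_ne.mem_nhds hw] with v hv hv0
  rwa [abs_arg_lt_iff h0 hφ hv0]

lemma eventually_lt_abs_arg {w : ℂ} (h0 : 0 ≤ φ) (hφ : φ ≤ π)
    (h : φ < |w.arg|) : ∀ᶠ v in 𝓝 w, φ < |v.arg| := by
  rw [lt_abs_arg_iff h0 hφ] at h
  have h1 : ∀ᶠ v : ℂ in 𝓝 w, v.re < ‖v‖ * cos φ :=
    (isOpen_lt (g := fun v : ℂ => ‖v‖ * cos φ) continuous_re (by fun_prop)).mem_nhds h
  filter_upwards [h1] with v hv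
  rwa [lt_abs_arg_iff h0 hφ]

/-- A smooth cut-off that vanishes on the sector of half-angle `φ` and is `1` outside of the sector
of half-angle `φ + δ`. -/
noncomputable def angCut (φ δ : ℝ) (w : ℂ) : ℝ := Real.smoothTransition ((|w.arg| - φ) / δ)

lemma angCut_eq_zero (hδ : 0 < δ) {w : ℂ} (h : |w.arg| ≤ φ) : angCut φ δ w = 0 :=
  Real.smoothTransition.zero_of_nonpos (div_nonpos_of_nonpos_of_nonneg (by linarith) hδ.le)

lemma angCut_eq_one (hδ : 0 < δ) {w : ℂ} (h : φ + δ ≤ |w.arg|) : angCut φ δ w = 1 :=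
  Real.smoothTransition.one_of_one_le ((one_le_div hδ).2 (by linarith))

/-- Near a point `w ≠ 0`, the function `angCut` is constant or a smooth function of `arg`. -/
lemma angCut_cases (hφ : 0 < φ) (hδ : 0 < δ) (hπ : φ + δ < π) {w : ℂ} (hw : w ≠ 0) :
    (angCut φ δ =ᶠ[𝓝 w] (fun _ => 0) ∧ |w.arg| < φ) ∨
    (angCut φ δ =ᶠ[𝓝 w] (fun _ => 1) ∧ φ + δ < |w.arg|) ∨
    (w ∈ slitPlane ∧ ∃ e : ℝ, (e = 1 ∨ e = -1) ∧ e = SignType.sign w.arg ∧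
      angCut φ δ =ᶠ[𝓝 w] fun v => Real.smoothTransition ((e * v.arg - φ) / δ)) := by
  by_cases h1 : |w.arg| < φ
  · left
    refine ⟨?_, h1⟩
    filter_upwards [eventually_abs_arg_lt hφ.le (by linarith) hw h1] with v hv
    exact angCut_eq_zero hδ hv.le
  by_cases h2 : φ + δ < |w.arg|
  · right; left
    refine ⟨?_, h2⟩
    filter_upwards [eventually_lt_abs_arg (by linarith) hπ.le h2] with v hv
    exact angCut_eq_one hδ hv.le
  right; right
  push Not at h1 h2
  have hs : w ∈ slitPlane := by
    rw [Complex.mem_slitPlane_iff_arg]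
    refine ⟨fun h => ?_, hw⟩
    rw [h, abs_of_pos pi_pos] at h2
    linarith
  refine ⟨hs, ?_⟩
  have hc := (Complex.continuousAt_arg hs)
  rcases lt_trichotomy w.arg 0 with h | h | h
  · refine ⟨-1, .inr rfl, by simp [h], ?_⟩
    filter_upwards [hc.eventually (gt_mem_nhds h)] with v hv
    rw [angCut, abs_of_neg hv]; ring_nf
  · rw [h, abs_zero] at h1; linarith
  · refine ⟨1, .inl rfl, by simp [h], ?_⟩
    filter_upwards [hc.eventually (lt_mem_nhds h)] with v hv
    rw [angCut, abs_of_pos hv]; ring_nf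

lemma contDiffAt_angCut (hφ : 0 < φ) (hδ : 0 < δ) (hπ : φ + δ < π) {w : ℂ}
    (hw : w ≠ 0) : ContDiffAt ℝ 1 (angCut φ δ) w := by
  rcases angCut_cases hφ hδ hπ hw with ⟨h, -⟩ | ⟨h, -⟩ | ⟨hs, e, -, -, h⟩
  · exact contDiffAt_const.congr_of_eventuallyEq h
  · exact contDiffAt_const.congr_of_eventuallyEq h
  · refine ContDiffAt.congr_of_eventuallyEq ?_ h
    exact (Real.smoothTransition.contDiff (n := 1)).contDiffAt.comp w
      (((contDiffAt_const.mul (contDiffAt_arg hs)).sub contDiffAt_const).div_const δ)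

lemma db_angCut (hφ : 0 < φ) (hδ : 0 < δ) (hπ : φ + δ < π) {w : ℂ}
    (hw : w ≠ 0) : db (angCut φ δ) w =
      mol δ (|w.arg| - φ) * ((SignType.sign w.arg : ℝ) : ℂ) * (I * w / ‖w‖ ^ 2) := by
  rcases angCut_cases hφ hδ hπ hw with ⟨h, h'⟩ | ⟨h, h'⟩ | ⟨hs, e, he, he', h⟩
  · rw [db_eq_zero_of_eventually_const h, mol_eq_zero hδ (.inl (by linarith))]; simp
  · rw [db_eq_zero_of_eventually_const h, mol_eq_zero hδ (.inr (by linarith))]; simp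
  · rw [db_congr h]
    have h1 := db_comp (S := fun x => Real.smoothTransition ((e * x - φ) / δ)) (u := Complex.arg)
      (z := w) ((differentiableAt_smoothTransition _).comp _ (by fun_prop))
      ((contDiffAt_arg hs).differentiableAt one_ne_zero)
    have h3 : HasDerivAt (fun x => (e * x - φ) / δ) (e / δ) w.arg := by
      have := (((hasDerivAt_id w.arg).const_mul e).sub_const φ).div_const δ
      simpa using this
    have h4 := ((differentiableAt_smoothTransition ((e * w.arg - φ) / δ)).hasDerivAt.comp
        (h := fun x => (e * x - φ) / δ) _ h3).deriv
    rw [Function.comp_def] at h4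
    have h5 : |w.arg| = e * w.arg := by
      rcases lt_trichotomy w.arg 0 with h | h | h
      · rw [he', abs_of_neg h]; simp [h]
      · simp [h]
      · rw [he', abs_of_pos h]; simp [h]
    rw [h1, h4, db_arg hs, ← he', h5, mol]
    push_cast
    ring

lemma norm_db_angCut_le {B : ℝ} (hB : ∀ x, deriv Real.smoothTransition x ≤ B)
    (hφ : 0 < φ) (hδ : 0 < δ) (hπ : φ + δ < π) {w : ℂ} (hw : w ≠ 0) :
    ‖db (angCut φ δ) w‖ ≤ B / δ * ‖w‖⁻¹ := by
  have h1 : |((SignType.sign w.arg : ℝ))| ≤ 1 := by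
    rcases lt_trichotomy w.arg 0 with h | h | h <;> simp [h]
  rw [db_angCut hφ hδ hπ hw, norm_mul, norm_mul, norm_real, norm_real, norm_div,
    norm_mul, Complex.norm_I, norm_pow, norm_real, norm_norm, one_mul,
    norm_of_nonneg (mol_nonneg hδ _), norm_eq_abs]
  have h2 : ‖w‖ / ‖w‖ ^ 2 = ‖w‖⁻¹ := by field_simp
  rw [h2]
  have h3 : mol δ (|w.arg| - φ) ≤ B / δ := by unfold mol; gcongr; exact hB _
  have h4 := mol_nonneg hδ (|w.arg| - φ)
  calc _ ≤ B / δ * 1 * ‖w‖⁻¹ := by gcongr; exact h4.trans h3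
    _ = _ := by ring

/-- The angular cut-off around the vertex `s a`. -/
noncomputable def secCut (a φ δ : ℝ) (s : ℤˣ) (z : ℂ) : ℝ := angCut φ δ (loc a s z)

lemma contDiff_loc (a : ℝ) (s : ℤˣ) : ContDiff ℝ 1 (loc a s) := by unfold loc; fun_prop

lemma db_comp_loc (a : ℝ) (s : ℤˣ) {u : ℂ → ℝ} (hu : DifferentiableAt ℝ u (loc a s z)) :
    db (fun z => u (loc a s z)) z = ((s : ℤ) : ℂ) * db u (loc a s z) := by
  have h1 : HasFDerivAt (loc a s) (((s : ℤ) : ℂ) • ContinuousLinearMap.id ℝ ℂ) z := by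
    have := ((hasFDerivAt_id (𝕜 := ℝ) z).const_mul ((s : ℤ) : ℂ)).sub_const (a : ℂ)
    exact this
  rw [HasFDerivAt.db_eq (u := fun z => u (loc a s z)) (hu.hasFDerivAt.comp z h1)]
  rcases units_eq_one_or s with rfl | rfl <;> simp [db]
  ring

lemma contDiffAt_secCut {a φ δ : ℝ} (hφ : 0 < φ) (hδ : 0 < δ) (hπ : φ + δ < π) {s : ℤˣ}
    (hz : loc a s z ≠ 0) : ContDiffAt ℝ 1 (secCut a φ δ s) z :=
  (contDiffAt_angCut hφ hδ hπ hz).comp z (contDiff_loc a s).contDiffAt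

lemma db_secCut {a φ δ : ℝ} (hφ : 0 < φ) (hδ : 0 < δ) (hπ : φ + δ < π) {s : ℤˣ}
    (hz : loc a s z ≠ 0) : db (secCut a φ δ s) z = ((s : ℤ) : ℂ) * db (angCut φ δ) (loc a s z) :=
  db_comp_loc a s ((contDiffAt_angCut hφ hδ hπ hz).differentiableAt one_ne_zero)

/-- The standing assumptions on a bisectorial operator. -/
structure Setup (A : X →ₗ.[ℂ] X) (ω a : ℝ) : Prop where
  hω : ω ∈ Ioc 0 (π / 2)
  ha : 0 ≤ a
  hA : IsBisectorial A ω a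

lemma notMem_closure_bisector (h0 : 0 < φ) (hφ : φ ≤ π / 2) {s : ℤˣ}
    (hz : loc a s z ≠ 0) (h : |(loc a s z).arg| < φ) : z ∉ closure (bisector φ a) := by
  intro hc
  have := closure_bisector_subset h0 hφ hc s
  rw [abs_arg_lt_iff h0.le (by linarith [pi_pos]) hz] at h
  linarith

lemma Setup.mem_resolventSet (hS : Setup A ω a) {s : ℤˣ}
    (hz : loc a s z ≠ 0) (h : |(loc a s z).arg| < ω) : z ∈ resolventSet A := by
  by_contra hc
  exact notMem_closure_bisector hS.hω.1 hS.hω.2 hz h (hS.hA.2.1 hc)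

lemma Setup.exists_norm_loc_mul_norm_res_le (hS : Setup A ω a) (h0 : 0 < φ)
    (hφ : φ < ω) : ∃ M : ℝ, 0 ≤ M ∧ ∀ (s : ℤˣ) (z : ℂ), loc a s z ≠ 0 → |(loc a s z).arg| < φ →
      ‖loc a s z‖ * ‖res A z‖ ≤ M := by
  obtain ⟨M, hM⟩ := hS.hA.2.2 φ ⟨h0, hφ⟩
  refine ⟨max M 0, le_max_right _ _, fun s z hz h => le_trans ?_ (le_max_left _ _)⟩
  have hφ' : φ ≤ π / 2 := hφ.le.trans hS.hω.2
  have h1 := hM z (notMem_closure_bisector h0 hφ' hz h)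
  have h2 := norm_loc_le_norm_loc_neg hS.ha (re_nonneg_of_abs_arg_le (h.le.trans hφ'))
  have h3 : min ‖z - a‖ ‖z + a‖ = ‖loc a s z‖ := by
    rcases units_eq_one_or s with rfl | rfl
    · rw [loc_neg_one, loc_one, norm_neg] at h2
      rw [loc_one, min_eq_left h2]
    · rw [neg_neg, loc_neg_one, loc_one, norm_neg] at h2
      rw [loc_neg_one, norm_neg, min_eq_right h2]
  rwa [h3] at h1

lemma mem_offDiscs_iff {ε : ℝ} : z ∈ offDiscs A a ε ↔ ∀ d ∈ removedPts A a, ε < ‖z - d‖ := by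
  simp [offDiscs, removedPts]

lemma mem_region_iff (h0 : 0 < p.φ) (hφ : p.φ < π / 2) :
    z ∈ region A a p ↔ (∀ s : ℤˣ, p.φ < |(loc a s z).arg|) ∧
      (∀ d ∈ removedPts A a, p.ε < ‖z - d‖) ∧ (infty ∉ singPts A a → ‖z‖ < p.R) := by
  rw [region, mem_inter_iff, mem_inter_iff, mem_bisector_iff h0 hφ, mem_offDiscs_iff]
  rfl

lemma isOpen_offDiscs (A : X →ₗ.[ℂ] X) (a ε : ℝ) : IsOpen (offDiscs A a ε) := by
  have : offDiscs A a ε = ⋂ d ∈ removedPts A a, {z : ℂ | ε < ‖z - d‖} := by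
    ext z; simp only [mem_offDiscs_iff, mem_iInter, mem_setOf_eq]
  rw [this]
  exact isOpen_biInter_finset fun d _ => isOpen_lt continuous_const (by fun_prop)

lemma isOpen_inDisc (A : X →ₗ.[ℂ] X) (a R : ℝ) : IsOpen (inDisc A a R) := by
  by_cases h : infty ∈ singPts A a
  · simp [inDisc, h]
  · simp only [inDisc, h, not_false_eq_true, forall_true_left]
    exact isOpen_lt (by fun_prop) continuous_const

lemma isOpen_bisector (h0 : 0 < φ) (hφ : φ < π / 2) (a : ℝ) : IsOpen (bisector φ a) := by
  have : bisector φ a = ⋂ s : ℤˣ, {z | φ < |(loc a s z).arg|} := by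
    ext z; simp only [mem_bisector_iff h0 hφ, mem_iInter, mem_setOf_eq]
  rw [this]
  exact isOpen_iInter_of_finite fun s => isOpen_lt_abs_arg_loc h0.le (by linarith [pi_pos]) a s

lemma isOpen_region (h0 : 0 < p.φ) (hφ : p.φ < π / 2) : IsOpen (region A a p) :=
  (isOpen_bisector h0 hφ a).inter ((isOpen_offDiscs A a _).inter (isOpen_inDisc A a _))

lemma Setup.lt_pi_div_two (hS : Setup A ω a) (hp : Admissible A ω a p) :
    p.φ < π / 2 := hp.1.2.trans_le hS.hω.2

lemma Setup.isOpen_region (hS : Setup A ω a) (hp : Admissible A ω a p) : IsOpen (region A a p) :=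
  BisectorialNFC.isOpen_region hp.1.1 (hS.lt_pi_div_two hp)

lemma infty_notMem_singPts_iff : infty ∉ singPts A a ↔ A.domain = ⊤ := by
  simp [singPts, extSpectrum]

lemma mem_removedPts {d : ℂ} :
    d ∈ removedPts A a ↔ (d = a ∨ d = -a) ∧ (d : OnePoint ℂ) ∉ singPts A a := by
  simp [removedPts]

/-- The parameters of a slightly smaller region. -/
def Params.shift (q : Params) (δ : ℝ) : Params := ⟨q.φ + δ, q.ε + δ, q.R - δ⟩

lemma Admissible.closedBall_subset (hp : Admissible A ω a p) {d : ℂ}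
    (hd : d ∈ removedPts A a) : closedBall d p.ε ⊆ resolventSet A := by
  rw [mem_removedPts] at hd
  exact hp.2.1.2.2 d (by simpa using hd.1) hd.2

lemma Admissible.mono_shift [CompleteSpace X]
    (hq : Admissible A ω a q) : ∃ δ₀ > 0, ∀ δ, 0 ≤ δ → δ ≤ δ₀ → Admissible A ω a (q.shift δ) := by
  have h1 : ∃ δ₁ > 0, ∀ δ, δ ≤ δ₁ → ∀ d ∈ ({(a : ℂ), -(a : ℂ)} : Set ℂ),
      (d : OnePoint ℂ) ∉ singPts A a → closedBall d (q.ε + δ) ⊆ resolventSet A := by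
    have key : ∀ d : ℂ, ∃ δ₁ > 0, (d ∈ ({(a : ℂ), -(a : ℂ)} : Set ℂ) → (d : OnePoint ℂ) ∉ singPts A a →
        closedBall d (q.ε + δ₁) ⊆ resolventSet A) := by
      intro d
      by_cases h : d ∈ ({(a : ℂ), -(a : ℂ)} : Set ℂ) ∧ (d : OnePoint ℂ) ∉ singPts A a
      · obtain ⟨r, hr, h2⟩ := (isCompact_closedBall d q.ε).exists_cthickening_subset_open
          (isOpen_resolventSet A) (hq.2.1.2.2 d h.1 h.2)
        refine ⟨r, hr, fun _ _ => ?_⟩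
        rwa [cthickening_closedBall hr.le hq.2.1.1.le, add_comm] at h2
      · exact ⟨1, one_pos, fun h1 h2 => absurd ⟨h1, h2⟩ h⟩
    obtain ⟨r1, hr1, h1⟩ := key a
    obtain ⟨r2, hr2, h2⟩ := key (-a)
    refine ⟨min r1 r2, lt_min hr1 hr2, fun δ hδ d hd hd' => ?_⟩
    rcases hd with rfl | hd
    · exact (closedBall_subset_closedBall (by linarith [min_le_left r1 r2])).trans
        (h1 (by simp) hd')
    · rw [mem_singleton_iff] at hd
      subst hd
      exact (closedBall_subset_closedBall (by linarith [min_le_right r1 r2])).trans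
        (h2 (by simp) hd')
  have h2 : ∃ δ₂ > 0, ∀ δ, δ ≤ δ₂ → (infty ∉ singPts A a →
      spectrumSet A ⊆ Metric.ball 0 (q.R - δ)) := by
    by_cases h : infty ∉ singPts A a
    · have hsub := hq.2.2.2 h
      have hK : IsCompact (spectrumSet A) := Metric.isCompact_of_isClosed_isBounded
        (isOpen_resolventSet A).isClosed_compl (Metric.isBounded_ball.subset hsub)
      rcases (spectrumSet A).eq_empty_or_nonempty with he | hne
      · exact ⟨1, one_pos, fun δ _ _ => by rw [he]; exact empty_subset _⟩
      obtain ⟨x, hx, hmax⟩ := hK.exists_isMaxOn hne continuous_norm.continuousOn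
      have hxR : ‖x‖ < q.R := by simpa using hsub hx
      refine ⟨(q.R - ‖x‖) / 2, by linarith, fun δ hδ _ y hy => ?_⟩
      have : ‖y‖ ≤ ‖x‖ := hmax hy
      rw [mem_ball, dist_zero_right]
      linarith
    · exact ⟨1, one_pos, fun δ _ h' => absurd h' h⟩
  obtain ⟨δ₁, hδ₁, h1⟩ := h1
  obtain ⟨δ₂, hδ₂, h2⟩ := h2
  obtain ⟨⟨a1, a2⟩, ⟨b1, b2, b3⟩, c1, c2⟩ := hq
  have h3 : ∃ δ₃ > 0, ∀ δ, δ ≤ δ₃ → (0 < a → q.ε + δ < a) := by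
    by_cases h : 0 < a
    · exact ⟨(a - q.ε) / 2, by linarith [b2 h], fun δ hδ _ => by linarith [b2 h]⟩
    · exact ⟨1, one_pos, fun δ _ h' => absurd h' h⟩
  obtain ⟨δ₃, hδ₃, h3⟩ := h3
  refine ⟨min (min δ₁ δ₂) (min δ₃ (min ((ω - q.φ) / 2) ((q.R - a) / 2))), ?_, fun δ hδ0 hδ => ?_⟩
  · refine lt_min (lt_min hδ₁ hδ₂) (lt_min hδ₃ (lt_min ?_ ?_)) <;> linarith
  · simp only [le_min_iff] at hδ
    obtain ⟨⟨d1, d2⟩, d3, d4, d5⟩ := hδ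
    refine ⟨⟨?_, ?_⟩, ⟨?_, h3 δ d3, h1 δ d1⟩, ?_, h2 δ d2⟩ <;> simp only [Params.shift] <;> linarith

/-- The angular factor of a cut-off. -/
noncomputable def angPart (a φ δ : ℝ) (z : ℂ) : ℝ := (∑ s : ℤˣ, secCut a φ δ s z) - 1

/-- The factor of a cut-off that cuts off the discs around the removed points. -/
noncomputable def discPart (A : X →ₗ.[ℂ] X) (a ε δ : ℝ) (z : ℂ) : ℝ :=
  1 + ∑ d ∈ removedPts A a, (radCut d ε δ z - 1)

open Classical in
/-- The factor of a cut-off that cuts off a neighbourhood of `∞`. -/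
noncomputable def outPart (A : X →ₗ.[ℂ] X) (a R δ : ℝ) (z : ℂ) : ℝ :=
  if infty ∈ singPts A a then 1 else 1 - radCut 0 (R - δ) δ z

/-- A smooth approximation of the indicator function of a region. -/
noncomputable def cut (A : X →ₗ.[ℂ] X) (a : ℝ) (q : Params) (δ : ℝ) (z : ℂ) : ℝ :=
  angPart a q.φ δ z * discPart A a q.ε δ z * outPart A a q.R δ z

/-- Conditions on the parameters of the cut-off `cut A a q δ`. -/
structure GoodCut (A : X →ₗ.[ℂ] X) (ω a : ℝ) (q : Params) (δ : ℝ) : Prop where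
  pos : 0 < δ
  left : Admissible A ω a q
  right : Admissible A ω a (q.shift δ)

lemma GoodCut.phi_pos (h : GoodCut A ω a q δ) : 0 < q.φ := h.left.1.1

lemma GoodCut.phi_lt (h : GoodCut A ω a q δ) : q.φ + δ < ω := h.right.1.2

lemma GoodCut.phi_lt_pi (hS : Setup A ω a) (h : GoodCut A ω a q δ) :
    q.φ + δ < π := by linarith [h.phi_lt, hS.hω.2, pi_pos]

lemma GoodCut.eps_pos (h : GoodCut A ω a q δ) : 0 < q.ε := h.left.2.1.1

lemma GoodCut.rad_pos (hS : Setup A ω a) (h : GoodCut A ω a q δ) :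
    0 < q.R - δ := hS.ha.trans_lt h.right.2.2.1

lemma univ_units : (Finset.univ : Finset ℤˣ) = {1, -1} := by decide

lemma angPart_eq (hδ : 0 < δ) {s : ℤˣ}
    (h : φ + δ ≤ |(loc a (-s) z).arg|) : angPart a φ δ z = secCut a φ δ s z := by
  have h1 : secCut a φ δ (-s) z = 1 := angCut_eq_one hδ h
  have h2 : ∑ s : ℤˣ, secCut a φ δ s z = secCut a φ δ s z + secCut a φ δ (-s) z := by
    rw [univ_units, Finset.sum_pair (by decide)]
    rcases units_eq_one_or s with rfl | rfl
    · rfl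
    · rw [neg_neg, add_comm]
  rw [angPart, h2, h1]; ring

lemma exists_le_abs_arg_loc_neg (ha : 0 ≤ a) (hz : OffVertices a z) :
    ∃ s : ℤˣ, π / 2 ≤ |(loc a (-s) z).arg| := by
  by_cases h : |(loc a 1 z).arg| ≤ π / 2
  · exact ⟨1, pi_div_two_le_abs_arg_loc_neg ha (hz _) h⟩
  · exact ⟨-1, by rw [neg_neg]; linarith⟩

lemma angCut_mem (φ δ : ℝ) (w : ℂ) : angCut φ δ w ∈ Icc (0 : ℝ) 1 :=
  ⟨Real.smoothTransition.nonneg _, Real.smoothTransition.le_one _⟩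

lemma radCut_mem (c : ℂ) (ε δ : ℝ) (w : ℂ) : radCut c ε δ w ∈ Icc (0 : ℝ) 1 :=
  ⟨Real.smoothTransition.nonneg _, Real.smoothTransition.le_one _⟩

lemma angPart_mem (hS : Setup A ω a) (hδ : 0 < δ) (hφ : φ + δ < ω)
    (hz : OffVertices a z) : angPart a φ δ z ∈ Icc (0 : ℝ) 1 := by
  obtain ⟨s, hs⟩ := exists_le_abs_arg_loc_neg hS.ha hz
  rw [angPart_eq hδ (s := s) (by linarith [hS.hω.2])]
  exact angCut_mem _ _ _

lemma norm_sub_of_removedPts {d d' : ℂ} (hd : d ∈ removedPts A a) (hd' : d' ∈ removedPts A a)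
    (h : d ≠ d') : ‖d - d'‖ = 2 * |a| := by
  rw [mem_removedPts] at hd hd'
  have e1 : ∀ x : ℂ, ‖x - -x‖ = 2 * ‖x‖ := fun x => by
    rw [sub_neg_eq_add, ← two_mul, norm_mul]; simp
  have e2 : ∀ x : ℂ, ‖-x - x‖ = 2 * ‖x‖ := fun x => by rw [← norm_neg, ← e1]; ring_nf
  aesop

lemma le_norm_sub_of_removedPts (ha : 0 ≤ a) {ε : ℝ} (hε : 0 < a → ε ≤ a) {d d' : ℂ}
    (hd : d ∈ removedPts A a) (hd' : d' ∈ removedPts A a) (h : d ≠ d')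
    (hz : ‖z - d‖ ≤ ε) : ε ≤ ‖z - d'‖ := by
  have h1 := norm_sub_of_removedPts hd hd' h
  have h2 : ‖d - d'‖ ≤ ‖z - d‖ + ‖z - d'‖ := by
    have := norm_sub_le (z - d') (z - d)
    grind
  rw [abs_of_nonneg ha] at h1
  have h3 : 0 < a := by
    have := norm_pos_iff.2 (sub_ne_zero.2 h)
    linarith
  linarith [hε h3]

lemma discPart_eq (ha : 0 ≤ a) {ε δ : ℝ} (hδ : 0 < δ) (hε : 0 < a → ε + δ ≤ a) {d : ℂ}
    (hd : d ∈ removedPts A a) (hz : ‖z - d‖ ≤ ε + δ) : discPart A a ε δ z = radCut d ε δ z := by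
  rw [discPart, Finset.sum_eq_single_of_mem d hd]
  · ring
  · intro d' hd' hne
    rw [radCut_eq_one hδ (le_norm_sub_of_removedPts ha hε hd hd' hne.symm hz), sub_self]

lemma discPart_eq_one {ε δ : ℝ} (hδ : 0 < δ)
    (hz : ∀ d ∈ removedPts A a, ε + δ ≤ ‖z - d‖) : discPart A a ε δ z = 1 := by
  rw [discPart, Finset.sum_eq_zero, add_zero]
  intro d hd
  rw [radCut_eq_one hδ (hz d hd), sub_self]

lemma discPart_mem (ha : 0 ≤ a) {ε δ : ℝ} (hδ : 0 < δ) (hε : 0 < a → ε + δ ≤ a) (z : ℂ) :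
    discPart A a ε δ z ∈ Icc (0 : ℝ) 1 := by
  by_cases h : ∀ d ∈ removedPts A a, ε + δ ≤ ‖z - d‖
  · rw [discPart_eq_one hδ h]; exact ⟨zero_le_one, le_rfl⟩
  · push Not at h
    obtain ⟨d, hd, h⟩ := h
    rw [discPart_eq ha hδ hε hd h.le]
    exact radCut_mem _ _ _ _

lemma outPart_mem (R δ : ℝ) (z : ℂ) : outPart A a R δ z ∈ Icc (0 : ℝ) 1 := by
  unfold outPart
  split_ifs
  · exact ⟨zero_le_one, le_rfl⟩
  · have := radCut_mem 0 (R - δ) δ z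
    simp_all

lemma outPart_eq_one {R δ : ℝ} (hδ : 0 < δ)
    (hz : infty ∉ singPts A a → ‖z‖ ≤ R - δ) : outPart A a R δ z = 1 := by
  unfold outPart
  split_ifs with h
  · rfl
  · rw [radCut_eq_zero hδ (by rw [sub_zero]; exact hz h), sub_zero]

lemma outPart_eq_zero {R δ : ℝ} (hδ : 0 < δ) (h : infty ∉ singPts A a)
    (hz : R ≤ ‖z‖) : outPart A a R δ z = 0 := by
  rw [outPart, if_neg h, radCut_eq_one hδ (by rw [sub_zero]; linarith), sub_self]

lemma cut_eq_one (hδ : 0 < δ)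
    (h1 : ∀ s, q.φ + δ ≤ |(loc a s z).arg|) (h2 : ∀ d ∈ removedPts A a, q.ε + δ ≤ ‖z - d‖)
    (h3 : infty ∉ singPts A a → ‖z‖ ≤ q.R - δ) : cut A a q δ z = 1 := by
  rw [cut, discPart_eq_one hδ h2, outPart_eq_one hδ h3, angPart_eq hδ (s := 1) (h1 _), secCut,
    angCut_eq_one hδ (h1 _)]; norm_num

lemma GoodCut.eps_le (h : GoodCut A ω a q δ) : 0 < a → q.ε + δ ≤ a :=
  fun ha => (h.right.2.1.2.1 ha).le

lemma cut_eq_zero (hS : Setup A ω a) (h : GoodCut A ω a q δ)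
    (hz : OffVertices a z) (hq : z ∉ region A a q) : cut A a q δ z = 0 := by
  rw [mem_region_iff h.left.1.1 (hS.lt_pi_div_two h.left)] at hq
  by_cases h1 : ∀ s : ℤˣ, q.φ < |(loc a s z).arg|
  · by_cases h2 : ∀ d ∈ removedPts A a, q.ε < ‖z - d‖
    · have h3 : ¬ (infty ∉ singPts A a → ‖z‖ < q.R) := fun h3 => hq ⟨h1, h2, h3⟩
      push Not at h3
      rw [cut, outPart_eq_zero h.pos h3.1 h3.2, mul_zero]
    · push Not at h2
      obtain ⟨d, hd, h2⟩ := h2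
      rw [cut, discPart_eq hS.ha h.pos h.eps_le hd (by linarith [h.pos]), radCut_eq_zero h.pos h2]
      ring
  · push Not at h1
    obtain ⟨s, hs⟩ := h1
    have h4 : q.φ < π / 2 := hS.lt_pi_div_two h.left
    have h5 := pi_div_two_le_abs_arg_loc_neg hS.ha (hz (-s)) (hs.trans h4.le)
    rw [cut, angPart_eq h.pos (s := s) (by linarith [h.phi_lt, hS.hω.2]), secCut,
      angCut_eq_zero h.pos hs]
    ring

/-- The distance to the vertices of the bisector. -/
noncomputable def vdist (a : ℝ) (z : ℂ) : ℝ := min ‖z - a‖ ‖z + a‖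

lemma vdist_nonneg (a : ℝ) (z : ℂ) : 0 ≤ vdist a z := le_min (norm_nonneg _) (norm_nonneg _)

lemma vdist_le_norm_loc (a : ℝ) (s : ℤˣ) (z : ℂ) : vdist a z ≤ ‖loc a s z‖ := by
  rcases units_eq_one_or s with rfl | rfl
  · rw [loc_one]; exact min_le_left _ _
  · rw [loc_neg_one, norm_neg]; exact min_le_right _ _

lemma vdist_le (ha : 0 ≤ a) (z : ℂ) : vdist a z ≤ (1 + a) * (1 + ‖z‖) := by
  have := (vdist_le_norm_loc a 1 z).trans (norm_loc_le ha 1 z)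
  nlinarith [norm_nonneg z, mul_nonneg ha (norm_nonneg z)]

lemma vdist_pos (hz : OffVertices a z) : 0 < vdist a z := by
  rw [offVertices_iff] at hz
  refine lt_min (norm_pos_iff.2 (sub_ne_zero.2 hz.1)) (norm_pos_iff.2 ?_)
  grind

/-- Smooth cut-off functions `χ` that are supported in the region with parameters `p` and equal `1`
near the spectrum, apart from the points `a` and `-a`. -/
structure IsCutoff (A : X →ₗ.[ℂ] X) (a : ℝ) (p : Params) (χ : ℂ → ℝ) : Prop where
  smooth : ∀ z, OffVertices a z → ContDiffAt ℝ 1 χ z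
  mem : ∀ z, OffVertices a z → χ z ∈ Icc (0 : ℝ) 1
  db_le : ∃ C, 0 ≤ C ∧ ∀ z, OffVertices a z → ‖db χ z‖ ≤ C * (‖z - a‖⁻¹ + ‖z + a‖⁻¹)
  zero : ∀ z, OffVertices a z → z ∉ region A a p → χ =ᶠ[𝓝 z] 0
  one : ∀ z, OffVertices a z → z ∉ resolventSet A → χ =ᶠ[𝓝 z] 1
  res_le : ∃ C, 0 ≤ C ∧ ∀ z, OffVertices a z → χ z ≠ 1 → ‖res A z‖ * vdist a z ≤ C

lemma contDiffAt_angPart (hφ : 0 < φ) (hδ : 0 < δ) (hπ : φ + δ < π)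
    (hz : OffVertices a z) : ContDiffAt ℝ 1 (angPart a φ δ) z :=
  (ContDiffAt.sum fun s _ => contDiffAt_secCut hφ hδ hπ (hz s)).sub contDiffAt_const

lemma contDiff_discPart {ε δ : ℝ} (hε : 0 < ε) (hδ : 0 < δ) : ContDiff ℝ 1 (discPart A a ε δ) :=
  contDiff_const.add (ContDiff.sum fun d _ => (contDiff_radCut d hε hδ).sub contDiff_const)

lemma contDiff_outPart {R δ : ℝ} (hR : 0 < R - δ) (hδ : 0 < δ) :
    ContDiff ℝ 1 (outPart A a R δ) := by
  unfold outPart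
  split_ifs
  · exact contDiff_const
  · exact contDiff_const.sub (contDiff_radCut 0 hR hδ)

lemma db_angPart (hφ : 0 < φ) (hδ : 0 < δ) (hπ : φ + δ < π)
    (hz : OffVertices a z) : db (angPart a φ δ) z = ∑ s : ℤˣ, db (secCut a φ δ s) z := by
  unfold angPart
  rw [db_sub_const, db_sum fun s _ => (contDiffAt_secCut hφ hδ hπ (hz s)).differentiableAt
    one_ne_zero]

lemma db_discPart {ε δ : ℝ} (hε : 0 < ε) (hδ : 0 < δ) (z : ℂ) :
    db (discPart A a ε δ) z = ∑ d ∈ removedPts A a, db (radCut d ε δ) z := by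
  have h1 : discPart A a ε δ = fun z => (∑ d ∈ removedPts A a, radCut d ε δ z)
      - ((removedPts A a).card - 1 : ℝ) := by
    ext z; simp [discPart, Finset.sum_sub_distrib]; ring
  rw [h1, db_sub_const, db_sum fun d _ => (contDiff_radCut d hε hδ).differentiable one_ne_zero z]

open Classical in
lemma db_outPart (R δ : ℝ) (z : ℂ) : db (outPart A a R δ) z =
    if infty ∈ singPts A a then 0 else - db (radCut 0 (R - δ) δ) z := by
  by_cases h : infty ∈ singPts A a
  · have : outPart A a R δ = fun _ => 1 := by ext z; simp [outPart, h]
    rw [this, if_pos h]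
    exact db_eq_zero_of_eventually_const EventuallyEq.rfl
  · have : outPart A a R δ = fun z => 1 - radCut 0 (R - δ) δ z := by ext z; simp [outPart, h]
    rw [this, if_neg h, db_const_sub]

lemma db_cut (hS : Setup A ω a) (h : GoodCut A ω a q δ)
    (hz : OffVertices a z) : db (cut A a q δ) z =
      (∑ s : ℤˣ, db (secCut a q.φ δ s) z) * (discPart A a q.ε δ z * outPart A a q.R δ z : ℝ)
      + (∑ d ∈ removedPts A a, db (radCut d q.ε δ) z) *
        (angPart a q.φ δ z * outPart A a q.R δ z : ℝ)
      + db (outPart A a q.R δ) z * (angPart a q.φ δ z * discPart A a q.ε δ z : ℝ) := by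
  have h1 := (contDiffAt_angPart h.phi_pos h.pos (h.phi_lt_pi hS) hz).differentiableAt one_ne_zero
  have h2 := (contDiff_discPart (A := A) (a := a) h.eps_pos h.pos).differentiable one_ne_zero z
  have h3 := (contDiff_outPart (A := A) (a := a) (h.rad_pos hS) h.pos).differentiable one_ne_zero z
  unfold cut
  rw [db_mul (u := fun z => angPart a q.φ δ z * discPart A a q.ε δ z) (h1.mul h2) h3, db_mul h1 h2,
    db_angPart h.phi_pos h.pos (h.phi_lt_pi hS) hz, db_discPart h.eps_pos h.pos]
  push_cast; ring

lemma contDiffAt_cut (hS : Setup A ω a) (h : GoodCut A ω a q δ)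
    (hz : OffVertices a z) : ContDiffAt ℝ 1 (cut A a q δ) z :=
  ((contDiffAt_angPart h.phi_pos h.pos (h.phi_lt_pi hS) hz).mul
    (contDiff_discPart h.eps_pos h.pos).contDiffAt).mul
    (contDiff_outPart (h.rad_pos hS) h.pos).contDiffAt

lemma cut_mem (hS : Setup A ω a) (h : GoodCut A ω a q δ)
    (hz : OffVertices a z) : cut A a q δ z ∈ Icc (0 : ℝ) 1 := by
  have h1 := angPart_mem hS h.pos h.phi_lt hz
  have h2 := discPart_mem (A := A) hS.ha h.pos h.eps_le z
  have h3 := outPart_mem (A := A) (a := a) q.R δ z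
  exact ⟨mul_nonneg (mul_nonneg h1.1 h2.1) h3.1, mul_le_one₀ (mul_le_one₀ h1.2 h2.1 h2.2) h3.1 h3.2⟩

lemma norm_db_radCut_le {B : ℝ} (hB : ∀ x, deriv Real.smoothTransition x ≤ B) (c : ℂ) {ε δ : ℝ}
    (hε : 0 < ε) (hδ : 0 < δ) (z : ℂ) :
    ‖db (radCut c ε δ) z‖ ≤ B / δ ∧ (ε + δ ≤ ‖z - c‖ → db (radCut c ε δ) z = 0) := by
  have hB0 : 0 ≤ B := (deriv_smoothTransition_nonneg 0).trans (hB 0)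
  rw [db_radCut c hε hδ]
  refine ⟨?_, fun h => by rw [mol_eq_zero hδ (.inr (by linarith))]; simp⟩
  rw [norm_mul, norm_real, norm_of_nonneg (mol_nonneg hδ _), norm_div,
    norm_real, norm_norm]
  have h3 : mol δ (‖z - c‖ - ε) ≤ B / δ := by unfold mol; gcongr; exact hB _
  calc _ ≤ B / δ * 1 := mul_le_mul h3 (div_self_le_one _) (by positivity) (by positivity)
    _ = _ := mul_one _

lemma exists_norm_db_cut_le (hS : Setup A ω a) (h : GoodCut A ω a q δ) :
    ∃ C, 0 ≤ C ∧ ∀ z, OffVertices a z → ‖db (cut A a q δ) z‖ ≤ C * (‖z - a‖⁻¹ + ‖z + a‖⁻¹) := by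
  obtain ⟨B, hB0, hB⟩ := exists_deriv_smoothTransition_le
  have hδ := h.pos
  have hε := h.eps_pos
  have hR := h.rad_pos hS
  have ha := hS.ha
  set N : ℝ := ((removedPts A a).card : ℝ) with hN
  refine ⟨B / δ + N * (B / δ * (q.ε + δ)) + B / δ * (q.R + a), ?_, fun z hz => ?_⟩
  · have : 0 ≤ q.R + a := by linarith
    positivity
  have hz' := offVertices_iff.1 hz
  have n1 : 0 < ‖z - a‖ := norm_pos_iff.2 (sub_ne_zero.2 hz'.1)
  have n2 : 0 < ‖z + a‖ := norm_pos_iff.2 (by rw [Ne, add_eq_zero_iff_eq_neg]; exact hz'.2)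
  have m1 := angPart_mem hS h.pos h.phi_lt hz
  have m2 := discPart_mem (A := A) hS.ha h.pos h.eps_le z
  have m3 := outPart_mem (A := A) (a := a) q.R δ z
  have mb : ∀ (w : ℂ) (x y : ℝ), x ∈ Icc (0 : ℝ) 1 → y ∈ Icc (0 : ℝ) 1 →
      ‖w * ((x * y : ℝ) : ℂ)‖ ≤ ‖w‖ := fun w x y hx hy => by
    rw [norm_mul, norm_real, norm_of_nonneg (mul_nonneg hx.1 hy.1)]
    exact mul_le_of_le_one_right (norm_nonneg _) (mul_le_one₀ hx.2 hy.1 hy.2)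
  have b1 : ‖∑ s : ℤˣ, db (secCut a q.φ δ s) z‖ ≤ B / δ * (‖z - a‖⁻¹ + ‖z + a‖⁻¹) := by
    refine (norm_sum_le _ _).trans ?_
    have : ∀ s : ℤˣ, ‖db (secCut a q.φ δ s) z‖ ≤ B / δ * ‖loc a s z‖⁻¹ := fun s => by
      rw [db_secCut h.phi_pos hδ (h.phi_lt_pi hS) (hz s), norm_mul, norm_unit, one_mul]
      exact norm_db_angCut_le hB h.phi_pos hδ (h.phi_lt_pi hS) (hz s)
    refine (sum_le_sum fun s _ => this s).trans (le_of_eq ?_)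
    rw [univ_units, Finset.sum_pair (by decide), loc_one, loc_neg_one, norm_neg, mul_add]
  have b2 : ‖∑ d ∈ removedPts A a, db (radCut d q.ε δ) z‖ ≤
      N * (B / δ * (q.ε + δ)) * (‖z - a‖⁻¹ + ‖z + a‖⁻¹) := by
    refine (norm_sum_le _ _).trans ?_
    rw [mul_assoc, hN, ← nsmul_eq_mul]
    refine Finset.sum_le_card_nsmul _ _ _ fun d hd => ?_
    obtain ⟨c1, c2⟩ := norm_db_radCut_le hB d hε hδ z
    by_cases hc : q.ε + δ ≤ ‖z - d‖
    · rw [c2 hc, norm_zero]; positivity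
    · push Not at hc
      have hd' : ‖z - d‖⁻¹ ≤ ‖z - a‖⁻¹ + ‖z + a‖⁻¹ := by
        rcases (mem_removedPts.1 hd).1 with rfl | rfl
        · linarith [inv_pos.2 n2]
        · simp_all
      have hp : 0 < ‖z - d‖ := by
        rcases (mem_removedPts.1 hd).1 with rfl | rfl
        · exact n1
        · rwa [sub_neg_eq_add]
      have h1 : 1 ≤ (q.ε + δ) * ‖z - d‖⁻¹ := by rw [← div_eq_mul_inv, one_le_div hp]; exact hc.le
      calc _ ≤ B / δ * 1 := by rw [mul_one]; exact c1
        _ ≤ B / δ * ((q.ε + δ) * ‖z - d‖⁻¹) := by gcongr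
        _ ≤ B / δ * ((q.ε + δ) * (‖z - a‖⁻¹ + ‖z + a‖⁻¹)) := by gcongr
        _ = _ := by ring
  have b3 : ‖db (outPart A a q.R δ) z‖ ≤ B / δ * (q.R + a) * (‖z - a‖⁻¹ + ‖z + a‖⁻¹) := by
    have hRa : 0 < q.R + a := by linarith
    rw [db_outPart]
    split_ifs
    · rw [norm_zero]; positivity
    · rw [norm_neg]
      obtain ⟨c1, c2⟩ := norm_db_radCut_le hB 0 hR hδ z
      by_cases hc : q.R - δ + δ ≤ ‖z - 0‖
      · rw [c2 hc, norm_zero]; positivity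
      · push Not at hc
        have h2 : ‖z - a‖ ≤ q.R + a := by
          have := norm_sub_le z (a : ℂ)
          rw [norm_real, norm_of_nonneg ha] at this
          grind
        have h1 : 1 ≤ (q.R + a) * ‖z - a‖⁻¹ := by rw [← div_eq_mul_inv, one_le_div n1]; exact h2
        calc _ ≤ B / δ * 1 := by rw [mul_one]; exact c1
          _ ≤ B / δ * ((q.R + a) * ‖z - a‖⁻¹) := by gcongr
          _ ≤ B / δ * ((q.R + a) * (‖z - a‖⁻¹ + ‖z + a‖⁻¹)) := by gcongr; linarith [inv_pos.2 n2]
          _ = _ := by ring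
  rw [db_cut hS h hz]
  calc _ ≤ ‖∑ s : ℤˣ, db (secCut a q.φ δ s) z‖ + ‖∑ d ∈ removedPts A a, db (radCut d q.ε δ) z‖
        + ‖db (outPart A a q.R δ) z‖ := by
        refine (norm_add_le _ _).trans (add_le_add ((norm_add_le _ _).trans (add_le_add ?_ ?_)) ?_)
        · exact mb _ _ _ m2 m3
        · exact mb _ _ _ m1 m3
        · exact mb _ _ _ m1 m2
    _ ≤ _ := by linarith

/-- `p` is a strictly larger region than `q`. -/
structure Params.Below (p q : Params) : Prop where
  φ : p.φ < q.φ
  ε : p.ε < q.ε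
  R : q.R < p.R

/-- The points that are away from the boundary of the region with parameters `q`. -/
def core (A : X →ₗ.[ℂ] X) (a : ℝ) (q : Params) : Set ℂ :=
  {z | (∀ s, q.φ ≤ |(loc a s z).arg|) ∧ (∀ d ∈ removedPts A a, q.ε ≤ ‖z - d‖) ∧
    (infty ∉ singPts A a → ‖z‖ ≤ q.R)}

lemma exists_norm_res_mul_le (hS : Setup A ω a) [CompleteSpace X]
    (h : GoodCut A ω a q δ) : ∃ C, 0 ≤ C ∧ ∀ z, OffVertices a z → z ∉ core A a (q.shift δ) →
      ‖res A z‖ * vdist a z ≤ C := by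
  have ha := hS.ha
  have hδ := h.pos
  obtain ⟨M, hM0, hM⟩ := hS.exists_norm_loc_mul_norm_res_le (φ := q.φ + δ)
    (by linarith [h.phi_pos]) h.phi_lt
  have hfin : ∃ C2, 0 ≤ C2 ∧ ∀ z, (∃ d ∈ removedPts A a, ‖z - d‖ < q.ε + δ) →
      ‖res A z‖ * (1 + ‖z‖) ≤ C2 := by
    have key : ∀ d ∈ removedPts A a, ∃ C, 0 ≤ C ∧ ∀ z ∈ closedBall d (q.ε + δ),
        ‖res A z‖ * (1 + ‖z‖) ≤ C := fun d hd => by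
      obtain ⟨C, hC0, hC⟩ := exists_norm_res_le_of_isCompact (isCompact_closedBall d (q.ε + δ))
        (h.right.closedBall_subset hd)
      have := h.eps_pos
      refine ⟨C * (1 + (‖d‖ + (q.ε + δ))), by positivity, fun z hz => ?_⟩
      have h1 : ‖z‖ ≤ ‖d‖ + (q.ε + δ) := norm_le_of_mem_closedBall hz
      have h2 := hC z hz
      gcongr
    choose! C hC0 hC using key
    refine ⟨∑ d ∈ removedPts A a, C d, sum_nonneg hC0, ?_⟩
    rintro z ⟨d, hd, hz⟩
    exact (hC d hd z (by rw [mem_closedBall, dist_eq_norm]; exact hz.le)).trans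
      (single_le_sum hC0 hd)
  have hout : ∃ C3, 0 ≤ C3 ∧ (infty ∉ singPts A a → ∀ z : ℂ, q.R - δ < ‖z‖ →
      ‖res A z‖ * (1 + ‖z‖) ≤ C3) := by
    by_cases hinf : infty ∉ singPts A a
    · obtain ⟨C, r, hC⟩ := exists_norm_mul_norm_res_le hS.hA.1 (infty_notMem_singPts_iff.1 hinf)
      have hK : IsCompact {z : ℂ | q.R - δ ≤ ‖z‖ ∧ ‖z‖ ≤ max r 1} := by
        refine Metric.isCompact_of_isClosed_isBounded ?_ ?_
        · exact (isClosed_le continuous_const continuous_norm).inter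
            (isClosed_le continuous_norm continuous_const)
        · exact (Metric.isBounded_closedBall (x := (0 : ℂ)) (r := max r 1)).subset fun z hz => by
            simp_all
      have hKsub : {z : ℂ | q.R - δ ≤ ‖z‖ ∧ ‖z‖ ≤ max r 1} ⊆ resolventSet A := fun z hz => by
        by_contra hc
        have := h.right.2.2.2 hinf hc
        rw [mem_ball, dist_zero_right] at this
        exact absurd this (not_lt.2 hz.1)
      obtain ⟨D, hD0, hD⟩ := exists_norm_res_le_of_isCompact hK hKsub
      refine ⟨2 * |C| + D * (1 + max r 1), by positivity, fun _ z hz => ?_⟩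
      by_cases hz2 : ‖z‖ ≤ max r 1
      · have h1 := hD z ⟨hz.le, hz2⟩
        calc _ ≤ D * (1 + max r 1) := by gcongr
          _ ≤ _ := by linarith [abs_nonneg C]
      · push Not at hz2
        obtain ⟨-, h2⟩ := hC z ((le_max_left _ _).trans hz2.le)
        have h3 : 1 ≤ ‖z‖ := (le_max_right _ _).trans hz2.le
        have h4 : 0 ≤ D * (1 + max r 1) := by positivity
        nlinarith [le_abs_self C, norm_nonneg (res A z)]
    · grind
  obtain ⟨C2, hC20, hC2⟩ := hfin
  obtain ⟨C3, hC30, hC3⟩ := hout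
  refine ⟨M + (C2 + C3) * (1 + a), by positivity, fun z hz hne => ?_⟩
  by_cases h1 : ∃ s : ℤˣ, |(loc a s z).arg| < q.φ + δ
  · obtain ⟨s, hs⟩ := h1
    have h2 := hM s z (hz s) hs
    have h3 := mul_le_mul_of_nonneg_left (vdist_le_norm_loc a s z) (norm_nonneg (res A z))
    have h4 : 0 ≤ (C2 + C3) * (1 + a) := by positivity
    linarith
  · have hk : ‖res A z‖ * (1 + ‖z‖) ≤ C2 + C3 := by
      by_cases h2 : ∃ d ∈ removedPts A a, ‖z - d‖ < q.ε + δ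
      · linarith [hC2 z h2]
      · by_cases h3 : infty ∉ singPts A a ∧ q.R - δ < ‖z‖
        · linarith [hC3 h3.1 z h3.2]
        · push Not at h1 h2 h3
          exact absurd ⟨h1, h2, h3⟩ hne
    calc _ ≤ ‖res A z‖ * ((1 + a) * (1 + ‖z‖)) := by gcongr; exact vdist_le ha z
      _ = (‖res A z‖ * (1 + ‖z‖)) * (1 + a) := by ring
      _ ≤ (C2 + C3) * (1 + a) := by gcongr
      _ ≤ _ := by linarith

lemma isCutoff_cut (hS : Setup A ω a) [CompleteSpace X]
    (hp : Admissible A ω a p) (h : GoodCut A ω a q δ) (hpq : p.Below q) :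
    IsCutoff A a p (cut A a q δ) where
  smooth _ hz := contDiffAt_cut hS h hz
  mem _ hz := cut_mem hS h hz
  db_le := exists_norm_db_cut_le hS h
  res_le := by
    obtain ⟨C, h0, hC⟩ := exists_norm_res_mul_le hS h
    exact ⟨C, h0, fun z hz hne => hC z hz fun hc => hne (cut_eq_one h.pos hc.1 hc.2.1 hc.2.2)⟩
  zero z hz hzp := by
    have hoff : ∀ᶠ w in 𝓝 z, OffVertices a w := by
      simp_rw [offVertices_iff] at hz ⊢
      exact (isOpen_ne.eventually_mem hz.1).and (isOpen_ne.eventually_mem hz.2)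
    rw [mem_region_iff hp.1.1 (hS.lt_pi_div_two hp)] at hzp
    have hev : ∀ᶠ w in 𝓝 z, w ∉ region A a q := by
      simp_rw [mem_region_iff h.left.1.1 (hS.lt_pi_div_two h.left)]
      by_cases h1 : ∀ s : ℤˣ, p.φ < |(loc a s z).arg|
      · by_cases h2 : ∀ d ∈ removedPts A a, p.ε < ‖z - d‖
        · have h3 : ¬ (infty ∉ singPts A a → ‖z‖ < p.R) := fun h3 => hzp ⟨h1, h2, h3⟩
          push Not at h3
          have : ∀ᶠ w : ℂ in 𝓝 z, q.R < ‖w‖ :=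
            continuous_norm.continuousAt.eventually (lt_mem_nhds (hpq.R.trans_le h3.2))
          filter_upwards [this] with w hw hw'
          grind
        · push Not at h2
          obtain ⟨d, hd, h2⟩ := h2
          have hc : ContinuousAt (fun w : ℂ => ‖w - d‖) z := by fun_prop
          filter_upwards [hc.eventually (gt_mem_nhds (h2.trans_lt hpq.ε))] with w hw hw'
          grind
      · push Not at h1
        obtain ⟨s, hs⟩ := h1
        have := (continuous_loc a s).continuousAt.eventually (eventually_abs_arg_lt
          h.phi_pos.le (by linarith [h.phi_lt_pi hS, h.pos]) (hz s) (hs.trans_lt hpq.φ))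
        filter_upwards [this] with w hw hw'
        grind
    filter_upwards [hoff, hev] with w h1 h2
    exact cut_eq_zero hS h h1 h2
  one z hz hzr := by
    have e1 : ∀ᶠ w in 𝓝 z, ∀ s : ℤˣ, q.φ + δ < |(loc a s w).arg| := by
      rw [eventually_all]
      intro s
      have h1 : q.φ + δ < |(loc a s z).arg| := by
        by_contra! hc
        exact hzr (hS.mem_resolventSet (hz s) (hc.trans_lt h.phi_lt))
      exact (isOpen_lt_abs_arg_loc (by linarith [h.phi_pos, h.pos]) (h.phi_lt_pi hS).le a s).mem_nhds
        h1
    have e2 : ∀ᶠ w in 𝓝 z, ∀ d ∈ removedPts A a, q.ε + δ < ‖w - d‖ := by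
      rw [Filter.eventually_all_finset]
      intro d hd
      have h1 : q.ε + δ < ‖z - d‖ := by
        by_contra! hc
        exact hzr (h.right.closedBall_subset hd (by rw [mem_closedBall, dist_eq_norm]; exact hc))
      have hc : ContinuousAt (fun w : ℂ => ‖w - d‖) z := by fun_prop
      exact hc.eventually (lt_mem_nhds h1)
    have e3 : ∀ᶠ w : ℂ in 𝓝 z, infty ∉ singPts A a → ‖w‖ < q.R - δ := by
      rw [eventually_imp_distrib_left]
      intro hinf
      have := h.right.2.2.2 hinf hzr
      rw [mem_ball, dist_zero_right] at this
      exact continuous_norm.continuousAt.eventually (gt_mem_nhds this)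
    filter_upwards [e1, e2, e3] with w h1 h2 h3
    exact cut_eq_one h.pos (fun s => (h1 s).le) (fun d hd => (h2 d hd).le) fun hi => (h3 hi).le

/-- `χ₂` equals `1` in a conical neighbourhood of the support of `χ₁`. -/
def Nested (a : ℝ) (χ₁ χ₂ : ℂ → ℝ) : Prop :=
  ∃ c > 0, ∀ z w, OffVertices a z → OffVertices a w → χ₁ z ≠ 0 → χ₂ w ≠ 1 →
    c * vdist a w ≤ ‖z - w‖ * (1 + ‖w‖)

lemma nested_cut (hS : Setup A ω a) {q r : Params} {δ δ' : ℝ} (h : GoodCut A ω a q δ)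
    (h' : GoodCut A ω a r δ') (hqr : (q.shift δ).Below r) :
    Nested a (cut A a r δ') (cut A a q δ) := by
  have ha := hS.ha
  have hφ : q.φ + δ < r.φ := hqr.φ
  have hε : q.ε + δ < r.ε := hqr.ε
  have hR : r.R < q.R - δ := hqr.R
  have hrφ : r.φ < π / 2 := hS.lt_pi_div_two h'.left
  have hq0 := h.phi_pos
  have hδ := h.pos
  have hsin : 0 < sin (r.φ - (q.φ + δ)) :=
    sin_pos_of_pos_of_lt_pi (by linarith) (by linarith)
  set m := min (sin (r.φ - (q.φ + δ))) (min (r.ε - (q.ε + δ)) (q.R - δ - r.R)) with hm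
  have hm0 : 0 < m := lt_min hsin (lt_min (by linarith) (by linarith))
  refine ⟨m * (1 + a)⁻¹, by positivity, fun z w hz hw h1 h2 => ?_⟩
  have hzr : z ∈ region A a r := by
    by_contra hc
    exact h1 (cut_eq_zero hS h' hz hc)
  rw [mem_region_iff h'.left.1.1 hrφ] at hzr
  obtain ⟨z1, z2, z3⟩ := hzr
  have hnw := norm_nonneg w
  have hfar : m ≤ ‖z - w‖ → m * (1 + a)⁻¹ * vdist a w ≤ ‖z - w‖ * (1 + ‖w‖) := by
    intro hle
    calc _ ≤ m * (1 + a)⁻¹ * ((1 + a) * (1 + ‖w‖)) := by gcongr; exact vdist_le ha w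
      _ = m * (1 + ‖w‖) := by field_simp
      _ ≤ _ := by gcongr
  by_cases c1 : ∃ s : ℤˣ, |(loc a s w).arg| < q.φ + δ
  · obtain ⟨s, hs⟩ := c1
    have h3 := (sin_mul_norm_le_norm_sub hφ hs.le (z1 s).le).1
    have h4 : ‖loc a s w - loc a s z‖ = ‖z - w‖ := by
      rw [loc, loc, ← norm_neg, show -(((s : ℤ) : ℂ) * w - a - (((s : ℤ) : ℂ) * z - a)) =
        ((s : ℤ) : ℂ) * (z - w) by ring, norm_mul, norm_unit, one_mul]
    rw [h4] at h3
    have h6 : m ≤ sin (r.φ - (q.φ + δ)) := min_le_left _ _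
    have h7 : (1 + a)⁻¹ ≤ 1 := inv_le_one_of_one_le₀ (by linarith)
    calc _ ≤ m * 1 * ‖loc a s w‖ :=
          mul_le_mul (mul_le_mul_of_nonneg_left h7 hm0.le) (vdist_le_norm_loc a s w)
            (vdist_nonneg _ _) (by positivity)
      _ ≤ sin (r.φ - (q.φ + δ)) * ‖loc a s w‖ := by rw [mul_one]; gcongr
      _ ≤ ‖z - w‖ := h3
      _ ≤ _ := le_mul_of_one_le_right (norm_nonneg _) (by linarith)
  · by_cases c2 : ∃ d ∈ removedPts A a, ‖w - d‖ < q.ε + δ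
    · obtain ⟨d, hd, hc⟩ := c2
      apply hfar
      have h3 := z2 d hd
      have h4 : ‖z - d‖ ≤ ‖z - w‖ + ‖w - d‖ := by
        have := norm_add_le (z - w) (w - d)
        rwa [sub_add_sub_cancel] at this
      grind
    · by_cases c3 : infty ∉ singPts A a ∧ q.R - δ < ‖w‖
      · apply hfar
        have h3 := z3 c3.1
        have h4 : ‖w‖ ≤ ‖z - w‖ + ‖z‖ := by
          have := norm_sub_le z (z - w)
          rw [sub_sub_cancel] at this
          linarith
        grind
      · push Not at c1 c2 c3
        exact absurd (cut_eq_one hδ c1 c2 c3) h2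

section Slices

variable {E : Type*} [NormedAddCommGroup E] [NormedSpace ℂ E]

/-- `F` is continuous on an open set and vanishes elsewhere. -/
def OpenCont (F : ℂ → E) : Prop := ∃ D, IsOpen D ∧ ContinuousOn F D ∧ ∀ z ∉ D, F z = 0

lemma OpenCont.aestronglyMeasurable_comp {F : ℂ → E} (hF : OpenCont F) {α : Type*}
    [TopologicalSpace α] [MeasurableSpace α] [OpensMeasurableSpace α]
    [TopologicalSpace.PseudoMetrizableSpace α]
    [SecondCountableTopology α] {γ : α → ℂ} (hγ : Continuous γ) (μ : Measure α) :
    AEStronglyMeasurable (fun x => F (γ x)) μ := by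
  obtain ⟨D, hD, hc, h0⟩ := hF
  have hm : MeasurableSet (γ ⁻¹' D) := (hD.preimage hγ).measurableSet
  have h1 : (fun x => F (γ x)) = (γ ⁻¹' D).indicator fun x => F (γ x) := by
    ext x
    by_cases h : γ x ∈ D
    · rw [indicator_of_mem (by exact h)]
    · simp_all
  rw [h1, aestronglyMeasurable_indicator_iff hm]
  exact (hc.comp hγ.continuousOn fun x hx => hx).aestronglyMeasurable hm

lemma OpenCont.smul {F : ℂ → E} {W : ℂ → ℝ} {D : Set ℂ} (hD : IsOpen D) (hF : ContinuousOn F D)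
    (h0 : ∀ z ∉ D, F z = 0) (hW : ContinuousOn W D) : OpenCont fun z => W z • F z :=
  ⟨D, hD, hW.smul hF, fun z hz => by simp [h0 z hz]⟩

/-- A family of approximate identities at `x₀`. -/
structure ApproxId (ρ : ℝ → ℝ → ℝ) (x₀ : ℝ) : Prop where
  cont : ∀ δ > 0, Continuous (ρ δ)
  nonneg : ∀ δ > 0, ∀ x, 0 ≤ ρ δ x
  int : ∀ δ > 0, ∫ x, ρ δ x = 1
  supp : ∀ δ > 0, ∀ x, δ < |x - x₀| → ρ δ x = 0

lemma ApproxId.integrable {ρ : ℝ → ℝ → ℝ} {x₀ : ℝ} (h : ApproxId ρ x₀) (hδ : 0 < δ) :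
    Integrable (ρ δ) := by
  by_contra hc
  have := h.int δ hδ
  rw [integral_undef hc] at this
  exact zero_ne_one this

lemma approxId_mol (x₀ : ℝ) : ApproxId (fun δ x => mol δ (x - x₀)) x₀ where
  cont δ _ := (continuous_mol δ).comp (by fun_prop)
  nonneg δ hδ x := mol_nonneg hδ _
  int δ hδ := by rw [integral_sub_right_eq_self (fun r => mol δ r), integral_mol hδ]
  supp δ hδ x hx := by
    refine mol_eq_zero hδ ?_
    grind

lemma approxId_mol_neg (x₀ : ℝ) : ApproxId (fun δ x => mol δ (-x - x₀)) (-x₀) where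
  cont δ _ := (continuous_mol δ).comp (by fun_prop)
  nonneg δ hδ x := mol_nonneg hδ _
  int δ hδ := by
    rw [integral_neg_eq_self (fun x => mol δ (x - x₀)),
      integral_sub_right_eq_self (fun r => mol δ r), integral_mol hδ]
  supp δ hδ x hx := by
    refine mol_eq_zero hδ ?_
    grind

lemma approxId_mol_shift (x₀ : ℝ) : ApproxId (fun δ x => mol δ (x - (x₀ - δ))) x₀ where
  cont δ _ := (continuous_mol δ).comp (by fun_prop)
  nonneg δ hδ x := mol_nonneg hδ _
  int δ hδ := by rw [integral_sub_right_eq_self (fun r => mol δ r), integral_mol hδ]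
  supp δ hδ x hx := by
    refine mol_eq_zero hδ ?_
    grind

variable [CompleteSpace E]

lemma ApproxId.integrable_slices {ρ : ℝ → ℝ → ℝ} {x₀ δ₁ : ℝ} (hρ : ApproxId ρ x₀)
    {S : Set ℝ} (hS : MeasurableSet S) {K : ℂ → E} (hK : OpenCont K)
    {γ : ℝ × ℝ → ℂ} (hγ : Continuous γ) {m : ℝ × ℝ → ℂ} (hm : Continuous m) {b : ℝ → ℝ}
    (hb : IntegrableOn b S) (hbd : ∀ x, |x - x₀| ≤ δ₁ → ∀ y ∈ S, ‖m (x, y) • K (γ (x, y))‖ ≤ b y)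
    (hδ : δ ∈ Ioo 0 δ₁) : Integrable fun x => ρ δ x • ∫ y in S, m (x, y) • K (γ (x, y)) := by
  have hms : AEStronglyMeasurable (fun x => ∫ y in S, m (x, y) • K (γ (x, y))) :=
    AEStronglyMeasurable.integral_prod_right' (f := fun p : ℝ × ℝ => m p • K (γ p))
      (hm.aestronglyMeasurable.smul (hK.aestronglyMeasurable_comp hγ _))
  refine Integrable.mono' ((hρ.integrable hδ.1).mul_const (∫ y in S, b y))
    ((hρ.cont δ hδ.1).aestronglyMeasurable.smul hms) (Eventually.of_forall fun x => ?_)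
  rw [norm_smul, norm_of_nonneg (hρ.nonneg δ hδ.1 x)]
  by_cases h : δ < |x - x₀|
  · rw [hρ.supp δ hδ.1 x h]; simp
  · refine mul_le_mul_of_nonneg_left ?_ (hρ.nonneg δ hδ.1 x)
    refine norm_integral_le_of_norm_le hb ?_
    filter_upwards [ae_restrict_mem hS] with y hy
    grind

lemma tendsto_integral_slices {ρ : ℝ → ℝ → ℝ} {x₀ δ₁ : ℝ} (hρ : ApproxId ρ x₀) (hδ₁ : 0 < δ₁)
    {S : Set ℝ} (hS : MeasurableSet S) {K : ℝ → ℂ → E} (hK : ∀ δ ∈ Ioo 0 δ₁, OpenCont (K δ))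
    {γ : ℝ × ℝ → ℂ} (hγ : Continuous γ) {m : ℝ × ℝ → ℂ} (hm : Continuous m) {b : ℝ → ℝ}
    (hb : IntegrableOn b S)
    (hbd : ∀ δ ∈ Ioo 0 δ₁, ∀ x, |x - x₀| ≤ δ₁ → ∀ y ∈ S, ‖m (x, y) • K δ (γ (x, y))‖ ≤ b y)
    {L : ℝ → E} (hL : ∀ᵐ y ∂(volume.restrict S), Tendsto (fun p : ℝ × ℂ => K p.1 p.2)
      (𝓝[>] 0 ×ˢ 𝓝 (γ (x₀, y))) (𝓝 (L y))) :
    Tendsto (fun δ => ∫ x, ρ δ x • ∫ y in S, m (x, y) • K δ (γ (x, y))) (𝓝[>] 0)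
      (𝓝 (∫ y in S, m (x₀, y) • L y)) := by
  have hev : ∀ᶠ δ in 𝓝[>] (0 : ℝ), δ ∈ Ioo 0 δ₁ := Ioo_mem_nhdsGT hδ₁
  have hx : ∀ᶠ x in 𝓝 x₀, |x - x₀| ≤ δ₁ := by
    filter_upwards [Metric.closedBall_mem_nhds x₀ hδ₁] with x hx
    simpa [Real.dist_eq] using hx
  refine tendsto_integral_approx_identity (x₀ := x₀)
    (g := fun δ x => ∫ y in S, m (x, y) • K δ (γ (x, y))) hρ.nonneg hρ.int hρ.supp ?_ ?_
  · refine tendsto_integral_filter_of_dominated_convergence b ?_ ?_ hb ?_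
    · filter_upwards [hev.prod_mk hx] with p hp
      exact ((hm.comp (by fun_prop)).aestronglyMeasurable).smul
        ((hK _ hp.1).aestronglyMeasurable_comp (hγ.comp (by fun_prop)) _)
    · filter_upwards [hev.prod_mk hx] with p hp
      filter_upwards [ae_restrict_mem hS] with y hy
      exact hbd _ hp.1 _ hp.2 y hy
    · filter_upwards [hL] with y hy
      have h1 : Tendsto (fun p : ℝ × ℝ => (p.1, γ (p.2, y))) (𝓝[>] 0 ×ˢ 𝓝 x₀)
          (𝓝[>] 0 ×ˢ 𝓝 (γ (x₀, y))) :=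
        tendsto_fst.prodMk ((hγ.comp (by fun_prop : Continuous fun x : ℝ => (x, y))).continuousAt.tendsto.comp tendsto_snd)
      have h2 : Tendsto (fun p : ℝ × ℝ => m (p.2, y)) (𝓝[>] 0 ×ˢ 𝓝 x₀) (𝓝 (m (x₀, y))) :=
        (hm.comp (by fun_prop : Continuous fun x : ℝ => (x, y))).continuousAt.tendsto.comp tendsto_snd
      exact h2.smul (hy.comp h1)
  · filter_upwards [hev] with δ hδ
    exact hρ.integrable_slices hS (hK δ hδ) hγ hm hb (hbd δ hδ) hδ

lemma ApproxId.integrable_radial_kernel {ρ : ℝ → ℝ → ℝ} {x₀ : ℝ} (hρ : ApproxId ρ x₀) (c : ℂ)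
    (hδ : 0 < δ) {F : ℂ → E} (hF : OpenCont F) {C : ℝ} (hC : ∀ z, ‖F z‖ ≤ C) :
    Integrable fun z => (ρ δ ‖z - c‖ * ((z - c) / ‖z - c‖) : ℂ) • F z := by
  obtain ⟨B, hB⟩ := (isCompact_Icc (a := x₀ - δ) (b := x₀ + δ)).exists_bound_of_continuousOn
    (hρ.cont δ hδ).continuousOn
  have hB0 : ∀ x, ρ δ x ≤ |B| := fun x => by
    by_cases h : δ < |x - x₀|
    · rw [hρ.supp δ hδ x h]; positivity
    · rw [not_lt, abs_le] at h
      exact (le_abs_self _).trans ((hB x ⟨by linarith, by linarith⟩).trans (le_abs_self B))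
  have hsupp : Function.support (fun z => (ρ δ ‖z - c‖ * ((z - c) / ‖z - c‖) : ℂ) • F z) ⊆
      closedBall c (x₀ + δ) := by
    intro z hz
    rw [mem_closedBall, dist_eq_norm]
    by_contra h
    push Not at h
    refine hz ?_
    simp only
    rw [hρ.supp δ hδ _ (lt_of_lt_of_le (by linarith) (le_abs_self _))]
    simp
  rw [← integrableOn_iff_integrable_of_support_subset hsupp]
  refine Measure.integrableOn_of_bounded (M := |B| * C) (measure_closedBall_lt_top).ne ?_ ?_
  · refine AEStronglyMeasurable.smul (Measurable.aestronglyMeasurable ?_)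
      (hF.aestronglyMeasurable_comp continuous_id _)
    have := (hρ.cont δ hδ).measurable
    fun_prop
  · refine Eventually.of_forall fun z => ?_
    rw [norm_smul, norm_mul, norm_real, norm_of_nonneg (hρ.nonneg δ hδ _)]
    have h1 : ‖(z - c) / (‖z - c‖ : ℂ)‖ ≤ 1 := by
      rw [norm_div, norm_real, norm_norm]; exact div_self_le_one _
    calc _ ≤ |B| * 1 * C := by gcongr; exacts [hB0 _, hC z]
      _ = _ := by ring

/-- Area integrals over thin annuli converge to integrals over circles. -/
lemma tendsto_integral_radial {ρ : ℝ → ℝ → ℝ} {x₀ δ₁ : ℝ} (hρ : ApproxId ρ x₀) (hδ₁ : 0 < δ₁)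
    (hx₀ : δ₁ < x₀) (c : ℂ) {K : ℝ → ℂ → E} (hK : ∀ δ ∈ Ioo 0 δ₁, OpenCont (K δ)) {C : ℝ}
    (hC : ∀ δ ∈ Ioo 0 δ₁, ∀ z, ‖K δ z‖ ≤ C) {L : ℝ → E}
    (hL : ∀ᵐ y ∂(volume.restrict (Ioo (-π) π)), Tendsto (fun p : ℝ × ℂ => K p.1 p.2)
      (𝓝[>] 0 ×ˢ 𝓝 (polar c x₀ y)) (𝓝 (L y))) :
    Tendsto (fun δ => ∫ z, (ρ δ ‖z - c‖ * ((z - c) / ‖z - c‖) : ℂ) • K δ z) (𝓝[>] 0)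
      (𝓝 (∫ θ in Ioo (-π) π, (x₀ * exp (θ * I)) • L θ)) := by
  have h := tendsto_integral_slices hρ hδ₁ (S := Ioo (-π) π) measurableSet_Ioo hK
    (γ := fun p => polar c p.1 p.2) (continuous_polar c)
    (m := fun p => p.1 * exp (p.2 * I)) (by fun_prop)
    (b := fun _ => (|x₀| + δ₁) * C)
    (integrableOn_const (by rw [Real.volume_Ioo]; exact ENNReal.ofReal_ne_top))
    (fun δ hδ x hx y hy => by
      rw [norm_smul, norm_mul, norm_exp_ofReal_mul_I, mul_one, norm_real]
      have h1 : ‖x‖ ≤ |x₀| + δ₁ := by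
        have := abs_sub_abs_le_abs_sub x x₀
        rw [norm_eq_abs]; linarith
      exact mul_le_mul h1 (hC δ hδ _) (norm_nonneg _) (by positivity)) hL
  refine h.congr' ?_
  filter_upwards [Ioo_mem_nhdsGT hδ₁] with δ hδ
  rw [integral_radial_kernel c (ρ δ) (K δ) (hρ.integrable_radial_kernel c hδ.1 (hK δ hδ) (hC δ hδ)),
    setIntegral_eq_integral_of_forall_compl_eq_zero]
  intro x hx
  rw [mem_Ioi, not_lt] at hx
  rw [hρ.supp δ hδ.1 x, zero_smul]
  grind

lemma integral_comp_loc (a : ℝ) (s : ℤˣ) (H : ℂ → E) : ∫ z, H (loc a s z) = ∫ w, H w := by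
  rcases units_eq_one_or s with rfl | rfl
  · simp_rw [loc_one]
    exact integral_sub_right_eq_self H _
  · simp_rw [loc_neg_one]
    rw [integral_add_right_eq_self (fun z => H (-z)), integral_neg_eq_self]

lemma _root_.MeasureTheory.Integrable.comp_loc {H : ℂ → E} (hH : Integrable H) (a : ℝ) (s : ℤˣ) :
    Integrable fun z => H (loc a s z) := by
  rcases units_eq_one_or s with rfl | rfl
  · simp_rw [loc_one]
    exact hH.comp_sub_right (a : ℂ)
  · simp_rw [loc_neg_one]
    exact hH.comp_neg.comp_add_right (a : ℂ)

/-- The parametrization of the rays by polar coordinates around the vertices. -/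
noncomputable def rayMap (a : ℝ) (s : ℤˣ) (p : ℝ × ℝ) : ℂ :=
  ((s : ℤ) : ℂ) * (a + p.2 * exp (p.1 * I))

lemma continuous_rayMap (a : ℝ) (s : ℤˣ) : Continuous (rayMap a s) := by unfold rayMap; fun_prop

lemma rayMap_eq_ray (a θ : ℝ) (s τ : ℤˣ) (t : ℝ) : rayMap a s ((τ : ℤ) * θ, t) = ray a θ s τ t := by
  simp [rayMap, ray]

lemma one_add_norm_loc_le (ha : 0 ≤ a) (s : ℤˣ) (z : ℂ) :
    1 + ‖loc a s z‖ ≤ (1 + a) * (1 + ‖z‖) := by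
  nlinarith [norm_loc_le ha s z, mul_nonneg ha (norm_nonneg z)]

lemma inv_sq_le_loc (ha : 0 ≤ a) (s : ℤˣ) (z : ℂ) :
    ((1 + ‖z‖) ^ 2)⁻¹ ≤ (1 + a) ^ 2 * ((1 + ‖loc a s z‖) ^ 2)⁻¹ := by
  have h := one_add_norm_loc_le ha s z
  rw [← div_eq_mul_inv, le_div_iff₀ (by positivity), inv_mul_le_iff₀ (by positivity), ← mul_pow,
    mul_comm]
  gcongr

lemma norm_rayMap_bound (ha : 0 ≤ a) (s : ℤˣ) (θ : ℝ) {t : ℝ} (ht : 0 < t) :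
    ((1 + ‖rayMap a s (θ, t)‖) ^ 2)⁻¹ ≤ (1 + a) ^ 2 * ((1 + t) ^ 2)⁻¹ := by
  have h := inv_sq_le_loc ha s (rayMap a s (θ, t))
  have h1 : loc a s (rayMap a s (θ, t)) = t * exp (θ * I) := by
    rw [loc, rayMap, ← mul_assoc, unit_sq]; ring
  rwa [h1, norm_mul, norm_exp_ofReal_mul_I, mul_one, norm_real,
    norm_of_nonneg ht.le] at h

lemma integrableOn_inv_one_add_sq : IntegrableOn (fun t : ℝ => ((1 + t) ^ 2)⁻¹) (Ioi 0) := by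
  have h := integrable_inv_one_add_sq
  refine Integrable.mono' h.integrableOn (by fun_prop) ?_
  filter_upwards [ae_restrict_mem measurableSet_Ioi] with t ht
  have ht0 : 0 < t := ht
  rw [norm_of_nonneg (by positivity)]
  exact inv_anti₀ (by positivity) (by nlinarith)

/-- Area integrals over thin sectors converge to integrals over rays. -/
lemma tendsto_integral_angular {a φ δ₁ : ℝ} (ha : 0 ≤ a) (hφ : 0 < φ) (hδ₁ : 0 < δ₁)
    (hπ : φ + δ₁ < π) (s : ℤˣ) {K : ℝ → ℂ → E} (hK : ∀ δ ∈ Ioo 0 δ₁, OpenCont (K δ)) {C : ℝ}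
    (hC : ∀ δ ∈ Ioo 0 δ₁, ∀ z, ‖K δ z‖ ≤ C * ((1 + ‖z‖) ^ 2)⁻¹) {L : ℤˣ → ℝ → E}
    (hL : ∀ τ : ℤˣ, ∀ᵐ t ∂(volume.restrict (Ioi (0 : ℝ))), Tendsto (fun p : ℝ × ℂ => K p.1 p.2)
      (𝓝[>] 0 ×ˢ 𝓝 (ray a φ s τ t)) (𝓝 (L τ t))) :
    (∀ δ ∈ Ioo 0 δ₁, Integrable fun z => db (secCut a φ δ s) z • K δ z) ∧
    Tendsto (fun δ => ∫ z, db (secCut a φ δ s) z • K δ z) (𝓝[>] 0)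
      (𝓝 (I • ∑ τ : ℤˣ, ∫ t in Ioi (0 : ℝ),
        (((τ : ℤ) : ℂ) * ((s : ℤ) : ℂ) * exp (((τ : ℤ) : ℂ) * φ * I)) • L τ t)) := by
  obtain ⟨B, hB0, hB⟩ := exists_deriv_smoothTransition_le
  have hC0 : 0 ≤ C := by
    have h1 := (norm_nonneg _).trans (hC (δ₁ / 2) ⟨by linarith, by linarith⟩ 0)
    simpa using h1
  let m : ℝ × ℝ → ℂ := fun p => I * ((s : ℤ) : ℂ) * exp (p.1 * I)
  have hm : Continuous m := by fun_prop
  have hmn : ∀ p, ‖m p‖ = 1 := fun p => by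
    simp only [m]
    rw [norm_mul, norm_mul, norm_exp_ofReal_mul_I, norm_unit, Complex.norm_I]; norm_num
  let b : ℝ → ℝ := fun t => C * ((1 + a) ^ 2 * ((1 + t) ^ 2)⁻¹)
  have hb : IntegrableOn b (Ioi 0) := (integrableOn_inv_one_add_sq.const_mul _).const_mul _
  have hbd : ∀ δ ∈ Ioo 0 δ₁, ∀ x : ℝ, ∀ y ∈ Ioi (0 : ℝ),
      ‖m (x, y) • K δ (rayMap a s (x, y))‖ ≤ b y := fun δ hδ x y hy => by
    rw [norm_smul, hmn, one_mul]
    exact (hC δ hδ _).trans (mul_le_mul_of_nonneg_left (norm_rayMap_bound ha s x hy) hC0)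
  have t1 := tendsto_integral_slices (approxId_mol φ) hδ₁ measurableSet_Ioi hK
    (continuous_rayMap a s) hm hb (fun δ hδ x _ => hbd δ hδ x) (L := L 1) (by
      filter_upwards [hL 1] with t ht
      have := rayMap_eq_ray a φ s 1 t
      simp only [Units.val_one, Int.cast_one, one_mul] at this
      rwa [this])
  have t2 := tendsto_integral_slices (approxId_mol_neg φ) hδ₁ measurableSet_Ioi hK
    (continuous_rayMap a s) hm hb (fun δ hδ x _ => hbd δ hδ x) (L := L (-1)) (by
      filter_upwards [hL (-1)] with t ht
      have := rayMap_eq_ray a φ s (-1) t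
      simp only [Units.val_neg, Units.val_one, Int.cast_neg, Int.cast_one, neg_mul, one_mul] at this
      rwa [this])
  have hlim := t1.sub t2
  have hval : (∫ y in Ioi (0 : ℝ), m (φ, y) • L 1 y) - (∫ y in Ioi (0 : ℝ), m (-φ, y) • L (-1) y) =
      I • ∑ τ : ℤˣ, ∫ t in Ioi (0 : ℝ),
        (((τ : ℤ) : ℂ) * ((s : ℤ) : ℂ) * exp (((τ : ℤ) : ℂ) * φ * I)) • L τ t := by
    rw [univ_units, Finset.sum_pair (by decide), smul_add, ← integral_smul, ← integral_smul,
      sub_eq_add_neg, ← integral_neg]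
    simp only [m, smul_smul, Units.val_neg, Units.val_one, Int.cast_neg, Int.cast_one, neg_mul,
      one_mul, ← neg_smul, mul_neg, ← mul_assoc, Complex.ofReal_neg]
  rw [hval] at hlim
  suffices key : ∀ δ ∈ Ioo 0 δ₁, Integrable (fun z => db (secCut a φ δ s) z • K δ z) ∧
      (∫ x, mol δ (x - φ) • ∫ y in Ioi 0, m (x, y) • K δ (rayMap a s (x, y))) -
        (∫ x, mol δ (-x - φ) • ∫ y in Ioi 0, m (x, y) • K δ (rayMap a s (x, y))) =
      ∫ z, db (secCut a φ δ s) z • K δ z by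
    refine ⟨fun δ hδ => (key δ hδ).1, hlim.congr' ?_⟩
    filter_upwards [Ioo_mem_nhdsGT hδ₁] with δ hδ using (key δ hδ).2
  intro δ hδ
  have hδ0 : 0 < δ := hδ.1
  have hπδ : φ + δ < π := by linarith [hδ.2]
  let H : ℂ → E := fun w => (((s : ℤ) : ℂ) * (mol δ (|w.arg| - φ) *
    ((SignType.sign w.arg : ℝ) : ℂ) * (I * w / ‖w‖ ^ 2))) • K δ (((s : ℤ) : ℂ) * (a + w))
  have hinv : ∀ z, ((s : ℤ) : ℂ) * (a + loc a s z) = z := fun z => by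
    rw [loc, add_sub_cancel, ← mul_assoc, unit_sq, one_mul]
  have hinv2 : ∀ w, loc a s (((s : ℤ) : ℂ) * (a + w)) = w := fun w => by
    rw [loc, ← mul_assoc, unit_sq]; ring
  have hHz : ∀ z, loc a s z ≠ 0 → db (secCut a φ δ s) z • K δ z = H (loc a s z) := fun z hz => by
    simp only [H]
    rw [db_secCut hφ hδ0 hπδ hz, db_angCut hφ hδ0 hπδ hz, hinv]
  have e0 : (fun z => db (secCut a φ δ s) z • K δ z) =ᵐ[volume] fun z => H (loc a s z) := by
    have : ∀ᵐ z : ℂ, z ≠ ((s : ℤ) : ℂ) * a := by simp [ae_iff]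
    filter_upwards [this] with z hz
    grind
  have e1 : ∫ z, db (secCut a φ δ s) z • K δ z = ∫ w, H w := by
    rw [← integral_comp_loc a s H]
    exact integral_congr_ae e0
  have hHi : Integrable H := by
    have hcont : Continuous fun w : ℂ => ((s : ℤ) : ℂ) * (a + w) := by fun_prop
    refine Integrable.mono' ((integrable_wt 0).const_mul (B / δ * (C * (1 + a) ^ 2))) ?_ ?_
    · refine AEStronglyMeasurable.smul (Measurable.aestronglyMeasurable ?_)
        ((hK δ hδ).aestronglyMeasurable_comp hcont _)
      have h1 := (continuous_mol δ).measurable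
      have h2 : Measurable fun w : ℂ => (SignType.sign w.arg : ℝ) := by
        have : (fun w : ℂ => (SignType.sign w.arg : ℝ)) = fun w : ℂ =>
            if 0 < w.arg then (1 : ℝ) else if w.arg < 0 then -1 else 0 := by
          ext w
          rw [sign_apply]
          split_ifs <;> simp
        rw [this]
        exact Measurable.ite (Complex.measurable_arg measurableSet_Ioi)
          measurable_const (Measurable.ite (Complex.measurable_arg measurableSet_Iio)
          measurable_const measurable_const)
      fun_prop
    · have : ∀ᵐ w : ℂ, w ≠ 0 := by simp [ae_iff]
      filter_upwards [this] with w hw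
      have h1 := norm_db_angCut_le hB hφ hδ0 hπδ hw
      rw [db_angCut hφ hδ0 hπδ hw] at h1
      have h2 := (hC δ hδ (((s : ℤ) : ℂ) * (a + w))).trans
        (mul_le_mul_of_nonneg_left (inv_sq_le_loc ha s _) hC0)
      rw [hinv2] at h2
      simp only [H]
      rw [norm_smul, norm_mul, norm_unit, one_mul, wt]
      have h3 : ‖w‖⁻¹ ≤ ‖w - (0 : ℝ)‖⁻¹ + ‖w + (0 : ℝ)‖⁻¹ := by simp_all
      calc _ ≤ (B / δ * ‖w‖⁻¹) * (C * ((1 + a) ^ 2 * ((1 + ‖w‖) ^ 2)⁻¹)) := by gcongr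
        _ ≤ (B / δ * (‖w - (0 : ℝ)‖⁻¹ + ‖w + (0 : ℝ)‖⁻¹)) *
            (C * ((1 + a) ^ 2 * ((1 + ‖w‖) ^ 2)⁻¹)) := by gcongr
        _ = _ := by ring
  refine ⟨(hHi.comp_loc a s).congr e0.symm, ?_⟩
  have i1 := (approxId_mol φ).integrable_slices (δ₁ := δ₁) measurableSet_Ioi (hK δ hδ)
    (continuous_rayMap a s) hm hb (fun x _ => hbd δ hδ x) hδ
  have i2 := (approxId_mol_neg φ).integrable_slices (δ₁ := δ₁) measurableSet_Ioi (hK δ hδ)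
    (continuous_rayMap a s) hm hb (fun x _ => hbd δ hδ x) hδ
  rw [e1, integral_polar_angular 0 hHi, ← integral_sub i1 i2]
  refine ((setIntegral_eq_integral_of_forall_compl_eq_zero (μ := volume)
    (s := Ioo (-π) π) ?_).symm.trans (Eq.symm ?_))
  rotate_left
  · refine setIntegral_congr_fun measurableSet_Ioo fun θ hθ => ?_
    rw [← sub_smul, ← integral_smul]
    refine setIntegral_congr_fun measurableSet_Ioi fun r (hr : 0 < r) => ?_
    have hp : polar 0 r θ = r * exp (θ * I) := by simp [polar]
    have harg : (polar 0 r θ).arg = θ := by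
      rw [hp, Complex.arg_real_mul _ hr, exp_mul_I, Complex.arg_cos_add_sin_mul_I]
      exact ⟨hθ.1, hθ.2.le⟩
    have hnp : ‖polar 0 r θ‖ = r := by
      have := norm_polar_sub 0 r θ
      rwa [sub_zero, abs_of_pos hr] at this
    have hr' : (r : ℂ) ≠ 0 := by exact_mod_cast hr.ne'
    simp only [H, m, rayMap]
    rw [harg, hnp, hp, ← coe_smul, ← coe_smul, smul_smul, smul_smul]
    congr 1
    have hsgn : (mol δ (|θ| - φ) : ℂ) * ((SignType.sign θ : ℝ) : ℂ) =
        ((mol δ (θ - φ) - mol δ (-θ - φ) : ℝ) : ℂ) := by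
      rcases lt_trichotomy θ 0 with h | h | h
      · rw [abs_of_neg h, mol_eq_zero hδ0 (x := θ - φ) (.inl (by linarith))]; simp [h]
      · rw [h, mol_eq_zero hδ0 (x := 0 - φ) (.inl (by linarith)),
          mol_eq_zero hδ0 (x := -0 - φ) (.inl (by linarith))]; simp
      · rw [abs_of_pos h, mol_eq_zero hδ0 (x := -θ - φ) (.inl (by linarith))]; simp [h]
    rw [hsgn]
    field_simp
  · intro θ hθ
    rw [mem_Ioo, not_and_or, not_lt, not_lt] at hθ
    rw [mol_eq_zero hδ0 (x := θ - φ), mol_eq_zero hδ0 (x := -θ - φ)]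
    · simp
    · grind
    · grind

end Slices

lemma finite_quadratic {x y z : ℝ} (h : ¬ (x = 0 ∧ y = 0 ∧ z = 0)) :
    {t : ℝ | x * t ^ 2 + y * t + z = 0}.Finite := by
  have hP : (Polynomial.C x * Polynomial.X ^ 2 + Polynomial.C y * Polynomial.X + Polynomial.C z :
      Polynomial ℝ) ≠ 0 := by
    intro h0
    apply h
    have h2 := congrArg (fun P => Polynomial.coeff P 2) h0
    have h1 := congrArg (fun P => Polynomial.coeff P 1) h0
    have h3 := congrArg (fun P => Polynomial.coeff P 0) h0
    simp [Polynomial.coeff_X, Polynomial.coeff_C] at h1 h2 h3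
    exact ⟨h2, h1, h3⟩
  refine (Polynomial.finite_setOf_isRoot hP).subset fun t ht => ?_
  simpa [Polynomial.IsRoot] using ht

lemma finite_cos {x y z : ℝ} (h : ¬ (x = 0 ∧ y = 0 ∧ z = 0)) : {θ : ℝ | θ ∈ Ioo (-π) π ∧
      x * cos θ ^ 2 + y * cos θ + z = 0}.Finite := by
  have hF := finite_quadratic h
  refine ((hF.image Real.arccos).union (hF.image fun t => -Real.arccos t)).subset ?_
  rintro θ ⟨h1, h2⟩
  rcases le_total 0 θ with h0 | h0
  · exact .inl ⟨cos θ, h2, Real.arccos_cos h0 h1.2.le⟩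
  · refine .inr ⟨cos θ, h2, ?_⟩
    beta_reduce
    rw [← Real.cos_neg, Real.arccos_cos (by linarith) (by linarith [h1.1]), neg_neg]

lemma norm_sq_eq (z : ℂ) : ‖z‖ ^ 2 = z.re ^ 2 + z.im ^ 2 := by
  rw [← normSq_eq_norm_sq, normSq_apply]; ring

lemma norm_ray_sub_sq (a φ : ℝ) (s τ : ℤˣ) (t d : ℝ) : ‖ray a φ s τ t - d‖ ^ 2 =
      1 * t ^ 2 + (2 * (a - (s : ℤ) * d) * cos φ) * t + (a - (s : ℤ) * d) ^ 2 := by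
  have hsc := sin_sq_add_cos_sq φ
  have h1 : ‖ray a φ s τ t - d‖ = ‖((a - (s : ℤ) * d : ℝ) : ℂ) +
      t * exp (((τ : ℤ) : ℂ) * φ * I)‖ := by
    rw [ray, show ((s : ℤ) : ℂ) * ((a : ℂ) + t * exp (((τ : ℤ) : ℂ) * φ * I)) - d =
      ((s : ℤ) : ℂ) * ((a : ℂ) + t * exp (((τ : ℤ) : ℂ) * φ * I) -
        ((s : ℤ) : ℂ) * d) by rw [mul_sub, ← mul_assoc ((s : ℤ) : ℂ) ((s : ℤ) : ℂ), unit_sq, one_mul],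
      norm_mul, norm_unit, one_mul]
    push_cast; ring_nf
  have h2 : exp (((τ : ℤ) : ℂ) * φ * I) = cos φ + ((τ : ℤ) : ℂ) * sin φ * I := by
    rcases units_eq_one_or τ with rfl | rfl
    · simp [exp_mul_I]
    · simp only [Units.val_neg, Units.val_one, Int.cast_neg, Int.cast_one, neg_mul, one_mul]
      rw [← neg_mul, exp_mul_I, Complex.cos_neg, Complex.sin_neg]
      simp
  rw [h1, norm_sq_eq, h2]
  rcases units_eq_one_or τ with rfl | rfl
  · simp [← ofReal_cos, ← ofReal_sin]
    linear_combination t ^ 2 * hsc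
  · simp [← ofReal_cos, ← ofReal_sin]
    linear_combination t ^ 2 * hsc

lemma finite_ray_circle (a φ : ℝ) (s τ : ℤˣ) (d r : ℝ) :
    {t : ℝ | ‖ray a φ s τ t - d‖ = r}.Finite := by
  refine (finite_quadratic (x := 1) (y := 2 * (a - (s : ℤ) * d) * cos φ)
    (z := (a - (s : ℤ) * d) ^ 2 - r ^ 2) (by simp)).subset fun t ht => ?_
  have := norm_ray_sub_sq a φ s τ t d
  simp_all

lemma norm_polar_sub_sq (c d r θ : ℝ) :
    ‖polar c r θ - d‖ ^ 2 = (c - d) ^ 2 + r ^ 2 + 2 * (c - d) * r * cos θ := by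
  have hsc := sin_sq_add_cos_sq θ
  rw [norm_sq_eq, polar, exp_mul_I]
  simp [← ofReal_cos, ← ofReal_sin]
  linear_combination r ^ 2 * hsc

lemma finite_circle_circle {c d r ρ : ℝ} (hr : 0 < r) (hρ : 0 < ρ) (h : c ≠ d ∨ r ≠ ρ) :
    {θ : ℝ | θ ∈ Ioo (-π) π ∧ ‖polar c r θ - d‖ = ρ}.Finite := by
  refine (finite_cos (x := 0) (y := 2 * (c - d) * r) (z := (c - d) ^ 2 + r ^ 2 - ρ ^ 2) ?_).subset
    fun θ hθ => ⟨hθ.1, ?_⟩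
  · rintro ⟨-, h1, h2⟩
    have h3 : c - d = 0 := by grind
    rw [h3] at h2
    have h4 : r = ρ := by nlinarith
    grind
  · have := norm_polar_sub_sq c d r θ
    rw [hθ.2] at this
    linarith

lemma finite_circle_ray (a : ℝ) (s : ℤˣ) (c φ : ℝ) {r : ℝ} (hr : 0 < r) : {θ : ℝ | θ ∈ Ioo (-π) π ∧
      (loc a s (polar c r θ)).re = ‖loc a s (polar c r θ)‖ * cos φ}.Finite := by
  have hs2 : (((s : ℤ) : ℝ)) ^ 2 = 1 := by rcases units_eq_one_or s with rfl | rfl <;> simp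
  set σ : ℝ := ((s : ℤ) : ℝ) with hσ
  set m : ℝ := σ * c - a with hm
  refine (finite_cos (x := r ^ 2) (y := 2 * m * σ * r - 2 * m * σ * r * cos φ ^ 2)
    (z := m ^ 2 - (m ^ 2 + r ^ 2) * cos φ ^ 2) ?_).subset fun θ hθ => ⟨hθ.1, ?_⟩
  · aesop
  · have hsc := sin_sq_add_cos_sq θ
    have h1 : (loc a s (polar c r θ)).re = m + σ * r * cos θ := by
      rw [loc, polar, exp_mul_I]
      simp [← ofReal_cos, ← ofReal_sin, hm, hσ]
      ring
    have h2 : ‖loc a s (polar c r θ)‖ ^ 2 = m ^ 2 + r ^ 2 + 2 * m * σ * r * cos θ := by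
      rw [norm_sq_eq, h1]
      have : (loc a s (polar c r θ)).im = σ * r * sin θ := by
        rw [loc, polar, exp_mul_I]
        aesop
      grind
    grind

section Contour

lemma eventually_fst_lt {c : ℝ} (hc : 0 < c) (z : ℂ) :
    ∀ᶠ p : ℝ × ℂ in 𝓝[>] 0 ×ˢ 𝓝 z, 0 < p.1 ∧ p.1 < c :=
  tendsto_fst.eventually (Ioo_mem_nhdsGT hc)

lemma eventually_snd_of {P : ℂ → Prop} (h : ∀ᶠ w in 𝓝 z, P w) :
    ∀ᶠ p : ℝ × ℂ in 𝓝[>] 0 ×ˢ 𝓝 z, P p.2 := tendsto_snd.eventually h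

lemma eventually_norm_sub_lt {z d : ℂ} {r : ℝ} (h : ‖z - d‖ < r) : ∀ᶠ w in 𝓝 z, ‖w - d‖ < r :=
  ((by fun_prop : Continuous fun w : ℂ => ‖w - d‖).continuousAt).eventually (gt_mem_nhds h)

lemma eventually_lt_norm_sub {z d : ℂ} {r : ℝ} (h : r < ‖z - d‖) : ∀ᶠ w in 𝓝 z, r < ‖w - d‖ :=
  ((by fun_prop : Continuous fun w : ℂ => ‖w - d‖).continuousAt).eventually (lt_mem_nhds h)

lemma eventually_discPart (ha : 0 ≤ a) {ε : ℝ} (hε : 0 < a → ε < a)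
    (hz : ∀ d ∈ removedPts A a, ‖z - d‖ ≠ ε) : ∀ᶠ p : ℝ × ℂ in 𝓝[>] 0 ×ˢ 𝓝 z,
      discPart A a ε p.1 p.2 = (offDiscs A a ε).indicator (fun _ => 1) z := by
  by_cases h : z ∈ offDiscs A a ε
  · rw [indicator_of_mem h]
    rw [mem_offDiscs_iff] at h
    have : ∀ᶠ p : ℝ × ℂ in 𝓝[>] 0 ×ˢ 𝓝 z, ∀ d ∈ removedPts A a, ε + p.1 ≤ ‖p.2 - d‖ := by
      rw [Filter.eventually_all_finset]
      intro d hd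
      filter_upwards [eventually_fst_lt (c := (‖z - d‖ - ε) / 2) (by linarith [h d hd]) z,
        eventually_snd_of (eventually_lt_norm_sub (r := ε + (‖z - d‖ - ε) / 2) (d := d) (z := z)
          (by linarith [h d hd]))] with p h1 h2
      linarith
    filter_upwards [this, eventually_fst_lt one_pos z] with p h1 h2
    exact discPart_eq_one h2.1 h1
  · rw [indicator_of_notMem h]
    rw [mem_offDiscs_iff] at h
    push Not at h
    obtain ⟨d, hd, h⟩ := h
    have h' := lt_of_le_of_ne h (hz d hd)
    obtain ⟨c, hc, hca⟩ : ∃ c > 0, 0 < a → ε + c ≤ a := by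
      by_cases h0 : 0 < a
      · exact ⟨a - ε, by linarith [hε h0], fun _ => by linarith⟩
      · exact ⟨1, one_pos, fun h => absurd h h0⟩
    filter_upwards [eventually_fst_lt hc z, eventually_snd_of (eventually_norm_sub_lt h')]
      with p h1 h2
    rw [discPart_eq ha h1.1 (fun h0 => by linarith [hca h0]) hd (by linarith),
      radCut_eq_zero h1.1 h2.le]

lemma eventually_outPart {R : ℝ} (hz : infty ∉ singPts A a → ‖z‖ ≠ R) :
    ∀ᶠ p : ℝ × ℂ in 𝓝[>] 0 ×ˢ 𝓝 z,
      outPart A a R p.1 p.2 = (inDisc A a R).indicator (fun _ => 1) z := by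
  by_cases h0 : infty ∈ singPts A a
  · rw [indicator_of_mem (show z ∈ inDisc A a R from fun h => absurd h0 h)]
    exact Eventually.of_forall fun p => if_pos h0
  rcases lt_or_gt_of_ne (hz h0) with h | h
  · rw [indicator_of_mem (show z ∈ inDisc A a R from fun _ => h)]
    have h' : ‖z - 0‖ < ‖z‖ + (R - ‖z‖) / 2 := by rw [sub_zero]; linarith
    filter_upwards [eventually_fst_lt (c := (R - ‖z‖) / 2) (by linarith) z,
      eventually_snd_of (eventually_norm_sub_lt h')] with p h1 h2
    rw [sub_zero] at h2
    exact outPart_eq_one h1.1 fun _ => by linarith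
  · rw [indicator_of_notMem (show z ∉ inDisc A a R from fun h' => by linarith [h' h0])]
    have h' : R < ‖z - 0‖ := by rwa [sub_zero]
    filter_upwards [eventually_fst_lt one_pos z,
      eventually_snd_of (eventually_lt_norm_sub h')] with p h1 h2
    rw [sub_zero] at h2
    exact outPart_eq_zero h1.1 h0 h2.le

lemma isOpen_offVertices (a : ℝ) : IsOpen {z | OffVertices a z} := by
  simp_rw [offVertices_iff]
  exact isOpen_ne.inter isOpen_ne

lemma eventually_angPart (ha : 0 ≤ a) (h0 : 0 < φ) (hφ : φ < π / 2)
    (hz : OffVertices a z) (hne : ∀ s : ℤˣ, |(loc a s z).arg| ≠ φ) : ∀ᶠ p : ℝ × ℂ in 𝓝[>] 0 ×ˢ 𝓝 z,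
      angPart a φ p.1 p.2 = (bisector φ a).indicator (fun _ => 1) z := by
  have hoff := eventually_snd_of ((isOpen_offVertices a).mem_nhds hz)
  by_cases h : z ∈ bisector φ a
  · rw [indicator_of_mem h]
    rw [mem_bisector_iff h0 hφ] at h
    have : ∀ᶠ p : ℝ × ℂ in 𝓝[>] 0 ×ˢ 𝓝 z, ∀ s : ℤˣ, φ + p.1 ≤ |(loc a s p.2).arg| := by
      rw [eventually_all]
      intro s
      have hle : |(loc a s z).arg| ≤ π := abs_arg_le_pi _
      have h1 := h s
      filter_upwards [eventually_fst_lt (c := (|(loc a s z).arg| - φ) / 2) (by linarith) z,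
        eventually_snd_of ((isOpen_lt_abs_arg_loc (φ := φ + (|(loc a s z).arg| - φ) / 2)
          (by linarith) (by linarith) a s).mem_nhds (by rw [mem_setOf_eq]; linarith))] with p h1 h2
      linarith
    filter_upwards [this, eventually_fst_lt one_pos z] with p h1 h2
    rw [angPart_eq h2.1 (s := 1) (h1 _), secCut, angCut_eq_one h2.1 (h1 _)]
  · rw [indicator_of_notMem h]
    rw [mem_bisector_iff h0 hφ] at h
    push Not at h
    obtain ⟨s, hs⟩ := h
    have hs' := lt_of_le_of_ne hs (hne s)
    have h3 := (continuous_loc a s).continuousAt.eventually (eventually_abs_arg_lt h0.le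
      (by linarith [pi_pos]) (hz s) hs')
    filter_upwards [eventually_snd_of h3, hoff, eventually_fst_lt (c := π / 2 - φ)
      (by linarith) z] with p h1 h2 h4
    have h5 := pi_div_two_le_abs_arg_loc_neg ha (h2 (-s)) (h1.le.trans hφ.le)
    rw [angPart_eq h4.1 (s := s) (by linarith), secCut, angCut_eq_zero h4.1 h1.le]

variable {E : Type*} [NormedAddCommGroup E] [NormedSpace ℂ E]

lemma tendsto_weight_smul {W : ℝ → ℂ → ℝ} {S : Set ℂ} {k : ℂ → E}
    (hW : ∀ᶠ p : ℝ × ℂ in 𝓝[>] 0 ×ˢ 𝓝 z, W p.1 p.2 = S.indicator (fun _ => 1) z)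
    (hk : z ∈ S → ContinuousAt k z) :
    Tendsto (fun p : ℝ × ℂ => W p.1 p.2 • k p.2) (𝓝[>] 0 ×ˢ 𝓝 z) (𝓝 (S.indicator k z)) := by
  by_cases h : z ∈ S
  · rw [indicator_of_mem h]
    rw [indicator_of_mem h] at hW
    refine ((hk h).tendsto.comp tendsto_snd).congr' ?_
    filter_upwards [hW] with p hp
    rw [hp, one_smul]; rfl
  · rw [indicator_of_notMem h]
    rw [indicator_of_notMem h] at hW
    refine tendsto_const_nhds.congr' ?_
    filter_upwards [hW] with p hp
    rw [hp, zero_smul]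

lemma eventually_mul_indicator {W V : ℝ → ℂ → ℝ} {S T : Set ℂ}
    (hW : ∀ᶠ p : ℝ × ℂ in 𝓝[>] 0 ×ˢ 𝓝 z, W p.1 p.2 = S.indicator (fun _ => 1) z)
    (hV : ∀ᶠ p : ℝ × ℂ in 𝓝[>] 0 ×ˢ 𝓝 z, V p.1 p.2 = T.indicator (fun _ => 1) z) :
    ∀ᶠ p : ℝ × ℂ in 𝓝[>] 0 ×ˢ 𝓝 z, W p.1 p.2 * V p.1 p.2 = (S ∩ T).indicator (fun _ => 1) z := by
  filter_upwards [hW, hV] with p h1 h2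
  rw [h1, h2]
  by_cases h3 : z ∈ S <;> by_cases h4 : z ∈ T <;> simp [h3, h4]

lemma setIntegral_Ioo_indicator_circle {S : Set ℂ} (hS : MeasurableSet S) (c : ℝ → ℂ)
    (k : ℂ → E) (d : ℂ) (r : ℝ) : ∫ θ in Ioo (-π) π, c θ • S.indicator k (polar d r θ) =
      ∫ θ in {θ : ℝ | θ ∈ Ioc (-π) π ∧ circleMap d r θ ∈ S}, c θ • k (circleMap d r θ) := by
  have hγ : Continuous fun θ : ℝ => polar d r θ :=
    (continuous_polar d).comp (by fun_prop : Continuous fun θ : ℝ => (r, θ))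
  have h1 : {θ : ℝ | θ ∈ Ioc (-π) π ∧ circleMap d r θ ∈ S} =
      Ioc (-π) π ∩ (fun θ : ℝ => polar d r θ) ⁻¹' S := rfl
  rw [h1, ← setIntegral_indicator (hγ.measurable hS), integral_Ioc_eq_integral_Ioo]
  refine setIntegral_congr_fun measurableSet_Ioo fun θ _ => ?_
  by_cases h : polar d r θ ∈ S
  · aesop
  · simp_all

lemma setIntegral_Ioi_indicator_ray {S : Set ℂ} (hS : MeasurableSet S) (c : ℂ)
    (k : ℂ → E) (φ : ℝ) (s τ : ℤˣ) : ∫ t in Ioi (0 : ℝ), c • S.indicator k (ray a φ s τ t) =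
      ∫ t in {t : ℝ | 0 < t ∧ ray a φ s τ t ∈ S}, c • k (ray a φ s τ t) := by
  have hγ : Continuous fun t : ℝ => ray a φ s τ t := by unfold ray; fun_prop
  have h1 : {t : ℝ | 0 < t ∧ ray a φ s τ t ∈ S} = Ioi 0 ∩ (fun t => ray a φ s τ t) ⁻¹' S := rfl
  rw [h1, ← setIntegral_indicator (hγ.measurable hS)]
  refine setIntegral_congr_fun measurableSet_Ioi fun t _ => ?_
  by_cases h : ray a φ s τ t ∈ S
  · simp_all
  · simp_all

lemma ae_restrict_of_finite {S F : Set ℝ} (hS : MeasurableSet S) (hF : F.Finite) :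
    ∀ᵐ t ∂(volume.restrict S), t ∈ S ∧ t ∉ F := by
  filter_upwards [ae_restrict_mem hS, ae_restrict_of_ae (hF.countable.ae_notMem volume)]
    with t h1 h2 using ⟨h1, h2⟩

lemma real_of_mem_removedPts {d : ℂ} (hd : d ∈ removedPts A a) : ∃ x : ℝ, d = x := by
  rcases (mem_removedPts.1 hd).1 with h | h
  · exact ⟨a, h⟩
  · exact ⟨-a, by rw [h]; push_cast; ring⟩

open Classical in
/-- Area integrals against `∂̄` of the cut-offs converge to the contour integral. -/
lemma tendsto_integral_db_cut [CompleteSpace E] (hS : Setup A ω a) {δ₁ : ℝ}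
    (hδ₁ : 0 < δ₁) (hg : ∀ δ ∈ Ioo 0 δ₁, GoodCut A ω a q δ) (hq : Admissible A ω a q)
    (hεR : infty ∉ singPts A a → ∀ d ∈ removedPts A a, q.ε ≠ q.R) {k : ℂ → E} {D : Set ℂ}
    (hD : IsOpen D) (hDv : ∀ z ∈ D, OffVertices a z) (hk : ContinuousOn k D)
    (hk0 : ∀ z ∉ D, k z = 0) {C : ℝ} (hC : ∀ z, ‖k z‖ ≤ C * ((1 + ‖z‖) ^ 2)⁻¹)
    (h1 : ∀ s τ t, 0 < t → ray a q.φ s τ t ∈ offDiscs A a q.ε ∩ inDisc A a q.R →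
      ray a q.φ s τ t ∈ D)
    (h2 : ∀ d ∈ removedPts A a, ∀ θ, polar d q.ε θ ∈ bisector q.φ a ∩ inDisc A a q.R →
      polar d q.ε θ ∈ D)
    (h3 : infty ∉ singPts A a → ∀ θ, polar 0 q.R θ ∈ bisector q.φ a ∩ offDiscs A a q.ε →
      polar 0 q.R θ ∈ D) :
    Tendsto (fun δ => ∫ z, db (cut A a q δ) z • k z) (𝓝[>] 0)
      (𝓝 (I • contourIntegral A a q k)) := by
  have ha := hS.ha
  have hφ0 : 0 < q.φ := hq.1.1
  have hφ : q.φ < π / 2 := hS.lt_pi_div_two hq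
  have hε0 : 0 < q.ε := hq.2.1.1
  have hR0 : 0 < q.R := ha.trans_lt hq.2.2.1
  have hC0 : 0 ≤ C := by
    have := (norm_nonneg _).trans (hC 0)
    simpa using this
  have hcont : ∀ z ∈ D, ContinuousAt k z := fun z hz => hk.continuousAt (hD.mem_nhds hz)
  have hkC : ∀ z, ‖k z‖ ≤ C := fun z => (hC z).trans (mul_le_of_le_one_right hC0
    (inv_le_one_of_one_le₀ (one_le_pow₀ (by linarith [norm_nonneg z]))))
  -- the weights
  let W1 : ℝ → ℂ → ℝ := fun δ z => discPart A a q.ε δ z * outPart A a q.R δ z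
  let W2 : ℝ → ℂ → ℝ := fun δ z => angPart a q.φ δ z * outPart A a q.R δ z
  let W3 : ℝ → ℂ → ℝ := fun δ z => angPart a q.φ δ z * discPart A a q.ε δ z
  have cA : ∀ δ ∈ Ioo 0 δ₁, ContinuousOn (angPart a q.φ δ) D := fun δ hδ z hz =>
    (contDiffAt_angPart hφ0 hδ.1 ((hg δ hδ).phi_lt_pi hS)
      (hDv z hz)).continuousAt.continuousWithinAt
  have cZ : ∀ δ ∈ Ioo 0 δ₁, ContinuousOn (discPart A a q.ε δ) D := fun δ hδ =>
    (contDiff_discPart hε0 hδ.1).continuous.continuousOn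
  have cH : ∀ δ ∈ Ioo 0 δ₁, ContinuousOn (outPart A a q.R δ) D := fun δ hδ =>
    (contDiff_outPart ((hg δ hδ).rad_pos hS) hδ.1).continuous.continuousOn
  have o1 : ∀ δ ∈ Ioo 0 δ₁, OpenCont fun z => W1 δ z • k z := fun δ hδ =>
    OpenCont.smul hD hk hk0 ((cZ δ hδ).mul (cH δ hδ))
  have o2 : ∀ δ ∈ Ioo 0 δ₁, OpenCont fun z => W2 δ z • k z := fun δ hδ =>
    OpenCont.smul hD hk hk0 ((cA δ hδ).mul (cH δ hδ))
  have o3 : ∀ δ ∈ Ioo 0 δ₁, OpenCont fun z => W3 δ z • k z := fun δ hδ =>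
    OpenCont.smul hD hk hk0 ((cA δ hδ).mul (cZ δ hδ))
  have wb : ∀ {x y : ℝ} (z : ℂ), (z ∈ D → x ∈ Icc (0 : ℝ) 1) → (z ∈ D → y ∈ Icc (0 : ℝ) 1) →
      ‖(x * y) • k z‖ ≤ ‖k z‖ := fun {x y} z hx hy => by
    by_cases hz : z ∈ D
    · rw [norm_smul, norm_of_nonneg (mul_nonneg (hx hz).1 (hy hz).1)]
      exact mul_le_of_le_one_left (norm_nonneg _) (mul_le_one₀ (hx hz).2 (hy hz).1 (hy hz).2)
    · rw [hk0 z hz, smul_zero]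
  have mA : ∀ δ ∈ Ioo 0 δ₁, ∀ z ∈ D, angPart a q.φ δ z ∈ Icc (0 : ℝ) 1 := fun δ hδ z hz =>
    angPart_mem hS hδ.1 (hg δ hδ).phi_lt (hDv z hz)
  have mZ : ∀ δ ∈ Ioo 0 δ₁, ∀ z ∈ D, discPart A a q.ε δ z ∈ Icc (0 : ℝ) 1 := fun δ hδ z _ =>
    discPart_mem ha hδ.1 (hg δ hδ).eps_le z
  have mH : ∀ δ : ℝ, ∀ z ∈ D, outPart A a q.R δ z ∈ Icc (0 : ℝ) 1 := fun δ z _ => outPart_mem _ _ _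
  have mS1 : MeasurableSet (offDiscs A a q.ε ∩ inDisc A a q.R) :=
    ((isOpen_offDiscs A a _).inter (isOpen_inDisc A a _)).measurableSet
  have mS2 : MeasurableSet (bisector q.φ a ∩ inDisc A a q.R) :=
    ((isOpen_bisector hφ0 hφ a).inter (isOpen_inDisc A a _)).measurableSet
  have mS3 : MeasurableSet (bisector q.φ a ∩ offDiscs A a q.ε) :=
    ((isOpen_bisector hφ0 hφ a).inter (isOpen_offDiscs A a _)).measurableSet
  have argne : ∀ z : ℂ, (∀ s : ℤˣ, (loc a s z).re ≠ ‖loc a s z‖ * cos q.φ) →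
      OffVertices a z ∧ ∀ s : ℤˣ, |(loc a s z).arg| ≠ q.φ := fun z hz => by
    refine ⟨fun s h => hz s (by simp [h]), fun s h => hz s ?_⟩
    rw [← h, cos_abs, norm_mul_cos_arg]
  -- rays
  have T1 : ∀ s : ℤˣ, _ := fun s => tendsto_integral_angular ha hφ0 hδ₁ (by
      by_contra hc
      push Not at hc
      have h6 : ∀ δ ∈ Ioo 0 δ₁, q.φ + δ < π / 2 := fun δ hδ => (hg δ hδ).phi_lt.trans_le hS.hω.2
      have h7 := h6 (π / 2 - q.φ) ⟨by linarith, by linarith [pi_pos]⟩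
      linarith) s o1 (C := C)
    (fun δ hδ z => (wb z (mZ δ hδ z) (mH δ z)).trans (hC z))
    (L := fun τ t => (offDiscs A a q.ε ∩ inDisc A a q.R).indicator k (ray a q.φ s τ t))
    (fun τ => by
      have hF : (⋃ d ∈ removedPts A a, {t : ℝ | ‖ray a q.φ s τ t - d‖ = q.ε}).Finite :=
        (Finset.finite_toSet _).biUnion fun d hd => by
          obtain ⟨x, rfl⟩ := real_of_mem_removedPts hd
          exact finite_ray_circle a q.φ s τ x q.ε
      have hF2 := finite_ray_circle a q.φ s τ 0 q.R
      filter_upwards [ae_restrict_of_finite measurableSet_Ioi (hF.union hF2)] with t ht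
      obtain ⟨ht0, ht⟩ := ht
      simp only [mem_union, mem_iUnion, mem_setOf_eq, not_or, not_exists, ofReal_zero,
        sub_zero] at ht
      exact tendsto_weight_smul (eventually_mul_indicator
        (eventually_discPart ha hq.2.1.2.1 fun d hd => ht.1 d hd)
        (eventually_outPart fun _ => ht.2)) fun h => hcont _ (h1 s τ t ht0 h))
  have T2 : ∀ d ∈ removedPts A a, _ := fun d hd => tendsto_integral_radial (approxId_mol q.ε)
    (δ₁ := min δ₁ (q.ε / 2)) (lt_min hδ₁ (by linarith)) (lt_of_le_of_lt (min_le_right _ _)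
      (by linarith)) d
    (fun δ hδ => o2 δ ⟨hδ.1, hδ.2.trans_le (min_le_left _ _)⟩) (C := C)
    (fun δ hδ z => (wb z (mA δ ⟨hδ.1, hδ.2.trans_le (min_le_left _ _)⟩ z) (mH δ z)).trans (hkC z))
    (L := fun θ => (bisector q.φ a ∩ inDisc A a q.R).indicator k (polar d q.ε θ))
    (by
      obtain ⟨x, hx⟩ := real_of_mem_removedPts hd
      have hF : (⋃ s : ℤˣ, {θ : ℝ | θ ∈ Ioo (-π) π ∧ (loc a s (polar d q.ε θ)).re =
          ‖loc a s (polar d q.ε θ)‖ * cos q.φ}).Finite := by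
        rw [hx]
        exact finite_iUnion fun s => finite_circle_ray a s x q.φ hε0
      have hF2 : {θ : ℝ | (infty ∉ singPts A a) ∧ θ ∈ Ioo (-π) π ∧
          ‖polar d q.ε θ - (0 : ℝ)‖ = q.R}.Finite := by
        by_cases hi : infty ∉ singPts A a
        · rw [hx]
          exact (finite_circle_circle hε0 hR0 (.inr (hεR hi d hd))).subset fun θ h => h.2
        · simp [hi]
      filter_upwards [ae_restrict_of_finite measurableSet_Ioo (hF.union hF2)] with θ hθ
      obtain ⟨hθ0, hθ⟩ := hθ
      simp only [mem_union, mem_iUnion, mem_setOf_eq, not_or, not_exists, ofReal_zero,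
        sub_zero, not_and] at hθ
      obtain ⟨g1, g2⟩ := argne _ fun s => hθ.1 s hθ0
      exact tendsto_weight_smul (eventually_mul_indicator (eventually_angPart ha hφ0 hφ g1 g2)
        (eventually_outPart fun hi => hθ.2 hi hθ0)) fun h => hcont _ (h2 d hd θ h))
  have T3 : infty ∉ singPts A a → _ := fun hi => tendsto_integral_radial
    (approxId_mol_shift q.R)
    (δ₁ := min δ₁ (q.R / 2)) (lt_min hδ₁ (by linarith)) (lt_of_le_of_lt (min_le_right _ _)
      (by linarith)) 0
    (fun δ hδ => o3 δ ⟨hδ.1, hδ.2.trans_le (min_le_left _ _)⟩) (C := C)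
    (fun δ hδ z => (wb z (mA δ ⟨hδ.1, hδ.2.trans_le (min_le_left _ _)⟩ z)
      (mZ δ ⟨hδ.1, hδ.2.trans_le (min_le_left _ _)⟩ z)).trans (hkC z))
    (L := fun θ => (bisector q.φ a ∩ offDiscs A a q.ε).indicator k (polar 0 q.R θ))
    (by
      have hF : (⋃ s : ℤˣ, {θ : ℝ | θ ∈ Ioo (-π) π ∧ (loc a s (polar (0 : ℝ) q.R θ)).re =
          ‖loc a s (polar (0 : ℝ) q.R θ)‖ * cos q.φ}).Finite :=
        finite_iUnion fun s => finite_circle_ray a s 0 q.φ hR0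
      have hF2 : (⋃ d ∈ removedPts A a, {θ : ℝ | θ ∈ Ioo (-π) π ∧
          ‖polar (0 : ℝ) q.R θ - d‖ = q.ε}).Finite :=
        (Finset.finite_toSet _).biUnion fun d hd => by
          have hne := hεR hi d hd
          obtain ⟨x, rfl⟩ := real_of_mem_removedPts hd
          exact finite_circle_circle hR0 hε0 (.inr hne.symm)
      rw [ofReal_zero] at hF hF2
      filter_upwards [ae_restrict_of_finite measurableSet_Ioo (hF.union hF2)] with θ hθ
      obtain ⟨hθ0, hθ⟩ := hθ
      simp only [mem_union, mem_iUnion, mem_setOf_eq, not_or, not_exists, not_and] at hθ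
      obtain ⟨g1, g2⟩ := argne _ fun s => hθ.1 s hθ0
      exact tendsto_weight_smul (eventually_mul_indicator (eventually_angPart ha hφ0 hφ g1 g2)
        (eventually_discPart ha hq.2.1.2.1 fun d hd => hθ.2 d hd hθ0)) fun h => hcont _ (h3 hi θ h))
  have L1 := tendsto_finset_sum Finset.univ fun s _ => (T1 s).2
  have L2 := tendsto_finset_sum (removedPts A a) fun d hd => T2 d hd
  have L3 : Tendsto (fun δ => if infty ∈ singPts A a then (0 : E) else
      ∫ z, (mol δ (‖z - 0‖ - (q.R - δ)) * ((z - 0) / ‖z - 0‖) : ℂ) • W3 δ z • k z) (𝓝[>] 0)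
      (𝓝 (if infty ∈ singPts A a then (0 : E) else ∫ θ in Ioo (-π) π,
        (q.R * exp (θ * I)) •
          (bisector q.φ a ∩ offDiscs A a q.ε).indicator k (polar 0 q.R θ))) := by
    split_ifs with hi
    · exact tendsto_const_nhds
    · exact T3 hi
  have LL := (L1.add L2).sub L3
  have hval : I • contourIntegral A a q k =
      (∑ s : ℤˣ, I • ∑ τ : ℤˣ, ∫ t in Ioi (0 : ℝ),
        (((τ : ℤ) : ℂ) * ((s : ℤ) : ℂ) * exp (((τ : ℤ) : ℂ) * q.φ * I)) •
        (offDiscs A a q.ε ∩ inDisc A a q.R).indicator k (ray a q.φ s τ t)) +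
      (∑ d ∈ removedPts A a, ∫ θ in Ioo (-π) π, (q.ε * exp (θ * I)) •
          (bisector q.φ a ∩ inDisc A a q.R).indicator k (polar d q.ε θ)) -
      (if infty ∈ singPts A a then (0 : E) else ∫ θ in Ioo (-π) π,
        (q.R * exp (θ * I)) •
          (bisector q.φ a ∩ offDiscs A a q.ε).indicator k (polar 0 q.R θ)) := by
    have hI : ∀ (x : ℝ) (θ : ℝ), (x * exp (θ * I) : ℂ) =
        -(I * (x * exp (θ * I) * I)) := fun x θ => by
      linear_combination (x * exp (θ * I) : ℂ) * Complex.I_mul_I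
    have hcirc : ∀ (x : ℝ) (d : ℂ) {S : Set ℂ}, MeasurableSet S →
        ∫ θ in Ioo (-π) π, (x * exp (θ * I)) •
          S.indicator k (polar d x θ) = -(I •
        ∫ θ in {θ : ℝ | θ ∈ Ioc (-π) π ∧ circleMap d x θ ∈ S},
        (x * exp (θ * I) * I) • k (circleMap d x θ)) := by
      intro x d S hS
      rw [setIntegral_Ioo_indicator_circle hS (fun θ => x * exp (θ * I)),
        ← integral_smul, ← integral_neg]
      congr 1
      ext θ
      rw [smul_smul, ← neg_smul, ← hI]
    simp_rw [hcirc _ _ mS2, hcirc _ _ mS3, setIntegral_Ioi_indicator_ray mS1]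
    rw [contourIntegral, smul_add, smul_sub, Finset.smul_sum, Finset.smul_sum, Finset.sum_neg_distrib,
      ← sub_eq_add_neg, sub_eq_add_neg _ (ite _ _ _)]
    congr 1
    split_ifs <;> simp
  rw [hval]
  refine LL.congr' ?_
  have hmin : 0 < min δ₁ (min (q.ε / 2) (q.R / 2)) :=
    lt_min hδ₁ (lt_min (by linarith) (by linarith))
  filter_upwards [Ioo_mem_nhdsGT hmin] with δ hδ
  have hδ' : δ ∈ Ioo 0 δ₁ := ⟨hδ.1, hδ.2.trans_le (min_le_left _ _)⟩
  have i1 : ∀ s : ℤˣ, _ := fun s => (T1 s).1 δ hδ'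
  have i2 : ∀ d ∈ removedPts A a, _ := fun d hd => (approxId_mol q.ε).integrable_radial_kernel d
    hδ.1 (o2 δ hδ') (C := C) fun z => (wb z (mA δ hδ' z) (mH δ z)).trans (hkC z)
  have i3 := (approxId_mol_shift q.R).integrable_radial_kernel 0
    hδ.1 (o3 δ hδ') (C := C) fun z => (wb z (mA δ hδ' z) (mZ δ hδ' z)).trans (hkC z)
  have i3' : Integrable fun z => (if infty ∈ singPts A a then (0 : E) else
      (mol δ (‖z - 0‖ - (q.R - δ)) * ((z - 0) / ‖z - 0‖) : ℂ) • W3 δ z • k z) := by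
    split_ifs
    · exact integrable_zero _ _ _
    · exact i3
  have e3 : (if infty ∈ singPts A a then (0 : E) else
      ∫ z, (mol δ (‖z - 0‖ - (q.R - δ)) * ((z - 0) / ‖z - 0‖) : ℂ) • W3 δ z • k z) =
      ∫ z, (if infty ∈ singPts A a then (0 : E) else
      (mol δ (‖z - 0‖ - (q.R - δ)) * ((z - 0) / ‖z - 0‖) : ℂ) • W3 δ z • k z) := by
    split_ifs
    · simp
    · rfl
  rw [e3, ← integral_finset_sum _ fun s _ => i1 s, ← integral_finset_sum _ i2,
    ← integral_add (integrable_finset_sum _ fun s _ => i1 s) (integrable_finset_sum _ i2)]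
  refine (integral_sub ((integrable_finset_sum _ fun s _ => i1 s).add
    (integrable_finset_sum _ i2)) i3').symm.trans ?_
  congr 1
  ext z
  rw [Pi.add_apply]
  have hcs : ∀ (c : ℂ) (w : ℝ), c • w • k z = (c * (w : ℂ)) • k z := fun c w => by
    rw [mul_smul, coe_smul]
  by_cases hz : z ∈ D
  · rw [db_cut hS (hg δ hδ') (hDv z hz), db_outPart, add_smul, add_smul, sum_mul,
      sum_mul, Finset.sum_smul, Finset.sum_smul, sub_eq_add_neg]
    congr 1
    · congr 1
      · grind
      · refine sum_congr rfl fun d _ => ?_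
        rw [db_radCut d hε0 hδ.1]
        exact hcs _ _
    · split_ifs
      · simp
      · rw [db_radCut 0 ((hg δ hδ').rad_pos hS) hδ.1, neg_mul, neg_smul]
        exact congrArg Neg.neg (hcs _ _)
  · simp [hk0 z hz]

end Contour

section Area

variable {χ χ₁ χ₂ : ℂ → ℝ} {E : Type*} [NormedAddCommGroup E] [NormedSpace ℂ E]

lemma measurable_db (u : ℂ → ℝ) : Measurable (db u) := by
  unfold db
  fun_prop

lemma ae_offVertices (a : ℝ) : ∀ᵐ z : ℂ, OffVertices a z := by
  have h1 : ∀ᵐ z : ℂ, z ≠ a := by simp [ae_iff]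
  have h2 : ∀ᵐ z : ℂ, z ≠ -a := by simp [ae_iff]
  filter_upwards [h1, h2] with z h1 h2 using offVertices_iff.2 ⟨h1, h2⟩

lemma IsCutoff.of_db_ne_zero (hχ : IsCutoff A a p χ) (hz : OffVertices a z)
    (h : db χ z ≠ 0) : z ∈ region A a p ∧ z ∈ resolventSet A ∧ χ z ≠ 0 ∧ χ z ≠ 1 := by
  have hev : ∀ᶠ w in 𝓝 z, χ w ∈ Icc (0 : ℝ) 1 := by
    filter_upwards [(isOpen_offVertices a).mem_nhds hz] with w hw using hχ.mem w hw
  refine ⟨?_, ?_, fun h0 => ?_, fun h1 => ?_⟩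
  · by_contra hc
    exact h (db_eq_zero_of_eventually_const (hχ.zero z hz hc))
  · by_contra hc
    exact h (db_eq_zero_of_eventually_const (hχ.one z hz hc))
  · refine h (db_eq_zero_of_isLocalExtr (.inl ?_))
    filter_upwards [hev] with w hw
    rw [h0]; exact hw.1
  · refine h (db_eq_zero_of_isLocalExtr (.inr ?_))
    filter_upwards [hev] with w hw
    rw [h1]; exact hw.2

lemma IsCutoff.aestronglyMeasurable [CompleteSpace X] (hχ : IsCutoff A a p χ)
    (ho : IsOpen (region A a p)) {k : ℂ → E}
    (hk : AEStronglyMeasurable k (volume.restrict (region A a p ∩ resolventSet A))) :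
    AEStronglyMeasurable (fun z => db χ z • k z) := by
  have hm : MeasurableSet (region A a p ∩ resolventSet A) :=
    (ho.inter (isOpen_resolventSet A)).measurableSet
  have h1 : (fun z => db χ z • k z) =ᵐ[volume]
      (region A a p ∩ resolventSet A).indicator fun z => db χ z • k z := by
    filter_upwards [ae_offVertices a] with z hz
    by_cases h : z ∈ region A a p ∩ resolventSet A
    · rw [indicator_of_mem h]
    · rw [indicator_of_notMem h]
      have : db χ z = 0 := by
        by_contra hc
        have := hχ.of_db_ne_zero hz hc
        exact h ⟨this.1, this.2.1⟩
      rw [this, zero_smul]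
  refine AEStronglyMeasurable.congr ?_ h1.symm
  rw [aestronglyMeasurable_indicator_iff hm]
  exact (measurable_db χ).aestronglyMeasurable.smul hk

lemma IsCutoff.integrable [CompleteSpace X] (hχ : IsCutoff A a p χ)
    (ho : IsOpen (region A a p)) {k : ℂ → E}
    (hk : AEStronglyMeasurable k (volume.restrict (region A a p ∩ resolventSet A))) {C : ℝ}
    (hC : ∀ z ∈ region A a p, OffVertices a z → χ z ≠ 0 → χ z ≠ 1 → ‖k z‖ ≤ C * ((1 + ‖z‖) ^ 2)⁻¹) :
    Integrable (fun z => db χ z • k z) := by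
  obtain ⟨B, hB0, hB⟩ := hχ.db_le
  refine Integrable.mono' ((integrable_wt a).const_mul (B * |C|)) (hχ.aestronglyMeasurable ho hk) ?_
  filter_upwards [ae_offVertices a] with z hz
  have hw : 0 ≤ wt a z := by unfold wt; positivity
  by_cases h : db χ z = 0
  · rw [h, zero_smul, norm_zero]; positivity
  · obtain ⟨h1, -, h2, h3⟩ := hχ.of_db_ne_zero hz h
    rw [norm_smul]
    calc _ ≤ (B * (‖z - a‖⁻¹ + ‖z + a‖⁻¹)) * (|C| * ((1 + ‖z‖) ^ 2)⁻¹) := by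
          gcongr
          · exact hB z hz
          · exact (hC z h1 hz h2 h3).trans (by gcongr; exact le_abs_self C)
      _ = _ := by unfold wt; ring

lemma IsCutoff.integral_eq [CompleteSpace X] [CompleteSpace E] (h1 : IsCutoff A a p χ₁)
    (h2 : IsCutoff A a p χ₂) (ho : IsOpen (region A a p)) {k : ℂ → E}
    (hk : ∀ z ∈ region A a p ∩ resolventSet A, AnalyticAt ℂ k z) {C : ℝ}
    (hC : ∀ z ∈ region A a p, OffVertices a z → χ₁ z ≠ 1 ∨ χ₂ z ≠ 1 →
      ‖k z‖ ≤ C * ((1 + ‖z‖) ^ 2)⁻¹) :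
    ∫ z, db χ₁ z • k z = ∫ z, db χ₂ z • k z := by
  have hm : AEStronglyMeasurable k (volume.restrict (region A a p ∩ resolventSet A)) :=
    ContinuousOn.aestronglyMeasurable (fun z hz => (hk z hz).continuousAt.continuousWithinAt)
      (ho.inter (isOpen_resolventSet A)).measurableSet
  have i1 := h1.integrable ho hm fun z hz hv _ h => hC z hz hv (.inl h)
  have i2 := h2.integrable ho hm fun z hz hv _ h => hC z hz hv (.inr h)
  have hdb : (fun z => db (fun z => χ₁ z - χ₂ z) z • k z) =ᵐ[volume]
      fun z => db χ₁ z • k z - db χ₂ z • k z := by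
    filter_upwards [ae_offVertices a] with z hz
    rw [db_sub ((h1.smooth z hz).differentiableAt one_ne_zero)
      ((h2.smooth z hz).differentiableAt one_ne_zero), sub_smul]
  have hz := integral_db_smul_eq_zero (a := a) (u := fun z => χ₁ z - χ₂ z) (k := k) (C := |C|)
    (fun z hz => (h1.smooth z (offVertices_iff.2 hz)).sub (h2.smooth z (offVertices_iff.2 hz)))
    (fun z hz => by
      rw [← offVertices_iff] at hz
      by_cases hr : z ∈ region A a p
      · by_cases hρ : z ∈ resolventSet A
        · exact .inr (hk z ⟨hr, hρ⟩)
        · left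
          filter_upwards [h1.one z hz hρ, h2.one z hz hρ] with w e1 e2
          rw [e1, e2]; simp
      · left
        filter_upwards [h1.zero z hz hr, h2.zero z hz hr] with w e1 e2
        rw [e1, e2]; simp)
    (fun z hz => by
      rw [← offVertices_iff] at hz
      have m1 := h1.mem z hz
      have m2 := h2.mem z hz
      by_cases hr : z ∈ region A a p
      · by_cases hne : χ₁ z ≠ 1 ∨ χ₂ z ≠ 1
        · have hle : ‖χ₁ z - χ₂ z‖ ≤ 1 := by
            rw [norm_eq_abs, abs_le]; constructor <;> linarith [m1.1, m1.2, m2.1, m2.2]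
          calc _ ≤ 1 * ‖k z‖ := by gcongr
            _ ≤ |C| * ((1 + ‖z‖) ^ 2)⁻¹ := by
              rw [one_mul]
              exact (hC z hr hz hne).trans (by gcongr; exact le_abs_self C)
        · push Not at hne
          rw [hne.1, hne.2]; simp; positivity
      · rw [(h1.zero z hz hr).eq_of_nhds, (h2.zero z hz hr).eq_of_nhds]; simp; positivity)
    ((i1.sub i2).congr hdb.symm)
  rw [integral_congr_ae hdb, integral_sub i1 i2, sub_eq_zero] at hz
  exact hz

/-- Holomorphic functions on a region with decay of order one at the vertices and of order `n - 1`
at `∞`. -/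
structure Psi (A : X →ₗ.[ℂ] X) (a : ℝ) (p : Params) (n : ℕ) (f : ℂ → ℂ) : Prop where
  holo : DifferentiableOn ℂ f (region A a p)
  bound : ∃ C, 0 ≤ C ∧ ∀ z ∈ region A a p, ‖f z‖ ≤ C * (vdist a z * ((1 + ‖z‖) ^ n)⁻¹)

/-- The area integral that represents the Cauchy integral. -/
noncomputable def areaOp (A : X →ₗ.[ℂ] X) (χ : ℂ → ℝ) (f : ℂ → ℂ) : X →L[ℂ] X :=
  (-(2 * π)⁻¹ : ℂ) • ∫ z, db χ z • (f z • res A z)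

lemma Psi.mono {m n : ℕ} (hf : Psi A a p n f) (h : m ≤ n) : Psi A a p m f := by
  refine ⟨hf.holo, ?_⟩
  obtain ⟨C, hC0, hC⟩ := hf.bound
  refine ⟨C, hC0, fun z hz => (hC z hz).trans ?_⟩
  have hv := vdist_nonneg a z
  have h1 : ((1 + ‖z‖) ^ n)⁻¹ ≤ ((1 + ‖z‖) ^ m)⁻¹ :=
    inv_anti₀ (by positivity) (pow_le_pow_right₀ (by linarith [norm_nonneg z]) h)
  gcongr

lemma Psi.exists_norm_le (ha : 0 ≤ a) (hf : Psi A a p 3 f) :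
    ∃ C, 0 ≤ C ∧ ∀ z ∈ region A a p, ‖f z‖ ≤ C * ((1 + ‖z‖) ^ 2)⁻¹ := by
  obtain ⟨C, hC0, hC⟩ := hf.bound
  refine ⟨C * (1 + a), by positivity, fun z hz => (hC z hz).trans ?_⟩
  have h1 := vdist_le ha z
  calc _ ≤ C * ((1 + a) * (1 + ‖z‖) * ((1 + ‖z‖) ^ 3)⁻¹) := by
        have hv := vdist_nonneg a z
        gcongr
    _ = _ := by field_simp

lemma Psi.aestronglyMeasurable {n : ℕ} (hf : Psi A a p n f)
    (ho : IsOpen (region A a p)) [CompleteSpace X] :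
    AEStronglyMeasurable f (volume.restrict (region A a p ∩ resolventSet A)) :=
  (hf.holo.continuousOn.mono inter_subset_left).aestronglyMeasurable
    (ho.inter (isOpen_resolventSet A)).measurableSet

lemma aestronglyMeasurable_res [CompleteSpace X] (ho : IsOpen (region A a p)) :
    AEStronglyMeasurable (res A) (volume.restrict (region A a p ∩ resolventSet A)) :=
  ContinuousOn.aestronglyMeasurable (fun z hz => (continuousAt_res hz.2).continuousWithinAt)
    (ho.inter (isOpen_resolventSet A)).measurableSet

lemma Psi.norm_smul_res_le {n : ℕ} (hf : Psi A a p n f) (hχ : IsCutoff A a p χ) :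
    ∃ C, 0 ≤ C ∧ ∀ z ∈ region A a p, OffVertices a z → χ z ≠ 1 →
      ‖f z • res A z‖ ≤ C * ((1 + ‖z‖) ^ n)⁻¹ := by
  obtain ⟨C, hC0, hC⟩ := hf.bound
  obtain ⟨D, hD0, hD⟩ := hχ.res_le
  refine ⟨C * D, by positivity, fun z hz hv h1 => ?_⟩
  rw [norm_smul]
  have hv0 := vdist_nonneg a z
  calc _ ≤ (C * (vdist a z * ((1 + ‖z‖) ^ n)⁻¹)) * ‖res A z‖ := by
        gcongr
        exact hC z hz
    _ = C * (‖res A z‖ * vdist a z) * ((1 + ‖z‖) ^ n)⁻¹ := by ring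
    _ ≤ _ := by
      gcongr
      grind

lemma Psi.integrable [CompleteSpace X] (hf : Psi A a p 2 f)
    (ho : IsOpen (region A a p)) (hχ : IsCutoff A a p χ) :
    Integrable fun z => db χ z • (f z • res A z) := by
  obtain ⟨C, hC0, hC⟩ := hf.norm_smul_res_le hχ
  exact hχ.integrable ho ((hf.aestronglyMeasurable ho).smul (aestronglyMeasurable_res ho))
    fun z hz hv _ h => hC z hz hv h

lemma Psi.analyticAt_smul_res [CompleteSpace X] {n : ℕ} (hf : Psi A a p n f)
    (ho : IsOpen (region A a p)) (hz : z ∈ region A a p ∩ resolventSet A) :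
    AnalyticAt ℂ (fun z => f z • res A z) z :=
  (hf.holo.analyticAt (ho.mem_nhds hz.1)).smul (analyticAt_res hz.2)

lemma Psi.areaOp_eq [CompleteSpace X] (hf : Psi A a p 2 f)
    (ho : IsOpen (region A a p)) (h1 : IsCutoff A a p χ₁) (h2 : IsCutoff A a p χ₂) :
    areaOp A χ₁ f = areaOp A χ₂ f := by
  obtain ⟨C, hC0, hC⟩ := hf.norm_smul_res_le h1
  obtain ⟨D, hD0, hD⟩ := hf.norm_smul_res_le h2
  unfold areaOp
  rw [h1.integral_eq h2 ho (fun z hz => hf.analyticAt_smul_res ho hz) (C := C + D)]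
  intro z hz hv hne
  rcases hne with h | h
  · refine (hC z hz hv h).trans ?_
    gcongr
    grind
  · refine (hD z hz hv h).trans ?_
    gcongr
    grind

lemma IsCutoff.integral_eq_zero [CompleteSpace X] [CompleteSpace E] (hχ : IsCutoff A a p χ)
    (ho : IsOpen (region A a p)) {k : ℂ → E}
    (hk : ∀ z ∈ region A a p, OffVertices a z → χ =ᶠ[𝓝 z] 0 ∨ AnalyticAt ℂ k z)
    (hm : AEStronglyMeasurable k (volume.restrict (region A a p ∩ resolventSet A))) {C : ℝ}
    (hC : ∀ z ∈ region A a p, OffVertices a z → χ z ≠ 0 → ‖k z‖ ≤ C * ((1 + ‖z‖) ^ 2)⁻¹) :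
    ∫ z, db χ z • k z = 0 := by
  refine integral_db_smul_eq_zero (a := a) (C := |C|)
    (fun z hz => hχ.smooth z (offVertices_iff.2 hz)) ?_ ?_
    (hχ.integrable ho hm fun z hz hv h0 _ => hC z hz hv h0)
  · intro z hv
    rw [← offVertices_iff] at hv
    by_cases hr : z ∈ region A a p
    · exact hk z hr hv
    · exact .inl (hχ.zero z hv hr)
  · intro z hv
    rw [← offVertices_iff] at hv
    by_cases h0 : χ z = 0
    · rw [h0, norm_zero, zero_mul]; positivity
    · have hr : z ∈ region A a p := by
        by_contra hr
        exact h0 (hχ.zero z hv hr).eq_of_nhds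
      have m1 := hχ.mem z hv
      calc _ ≤ 1 * ‖k z‖ := by
            gcongr
            rw [norm_of_nonneg m1.1]; exact m1.2
        _ ≤ |C| * ((1 + ‖z‖) ^ 2)⁻¹ := by
          rw [one_mul]
          exact (hC z hr hv h0).trans (by gcongr; exact le_abs_self C)

lemma Psi.mul_res_aux {n : ℕ} (hf : Psi A a p n f) {b : ℂ} {η : ℝ} (hη : 0 < η)
    (hbη : ∀ z ∈ region A a p, η ≤ ‖z - b‖) : Psi A a p n fun z => f z * (b - z)⁻¹ := by
  have hne : ∀ z ∈ region A a p, b - z ≠ 0 := fun z hz =>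
    norm_pos_iff.1 (norm_sub_rev z b ▸ hη.trans_le (hbη z hz))
  refine ⟨hf.holo.mul (DifferentiableOn.inv (by fun_prop) hne), ?_⟩
  obtain ⟨C, hC0, hC⟩ := hf.bound
  refine ⟨C * η⁻¹, by positivity, fun z hz => ?_⟩
  rw [norm_mul, norm_inv, norm_sub_rev]
  have hv0 := vdist_nonneg a z
  calc _ ≤ (C * (vdist a z * ((1 + ‖z‖) ^ n)⁻¹)) * η⁻¹ := by
        gcongr
        · exact hC z hz
        · exact hbη z hz
    _ = _ := by ring

lemma res_mul_res {z w : ℂ} (hz : z ∈ resolventSet A) (hw : w ∈ resolventSet A) (h : w - z ≠ 0) :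
    res A z * res A w = (w - z)⁻¹ • (res A z - res A w) := by
  rw [res_sub_res hz hw, smul_smul, inv_mul_cancel₀ h, one_smul]

lemma Psi.areaOp_mul_res [CompleteSpace X] (ha : 0 ≤ a) (hf : Psi A a p 3 f)
    (ho : IsOpen (region A a p)) (hχ : IsCutoff A a p χ) {b : ℂ} (hb : b ∈ resolventSet A)
    {η : ℝ} (hη : 0 < η) (hbη : ∀ z ∈ region A a p, η ≤ ‖z - b‖) :
    areaOp A χ f * res A b = areaOp A χ fun z => f z * (b - z)⁻¹ := by
  have hg := hf.mul_res_aux hη hbη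
  have i1 := (hf.mono (by norm_num : 2 ≤ 3)).integrable ho hχ
  have i2 := (hg.mono (by norm_num : 2 ≤ 3)).integrable ho hχ
  obtain ⟨C, hC0, hC⟩ := hg.exists_norm_le ha
  have hz : ∫ z, db χ z • (f z * (b - z)⁻¹) = 0 := by
    refine hχ.integral_eq_zero ho (fun z hz _ => .inr (hg.holo.analyticAt (ho.mem_nhds hz)))
      (hg.aestronglyMeasurable ho) (C := C) fun z hz _ _ => hC z hz
  have i3 : Integrable fun z => db χ z • (f z * (b - z)⁻¹) :=
    hχ.integrable ho (hg.aestronglyMeasurable ho) (C := C) fun z hz _ _ _ => hC z hz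
  unfold areaOp
  rw [smul_mul_assoc, ← integral_mul_const_of_integrable i1]
  congr 1
  have e1 : (fun z => db χ z • f z • res A z * res A b) =ᵐ[volume] fun z =>
      db χ z • ((f z * (b - z)⁻¹) • res A z) - (db χ z • (f z * (b - z)⁻¹)) • res A b := by
    filter_upwards [ae_offVertices a] with z hv
    by_cases h : db χ z = 0
    · rw [h]; simp
    · obtain ⟨hr, hρ, -, -⟩ := hχ.of_db_ne_zero hv h
      have hne : b - z ≠ 0 := norm_pos_iff.1 (norm_sub_rev z b ▸ hη.trans_le (hbη z hr))
      rw [smul_mul_assoc, smul_mul_assoc, res_mul_res hρ hb hne, smul_smul, smul_smul, smul_sub, smul_smul, smul_eq_mul]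
      ring_nf
  rw [integral_congr_ae e1, integral_sub i2 (i3.smul_const _), integral_smul_const, hz, zero_smul,
    sub_zero]

lemma continuous_vdist (a : ℝ) : Continuous (vdist a) := by unfold vdist; fun_prop

lemma Nested.exists_ball (hN : Nested a χ₁ χ₂) (hz : OffVertices a z) (h : χ₁ z ≠ 0) :
    ∀ᶠ w in 𝓝 z, χ₂ w = 1 := by
  obtain ⟨c, hc, hcz⟩ := hN
  have h1 : ContinuousAt (fun w => c * vdist a w - ‖z - w‖ * (1 + ‖w‖)) z := by
    have := continuous_vdist a
    fun_prop
  have h2 : 0 < c * vdist a z - ‖z - z‖ * (1 + ‖z‖) := by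
    rw [sub_self, norm_zero, zero_mul, sub_zero]
    exact mul_pos hc (vdist_pos hz)
  filter_upwards [h1.eventually (lt_mem_nhds h2), (isOpen_offVertices a).mem_nhds hz] with w hw hv
  grind

lemma inv_norm_sub_le {c : ℝ} {z w : ℂ} (hc : 0 < c) (hv : 0 < vdist a w)
    (h : c * vdist a w ≤ ‖z - w‖ * (1 + ‖w‖)) : ‖z - w‖⁻¹ ≤ c⁻¹ * (vdist a w)⁻¹ * (1 + ‖w‖) := by
  have h1 := mul_pos hc hv
  have hp : 0 < ‖z - w‖ := pos_of_mul_pos_left (h1.trans_le h) (by positivity)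
  rw [← mul_inv, ← div_eq_inv_mul, inv_le_comm₀ hp (by positivity), inv_div]
  exact (div_le_iff₀ (by positivity)).2 h

/-- Cauchy's formula for the outer cut-off. -/
lemma Psi.integral_cauchy [CompleteSpace X] (ha : 0 ≤ a) {g : ℂ → ℂ} (hg : Psi A a p 3 g)
    (ho : IsOpen (region A a p)) (h2 : IsCutoff A a p χ₂) (hN : Nested a χ₁ χ₂)
    (hz : OffVertices a z) (hzr : z ∈ region A a p) (h : χ₁ z ≠ 0) :
    Integrable (fun w => db χ₂ w • (g w * (w - z)⁻¹)) ∧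
      ∫ w, db χ₂ w • (g w * (w - z)⁻¹) = -(2 * π) * g z := by
  obtain ⟨r, hr, hball⟩ := Metric.eventually_nhds_iff_ball.1
    ((hN.exists_ball hz h).and (ho.eventually_mem hzr))
  obtain ⟨C, hC0, hC⟩ := hg.exists_norm_le ha
  have hε : 0 < r / 3 := by positivity
  set ρ : ℂ → ℝ := radCut z (r / 3) (r / 3) with hρ
  have hkm : AEStronglyMeasurable (fun w => g w * (w - z)⁻¹)
      (volume.restrict (region A a p ∩ resolventSet A)) :=
    (hg.aestronglyMeasurable ho).mul (by exact (Measurable.aestronglyMeasurable (by fun_prop)))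
  have i1 : Integrable (fun w => db χ₂ w • (g w * (w - z)⁻¹)) := by
    obtain ⟨c, hc, hcz⟩ := hN
    obtain ⟨D, hD0, hD⟩ := hg.bound
    refine h2.integrable ho hkm (C := D * c⁻¹) fun w hw hv _ h1 => ?_
    have h3 := hcz z w hz hv h h1
    have hvp := vdist_pos hv
    rw [norm_mul, norm_inv, norm_sub_rev]
    have h4 := inv_norm_sub_le hc hvp h3
    calc _ ≤ (D * (vdist a w * ((1 + ‖w‖) ^ 3)⁻¹)) * (c⁻¹ * (vdist a w)⁻¹ * (1 + ‖w‖)) := by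
          gcongr
          exact hD w hw
      _ = _ := by field_simp
  refine ⟨i1, ?_⟩
  have hcb : closedBall z (r / 3 + r / 3) ⊆ Metric.ball z r :=
    Metric.closedBall_subset_ball (by linarith)
  obtain ⟨i2, e2⟩ := integral_db_radCut_residue (c := z) hε hε (G := g) fun w hw =>
    (hg.holo.differentiableAt (ho.mem_nhds (hball w (hcb hw)).2))
  have i2' : Integrable fun w => db ρ w • (g w * (w - z)⁻¹) := by
    refine i2.congr (Eventually.of_forall fun w => ?_)
    simp only [smul_eq_mul]; ring
  have e2' : ∫ w, db ρ w • (g w * (w - z)⁻¹) = 2 * π * g z := by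
    rw [← show ((2 * π : ℝ)) • g z = 2 * π * g z by rw [Complex.real_smul]; push_cast; ring, ← e2]
    congr 1; ext w
    simp only [smul_eq_mul, hρ]; ring
  have hρs : ∀ w, ContDiffAt ℝ 1 ρ w := fun w => (contDiff_radCut z hε hε).contDiffAt
  have hdb : (fun w => db (fun w => χ₂ w + ρ w - 1) w • (g w * (w - z)⁻¹)) =ᵐ[volume]
      fun w => db χ₂ w • (g w * (w - z)⁻¹) + db ρ w • (g w * (w - z)⁻¹) := by
    filter_upwards [ae_offVertices a] with w hw
    rw [db_sub_const, db_add ((h2.smooth w hw).differentiableAt one_ne_zero)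
      ((hρs w).differentiableAt one_ne_zero), add_smul]
  have key := integral_db_smul_eq_zero (a := a) (u := fun w => χ₂ w + ρ w - 1)
    (k := fun w => g w * (w - z)⁻¹) (C := C * (r / 3)⁻¹)
    (fun w hv => ((h2.smooth w (offVertices_iff.2 hv)).add (hρs w)).sub contDiffAt_const)
    (fun w hv => by
      rw [← offVertices_iff] at hv
      by_cases hwz : w = z
      · left
        rw [hwz]
        filter_upwards [ball_mem_nhds z hε, hN.exists_ball hz h] with v hv1 hv2
        rw [hv2, hρ, radCut_eq_zero hε (by rw [← dist_eq_norm]; exact (Metric.mem_ball.1 hv1).le)]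
        simp
      by_cases hwr : w ∈ region A a p
      · right
        exact (hg.holo.analyticAt (ho.mem_nhds hwr)).mul
          (AnalyticAt.inv (by fun_prop) (sub_ne_zero.2 hwz))
      · left
        have hfar : r ≤ ‖w - z‖ := by
          by_contra hc
          exact hwr (hball w (by rw [mem_ball, dist_eq_norm]; exact not_le.1 hc)).2
        filter_upwards [h2.zero w hv hwr, eventually_lt_norm_sub (d := z) (z := w)
          (r := r / 3 + r / 3) (by linarith)] with v hv1 hv2
        rw [hv1, hρ, radCut_eq_one hε hv2.le]
        simp)
    (fun w hv => by
      rw [← offVertices_iff] at hv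
      have m2 := h2.mem w hv
      have mρ := radCut_mem z (r / 3) (r / 3) w
      by_cases hwr : w ∈ region A a p
      · by_cases hn : ‖w - z‖ ≤ r / 3
        · have : χ₂ w = 1 := (hball w (by rw [mem_ball, dist_eq_norm]; linarith)).1
          rw [this, hρ, radCut_eq_zero hε hn]
          simp; positivity
        · have hle : ‖χ₂ w + ρ w - 1‖ ≤ 1 := by
            rw [norm_eq_abs, abs_le]
            grind
          rw [norm_mul, norm_inv]
          calc _ ≤ 1 * ((C * ((1 + ‖w‖) ^ 2)⁻¹) * (r / 3)⁻¹) := by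
                gcongr
                · exact hC w hwr
                · exact (not_le.1 hn).le
            _ = _ := by ring
      · have hfar : r ≤ ‖w - z‖ := by
          by_contra hc
          exact hwr (hball w (by rw [mem_ball, dist_eq_norm]; exact not_le.1 hc)).2
        rw [(h2.zero w hv hwr).eq_of_nhds, hρ, radCut_eq_one hε (by linarith)]
        simp; positivity)
    ((i1.add i2').congr hdb.symm)
  rw [integral_congr_ae hdb, integral_add i1 i2', e2'] at key
  linear_combination key

lemma Psi.integral_cauchy_zero [CompleteSpace X] (ha : 0 ≤ a) (hf : Psi A a p 3 f)
    (ho : IsOpen (region A a p)) (h1 : IsCutoff A a p χ₁) (hN : Nested a χ₁ χ₂)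
    {w : ℂ} (hw : OffVertices a w) (h : χ₂ w ≠ 1) : ∫ z, db χ₁ z • (f z * (w - z)⁻¹) = 0 := by
  obtain ⟨C, hC0, hC⟩ := hf.exists_norm_le ha
  obtain ⟨c, hc, hcz⟩ := hN
  set r := c * vdist a w * (1 + ‖w‖)⁻¹ with hr
  have h0 : 0 < 1 + ‖w‖ := by linarith [norm_nonneg w]
  have hr0 : 0 < r := mul_pos (mul_pos hc (vdist_pos hw)) (inv_pos.2 h0)
  have hfar : ∀ z, OffVertices a z → χ₁ z ≠ 0 → r ≤ ‖z - w‖ := fun z hz hne => by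
    rw [hr, ← div_eq_mul_inv, div_le_iff₀ h0]
    exact hcz z w hz hw hne h
  refine h1.integral_eq_zero ho ?_ ?_ (C := C * r⁻¹) ?_
  · intro z hz hv
    by_cases hzw : z = w
    · left
      rw [hzw]
      filter_upwards [ball_mem_nhds w hr0, (isOpen_offVertices a).mem_nhds hw] with v h3 h4
      by_contra hne
      rw [mem_ball, dist_eq_norm] at h3
      linarith [hfar v h4 hne]
    · right
      exact (hf.holo.analyticAt (ho.mem_nhds hz)).mul
        (AnalyticAt.inv (by fun_prop) (sub_ne_zero.2 (Ne.symm hzw)))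
  · exact (hf.aestronglyMeasurable ho).mul (Measurable.aestronglyMeasurable (by fun_prop))
  · intro z hz hv hne
    rw [norm_mul, norm_inv, norm_sub_rev]
    calc _ ≤ (C * ((1 + ‖z‖) ^ 2)⁻¹) * r⁻¹ := by
          gcongr
          · exact hC z hz
          · exact hfar z hv hne
      _ = _ := by ring

lemma Psi.areaOp_mul [CompleteSpace X] (ha : 0 ≤ a) {f g : ℂ → ℂ} (hf : Psi A a p 3 f)
    (hg : Psi A a p 3 g) (ho : IsOpen (region A a p)) (h1 : IsCutoff A a p χ₁)
    (h2 : IsCutoff A a p χ₂) (hN : Nested a χ₁ χ₂) :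
    areaOp A χ₁ f * areaOp A χ₂ g = areaOp A χ₁ fun z => f z * g z := by
  have i1 := (hf.mono (by norm_num : 2 ≤ 3)).integrable ho h1
  have i2 := (hg.mono (by norm_num : 2 ≤ 3)).integrable ho h2
  obtain ⟨Cf, hCf0, hCf⟩ := hf.exists_norm_le ha
  set K : ℂ → ℂ → X →L[ℂ] X := fun z w => (db χ₁ z * f z * (db χ₂ w * g w * (w - z)⁻¹)) • res A w
    with hK
  have hres : ∀ z w, OffVertices a z → OffVertices a w → db χ₁ z ≠ 0 → db χ₂ w ≠ 0 →
      w - z ≠ 0 ∧ res A z * res A w = (w - z)⁻¹ • (res A z - res A w) := fun z w hz hw d1 d2 => by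
    obtain ⟨-, hρz, hχz, -⟩ := h1.of_db_ne_zero hz d1
    obtain ⟨-, hρw, -, hχw⟩ := h2.of_db_ne_zero hw d2
    have hne : w - z ≠ 0 := fun h => hχw (by
      rw [sub_eq_zero.1 h]; exact (hN.exists_ball hz hχz).self_of_nhds)
    exact ⟨hne, res_mul_res hρz hρw hne⟩
  have hKi : Integrable (Function.uncurry K) (volume.prod volume) := by
    obtain ⟨c, hc, hcz⟩ := id hN
    obtain ⟨D, hD0, hD⟩ := hg.bound
    obtain ⟨B, hB0, hB⟩ := h2.db_le
    have k1 : Integrable (fun q : ℂ × ℂ => (db χ₁ q.1 * f q.1 * (db χ₂ q.2 * g q.2 * (q.2 - q.1)⁻¹)) •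
        res A q.1) (volume.prod volume) := by
      have hmeas : AEStronglyMeasurable (fun q : ℂ × ℂ => (db χ₁ q.1 * f q.1 *
          (db χ₂ q.2 * g q.2 * (q.2 - q.1)⁻¹)) • res A q.1) (volume.prod volume) := by
        have m1 := i1.aestronglyMeasurable.comp_fst (ν := (volume : Measure ℂ))
        have m2 := (h2.aestronglyMeasurable ho (hg.aestronglyMeasurable ho)).comp_snd
          (μ := (volume : Measure ℂ))
        have m3 : AEStronglyMeasurable (fun q : ℂ × ℂ => (q.2 - q.1)⁻¹) (volume.prod volume) :=
          Measurable.aestronglyMeasurable (by fun_prop)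
        refine ((m2.mul m3).smul m1).congr (Eventually.of_forall fun q => ?_)
        simp only [Pi.mul_apply, Pi.smul_apply', smul_eq_mul, smul_smul]
        ring_nf
      refine Integrable.mono' (i1.norm.mul_prod ((integrable_wt a).const_mul (D * B * c⁻¹)))
        hmeas ?_
      filter_upwards [Measure.quasiMeasurePreserving_fst.ae (ae_offVertices a),
        Measure.quasiMeasurePreserving_snd.ae (ae_offVertices a)] with q hq1 hq2
      have hw0 : 0 ≤ wt a q.2 := by unfold wt; positivity
      by_cases d1 : db χ₁ q.1 = 0
      · rw [d1]; simp
      by_cases d2 : db χ₂ q.2 = 0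
      · rw [d2]; simp; positivity
      obtain ⟨-, -, hχz, -⟩ := h1.of_db_ne_zero hq1 d1
      obtain ⟨hwr, -, -, hχw⟩ := h2.of_db_ne_zero hq2 d2
      have h3 := hcz q.1 q.2 hq1 hq2 hχz hχw
      have hvp := vdist_pos hq2
      have h4 := inv_norm_sub_le hc hvp h3
      rw [norm_smul, norm_mul, norm_smul, norm_smul]
      have h5 : ‖db χ₂ q.2 * g q.2 * (q.2 - q.1)⁻¹‖ ≤ D * B * c⁻¹ * wt a q.2 := by
        rw [norm_mul, norm_mul, norm_inv, norm_sub_rev q.2]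
        calc _ ≤ (B * (‖q.2 - a‖⁻¹ + ‖q.2 + a‖⁻¹)) * (D * (vdist a q.2 * ((1 + ‖q.2‖) ^ 3)⁻¹)) *
              (c⁻¹ * (vdist a q.2)⁻¹ * (1 + ‖q.2‖)) := by
              gcongr
              · exact hB q.2 hq2
              · exact hD q.2 hwr
          _ = _ := by unfold wt; field_simp
      rw [norm_mul]
      calc _ ≤ ‖db χ₁ q.1‖ * ‖f q.1‖ * (D * B * c⁻¹ * wt a q.2) * ‖res A q.1‖ := by gcongr
        _ = _ := by ring
    refine (k1.sub (i1.mul_prod i2)).congr ?_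
    filter_upwards [Measure.quasiMeasurePreserving_fst.ae (ae_offVertices a),
      Measure.quasiMeasurePreserving_snd.ae (ae_offVertices a)] with q hq1 hq2
    simp only [Pi.sub_apply, Function.uncurry, hK]
    by_cases d1 : db χ₁ q.1 = 0
    · rw [d1]; simp
    by_cases d2 : db χ₂ q.2 = 0
    · rw [d2]; simp
    have h3 := (hres _ _ hq1 hq2 d1 d2).2
    rw [smul_mul_assoc, smul_mul_assoc, mul_smul_comm, mul_smul_comm, h3]
    simp only [smul_smul, smul_sub]
    grind
  have hzero : ∫ z, ∫ w, K z w = 0 := by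
    rw [integral_integral_swap hKi]
    refine integral_eq_zero_of_ae ?_
    filter_upwards [ae_offVertices a] with w hw
    by_cases d2 : db χ₂ w = 0
    · simp [hK, d2]
    · have h3 := hf.integral_cauchy_zero ha ho h1 hN hw (h2.of_db_ne_zero hw d2).2.2.2
      have h4 : ∀ z, K z w = (db χ₁ z • (f z * (w - z)⁻¹)) • ((db χ₂ w * g w) • res A w) := fun z => by
        simp only [hK, smul_smul, smul_eq_mul]; ring_nf
      simp only [h4]
      rw [integral_smul_const, h3, zero_smul]
      rfl
  have e1 : (fun z => (db χ₁ z • f z • res A z) * ∫ w, db χ₂ w • g w • res A w) =ᵐ[volume]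
      fun z => (-(2 * π) : ℂ) • (db χ₁ z • (f z * g z) • res A z) - ∫ w, K z w := by
    filter_upwards [ae_offVertices a] with z hz
    by_cases d1 : db χ₁ z = 0
    · simp [hK, d1]
    obtain ⟨hzr, hρz, hχz, -⟩ := h1.of_db_ne_zero hz d1
    obtain ⟨c1, c2⟩ := hg.integral_cauchy ha ho h2 hN hz hzr hχz
    rw [← integral_const_mul_of_integrable i2]
    have e2 : (fun w => (db χ₁ z • f z • res A z) * (db χ₂ w • g w • res A w)) =ᵐ[volume]
        fun w => (db χ₂ w • (g w * (w - z)⁻¹)) • ((db χ₁ z * f z) • res A z) - K z w := by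
      filter_upwards [ae_offVertices a] with w hw
      by_cases d2 : db χ₂ w = 0
      · simp [hK, d2]
      have h3 := (hres _ _ hz hw d1 d2).2
      rw [smul_mul_assoc, smul_mul_assoc, mul_smul_comm, mul_smul_comm, h3]
      simp only [hK, smul_smul, smul_sub, smul_eq_mul]
      ring_nf
    have i3 : Integrable fun w => (db χ₂ w • (g w * (w - z)⁻¹)) • ((db χ₁ z * f z) • res A z) :=
      c1.smul_const _
    have i4 : Integrable (K z) := by
      refine (i3.sub ((i2.const_mul (db χ₁ z • f z • res A z)).congr e2)).congr
        (Eventually.of_forall fun w => ?_)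
      simp_all
    rw [integral_congr_ae e2, integral_sub i3 i4, integral_smul_const, c2]
    simp only [smul_smul]
    ring_nf
  have hfg : Psi A a p 2 fun z => f z * g z := by
    obtain ⟨C, hC0, hC⟩ := hf.bound
    obtain ⟨D, hD0, hD⟩ := hg.exists_norm_le ha
    refine ⟨hf.holo.mul hg.holo, C * D, by positivity, fun z hz => ?_⟩
    rw [norm_mul]
    have hv := vdist_nonneg a z
    have h3 : ((1 + ‖z‖) ^ 3)⁻¹ ≤ 1 :=
      inv_le_one_of_one_le₀ (one_le_pow₀ (by linarith [norm_nonneg z]))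
    calc _ ≤ (C * (vdist a z * 1)) * (D * ((1 + ‖z‖) ^ 2)⁻¹) := by
          gcongr
          · exact (hC z hz).trans (by gcongr)
          · exact hD z hz
      _ = _ := by ring
  have i5 := hfg.integrable ho h1
  have e3 := integral_sub (f := fun z => (-(2 * π) : ℂ) • (db χ₁ z • (f z * g z) • res A z))
    (g := fun z => ∫ w, K z w) (i5.smul (-(2 * π) : ℂ)) hKi.integral_prod_left
  unfold areaOp
  rw [smul_mul_smul_comm, ← integral_mul_const_of_integrable i1, integral_congr_ae e1, e3, hzero, sub_zero, integral_smul, smul_smul]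
  congr 1
  have : (π : ℂ) ≠ 0 := by exact_mod_cast Real.pi_ne_zero
  push_cast
  field_simp

end Area

section CauchyOp

variable {E : Type*} [NormedAddCommGroup E] [NormedSpace ℂ E]

lemma unit_eq_or_eq_neg : ∀ s' s : ℤˣ, s' = s ∨ s' = -s := by decide

lemma norm_circleMap_sub_self (c : ℂ) (r θ : ℝ) : ‖circleMap c r θ - c‖ = |r| :=
  norm_polar_sub c r θ

lemma measurableSet_ray (S : Set ℂ) (hS : IsOpen S) (φ : ℝ) (s τ : ℤˣ) :
    MeasurableSet {t : ℝ | 0 < t ∧ ray a φ s τ t ∈ S} := by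
  have hγ : Continuous fun t : ℝ => ray a φ s τ t := by unfold ray; fun_prop
  exact (isOpen_Ioi.inter (hS.preimage hγ)).measurableSet

lemma measurableSet_circle (S : Set ℂ) (hS : IsOpen S) (d : ℂ) (r : ℝ) :
    MeasurableSet {θ : ℝ | θ ∈ Ioc (-π) π ∧ circleMap d r θ ∈ S} :=
  measurableSet_Ioc.inter (hS.preimage (continuous_circleMap d r)).measurableSet

lemma isOpen_cutoffs (A : X →ₗ.[ℂ] X) (a : ℝ) (q : Params) :
    IsOpen (offDiscs A a q.ε ∩ inDisc A a q.R) :=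
  (isOpen_offDiscs A a _).inter (isOpen_inDisc A a _)

/-- The points of the boundary of the region with parameters `q`. -/
def contourSet (A : X →ₗ.[ℂ] X) (a : ℝ) (q : Params) : Set ℂ :=
  {z | (∃ s τ t, 0 < t ∧ z = ray a q.φ s τ t ∧ z ∈ offDiscs A a q.ε ∩ inDisc A a q.R) ∨
    (∃ d ∈ removedPts A a, ∃ θ, z = circleMap d q.ε θ ∧ z ∈ bisector q.φ a ∩ inDisc A a q.R) ∨
    (infty ∉ singPts A a ∧ ∃ θ, z = circleMap 0 q.R θ ∧
      z ∈ bisector q.φ a ∩ offDiscs A a q.ε)}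

lemma contourIntegral_congr (h0 : 0 < q.φ) (hφ : q.φ < π / 2) {F G : ℂ → E}
    (h : ∀ z ∈ contourSet A a q, F z = G z) :
    contourIntegral A a q F = contourIntegral A a q G := by
  have ob := isOpen_bisector h0 hφ a
  unfold contourIntegral
  congr 1
  · congr 1
    · refine sum_congr rfl fun s _ => sum_congr rfl fun τ _ =>
        setIntegral_congr_fun (measurableSet_ray _ (isOpen_cutoffs A a q) _ _ _) fun t ht => ?_
      rw [h _ (.inl ⟨s, τ, t, ht.1, rfl, ht.2⟩)]
    · refine sum_congr rfl fun d hd =>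
        setIntegral_congr_fun (measurableSet_circle _ (ob.inter (isOpen_inDisc A a _)) _ _)
          fun θ hθ => ?_
      rw [h _ (.inr (.inl ⟨d, hd, θ, rfl, hθ.2⟩))]
  · split_ifs with hi
    · rfl
    · refine setIntegral_congr_fun (measurableSet_circle _ (ob.inter (isOpen_offDiscs A a _)) _ _)
          fun θ hθ => ?_
      rw [h _ (.inr (.inr ⟨hi, θ, rfl, hθ.2⟩))]

lemma offVertices_ray (ha : 0 ≤ a) (h0 : 0 < φ) (hφ : φ < π / 2) (s τ : ℤˣ) {t : ℝ}
    (ht : 0 < t) : OffVertices a (ray a φ s τ t) := by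
  have h1 : loc a s (ray a φ s τ t) ≠ 0 := fun h => by
    have := norm_loc_ray a φ s τ ht.le
    rw [h, norm_zero] at this
    exact ht.ne this
  have h2 := (abs_arg_lt_iff (φ := π / 2) (by linarith [pi_pos])
    (by linarith [pi_pos]) h1).1 (by
      rw [abs_arg_loc_ray a h0.le (by linarith [pi_pos]) s τ ht]; exact hφ)
  rw [Real.cos_pi_div_two, mul_zero] at h2
  intro s'
  rcases unit_eq_or_eq_neg s' s with h | h
  · rw [h]; exact h1
  · rw [h]
    intro h3
    have := re_loc_neg a s (ray a φ s τ t)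
    rw [h3, Complex.zero_re] at this
    linarith

lemma ray_mem_bisector (ha : 0 ≤ a) {φ ψ : ℝ} (h0 : 0 < φ) (hφ : φ < ψ) (hψ : ψ < π / 2)
    (s τ : ℤˣ) {t : ℝ} (ht : 0 < t) : ray a ψ s τ t ∈ bisector φ a := by
  have harg := abs_arg_loc_ray a (h0.trans hφ).le (by linarith [pi_pos]) s τ ht
  rw [mem_bisector_iff h0 (hφ.trans hψ)]
  intro s'
  rcases unit_eq_or_eq_neg s' s with h | h
  · rw [h, harg]; exact hφ
  · rw [h]
    have := pi_div_two_le_abs_arg_loc_neg ha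
      (offVertices_ray ha (h0.trans hφ) hψ s τ ht (-s)) (by rw [harg]; exact hψ.le)
    linarith

lemma bisector_mono {φ ψ : ℝ} (h0 : 0 < φ) (hφ : φ ≤ ψ) (hψ : ψ < π / 2) :
    bisector ψ a ⊆ bisector φ a := fun z hz => by
  rw [mem_bisector_iff h0 (hφ.trans_lt hψ)]
  rw [mem_bisector_iff (h0.trans_le hφ) hψ] at hz
  exact fun s => hφ.trans_lt (hz s)

lemma contourSet_subset_region (hS : Setup A ω a) (hp : Admissible A ω a p)
    (hq : Admissible A ω a q) (hpq : p.Below q) : contourSet A a q ⊆ region A a p := by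
  have ha := hS.ha
  have hφ := hS.lt_pi_div_two hq
  have hoff : offDiscs A a q.ε ⊆ offDiscs A a p.ε := fun z hz d hd hd' => hpq.ε.trans (hz d hd hd')
  have hin : inDisc A a q.R ⊆ inDisc A a p.R := fun z hz hi => (hz hi).trans hpq.R
  rintro z (⟨s, τ, t, ht, rfl, hz⟩ | ⟨d, hd, θ, rfl, hz⟩ | ⟨hi, θ, rfl, hz⟩)
  · exact ⟨ray_mem_bisector ha hp.1.1 hpq.φ hφ s τ ht, hoff hz.1, hin hz.2⟩
  · refine ⟨bisector_mono hp.1.1 hpq.φ.le hφ hz.1, ?_, hin hz.2⟩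
    rw [mem_offDiscs_iff]
    intro d' hd'
    have h1 : ‖circleMap d q.ε θ - d‖ = q.ε := by rw [norm_circleMap_sub_self, abs_of_pos hq.2.1.1]
    by_cases h : d = d'
    · rw [← h, h1]; exact hpq.ε
    · exact hpq.ε.trans_le (le_norm_sub_of_removedPts ha (fun h0 => (hq.2.1.2.1 h0).le) hd hd' h h1.le)
  · refine ⟨bisector_mono hp.1.1 hpq.φ.le hφ hz.1, hoff hz.2, fun _ => ?_⟩
    rw [norm_circleMap_zero, abs_of_pos (ha.trans_lt hq.2.2.1)]
    exact hpq.R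

lemma contourSet_subset_resolventSet (hS : Setup A ω a) (hq : Admissible A ω a q) :
    contourSet A a q ⊆ resolventSet A := by
  have ha := hS.ha
  have hφ := hS.lt_pi_div_two hq
  rintro z (⟨s, τ, t, ht, rfl, hz⟩ | ⟨d, hd, θ, rfl, hz⟩ | ⟨hi, θ, rfl, hz⟩)
  · refine hS.mem_resolventSet (s := s) (offVertices_ray ha hq.1.1 hφ s τ ht s) ?_
    rw [abs_arg_loc_ray a hq.1.1.le (by linarith [pi_pos]) s τ ht]
    exact hq.1.2
  · refine hq.closedBall_subset hd ?_
    rw [mem_closedBall, dist_eq_norm, norm_circleMap_sub_self, abs_of_pos hq.2.1.1]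
  · by_contra hc
    have := hq.2.2.2 hi hc
    rw [mem_ball, dist_zero_right, norm_circleMap_zero, abs_of_pos (ha.trans_lt hq.2.2.1)] at this
    exact lt_irrefl _ this

lemma contourSet_notMem_core (hS : Setup A ω a) (hq : Admissible A ω a q) (hδ : 0 < δ)
    (hz : z ∈ contourSet A a q) : z ∉ core A a (q.shift δ) := by
  have ha := hS.ha
  have hφ := hS.lt_pi_div_two hq
  rintro ⟨h1, h2, h3⟩
  simp only [Params.shift] at h1 h2 h3
  rcases hz with ⟨s, τ, t, ht, rfl, hz⟩ | ⟨d, hd, θ, rfl, hz⟩ | ⟨hi, θ, rfl, hz⟩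
  · have := h1 s
    rw [abs_arg_loc_ray a hq.1.1.le (by linarith [pi_pos]) s τ ht] at this
    linarith
  · have := h2 d hd
    rw [norm_circleMap_sub_self, abs_of_pos hq.2.1.1] at this
    linarith
  · have := h3 hi
    rw [norm_circleMap_zero, abs_of_pos (ha.trans_lt hq.2.2.1)] at this
    linarith

lemma offVertices_of_mem_region (hS : Setup A ω a) (hp : Admissible A ω a p)
    (hz : z ∈ region A a p) : OffVertices a z := by
  rw [mem_region_iff hp.1.1 (hS.lt_pi_div_two hp)] at hz
  intro s h
  have := hz.1 s
  rw [h, Complex.arg_zero, abs_zero] at this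
  exact absurd this (not_lt.2 hp.1.1.le)

lemma eventually_notMem_core (hz : OffVertices a z) (h0 : 0 ≤ q.φ) (hφ : q.φ ≤ π)
    (h : z ∉ core A a q) : ∀ᶠ w in 𝓝 z, w ∉ core A a q := by
  by_cases h1 : ∀ s, q.φ ≤ |(loc a s z).arg|
  · by_cases h2 : ∀ d ∈ removedPts A a, q.ε ≤ ‖z - d‖
    · have h3 : ¬ (infty ∉ singPts A a → ‖z‖ ≤ q.R) := fun h3 => h ⟨h1, h2, h3⟩
      push Not at h3
      filter_upwards [continuous_norm.continuousAt.eventually (lt_mem_nhds h3.2)] with w hw hc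
      exact absurd (hc.2.2 h3.1) (not_le.2 hw)
    · push Not at h2
      obtain ⟨d, hd, h2⟩ := h2
      filter_upwards [eventually_norm_sub_lt h2] with w hw hc
      exact absurd (hc.2.1 d hd) (not_le.2 hw)
  · push Not at h1
    obtain ⟨s, hs⟩ := h1
    filter_upwards [(continuous_loc a s).continuousAt.eventually
      (eventually_abs_arg_lt h0 hφ (hz s) hs)] with w hw hc
    exact absurd (hc.1 s) (not_le.2 hw)

lemma eps_ne_rad [CompleteSpace X] [Nontrivial X] (hS : Setup A ω a) (hq : Admissible A ω a q)
    (hi : infty ∉ singPts A a) {d : ℂ} (hd : d ∈ removedPts A a) : q.ε ≠ q.R := by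
  intro heq
  rcases hS.ha.lt_or_eq with h | h
  · linarith [hq.2.1.2.1 h, hq.2.2.1]
  · obtain ⟨z, hz⟩ := spectrumSet_nonempty hS.hA.1 (infty_notMem_singPts_iff.1 hi)
    have hd0 : d = 0 := by rcases (mem_removedPts.1 hd).1 with h' | h' <;> rw [h', ← h] <;> simp
    have h1 := hq.2.2.2 hi hz
    refine hz (hq.closedBall_subset hd ?_)
    rw [hd0, heq]
    exact Metric.ball_subset_closedBall h1

lemma Psi.cauchyOp_eq [CompleteSpace X] [Nontrivial X] (hS : Setup A ω a)
    (hp : Admissible A ω a p) (hq : Admissible A ω a q) (hpq : p.Below q)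
    (hf : Psi A a p 2 f) {χ : ℂ → ℝ} (hχ : IsCutoff A a p χ) : cauchyOp A a q f = areaOp A χ f := by
  have ho := hS.isOpen_region hp
  obtain ⟨δ₁, hδ₁, hadm⟩ := hq.mono_shift
  have hgood : ∀ δ, 0 < δ → δ ≤ δ₁ → GoodCut A ω a q δ := fun δ h1 h2 => ⟨h1, hq, hadm δ h1.le h2⟩
  have hg := hgood δ₁ hδ₁ le_rfl
  obtain ⟨C, hC0, hC⟩ := exists_norm_res_mul_le hS hg
  obtain ⟨B, hB0, hB⟩ := hf.bound
  set D : Set ℂ := (region A a p ∩ resolventSet A) ∩ (core A a (q.shift δ₁))ᶜ with hD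
  set k : ℂ → X →L[ℂ] X := D.indicator fun z => f z • res A z with hk
  have hDo : IsOpen D := by
    rw [isOpen_iff_mem_nhds]
    rintro z ⟨hz, hzc⟩
    filter_upwards [(ho.inter (isOpen_resolventSet A)).mem_nhds hz,
      eventually_notMem_core (offVertices_of_mem_region hS hp hz.1) hg.right.1.1.le
        (hg.phi_lt_pi hS).le hzc] with w h1 h2 using ⟨h1, h2⟩
  have hcS : contourSet A a q ⊆ D := fun z hz =>
    ⟨⟨contourSet_subset_region hS hp hq hpq hz, contourSet_subset_resolventSet hS hq hz⟩,
      contourSet_notMem_core hS hq hδ₁ hz⟩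
  have hlim := tendsto_integral_db_cut hS hδ₁ (fun δ hδ => hgood δ hδ.1 hδ.2.le) hq
    (fun hi d hd => eps_ne_rad hS hq hi hd) (k := k) hDo
    (fun z hz => offVertices_of_mem_region hS hp hz.1.1)
    (ContinuousOn.congr (fun z hz => (hf.analyticAt_smul_res ho hz.1).continuousAt.continuousWithinAt)
      fun z hz => indicator_of_mem hz _)
    (fun z hz => indicator_of_notMem hz _) (C := B * C)
    (fun z => by
      by_cases hz : z ∈ D
      · rw [hk, indicator_of_mem hz, norm_smul]
        have hv := vdist_nonneg a z
        calc _ ≤ (B * (vdist a z * ((1 + ‖z‖) ^ 2)⁻¹)) * ‖res A z‖ := by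
              gcongr
              exact hB z hz.1.1
          _ = B * (‖res A z‖ * vdist a z) * ((1 + ‖z‖) ^ 2)⁻¹ := by ring
          _ ≤ _ := by
            gcongr
            exact hC z (offVertices_of_mem_region hS hp hz.1.1) hz.2
      · rw [hk, indicator_of_notMem hz, norm_zero]; positivity)
    (fun s τ t ht h => hcS (.inl ⟨s, τ, t, ht, rfl, h⟩))
    (fun d hd θ h => hcS (.inr (.inl ⟨d, hd, θ, rfl, h⟩)))
    (fun hi θ h => hcS (.inr (.inr ⟨hi, θ, rfl, h⟩)))
  have h1 : contourIntegral A a q k = contourIntegral A a q fun z => f z • res A z :=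
    contourIntegral_congr hq.1.1 (hS.lt_pi_div_two hq) fun z hz => indicator_of_mem (hcS hz) _
  have h2 : ∀ δ ∈ Ioo 0 δ₁, (-(2 * π)⁻¹ : ℂ) • ∫ z, db (cut A a q δ) z • k z = areaOp A χ f := by
    intro δ hδ
    have hcut := isCutoff_cut hS hp (hgood δ hδ.1 hδ.2.le) hpq
    rw [← hf.areaOp_eq ho hcut hχ, areaOp]
    congr 1
    refine integral_congr_ae ?_
    filter_upwards [ae_offVertices a] with z hz
    by_cases hd : db (cut A a q δ) z = 0
    · rw [hd, zero_smul, zero_smul]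
    · obtain ⟨e1, e2, -, e3⟩ := hcut.of_db_ne_zero hz hd
      have : z ∈ D := by
        refine ⟨⟨e1, e2⟩, fun hc => e3 (cut_eq_one hδ.1 (fun s => ?_) (fun d hd => ?_) fun hi => ?_)⟩
        · exact le_trans (by simp only [Params.shift]; linarith [hδ.2]) (hc.1 s)
        · exact le_trans (by simp only [Params.shift]; linarith [hδ.2]) (hc.2.1 d hd)
        · exact (hc.2.2 hi).trans (by simp only [Params.shift]; linarith [hδ.2])
      rw [hk, indicator_of_mem this]
  have h3 := hlim.const_smul (-(2 * π)⁻¹ : ℂ)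
  have h4 : Tendsto (fun δ => (-(2 * π)⁻¹ : ℂ) • ∫ z, db (cut A a q δ) z • k z) (𝓝[>] 0)
      (𝓝 (areaOp A χ f)) := by
    refine tendsto_const_nhds.congr' ?_
    filter_upwards [Ioo_mem_nhdsGT hδ₁] with δ hδ using (h2 δ hδ).symm
  rw [← tendsto_nhds_unique h3 h4, cauchyOp, h1, smul_smul]
  congr 1
  have hpi : (π : ℂ) ≠ 0 := by exact_mod_cast Real.pi_ne_zero
  have hI := Complex.I_ne_zero
  push_cast
  field_simp
  rw [Complex.I_sq, neg_neg]

end CauchyOp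

/-- The parameters of the part of a ray that belongs to the contour. -/
abbrev raySet (A : X →ₗ.[ℂ] X) (a : ℝ) (q : Params) (s τ : ℤˣ) : Set ℝ :=
  {t : ℝ | 0 < t ∧ ray a q.φ s τ t ∈ offDiscs A a q.ε ∩ inDisc A a q.R}

/-- Bounded holomorphic functions on the region with parameters `p` that are integrable along the
rays of the contour with parameters `q`. -/
structure Elem (A : X →ₗ.[ℂ] X) (a : ℝ) (p q : Params) (f : ℂ → ℂ) : Prop where
  holo : DifferentiableOn ℂ f (region A a p)
  bdd : ∃ C : ℝ, ∀ z ∈ region A a p, ‖f z‖ ≤ C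
  int : ∀ s τ : ℤˣ, IntegrableOn (fun t => ‖f (ray a q.φ s τ t)‖ / vdist a (ray a q.φ s τ t))
    (raySet A a q s τ)

/-- The standing assumptions on a pair of nested regions. -/
structure Pair (A : X →ₗ.[ℂ] X) (ω a : ℝ) (p q : Params) : Prop where
  setup : Setup A ω a
  outer : Admissible A ω a p
  inner : Admissible A ω a q
  below : p.Below q

lemma Pair.isOpen (h : Pair A ω a p q) : IsOpen (region A a p) := h.setup.isOpen_region h.outer

lemma Pair.contour_subset (h : Pair A ω a p q) : contourSet A a q ⊆ region A a p :=
  contourSet_subset_region h.setup h.outer h.inner h.below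

lemma Pair.continuousOn_ray (h : Pair A ω a p q) {F : ℂ → ℂ}
    (hF : ContinuousOn F (region A a p)) (s τ : ℤˣ) : ContinuousOn (fun t => F (ray a q.φ s τ t))
      (raySet A a q s τ) :=
  hF.comp (by unfold ray; fun_prop) fun t ht => h.contour_subset (.inl ⟨s, τ, t, ht.1, rfl, ht.2⟩)

lemma Pair.exists_vdist_mul_norm_res_le [CompleteSpace X] (h : Pair A ω a p q) :
    ∃ M, 0 ≤ M ∧ ∀ z ∈ contourSet A a q, vdist a z * ‖res A z‖ ≤ M ∧
      ((∃ d ∈ removedPts A a, ∃ θ, z = circleMap d q.ε θ) ∨ (infty ∉ singPts A a ∧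
        ∃ θ, z = circleMap 0 q.R θ) → ‖res A z‖ ≤ M) := by
  obtain ⟨δ₁, hδ₁, hadm⟩ := h.inner.mono_shift
  have hg : GoodCut A ω a q δ₁ := ⟨hδ₁, h.inner, hadm δ₁ hδ₁.le le_rfl⟩
  obtain ⟨C, hC0, hC⟩ := exists_norm_res_mul_le h.setup hg
  have hK : IsCompact ((⋃ d ∈ removedPts A a, closedBall d q.ε) ∪
      {z | infty ∉ singPts A a ∧ z ∈ Metric.sphere (0 : ℂ) q.R}) := by
    refine ((removedPts A a).finite_toSet.isCompact_biUnion fun d _ =>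
      isCompact_closedBall d q.ε).union ?_
    by_cases hi : infty ∉ singPts A a
    · simp only [hi, not_false_eq_true, true_and]
      exact isCompact_sphere _ _
    · simp [hi]
  obtain ⟨D, -, hD⟩ := exists_norm_res_le_of_isCompact hK (A := A) (by
    rintro z (hz | ⟨hi, hz⟩)
    · simp only [mem_iUnion] at hz
      obtain ⟨d, hd, hz⟩ := hz
      exact h.inner.closedBall_subset hd hz
    · by_contra hc
      have h1 := h.inner.2.2.2 hi hc
      rw [mem_ball_zero_iff] at h1
      rw [mem_sphere_zero_iff_norm] at hz
      linarith)
  refine ⟨max C D, le_max_of_le_left hC0, fun z hz => ⟨?_, fun hc => ?_⟩⟩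
  · rw [mul_comm]
    exact (hC z (offVertices_of_mem_region h.setup h.outer (h.contour_subset hz))
      (contourSet_notMem_core h.setup h.inner hδ₁ hz)).trans (le_max_left _ _)
  · refine (hD z ?_).trans (le_max_right _ _)
    rcases hc with ⟨d, hd, θ, rfl⟩ | ⟨hi, θ, rfl⟩
    · left
      simp only [mem_iUnion]
      refine ⟨d, hd, ?_⟩
      rw [mem_closedBall, dist_eq_norm, norm_circleMap_sub_self, abs_of_pos h.inner.2.1.1]
    · right
      refine ⟨hi, ?_⟩
      rw [mem_sphere_zero_iff_norm, norm_circleMap_zero,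
        abs_of_pos (h.setup.ha.trans_lt h.inner.2.2.1)]

lemma Pair.norm_smul_res_ray_le [CompleteSpace X] (h : Pair A ω a p q) {M : ℝ}
    (hM : ∀ z ∈ contourSet A a q, vdist a z * ‖res A z‖ ≤ M) (f : ℂ → ℂ) (s τ : ℤˣ) {t : ℝ}
    (ht : t ∈ raySet A a q s τ) :
    ‖(((τ : ℤ) : ℂ) * ((s : ℤ) : ℂ) * exp (((τ : ℤ) : ℂ) * q.φ * I)) •
        f (ray a q.φ s τ t) • res A (ray a q.φ s τ t)‖ ≤
      M * (‖f (ray a q.φ s τ t)‖ / vdist a (ray a q.φ s τ t)) := by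
  have hz : ray a q.φ s τ t ∈ contourSet A a q := .inl ⟨s, τ, t, ht.1, rfl, ht.2⟩
  have hv := vdist_pos (offVertices_of_mem_region h.setup h.outer (h.contour_subset hz))
  rw [norm_smul, norm_smul, norm_mul, norm_mul, norm_unit, norm_unit, norm_ray_aux, one_mul, one_mul,
    one_mul, mul_div_assoc', le_div_iff₀ hv]
  calc _ = ‖f (ray a q.φ s τ t)‖ * (vdist a (ray a q.φ s τ t) * ‖res A (ray a q.φ s τ t)‖) := by ring
    _ ≤ ‖f (ray a q.φ s τ t)‖ * M := by gcongr; exact hM _ hz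
    _ = _ := mul_comm _ _

lemma norm_circle_weight (r θ : ℝ) : ‖(r * exp (θ * I) * I : ℂ)‖ = |r| := by
  rw [norm_mul, norm_mul, norm_exp_ofReal_mul_I, Complex.norm_I, norm_real]; simp

open Classical in
lemma Pair.exists_norm_cauchyOp_le [CompleteSpace X] (h : Pair A ω a p q) :
    ∃ C, ∀ f, Elem A a p q f → ∀ K, (∀ z ∈ region A a p, ‖f z‖ ≤ K) →
      (∀ s τ : ℤˣ, ∫ t in raySet A a q s τ,
        ‖f (ray a q.φ s τ t)‖ / vdist a (ray a q.φ s τ t) ≤ K) → ‖cauchyOp A a q f‖ ≤ C * K := by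
  obtain ⟨M, hM0, hM⟩ := h.exists_vdist_mul_norm_res_le
  obtain ⟨c, hc⟩ : ∃ c : ℂ, c = (2 * π * I : ℂ)⁻¹ := ⟨_, rfl⟩
  refine ⟨‖c‖ * ((∑ _s : ℤˣ, ∑ _τ : ℤˣ, M) +
    (∑ _d ∈ removedPts A a, |q.ε| * M * (2 * π)) + |q.R| * M * (2 * π)), fun f hf K hK hI => ?_⟩
  have hR0 : (0 : ℝ) < q.R := h.setup.ha.trans_lt h.inner.2.2.1
  have hK0 : 0 ≤ K := le_trans (integral_nonneg fun t => by
    have := vdist_nonneg a (ray a q.φ 1 1 t)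
    positivity) (hI 1 1)
  have hvol : ∀ (S : Set ℂ) (d : ℂ) (r : ℝ),
      volume.real {θ : ℝ | θ ∈ Ioc (-π) π ∧ circleMap d r θ ∈ S} ≤ 2 * π :=
    fun S d r => by
      have h1 := measureReal_mono (μ := volume) (show {θ : ℝ | θ ∈ Ioc (-π) π ∧
        circleMap d r θ ∈ S} ⊆ Ioc (-π) π from fun θ hθ => hθ.1) (by simp)
      rw [Real.volume_real_Ioc_of_le (by linarith [pi_pos])] at h1
      linarith
  have hcirc : ∀ (S : Set ℂ) (d : ℂ) (r : ℝ), (∀ θ, circleMap d r θ ∈ S →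
      ‖f (circleMap d r θ) • res A (circleMap d r θ)‖ ≤ K * M) →
      ‖∫ θ in {θ : ℝ | θ ∈ Ioc (-π) π ∧ circleMap d r θ ∈ S},
        (r * exp (θ * I) * I) • f (circleMap d r θ) • res A (circleMap d r θ)‖
      ≤ |r| * M * (2 * π) * K := by
    intro S d r hb
    refine (norm_setIntegral_le_of_norm_le_const (C := |r| * (K * M)) ?_ fun θ hθ => ?_).trans ?_
    · exact lt_of_le_of_lt (measure_mono fun θ hθ => hθ.1) measure_Ioc_lt_top
    · rw [norm_smul, norm_circle_weight]
      gcongr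
      exact hb θ hθ.2
    · calc _ ≤ |r| * (K * M) * (2 * π) := by gcongr; exact hvol S d r
        _ = _ := by ring
  have hb : ∀ z ∈ contourSet A a q, ‖res A z‖ ≤ M → ‖f z • res A z‖ ≤ K * M := fun z hz h1 => by
    rw [norm_smul]
    exact mul_le_mul (hK z (h.contour_subset hz)) h1 (norm_nonneg _) hK0
  rw [cauchyOp, ← hc, norm_smul, mul_assoc]
  refine mul_le_mul_of_nonneg_left ?_ (norm_nonneg c)
  rw [contourIntegral, add_mul, add_mul, sum_mul, sum_mul]
  refine (norm_add_le _ _).trans (add_le_add ((norm_sub_le _ _).trans (add_le_add ?_ ?_)) ?_)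
  · refine (norm_sum_le _ _).trans (sum_le_sum fun s _ => ?_)
    refine (norm_sum_le _ _).trans (sum_le_sum fun τ _ => ?_)
    refine (norm_integral_le_of_norm_le ((hf.int s τ).const_mul M) ?_).trans ?_
    · filter_upwards [ae_restrict_mem (measurableSet_ray _ (isOpen_cutoffs A a q) q.φ s τ)] with t ht
      exact h.norm_smul_res_ray_le (fun z hz => (hM z hz).1) f s τ ht
    · rw [integral_const_mul]
      exact mul_le_mul_of_nonneg_left (hI s τ) hM0
  · rw [sum_mul]
    refine (norm_sum_le _ _).trans (sum_le_sum fun d hd => hcirc _ d q.ε fun θ hθ => ?_)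
    have hz : circleMap d q.ε θ ∈ contourSet A a q := .inr (.inl ⟨d, hd, θ, rfl, hθ⟩)
    exact hb _ hz ((hM _ hz).2 (.inl ⟨d, hd, θ, rfl⟩))
  · split_ifs with hi
    · rw [norm_zero]
      positivity
    · refine hcirc _ 0 q.R fun θ hθ => ?_
      have hz : circleMap 0 q.R θ ∈ contourSet A a q := .inr (.inr ⟨hi, θ, rfl, hθ⟩)
      exact hb _ hz ((hM _ hz).2 (.inr ⟨hi, θ, rfl⟩))

open Classical in
lemma Pair.tendsto_cauchyOp [CompleteSpace X] (h : Pair A ω a p q)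
    (hf : Elem A a p q f) {r : ℕ → ℂ → ℂ} (hr : ∀ n, ContinuousOn (r n) (region A a p)) {C : ℝ}
    (hC : ∀ n, ∀ z ∈ region A a p, ‖r n z‖ ≤ C)
    (hlim : ∀ z ∈ region A a p, Tendsto (fun n => r n z) atTop (𝓝 1)) :
    Tendsto (fun n => cauchyOp A a q fun z => r n z * f z) atTop (𝓝 (cauchyOp A a q f)) := by
  obtain ⟨M, hM0, hM⟩ := h.exists_vdist_mul_norm_res_le
  obtain ⟨K, hK⟩ := hf.bdd
  have ob := isOpen_bisector h.inner.1.1 (h.setup.lt_pi_div_two h.inner) a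
  have hresc : ContinuousOn (res A) (contourSet A a q) := fun z hz =>
    (continuousAt_res (contourSet_subset_resolventSet h.setup h.inner hz)).continuousWithinAt
  have hfc := hf.holo.continuousOn.mono h.contour_subset
  have hkc : ∀ n, ContinuousOn (fun z => (r n z * f z) • res A z) (contourSet A a q) := fun n =>
    (((hr n).mono h.contour_subset).mul hfc).smul hresc
  have hlim' : ∀ z ∈ contourSet A a q,
      Tendsto (fun n => (r n z * f z) • res A z) atTop (𝓝 (f z • res A z)) := fun z hz => by
    have := ((hlim z (h.contour_subset hz)).mul_const (f z)).smul_const (res A z)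
    rwa [one_mul] at this
  have hcirc : ∀ (S : Set ℂ), IsOpen S → ∀ (d : ℂ) (x : ℝ),
      (∀ θ, circleMap d x θ ∈ S → circleMap d x θ ∈ contourSet A a q ∧
        ‖res A (circleMap d x θ)‖ ≤ M) →
      Tendsto (fun n => ∫ θ in {θ : ℝ | θ ∈ Ioc (-π) π ∧ circleMap d x θ ∈ S},
        (x * exp (θ * I) * I) • (r n (circleMap d x θ) *
          f (circleMap d x θ)) • res A (circleMap d x θ)) atTop
      (𝓝 (∫ θ in {θ : ℝ | θ ∈ Ioc (-π) π ∧ circleMap d x θ ∈ S},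
        (x * exp (θ * I) * I) •
          f (circleMap d x θ) • res A (circleMap d x θ))) := by
    intro S hS d x hx
    have hm := measurableSet_circle S hS d x
    refine tendsto_integral_of_dominated_convergence (fun _ => |x| * (C * K * M)) ?_ ?_ ?_ ?_
    · intro n
      refine ContinuousOn.aestronglyMeasurable ?_ hm
      have h1 : ContinuousOn (fun θ : ℝ => (x * exp (θ * I) * I : ℂ))
        {θ : ℝ | θ ∈ Ioc (-π) π ∧ circleMap d x θ ∈ S} := by fun_prop
      exact h1.smul ((hkc n).comp (continuous_circleMap d x).continuousOn fun θ hθ => (hx θ hθ.2).1)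
    · exact integrableOn_const
        (lt_of_le_of_lt (measure_mono fun θ hθ => hθ.1) measure_Ioc_lt_top).ne
    · intro n
      filter_upwards [ae_restrict_mem hm] with θ hθ
      obtain ⟨h1, h2⟩ := hx θ hθ.2
      rw [norm_smul, norm_smul, norm_circle_weight, norm_mul]
      have h3 := hC n _ (h.contour_subset h1)
      have h4 := hK _ (h.contour_subset h1)
      exact mul_le_mul_of_nonneg_left (mul_le_mul (mul_le_mul h3 h4 (norm_nonneg _)
        ((norm_nonneg _).trans h3)) h2 (norm_nonneg _) (mul_nonneg ((norm_nonneg _).trans h3)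
          ((norm_nonneg _).trans h4))) (abs_nonneg x)
    · filter_upwards [ae_restrict_mem hm] with θ hθ
      exact (hlim' _ (hx θ hθ.2).1).const_smul _
  unfold cauchyOp
  refine Tendsto.const_smul ?_ _
  unfold contourIntegral
  refine Tendsto.add (Tendsto.sub (tendsto_finset_sum _ fun s _ => tendsto_finset_sum _ fun τ _ => ?_)
    (tendsto_finset_sum _ fun d hd => ?_)) ?_
  · have hm := measurableSet_ray _ (isOpen_cutoffs A a q) q.φ s τ (a := a)
    refine tendsto_integral_of_dominated_convergence
      (fun t => C * (M * (‖f (ray a q.φ s τ t)‖ / vdist a (ray a q.φ s τ t)))) ?_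
      (((hf.int s τ).const_mul M).const_mul C) ?_ ?_
    · intro n
      refine ContinuousOn.aestronglyMeasurable ?_ hm
      have h1 : ContinuousOn (ray a q.φ s τ) (raySet A a q s τ) := by unfold ray; fun_prop
      have h2 := (hkc n).comp h1 fun t ht => .inl ⟨s, τ, t, ht.1, rfl, ht.2⟩
      exact (continuousOn_const (c := ((τ : ℤ) : ℂ) * ((s : ℤ) : ℂ) *
        exp (((τ : ℤ) : ℂ) * q.φ * I))).smul h2
    · intro n
      filter_upwards [ae_restrict_mem hm] with t ht
      have h1 := h.norm_smul_res_ray_le (fun z hz => (hM z hz).1) f s τ ht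
      have h2 := hC n _ (h.contour_subset (.inl ⟨s, τ, t, ht.1, rfl, ht.2⟩))
      rw [mul_smul (r n _) (f _), smul_comm _ (r n _), norm_smul (r n _)]
      exact mul_le_mul h2 h1 (norm_nonneg _) ((norm_nonneg _).trans h2)
    · filter_upwards [ae_restrict_mem hm] with t ht
      exact (hlim' _ (.inl ⟨s, τ, t, ht.1, rfl, ht.2⟩)).const_smul _
  · refine hcirc _ (ob.inter (isOpen_inDisc A a _)) d q.ε fun θ hθ => ?_
    have hz : circleMap d q.ε θ ∈ contourSet A a q := .inr (.inl ⟨d, hd, θ, rfl, hθ⟩)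
    exact ⟨hz, (hM _ hz).2 (.inl ⟨d, hd, θ, rfl⟩)⟩
  · split_ifs with hi
    · exact tendsto_const_nhds
    · refine hcirc _ (ob.inter (isOpen_offDiscs A a _)) 0 q.R fun θ hθ => ?_
      have hz : circleMap 0 q.R θ ∈ contourSet A a q := .inr (.inr ⟨hi, θ, rfl, hθ⟩)
      exact ⟨hz, (hM _ hz).2 (.inr ⟨hi, θ, rfl⟩)⟩

lemma Pair.ae_ray (h : Pair A ω a p q) (s τ : ℤˣ) : ∀ᵐ t ∂volume.restrict (raySet A a q s τ),
    0 < t ∧ ray a q.φ s τ t ∈ region A a p ∧ 0 < vdist a (ray a q.φ s τ t) := by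
  filter_upwards [ae_restrict_mem (measurableSet_ray _ (isOpen_cutoffs A a q) q.φ s τ)] with t ht
  have hz := h.contour_subset (.inl ⟨s, τ, t, ht.1, rfl, ht.2⟩)
  exact ⟨ht.1, hz, vdist_pos (offVertices_of_mem_region h.setup h.outer hz)⟩

lemma Pair.integrableOn_ray (h : Pair A ω a p q) (hf : ContinuousOn f (region A a p))
    (s τ : ℤˣ) {m : ℝ → ℝ} (hm : IntegrableOn m (raySet A a q s τ))
    (hle : ∀ᵐ t ∂volume.restrict (raySet A a q s τ),
      ‖f (ray a q.φ s τ t)‖ / vdist a (ray a q.φ s τ t) ≤ m t) :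
    IntegrableOn (fun t => ‖f (ray a q.φ s τ t)‖ / vdist a (ray a q.φ s τ t)) (raySet A a q s τ) := by
  refine Integrable.mono' hm (AEStronglyMeasurable.div₀ (ContinuousOn.aestronglyMeasurable
    (h.continuousOn_ray hf s τ).norm (measurableSet_ray _ (isOpen_cutoffs A a q) q.φ s τ)) ?_) ?_
  · refine Continuous.aestronglyMeasurable ((continuous_vdist a).comp ?_)
    unfold ray; fun_prop
  · filter_upwards [hle] with t ht
    rwa [norm_of_nonneg (div_nonneg (norm_nonneg _) (vdist_nonneg _ _))]

lemma inv_sq_ray_le (ha : 0 ≤ a) (φ : ℝ) (s τ : ℤˣ) {t : ℝ} (ht : 0 < t) :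
    ((1 + ‖ray a φ s τ t‖) ^ 2)⁻¹ ≤ (1 + a) ^ 2 * ((1 + t) ^ 2)⁻¹ := by
  have h1 := norm_loc_le ha s (ray a φ s τ t)
  rw [norm_loc_ray a φ s τ ht.le] at h1
  rw [← div_eq_mul_inv, le_div_iff₀ (by positivity), inv_mul_le_iff₀ (by positivity), ← mul_pow]
  gcongr
  nlinarith [norm_nonneg (ray a φ s τ t)]

lemma Elem.mul_bounded (h : Pair A ω a p q) {f g : ℂ → ℂ} (hf : Elem A a p q f)
    (hg : DifferentiableOn ℂ g (region A a p)) (hgb : ∃ C : ℝ, ∀ z ∈ region A a p, ‖g z‖ ≤ C) :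
    Elem A a p q fun z => g z * f z := by
  obtain ⟨C, hC⟩ := hgb
  obtain ⟨K, hK⟩ := hf.bdd
  refine ⟨hg.mul hf.holo, ⟨C * K, fun z hz => ?_⟩, fun s τ => ?_⟩
  · rw [norm_mul]
    exact mul_le_mul (hC z hz) (hK z hz) (norm_nonneg _) ((norm_nonneg _).trans (hC z hz))
  · refine h.integrableOn_ray (hg.mul hf.holo).continuousOn s τ ((hf.int s τ).const_mul C) ?_
    filter_upwards [h.ae_ray s τ] with t ⟨_, hz, hv⟩
    rw [Pi.mul_apply, norm_mul, mul_div_assoc]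
    gcongr
    exact hC _ hz

lemma Elem.add (h : Pair A ω a p q) {f g : ℂ → ℂ} (hf : Elem A a p q f) (hg : Elem A a p q g) :
    Elem A a p q fun z => f z + g z := by
  obtain ⟨C, hC⟩ := hf.bdd
  obtain ⟨K, hK⟩ := hg.bdd
  refine ⟨hf.holo.add hg.holo, ⟨C + K, fun z hz => (norm_add_le _ _).trans
    (add_le_add (hC z hz) (hK z hz))⟩, fun s τ => ?_⟩
  refine h.integrableOn_ray (hf.holo.add hg.holo).continuousOn s τ ((hf.int s τ).add (hg.int s τ)) ?_
  filter_upwards [h.ae_ray s τ] with t ⟨_, _, hv⟩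
  simp only [Pi.add_apply, ← add_div]
  gcongr
  exact norm_add_le _ _

section Regularizer

lemma sin_mul_le_norm_loc_sub (h0 : 0 < φ) (hφ : φ < π / 2)
    (hz : z ∈ bisector φ a) (s : ℤˣ) {t : ℝ} (ht : 0 ≤ t) :
    sin φ * t ≤ ‖loc a s z - t‖ ∧ sin φ * ‖loc a s z‖ ≤ ‖loc a s z - t‖ := by
  have h := sin_mul_norm_le_norm_sub h0 (u := (t : ℂ))
    (v := loc a s z) (by rw [arg_ofReal_of_nonneg ht, abs_zero])
    ((mem_bisector_iff h0 hφ).1 hz s).le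
  rw [sub_zero, norm_real, norm_of_nonneg ht, norm_sub_rev] at h
  exact h

/-- Bounded holomorphic functions on the bisector that tend boundedly to `1` and vanish at `a`,
`-a` and `∞`. -/
noncomputable def regularizer (a : ℝ) (n : ℕ) (z : ℂ) : ℂ :=
  (∏ s : ℤˣ, loc a s z / (loc a s z - ((n + 1 : ℝ)⁻¹ : ℝ))) *
    ((n + 1 : ℝ) / (loc a 1 z - (n + 1 : ℝ))) ^ 3 * (-1)

lemma exists_vdist_eq (a : ℝ) (z : ℂ) : ∃ s : ℤˣ, vdist a z = ‖loc a s z‖ := by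
  rcases min_choice ‖z - a‖ ‖z + a‖ with h | h
  · exact ⟨1, by simp [vdist, h, loc]⟩
  · refine ⟨-1, ?_⟩
    rw [vdist, h, ← norm_neg]
    congr 1
    simp [loc]
    ring

lemma prod_units (F : ℤˣ → ℂ) (s : ℤˣ) : ∏ s, F s = F s * F (-s) := by
  rw [univ_units, Finset.prod_pair (by decide)]
  rcases unit_eq_or_eq_neg s 1 with rfl | rfl
  · rfl
  · rw [neg_neg, mul_comm]

lemma norm_regularizer_le (h0 : 0 < φ) (hφ : φ < π / 2) (ha : 0 ≤ a) (n : ℕ)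
    (hz : z ∈ bisector φ a) : ‖regularizer a n z‖ ≤ (sin φ)⁻¹ ^ 5 ∧
      ‖regularizer a n z‖ ≤ (sin φ)⁻¹ ^ 5 * (n + 1) ^ 4 * (2 + a) ^ 3 *
        (vdist a z * ((1 + ‖z‖) ^ 3)⁻¹) := by
  have hs : 0 < sin φ := sin_pos_of_pos_of_lt_pi h0 (by linarith [pi_pos])
  set c := sin φ
  set N : ℝ := n + 1 with hN
  have hN1 : 1 ≤ N := by rw [hN]; linarith [Nat.cast_nonneg (α := ℝ) n]
  have hF : ∀ s : ℤˣ, ‖loc a s z / (loc a s z - (N⁻¹ : ℝ))‖ ≤ c⁻¹ ∧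
      ‖loc a s z / (loc a s z - (N⁻¹ : ℝ))‖ ≤ c⁻¹ * N * ‖loc a s z‖ := fun s => by
    obtain ⟨h1, h2⟩ := sin_mul_le_norm_loc_sub h0 hφ hz s (t := N⁻¹) (by positivity)
    have h3 : 0 < ‖loc a s z - (N⁻¹ : ℝ)‖ := lt_of_lt_of_le (by positivity) h1
    rw [norm_div]
    refine ⟨?_, ?_⟩
    · rw [div_le_iff₀ h3, inv_mul_eq_div, le_div_iff₀ hs, mul_comm]
      exact h2
    · rw [div_le_iff₀ h3]
      calc ‖loc a s z‖ = c⁻¹ * N * ‖loc a s z‖ * (c * N⁻¹) := by field_simp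
        _ ≤ _ := by gcongr
  have hG : ‖(N : ℂ) / (loc a 1 z - (N : ℝ))‖ ≤ c⁻¹ ∧
      ‖(N : ℂ) / (loc a 1 z - (N : ℝ))‖ ≤ c⁻¹ * (N * (2 + a)) * (1 + ‖z‖)⁻¹ := by
    obtain ⟨h1, h2⟩ := sin_mul_le_norm_loc_sub h0 hφ hz 1 (t := N) (by positivity)
    have h3 : 0 < ‖loc a 1 z - (N : ℝ)‖ := lt_of_lt_of_le (by positivity) h1
    rw [norm_div, norm_real, norm_of_nonneg (by linarith)]
    refine ⟨?_, ?_⟩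
    · rw [div_le_iff₀ h3, inv_mul_eq_div, le_div_iff₀ hs, mul_comm]
      exact h1
    · have h4 : ‖z‖ ≤ ‖loc a 1 z‖ + a := by
        have : z = loc a 1 z + a := by simp [loc]
        calc ‖z‖ = ‖loc a 1 z + a‖ := by rw [← this]
          _ ≤ _ := (norm_add_le _ _).trans (by rw [norm_real, norm_of_nonneg ha])
      have h6 : 0 < 1 + ‖z‖ := by positivity
      have h5 : c * (1 + ‖z‖) ≤ (2 + a) * ‖loc a 1 z - (N : ℝ)‖ := by
        have : c * (1 + a) ≤ (1 + a) * (c * N) := by nlinarith [mul_pos hs (by linarith : 0 < 1 + a)]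
        nlinarith
      rw [div_le_iff₀ h3, ← div_eq_mul_inv, div_mul_eq_mul_div, le_div_iff₀ h6]
      calc N * (1 + ‖z‖) = c⁻¹ * N * (c * (1 + ‖z‖)) := by field_simp
        _ ≤ c⁻¹ * N * ((2 + a) * ‖loc a 1 z - (N : ℝ)‖) := by gcongr
        _ = _ := by ring
  obtain ⟨s, hv⟩ := exists_vdist_eq a z
  rw [regularizer, prod_units _ s, norm_mul, norm_neg, norm_one, mul_one, norm_mul, norm_mul, norm_pow]
  have hc : (n : ℂ) + 1 = (N : ℂ) := by rw [hN]; push_cast; rfl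
  push_cast at hF hG ⊢
  rw [hc] at *
  refine ⟨?_, ?_⟩
  · calc _ ≤ c⁻¹ * c⁻¹ * c⁻¹ ^ 3 := by
          gcongr
          exacts [(hF s).1, (hF (-s)).1, hG.1]
      _ = _ := by ring
  · calc _ ≤ (c⁻¹ * N * ‖loc a s z‖) * c⁻¹ * (c⁻¹ * (N * (2 + a)) * (1 + ‖z‖)⁻¹) ^ 3 := by
          gcongr
          exacts [(hF s).2, (hF (-s)).1, hG.2]
      _ = _ := by rw [hv, ← inv_pow]; ring

lemma loc_sub_ne_zero (h0 : 0 < φ) (hφ : φ < π / 2)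
    (hz : z ∈ bisector φ a) (s : ℤˣ) {t : ℝ} (ht : 0 < t) : loc a s z - t ≠ 0 := by
  have h1 := (sin_mul_le_norm_loc_sub h0 hφ hz s ht.le).1
  have hs : 0 < sin φ := sin_pos_of_pos_of_lt_pi h0 (by linarith [pi_pos])
  exact norm_pos_iff.1 (lt_of_lt_of_le (by positivity) h1)

lemma differentiableOn_regularizer (h0 : 0 < φ) (hφ : φ < π / 2) (n : ℕ) :
    DifferentiableOn ℂ (regularizer a n) (bisector φ a) := by
  have h1 : ∀ s, Differentiable ℂ (loc a s) := fun s => by unfold loc; fun_prop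
  intro z hz
  have h2 : ∀ s, loc a s z - ((n + 1 : ℝ)⁻¹ : ℝ) ≠ 0 := fun s =>
    loc_sub_ne_zero h0 hφ hz s (by positivity)
  have h3 := loc_sub_ne_zero h0 hφ hz 1 (t := n + 1) (by positivity)
  have h4 := h1 1 z
  have h5 := h1 (-1) z
  refine DifferentiableAt.differentiableWithinAt ?_
  unfold regularizer
  simp_rw [prod_units _ 1]
  exact (((h4.div (h4.sub_const _) (h2 1)).mul (h5.div (h5.sub_const _) (h2 (-1)))).mul
    (((differentiableAt_const _).div (h4.sub_const _) (by exact_mod_cast h3)).pow 3)).mul_const _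

lemma tendsto_regularizer (hz : OffVertices a z) :
    Tendsto (fun n => regularizer a n z) atTop (𝓝 1) := by
  have h1 : Tendsto (fun n : ℕ => (((n + 1 : ℝ)⁻¹ : ℝ) : ℂ)) atTop (𝓝 0) := by
    have := tendsto_one_div_add_atTop_nhds_zero_nat (𝕜 := ℝ)
    simp_rw [one_div] at this
    exact_mod_cast (Complex.continuous_ofReal.tendsto 0).comp this
  have h2 : ∀ s : ℤˣ, Tendsto (fun n : ℕ => loc a s z / (loc a s z - ((n + 1 : ℝ)⁻¹ : ℝ))) atTop
      (𝓝 1) := fun s => by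
    have := (tendsto_const_nhds (x := loc a s z)).div
      ((tendsto_const_nhds (x := loc a s z)).sub h1) (by rw [sub_zero]; exact hz s)
    rwa [sub_zero, div_self (hz s)] at this
  have h3 : Tendsto (fun n : ℕ => ((n + 1 : ℝ) / (loc a 1 z - (n + 1 : ℝ)) : ℂ)) atTop
      (𝓝 (-1)) := by
    have h4 : Tendsto (fun n : ℕ => (1 : ℂ) / (loc a 1 z * (((n + 1 : ℝ)⁻¹ : ℝ) : ℂ) - 1)) atTop
        (𝓝 (1 / (loc a 1 z * 0 - 1))) :=
      tendsto_const_nhds.div ((tendsto_const_nhds.mul h1).sub tendsto_const_nhds) (by simp)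
    rw [mul_zero, zero_sub, div_neg, div_one] at h4
    refine h4.congr fun n => ?_
    have h5 : (((n + 1 : ℝ) : ℝ) : ℂ) ≠ 0 := by exact_mod_cast (by positivity : (n + 1 : ℝ) ≠ 0)
    rw [← mul_div_mul_left _ _ h5]
    push_cast at h5 ⊢
    congr 1
    · ring
    · field_simp
  have := (((h2 1).mul (h2 (-1))).mul (h3.pow 3)).mul_const (-1)
  norm_num at this
  refine this.congr fun n => ?_
  rw [regularizer, prod_units _ 1]
  norm_num

lemma Pair.psi_regularizer_mul (h : Pair A ω a p q)
    (hf : DifferentiableOn ℂ f (region A a p)) (hb : ∃ C : ℝ, ∀ z ∈ region A a p, ‖f z‖ ≤ C) (n : ℕ) :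
    Psi A a p 3 fun z => regularizer a n z * f z := by
  obtain ⟨C, hC⟩ := hb
  have hφ := h.setup.lt_pi_div_two h.outer
  refine ⟨((differentiableOn_regularizer h.outer.1.1 hφ n).mono inter_subset_left).mul hf,
    (sin p.φ)⁻¹ ^ 5 * (n + 1) ^ 4 * (2 + a) ^ 3 * |C|, ?_, fun z hz => ?_⟩
  · have := sin_pos_of_pos_of_lt_pi h.outer.1.1 (by linarith [pi_pos])
    have := h.setup.ha
    positivity
  have h1 := (norm_regularizer_le h.outer.1.1 hφ h.setup.ha n hz.1).2
  rw [norm_mul]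
  calc _ ≤ _ := mul_le_mul h1 ((hC z hz).trans (le_abs_self C)) (norm_nonneg _) ((norm_nonneg _).trans h1)
    _ = _ := by ring

variable [CompleteSpace X]

lemma Pair.tendsto_cauchyOp_regularizer (h : Pair A ω a p q) (hf : Elem A a p q f) :
    Tendsto (fun n => cauchyOp A a q fun z => regularizer a n z * f z) atTop
      (𝓝 (cauchyOp A a q f)) :=
  have hφ := h.setup.lt_pi_div_two h.outer
  h.tendsto_cauchyOp hf
    (fun n => ((differentiableOn_regularizer h.outer.1.1 hφ n).mono inter_subset_left).continuousOn)
    (fun n _ hz => (norm_regularizer_le h.outer.1.1 hφ h.setup.ha n hz.1).1)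
    fun _ hz => tendsto_regularizer (offVertices_of_mem_region h.setup h.outer hz)

lemma Pair.elem_regularizer_mul (h : Pair A ω a p q) (hf : Elem A a p q f) (n : ℕ) :
    Elem A a p q fun z => regularizer a n z * f z :=
  have hφ := h.setup.lt_pi_div_two h.outer
  hf.mul_bounded h ((differentiableOn_regularizer h.outer.1.1 hφ n).mono inter_subset_left)
    ⟨_, fun _ hz => (norm_regularizer_le h.outer.1.1 hφ h.setup.ha n hz.1).1⟩

lemma Pair.exists_cutoffs (h : Pair A ω a p q) :
    ∃ χ₁ χ₂, IsCutoff A a p χ₁ ∧ IsCutoff A a p χ₂ ∧ Nested a χ₁ χ₂ := by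
  obtain ⟨δ, hδ, hadm⟩ := h.inner.mono_shift
  have e1 : (q.shift (δ / 2)).shift (δ / 4) = q.shift (3 * δ / 4) := by
    simp only [Params.shift, Params.mk.injEq]
    refine ⟨?_, ?_, ?_⟩ <;> ring
  have h1 : GoodCut A ω a q (δ / 4) :=
    ⟨by positivity, h.inner, hadm _ (by positivity) (by linarith)⟩
  have h2 : GoodCut A ω a (q.shift (δ / 2)) (δ / 4) := by
    refine ⟨by positivity, hadm _ (by positivity) (by linarith), ?_⟩
    rw [e1]
    exact hadm _ (by positivity) (by linarith)
  obtain ⟨b1, b2, b3⟩ := h.below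
  have b : p.Below (q.shift (δ / 2)) := by
    refine ⟨?_, ?_, ?_⟩ <;> simp only [Params.shift] <;> linarith
  refine ⟨_, _, isCutoff_cut h.setup h.outer h2 b, isCutoff_cut h.setup h.outer h1 h.below,
    nested_cut h.setup h1 h2 ?_⟩
  refine ⟨?_, ?_, ?_⟩ <;> simp only [Params.shift] <;> linarith

variable [Nontrivial X]

lemma Pair.cauchyOp_mul (h : Pair A ω a p q) {f g : ℂ → ℂ} (hf : Elem A a p q f)
    (hg : Elem A a p q g) :
    cauchyOp A a q f * cauchyOp A a q g = cauchyOp A a q fun z => f z * g z := by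
  obtain ⟨χ₁, χ₂, h1, h2, hN⟩ := h.exists_cutoffs
  have hfg := hg.mul_bounded h hf.holo hf.bdd
  refine tendsto_nhds_unique ((h.tendsto_cauchyOp_regularizer hf).mul
    (h.tendsto_cauchyOp_regularizer hg)) ?_
  have hφ := h.setup.lt_pi_div_two h.outer
  have h3 := h.tendsto_cauchyOp hfg (r := fun n z => regularizer a n z * regularizer a n z)
    (fun n => (((differentiableOn_regularizer h.outer.1.1 hφ n).mul
      (differentiableOn_regularizer h.outer.1.1 hφ n)).mono inter_subset_left).continuousOn)
    (C := (sin p.φ)⁻¹ ^ 5 * (sin p.φ)⁻¹ ^ 5)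
    (fun n z hz => by
      have := (norm_regularizer_le h.outer.1.1 hφ h.setup.ha n hz.1).1
      rw [norm_mul]
      exact mul_le_mul this this (norm_nonneg _) ((norm_nonneg _).trans this))
    (fun z hz => by
      have := tendsto_regularizer (offVertices_of_mem_region h.setup h.outer hz)
      simpa using this.mul this)
  refine h3.congr fun n => ?_
  have p1 := h.psi_regularizer_mul hf.holo hf.bdd n
  have p2 := h.psi_regularizer_mul hg.holo hg.bdd n
  have p3 : Psi A a p 3 fun z => regularizer a n z * (f z * (regularizer a n z * g z)) := by
    have he := h.elem_regularizer_mul hg n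
    have := he.mul_bounded h hf.holo hf.bdd
    exact h.psi_regularizer_mul this.holo this.bdd n
  have e : (fun z => regularizer a n z * regularizer a n z * (f z * g z)) =
      fun z => (regularizer a n z * f z) * (regularizer a n z * g z) := by
    funext z; ring
  have e' : (fun z => regularizer a n z * (f z * (regularizer a n z * g z))) =
      fun z => (regularizer a n z * f z) * (regularizer a n z * g z) := by
    funext z; ring
  rw [e'] at p3
  rw [e, (p1.mono (by norm_num)).cauchyOp_eq h.setup h.outer h.inner h.below h1,
    (p2.mono (by norm_num)).cauchyOp_eq h.setup h.outer h.inner h.below h2,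
    (p3.mono (by norm_num)).cauchyOp_eq h.setup h.outer h.inner h.below h1,
    Psi.areaOp_mul h.setup.ha p1 p2 h.isOpen h1 h2 hN]

lemma Pair.cauchyOp_eq (h : Pair A ω a p q) {q' : Params} (h' : Pair A ω a p q')
    (hf : Elem A a p q f) (hf' : Elem A a p q' f) : cauchyOp A a q f = cauchyOp A a q' f := by
  obtain ⟨χ, -, h1, -, -⟩ := h.exists_cutoffs
  refine tendsto_nhds_unique (h.tendsto_cauchyOp_regularizer hf)
    ((h'.tendsto_cauchyOp_regularizer hf').congr fun n => ?_)
  have p1 := (h.psi_regularizer_mul hf.holo hf.bdd n).mono (by norm_num : 2 ≤ 3)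
  rw [p1.cauchyOp_eq h.setup h.outer h.inner h.below h1,
    p1.cauchyOp_eq h'.setup h'.outer h'.inner h'.below h1]

lemma Pair.cauchyOp_add (h : Pair A ω a p q) {f g : ℂ → ℂ} (hf : Elem A a p q f)
    (hg : Elem A a p q g) :
    (cauchyOp A a q fun z => f z + g z) = cauchyOp A a q f + cauchyOp A a q g := by
  obtain ⟨χ, -, h1, -, -⟩ := h.exists_cutoffs
  have hfg := hf.add h hg
  refine tendsto_nhds_unique (h.tendsto_cauchyOp_regularizer hfg)
    (((h.tendsto_cauchyOp_regularizer hf).add (h.tendsto_cauchyOp_regularizer hg)).congr fun n => ?_)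
  have p1 := (h.psi_regularizer_mul hf.holo hf.bdd n).mono (by norm_num : 2 ≤ 3)
  have p2 := (h.psi_regularizer_mul hg.holo hg.bdd n).mono (by norm_num : 2 ≤ 3)
  have p3 := (h.psi_regularizer_mul hfg.holo hfg.bdd n).mono (by norm_num : 2 ≤ 3)
  rw [p1.cauchyOp_eq h.setup h.outer h.inner h.below h1,
    p2.cauchyOp_eq h.setup h.outer h.inner h.below h1,
    p3.cauchyOp_eq h.setup h.outer h.inner h.below h1, areaOp, areaOp, areaOp, ← smul_add,
    ← integral_add (p1.integrable h.isOpen h1) (p2.integrable h.isOpen h1)]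
  simp only [mul_add, add_smul, smul_add]

lemma Pair.cauchyOp_smul (h : Pair A ω a p q) (hf : Elem A a p q f) (c : ℂ) :
    (cauchyOp A a q fun z => c * f z) = c • cauchyOp A a q f := by
  obtain ⟨χ, -, h1, -, -⟩ := h.exists_cutoffs
  have hfg := hf.mul_bounded h (differentiableOn_const c) ⟨‖c‖, fun _ _ => le_rfl⟩
  refine tendsto_nhds_unique (h.tendsto_cauchyOp_regularizer hfg)
    (((h.tendsto_cauchyOp_regularizer hf).const_smul c).congr fun n => ?_)
  have p1 := (h.psi_regularizer_mul hf.holo hf.bdd n).mono (by norm_num : 2 ≤ 3)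
  have p3 := (h.psi_regularizer_mul hfg.holo hfg.bdd n).mono (by norm_num : 2 ≤ 3)
  rw [p1.cauchyOp_eq h.setup h.outer h.inner h.below h1,
    p3.cauchyOp_eq h.setup h.outer h.inner h.below h1, areaOp, areaOp, smul_comm, ← integral_smul]
  congr 2
  funext z
  rw [smul_comm c, ← mul_smul c]
  congr 2
  ring

lemma Pair.cauchyOp_mul_res (h : Pair A ω a p q) (hf : Elem A a p q f) {b : ℂ}
    (hb : b ∈ resolventSet A) {η : ℝ} (hη : 0 < η) (hbη : ∀ z ∈ region A a p, η ≤ ‖z - b‖) :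
    cauchyOp A a q f * res A b = (cauchyOp A a q fun z => f z * (b - z)⁻¹) ∧
      res A b * cauchyOp A a q f = cauchyOp A a q f * res A b := by
  obtain ⟨χ, -, h1, -, -⟩ := h.exists_cutoffs
  have hne : ∀ z ∈ region A a p, b - z ≠ 0 := fun z hz h => by
    have := hbη z hz
    rw [← neg_sub, h, neg_zero, norm_zero] at this
    linarith
  have hfb : Elem A a p q fun z => f z * (b - z)⁻¹ := by
    simp_rw [mul_comm (f _)]
    refine hf.mul_bounded h (DifferentiableOn.inv (by fun_prop) hne) ⟨η⁻¹, fun z hz => ?_⟩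
    rw [norm_inv, norm_sub_rev]
    exact inv_anti₀ hη (hbη z hz)
  have p1 := fun n => h.psi_regularizer_mul hf.holo hf.bdd n
  have p2 := fun n => h.psi_regularizer_mul hfb.holo hfb.bdd n
  have e := fun n => ((p1 n).mono (by norm_num : 2 ≤ 3)).cauchyOp_eq h.setup h.outer h.inner
    h.below h1
  have e2 := fun n => ((p2 n).mono (by norm_num : 2 ≤ 3)).cauchyOp_eq h.setup h.outer h.inner
    h.below h1
  refine ⟨tendsto_nhds_unique ((h.tendsto_cauchyOp_regularizer hf).mul_const (res A b))
    ((h.tendsto_cauchyOp_regularizer hfb).congr fun n => ?_),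
    tendsto_nhds_unique ((h.tendsto_cauchyOp_regularizer hf).const_mul (res A b))
      (((h.tendsto_cauchyOp_regularizer hf).mul_const (res A b)).congr fun n => ?_)⟩
  · rw [e, e2, (p1 n).areaOp_mul_res h.setup.ha h.isOpen h1 hb hη hbη]
    simp only [mul_assoc]
  · have i1 := ((p1 n).mono (by norm_num : 2 ≤ 3)).integrable h.isOpen h1
    rw [e, areaOp, smul_mul_assoc, mul_smul_comm, ← integral_mul_const_of_integrable i1,
      ← integral_const_mul_of_integrable i1]
    congr 2
    funext z
    simp only [smul_mul_assoc, mul_smul_comm]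
    rw [res_mul_comm]

end Regularizer

section Residues

variable {χ : ℂ → ℝ}

lemma integral_neg_add_sum {α ι E : Type*} [MeasurableSpace α] {μ : Measure α} [Fintype ι]
    [NormedAddCommGroup E] [NormedSpace ℝ E] {F : α → E} {G : ι → α → E} (hF : Integrable F μ)
    (hG : ∀ i, Integrable (G i) μ) : Integrable (fun z => -F z + ∑ i, G i z) μ ∧
      ∫ z, (-F z + ∑ i, G i z) ∂μ = -∫ z, F z ∂μ + ∑ i, ∫ z, G i z ∂μ := by
  have h1 : Integrable (fun z => -F z) μ := hF.neg
  have h2 : Integrable (fun z => ∑ i, G i z) μ := integrable_finsetSum _ fun i _ => hG i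
  exact ⟨h1.add h2, by rw [integral_add h1 h2, integral_neg, integral_finsetSum _ fun i _ => hG i]⟩

/-- The poles of the auxiliary rational functions. -/
noncomputable def pole (a : ℝ) (i : Fin 3) : ℂ := ((a + 1 + (i : ℕ) : ℝ) : ℂ)

lemma one_le_norm_pole_sub {i j : Fin 3} (h : i ≠ j) : 1 ≤ ‖pole a i - pole a j‖ := by
  have h1 : pole a i - pole a j = (((i : ℕ) - (j : ℕ) : ℤ) : ℂ) := by
    simp only [pole]; push_cast; ring
  rw [h1, Complex.norm_intCast]
  have : ((i : ℕ) - (j : ℕ) : ℤ) ≠ 0 := fun h0 => h (Fin.ext (by omega))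
  exact_mod_cast Int.one_le_abs this

lemma loc_pole (a : ℝ) (i : Fin 3) : loc a 1 (pole a i) = ((1 + (i : ℕ) : ℝ) : ℂ) := by
  simp only [loc, pole]; push_cast; ring

lemma abs_arg_loc_lt_of_near (h0 : 0 < φ) (hφ : φ ≤ π / 2) (i : Fin 3)
    (hz : ‖z - pole a i‖ < sin φ) : loc a 1 z ≠ 0 ∧ |(loc a 1 z).arg| < φ := by
  have e : loc a 1 (pole a i) - loc a 1 z = -(z - pole a i) := by simp only [loc]; push_cast; ring
  have hs := Real.sin_le_one φ
  refine ⟨fun h => ?_, ?_⟩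
  · rw [h, sub_zero, loc_pole] at e
    rw [← norm_neg, ← e, norm_real, norm_of_nonneg (by linarith)] at hz
    linarith
  · by_contra hc
    have := (sin_mul_norm_le_norm_sub h0 (u := loc a 1 (pole a i)) (v := loc a 1 z)
      (by rw [loc_pole, arg_ofReal_of_nonneg (by linarith), abs_zero]) (not_lt.1 hc)).1
    rw [e, norm_neg, sub_zero, loc_pole, norm_real, norm_of_nonneg (by linarith)] at this
    have := sin_pos_of_pos_of_lt_pi h0 (by linarith [pi_pos])
    nlinarith

variable [CompleteSpace X]

lemma le_norm_sub_pole {r : ℝ} (hr1 : r ≤ 1 / 4) {i j : Fin 3} (hij : i ≠ j)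
    (hz : ‖z - pole a i‖ ≤ r + r) : r + r ≤ ‖z - pole a j‖ := by
  have h1 := one_le_norm_pole_sub (a := a) hij
  have h2 := norm_sub_le (z - pole a j) (z - pole a i)
  rw [sub_sub_sub_cancel_left] at h2
  linarith

lemma integral_db_radCut_smul_res {c : Fin 3 → ℂ}
    (hfc : ∀ z, f z = ∑ i, c i * (pole a i - z)⁻¹) {r : ℝ} (hr0 : 0 < r) (hr1 : r ≤ 1 / 4)
    {i : Fin 3} (hA : ∀ z, ‖z - pole a i‖ ≤ r + r → z ∈ resolventSet A) :
    Integrable (fun z => db (radCut (pole a i) r r) z • (f z • res A z)) ∧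
      ∫ z, db (radCut (pole a i) r r) z • (f z • res A z) =
        -((2 * π * c i : ℂ) • res A (pole a i)) := by
  set G : ℂ → X →L[ℂ] X := fun z =>
    (-c i + (z - pole a i) * ∑ j ∈ Finset.univ.erase i, c j * (pole a j - z)⁻¹) • res A z with hG
  have e : (fun z => db (radCut (pole a i) r r) z • (f z • res A z)) =
      fun z => db (radCut (pole a i) r r) z • (z - pole a i)⁻¹ • G z := by
    funext z
    by_cases hz : z = pole a i
    · have : db (radCut (pole a i) r r) z = 0 := by
        refine db_eq_zero_of_eventually_const (c := 0) ?_
        have : Metric.ball (pole a i) r ∈ 𝓝 z := by rw [hz]; exact ball_mem_nhds _ hr0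
        filter_upwards [this] with w hw
        exact radCut_eq_zero hr0 (by rw [mem_ball, dist_eq_norm] at hw; exact hw.le)
      rw [this, zero_smul, zero_smul]
    · have h1 : z - pole a i ≠ 0 := sub_ne_zero.2 hz
      rw [hG]; simp only
      rw [smul_smul (z - pole a i)⁻¹, hfc, ← Finset.add_sum_erase _ _ (Finset.mem_univ i)]
      congr 2
      rw [mul_add, ← mul_assoc, inv_mul_cancel₀ h1, one_mul, ← neg_sub z, inv_neg]
      ring
  have hd : ∀ z ∈ closedBall (pole a i) (r + r), DifferentiableAt ℂ G z := by
    intro z hz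
    rw [mem_closedBall, dist_eq_norm] at hz
    suffices h : DifferentiableAt ℂ (fun z => -c i + (z - pole a i) *
      ∑ j ∈ Finset.univ.erase i, c j * (pole a j - z)⁻¹) z from
        h.smul (differentiableAt_res (hA z hz))
    refine (differentiableAt_const _).add ((differentiableAt_id.sub_const _).mul
      (DifferentiableAt.fun_sum fun j hj => ?_))
    have h3 : pole a j - z ≠ 0 := fun h => by
      have := le_norm_sub_pole hr1 (Ne.symm (Finset.ne_of_mem_erase hj)) hz
      rw [← norm_neg, neg_sub, h, norm_zero] at this
      linarith
    exact (differentiableAt_const _).mul (((differentiableAt_const _).sub differentiableAt_id).inv h3)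
  obtain ⟨i1, i2⟩ := integral_db_radCut_residue (c := pole a i) hr0 hr0 hd
  rw [e]
  refine ⟨i1, i2.trans ?_⟩
  rw [hG]; simp only
  rw [sub_self, zero_mul, add_zero, neg_smul, smul_neg, ← coe_smul, smul_smul]
  push_cast; rfl

lemma Psi.areaOp_eq_sum_res (hS : Setup A ω a) (hp : Admissible A ω a p)
    (hχ : IsCutoff A a p χ) {c : Fin 3 → ℂ} (hfc : ∀ z, f z = ∑ i, c i * (pole a i - z)⁻¹)
    (hfb : ∀ r > 0, ∃ C, 0 ≤ C ∧ ∀ z, (∀ i, r ≤ ‖z - pole a i‖) →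
      ‖f z‖ ≤ C * (vdist a z * ((1 + ‖z‖) ^ 2)⁻¹))
    (hf : Psi A a p 2 f) : areaOp A χ f = ∑ i, c i • res A (pole a i) := by
  have ho := hS.isOpen_region hp
  have hφ := hS.lt_pi_div_two hp
  have hsin : 0 < sin p.φ := sin_pos_of_pos_of_lt_pi hp.1.1 (by linarith [pi_pos])
  obtain ⟨r, hr⟩ : ∃ r, r = sin p.φ / 4 := ⟨_, rfl⟩
  have hr0 : 0 < r := by rw [hr]; positivity
  have hr1 : r ≤ 1 / 4 := by rw [hr]; linarith [Real.sin_le_one p.φ]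
  have hnear : ∀ (i : Fin 3) (z : ℂ), ‖z - pole a i‖ ≤ r + r → z ∈ resolventSet A ∧
      z ∉ region A a p ∧ OffVertices a z := by
    intro i z hz
    obtain ⟨h1, h2⟩ := abs_arg_loc_lt_of_near hp.1.1 hφ.le i
      (lt_of_le_of_lt hz (by linarith : r + r < sin p.φ))
    refine ⟨hS.mem_resolventSet h1 (h2.trans hp.1.2), fun h => ?_, ?_⟩
    · exact absurd (((mem_bisector_iff hp.1.1 hφ).1 h.1) 1) (not_lt.2 h2.le)
    · intro s
      rcases unit_eq_or_eq_neg s 1 with rfl | rfl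
      · exact h1
      · intro h3
        have h4 := re_loc_neg a 1 z
        rw [h3] at h4
        have h5 := re_nonneg_of_abs_arg_le (h2.le.trans hφ.le)
        have ha := hS.ha
        rw [Complex.zero_re] at h4
        apply h1
        have h6 : z = -a := by
          have : loc a (-1) z = -(z + a) := by simp [loc]; ring
          rw [this, neg_eq_zero] at h3
          exact eq_neg_of_add_eq_zero_left h3
        have : a = 0 := by linarith
        rw [h6, this]; simp [loc]
  obtain ⟨β, hβ⟩ : ∃ β : Fin 3 → ℂ → ℝ, β = fun i => radCut (pole a i) r r := ⟨_, rfl⟩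
  have hβc : ∀ i, ContDiff ℝ 1 (β i) := fun i => by rw [hβ]; exact contDiff_radCut _ hr0 hr0
  obtain ⟨u, hu⟩ : ∃ u : ℂ → ℝ, u = fun z => (1 - χ z) - ∑ i, (1 - β i z) := ⟨_, rfl⟩
  have hu1 : ∀ z, OffVertices a z → (∃ i, ‖z - pole a i‖ ≤ r) → u z = 0 := by
    rintro z hz ⟨i, hi⟩
    have hx : χ z = 0 := (hχ.zero z hz (hnear i z (by linarith)).2.1).eq_of_nhds
    have hs : ∑ j, (1 - β j z) = 1 := by
      rw [Finset.sum_eq_single i]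
      · rw [hβ]; simp only; rw [radCut_eq_zero hr0 hi, sub_zero]
      · intro j _ hj
        rw [hβ]; simp only
        rw [radCut_eq_one hr0 (le_norm_sub_pole hr1 (Ne.symm hj) (by linarith)), sub_self]
      · simp
    rw [hu]; simp only; rw [hx, hs]; ring
  have hβ1 : ∀ z, (∀ i, r + r ≤ ‖z - pole a i‖) → ∑ i, (1 - β i z) = 0 := fun z hz =>
    Finset.sum_eq_zero fun i _ => by rw [hβ]; simp only; rw [radCut_eq_one hr0 (hz i), sub_self]
  have hcont : ∀ i, Continuous fun z => ‖z - pole a i‖ := fun i => by fun_prop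
  have hk : ∀ z, OffVertices a z → u =ᶠ[𝓝 z] 0 ∨ AnalyticAt ℂ (fun z => f z • res A z) z := by
    intro z hz
    have hov := (isOpen_offVertices a).mem_nhds hz
    by_cases h1 : ∃ i, ‖z - pole a i‖ < r
    · obtain ⟨i, hi⟩ := h1
      left
      filter_upwards [hov, (hcont i).continuousAt.eventually_lt continuousAt_const hi] with w h2 h3
      exact hu1 w h2 ⟨i, h3.le⟩
    · push Not at h1
      by_cases h2 : z ∈ resolventSet A
      · right
        refine AnalyticAt.smul (f := f) ?_ (analyticAt_res h2)
        have : f = fun z => ∑ i, c i * (pole a i - z)⁻¹ := funext hfc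
        rw [this]
        refine Finset.analyticAt_fun_sum _ fun i _ => ?_
        have h3 : pole a i - z ≠ 0 := fun h => by
          have := h1 i
          rw [← norm_neg, neg_sub, h, norm_zero] at this
          linarith
        have h4 : AnalyticAt ℂ (fun z => pole a i - z) z := analyticAt_const.sub analyticAt_id
        exact analyticAt_const.mul (h4.inv h3)
      · left
        have h3 : ∀ i, r + r < ‖z - pole a i‖ := fun i => by
          by_contra hc
          exact h2 (hnear i z (not_lt.1 hc)).1
        filter_upwards [hχ.one z hz h2, eventually_all.2 fun i =>
          continuousAt_const.eventually_lt (hcont i).continuousAt (h3 i)] with w h4 h5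
        rw [hu]; simp only
        rw [h4, hβ1 w fun i => (h5 i).le]; simp
  have hb : ∃ C, ∀ z, OffVertices a z → ‖u z‖ * ‖f z • res A z‖ ≤ C * ((1 + ‖z‖) ^ 2)⁻¹ := by
    obtain ⟨C, hC0, hC⟩ := hfb r hr0
    obtain ⟨D, hD0, hD⟩ := hχ.res_le
    have hu5 : ∀ z, OffVertices a z → ‖u z‖ ≤ 5 := by
      intro z hz
      have h1 := hχ.mem z hz
      have h2 : ∀ i, ‖1 - β i z‖ ≤ 1 := fun i => by
        have := radCut_mem (pole a i) r r z
        rw [hβ, norm_eq_abs, abs_le]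
        constructor <;> simp only <;> linarith [this.1, this.2]
      have h3 : ‖∑ i, (1 - β i z)‖ ≤ 3 := by
        refine (norm_sum_le _ _).trans ((sum_le_sum fun i _ => h2 i).trans ?_)
        simp
      have h4 : ‖1 - χ z‖ ≤ 1 := by
        rw [norm_eq_abs, abs_le]
        constructor <;> linarith [h1.1, h1.2]
      rw [hu]
      refine (norm_sub_le _ _).trans ?_
      linarith
    refine ⟨5 * (C * D), fun z hz => ?_⟩
    by_cases h0 : u z = 0
    · rw [h0, norm_zero, zero_mul]; positivity
    have h1 : ∀ i, r ≤ ‖z - pole a i‖ := fun i => by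
      by_contra hc
      exact h0 (hu1 z hz ⟨i, (not_le.1 hc).le⟩)
    have h2 : χ z ≠ 1 := fun h => by
      have hzr : z ∈ region A a p := by
        by_contra hc
        have := (hχ.zero z hz hc).eq_of_nhds
        rw [h] at this
        exact one_ne_zero this
      apply h0
      rw [hu]; simp only
      rw [h, hβ1 z fun i => ?_]
      · simp
      · by_contra hc
        exact (hnear i z (not_le.1 hc).le).2.1 hzr
    have hv := vdist_nonneg a z
    calc _ ≤ 5 * ((C * (vdist a z * ((1 + ‖z‖) ^ 2)⁻¹)) * ‖res A z‖) := by
          rw [norm_smul]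
          gcongr
          exacts [hu5 z hz, hC z h1]
      _ = 5 * (C * (‖res A z‖ * vdist a z)) * ((1 + ‖z‖) ^ 2)⁻¹ := by ring
      _ ≤ 5 * (C * D) * ((1 + ‖z‖) ^ 2)⁻¹ := by
        gcongr
        exact hD z hz h2
  have hres : ∀ i, Integrable (fun z => db (β i) z • (f z • res A z)) ∧
      ∫ z, db (β i) z • (f z • res A z) = -((2 * π * c i : ℂ) • res A (pole a i)) := fun i => by
    rw [hβ]
    exact integral_db_radCut_smul_res hfc hr0 hr1 fun z hz => (hnear i z hz).1
  obtain ⟨C, hC⟩ := hb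
  have hdu : ∀ z, OffVertices a z → db u z = -db χ z + ∑ i, db (β i) z := by
    intro z hz
    have d1 : DifferentiableAt ℝ χ z := (hχ.smooth z hz).differentiableAt one_ne_zero
    have d2 : ∀ i, DifferentiableAt ℝ (β i) z := fun i => (hβc i).differentiable one_ne_zero z
    rw [hu, db_sub (u := fun z => 1 - χ z) (v := fun z => ∑ i, (1 - β i z)) (d1.const_sub 1)
      (DifferentiableAt.fun_sum fun i _ => (d2 i).const_sub 1), db_const_sub,
      db_sum fun i _ => (d2 i).const_sub 1]
    simp only [db_const_sub, Finset.sum_neg_distrib, sub_neg_eq_add]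
  have iχ := hf.integrable ho hχ
  have hae : (fun z => db u z • (f z • res A z)) =ᵐ[volume]
      fun z => -(db χ z • (f z • res A z)) + ∑ i, db (β i) z • (f z • res A z) := by
    filter_upwards [ae_offVertices a] with z hz
    rw [hdu z hz, add_smul, neg_smul, Finset.sum_smul]
  obtain ⟨itot, hint⟩ := integral_neg_add_sum iχ fun i => (hres i).1
  have h0 := integral_db_smul_eq_zero (a := a) (u := u) (k := fun z => f z • res A z) (C := C)
    (fun z hz => by
      rw [hu]
      exact ((contDiffAt_const.sub (hχ.smooth z (offVertices_iff.2 hz)))).sub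
        (ContDiffAt.sum fun i _ => contDiffAt_const.sub (hβc i).contDiffAt))
    (fun z hz => hk z (offVertices_iff.2 hz)) (fun z hz => hC z (offVertices_iff.2 hz))
    ((integrable_congr hae).2 itot)
  rw [integral_congr_ae hae, hint, neg_add_eq_zero] at h0
  rw [areaOp, h0, Finset.smul_sum]
  refine sum_congr rfl fun i _ => ?_
  have hpi : (π : ℂ) ≠ 0 := by exact_mod_cast Real.pi_ne_zero
  rw [(hres i).2, neg_smul, smul_neg, neg_neg, smul_smul]
  congr 1
  push_cast
  field_simp

end Residues

section Rational

open Polynomial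

lemma Setup.mem_resolventSet_of_lt (hS : Setup A ω a) (s : ℤˣ) {b : ℝ} (hb : a < b) :
    (((s : ℤ) : ℂ) * b) ∈ resolventSet A := by
  have h1 : loc a s (((s : ℤ) : ℂ) * b) = ((b - a : ℝ) : ℂ) := by
    rw [loc, ← mul_assoc, unit_sq, one_mul]; push_cast; rfl
  refine hS.mem_resolventSet (s := s) ?_ ?_ <;> rw [h1]
  · exact_mod_cast (sub_pos.2 hb).ne'
  · rw [arg_ofReal_of_nonneg (sub_pos.2 hb).le, abs_zero]
    exact hS.hω.1

lemma Setup.le_norm_sub (hS : Setup A ω a) (hp : Admissible A ω a p) (s : ℤˣ) {b : ℝ}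
    (hb : a < b) (hz : z ∈ region A a p) : sin p.φ * (b - a) ≤ ‖z - ((s : ℤ) : ℂ) * b‖ := by
  have h1 := (sin_mul_le_norm_loc_sub hp.1.1 (hS.lt_pi_div_two hp) hz.1 s (sub_pos.2 hb).le).1
  have h2 : loc a s z - ((b - a : ℝ) : ℂ) = ((s : ℤ) : ℂ) * (z - ((s : ℤ) : ℂ) * b) := by
    rw [mul_sub, ← mul_assoc, unit_sq, one_mul, loc]; push_cast; ring
  rwa [h2, norm_mul, norm_unit, one_mul] at h1

lemma Setup.sin_pos (hS : Setup A ω a) (hp : Admissible A ω a p) : 0 < sin p.φ :=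
  sin_pos_of_pos_of_lt_pi hp.1.1 (by linarith [hS.lt_pi_div_two hp, pi_pos])

lemma pole_eq (a : ℝ) (i : Fin 3) :
    pole a i = (((1 : ℤˣ) : ℤ) : ℂ) * ((a + 1 + (i : ℕ) : ℝ) : ℂ) := by
  simp [pole]

lemma Setup.pole_mem (hS : Setup A ω a) (i : Fin 3) : pole a i ∈ resolventSet A := by
  rw [pole_eq]
  exact hS.mem_resolventSet_of_lt 1 (by linarith [Nat.cast_nonneg (α := ℝ) (i : ℕ)])

lemma Setup.sin_le_norm_sub_pole (hS : Setup A ω a) (hp : Admissible A ω a p) (i : Fin 3)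
    (hz : z ∈ region A a p) : sin p.φ ≤ ‖z - pole a i‖ := by
  have h1 := hS.le_norm_sub hp 1 (b := a + 1 + (i : ℕ)) (by linarith) hz
  rw [← pole_eq] at h1
  have := hS.sin_pos hp
  nlinarith

lemma Setup.pole_sub_ne_zero (hS : Setup A ω a) (hp : Admissible A ω a p) (i : Fin 3)
    (hz : z ∈ region A a p) : pole a i - z ≠ 0 := fun h => by
  have h1 := hS.sin_le_norm_sub_pole hp i hz
  rw [← norm_neg, neg_sub, h, norm_zero] at h1
  exact absurd (hS.sin_pos hp) (not_lt.2 h1)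

lemma one_add_norm_le {b z : ℂ} {r : ℝ} (hr0 : 0 < r) (hr : r ≤ ‖z - b‖) :
    1 + ‖z‖ ≤ ((1 + ‖b‖) / r + 1) * ‖z - b‖ := by
  have h1 : ‖z‖ ≤ ‖z - b‖ + ‖b‖ := by simpa using norm_add_le (z - b) b
  have h2 : 1 + ‖b‖ ≤ (1 + ‖b‖) / r * ‖z - b‖ := by
    rw [div_mul_eq_mul_div, le_div_iff₀ hr0]
    gcongr
  linarith

lemma norm_inv_sub_le {b z : ℂ} {r : ℝ} (hr0 : 0 < r) (hr : r ≤ ‖z - b‖) :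
    ‖(b - z)⁻¹‖ ≤ ((1 + ‖b‖) / r + 1) * (1 + ‖z‖)⁻¹ := by
  have h1 := one_add_norm_le hr0 hr
  rw [norm_inv, norm_sub_rev, ← div_eq_mul_inv, le_div_iff₀ (by positivity),
    inv_mul_le_iff₀ (by linarith), mul_comm]
  exact h1

/-- The coordinate in which the rational functions of the calculus are polynomials. -/
noncomputable def cay (a : ℝ) (z : ℂ) : ℂ := (pole a 0 - z)⁻¹

/-- The polynomial that represents `(b - z) * cay a z`. -/
noncomputable def kap (a : ℝ) (b : ℂ) : ℂ[X] := 1 + C (b - pole a 0) * Polynomial.X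

lemma eval_kap {b z : ℂ} (hz : pole a 0 - z ≠ 0) :
    (kap a b).eval (cay a z) = (b - z) * cay a z := by
  simp only [kap, cay, eval_add, eval_one, eval_mul, eval_C, eval_X]
  field_simp
  ring

lemma res_mul_kap {b : ℂ} (h0 : pole a 0 ∈ resolventSet A) (hb : b ∈ resolventSet A) :
    res A b * aeval (res A (pole a 0)) (kap a b) = res A (pole a 0) := by
  have h := res_sub_res h0 hb
  rw [kap, map_add, map_mul, aeval_C, aeval_X, map_one, Algebra.algebraMap_eq_smul_one,
    smul_mul_assoc, one_mul, mul_add, mul_one, mul_smul_comm, res_mul_comm A b, ← h]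
  abel

lemma injective_aeval_kap {b : ℂ} (h0 : pole a 0 ∈ resolventSet A) (hb : b ∈ resolventSet A) :
    Function.Injective (aeval (res A (pole a 0)) (kap a b)) := fun x y hxy => by
  have h := res_mul_kap h0 hb
  apply res_injective h0
  rw [← h, ContinuousLinearMap.mul_apply, ContinuousLinearMap.mul_apply, hxy]

lemma differentiableOn_cay (hS : Setup A ω a) (hp : Admissible A ω a p) :
    DifferentiableOn ℂ (cay a) (region A a p) :=
  DifferentiableOn.inv (by fun_prop) fun _ hz => hS.pole_sub_ne_zero hp 0 hz

lemma norm_cay_le (hS : Setup A ω a) (hp : Admissible A ω a p)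
    (hz : z ∈ region A a p) : ‖cay a z‖ ≤ (sin p.φ)⁻¹ := by
  rw [cay, norm_inv, norm_sub_rev]
  exact inv_anti₀ (hS.sin_pos hp) (hS.sin_le_norm_sub_pole hp 0 hz)

lemma differentiableOn_eval_cay (hS : Setup A ω a) (hp : Admissible A ω a p) (P : ℂ[X]) :
    DifferentiableOn ℂ (fun z => P.eval (cay a z)) (region A a p) :=
  P.differentiable.comp_differentiableOn (differentiableOn_cay hS hp)

lemma exists_norm_eval_cay_le (hS : Setup A ω a) (hp : Admissible A ω a p) (P : ℂ[X]) :
    ∃ K, ∀ z ∈ region A a p, ‖P.eval (cay a z)‖ ≤ K := by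
  obtain ⟨K, hK⟩ := (isCompact_closedBall (0 : ℂ) (sin p.φ)⁻¹).exists_bound_of_continuousOn
    P.continuous.continuousOn
  exact ⟨K, fun z hz => hK _ (by rw [mem_closedBall_zero_iff]; exact norm_cay_le hS hp hz)⟩

lemma Elem.congr (h : Pair A ω a p q) {g : ℂ → ℂ} (hf : Elem A a p q f)
    (hfg : EqOn g f (region A a p)) : Elem A a p q g := by
  obtain ⟨C, hC⟩ := hf.bdd
  refine ⟨hf.holo.congr hfg, ⟨C, fun z hz => by rw [hfg hz]; exact hC z hz⟩, fun s τ => ?_⟩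
  refine (hf.int s τ).congr_fun (fun t ht => ?_) (measurableSet_ray _ (isOpen_cutoffs A a q) q.φ s τ)
  simp only
  rw [hfg (h.contour_subset (.inl ⟨s, τ, t, ht.1, rfl, ht.2⟩))]

lemma Pair.cauchyOp_congr (h : Pair A ω a p q) {g : ℂ → ℂ} (hfg : EqOn f g (region A a p)) :
    cauchyOp A a q f = cauchyOp A a q g := by
  rw [cauchyOp, cauchyOp, contourIntegral_congr h.inner.1.1 (h.setup.lt_pi_div_two h.inner)]
  intro z hz
  rw [hfg (h.contour_subset hz)]

lemma Psi.elem [CompleteSpace X] (h : Pair A ω a p q) (hf : Psi A a p 2 f) : Elem A a p q f := by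
  obtain ⟨C, hC0, hC⟩ := hf.bound
  have hb : ∀ z ∈ region A a p, ‖f z‖ ≤ C * (1 + a) := fun z hz => by
    have h1 := vdist_le h.setup.ha z
    have h3 := vdist_nonneg a z
    have h4 := h.setup.ha
    refine (hC z hz).trans ?_
    calc _ ≤ C * (((1 + a) * (1 + ‖z‖)) * ((1 + ‖z‖) ^ 2)⁻¹) := by gcongr
      _ = C * (1 + a) * (1 + ‖z‖)⁻¹ := by field_simp
      _ ≤ C * (1 + a) * 1 := by
          gcongr
          exact inv_le_one_of_one_le₀ (by linarith [norm_nonneg z])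
      _ = _ := mul_one _
  refine ⟨hf.holo, ⟨_, hb⟩, fun s τ => ?_⟩
  have hi : IntegrableOn (fun t : ℝ => C * (1 + a) ^ 2 * ((1 + t) ^ 2)⁻¹) (raySet A a q s τ) :=
    IntegrableOn.mono_set (Integrable.const_mul integrableOn_inv_one_add_sq _) fun t ht => ht.1
  refine h.integrableOn_ray hf.holo.continuousOn s τ hi ?_
  filter_upwards [h.ae_ray s τ] with t ⟨ht, hz, hv⟩
  have h2 := inv_sq_ray_le h.setup.ha q.φ s τ ht
  rw [div_le_iff₀ hv]
  calc _ ≤ C * (vdist a (ray a q.φ s τ t) * ((1 + a) ^ 2 * ((1 + t) ^ 2)⁻¹)) :=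
        (hC _ hz).trans (by gcongr)
    _ = _ := by ring

variable [CompleteSpace X] [Nontrivial X]

lemma Pair.res_pole_mul (h : Pair A ω a p q) (hf : Elem A a p q f) :
    cauchyOp A a q f * res A (pole a 0) = (cauchyOp A a q fun z => f z * cay a z) ∧
      Commute (res A (pole a 0)) (cauchyOp A a q f) :=
  h.cauchyOp_mul_res hf (h.setup.pole_mem 0) (h.setup.sin_pos h.outer)
    fun _ hz => h.setup.sin_le_norm_sub_pole h.outer 0 hz

lemma Pair.elem_mul_eval (h : Pair A ω a p q) (hf : Elem A a p q f) (P : ℂ[X]) :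
    Elem A a p q fun z => f z * P.eval (cay a z) := by
  simp_rw [mul_comm (f _)]
  exact hf.mul_bounded h (differentiableOn_eval_cay h.setup h.outer P)
    (exists_norm_eval_cay_le h.setup h.outer P)

lemma Pair.cauchyOp_mul_eval (h : Pair A ω a p q) (hf : Elem A a p q f) (P : ℂ[X]) :
    (cauchyOp A a q fun z => f z * P.eval (cay a z)) =
      cauchyOp A a q f * aeval (res A (pole a 0)) P := by
  induction P using Polynomial.induction_on with
  | C c =>
    simp_rw [eval_C, aeval_C, Algebra.algebraMap_eq_smul_one, mul_smul_comm, mul_one,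
      mul_comm (f _) c]
    exact h.cauchyOp_smul hf c
  | add P Q hP hQ =>
    simp_rw [eval_add, mul_add, map_add, mul_add, ← hP, ← hQ]
    exact h.cauchyOp_add (h.elem_mul_eval hf P) (h.elem_mul_eval hf Q)
  | monomial n c hn =>
    have h1 := (h.res_pole_mul (h.elem_mul_eval hf (C c * Polynomial.X ^ n))).1
    rw [hn] at h1
    rw [pow_succ, ← mul_assoc, map_mul, aeval_X, ← mul_assoc, h1]
    simp only [eval_mul, eval_X, mul_assoc]

lemma Pair.commute_aeval (h : Pair A ω a p q) (hf : Elem A a p q f) (P : ℂ[X]) :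
    Commute (aeval (res A (pole a 0)) P) (cauchyOp A a q f) := by
  have h0 := (h.res_pole_mul hf).2
  induction P using Polynomial.induction_on with
  | C c => rw [aeval_C]; exact Algebra.commutes _ _
  | add P Q hP hQ => rw [map_add]; exact hP.add_left hQ
  | monomial n c hn => rw [pow_succ, ← mul_assoc, map_mul, aeval_X]; exact hn.mul_left h0

lemma norm_loc_mul_le (ha : 0 ≤ a) (z : ℂ) :
    ‖((a : ℂ) - z) * (-(a : ℂ) - z)‖ ≤ vdist a z * ((1 + a) * (1 + ‖z‖)) := by
  obtain ⟨s, hs⟩ := exists_vdist_eq a z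
  have h1 := norm_loc_mul_norm_loc a s z
  have h2 : ((a : ℂ) - z) * (-(a : ℂ) - z) = z ^ 2 - a ^ 2 := by ring
  have h3 := norm_loc_le ha (-s) z
  rw [h2, ← h1, ← hs]
  refine mul_le_mul_of_nonneg_left (h3.trans ?_) (vdist_nonneg a z)
  nlinarith [norm_nonneg z]

end Rational

section Base

open Polynomial

lemma Pair.cauchyOp_eval_of_psi [CompleteSpace X] [Nontrivial X] (h : Pair A ω a p q)
    {c : Fin 3 → ℂ} (hfb : ∀ r > 0, ∃ C, 0 ≤ C ∧ ∀ z, (∀ i, r ≤ ‖z - pole a i‖) →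
      ‖∑ i, c i * (pole a i - z)⁻¹‖ ≤ C * (vdist a z * ((1 + ‖z‖) ^ 2)⁻¹)) {P : ℂ[X]}
    (hP : P = Polynomial.X * (C (c 0) * (kap a (pole a 1) * kap a (pole a 2)) +
      C (c 1) * kap a (pole a 2) + C (c 2) * kap a (pole a 1))) :
    Elem A a p q (fun z => P.eval (cay a z)) ∧
      (cauchyOp A a q fun z => P.eval (cay a z)) = aeval (res A (pole a 0)) P := by
  have hne := fun i z (hz : z ∈ region A a p) => h.setup.pole_sub_ne_zero h.outer i hz
  have hψ : Psi A a p 2 fun z => ∑ i, c i * (pole a i - z)⁻¹ := by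
    refine ⟨DifferentiableOn.fun_sum fun i _ => DifferentiableOn.const_mul
      (DifferentiableOn.inv (by fun_prop) (hne i)) _, ?_⟩
    obtain ⟨C, hC0, hC⟩ := hfb _ (h.setup.sin_pos h.outer)
    exact ⟨C, hC0, fun z hz => hC z fun i => h.setup.sin_le_norm_sub_pole h.outer i hz⟩
  have hel := hψ.elem h
  obtain ⟨χ, -, h1, -, -⟩ := h.exists_cutoffs
  have e1 := hψ.areaOp_eq_sum_res h.setup h.outer h1 (fun _ => rfl) hfb
  rw [← hψ.cauchyOp_eq h.setup h.outer h.inner h.below h1] at e1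
  have hk := fun i => res_mul_kap (A := A) (h.setup.pole_mem 0) (h.setup.pole_mem i)
  have hcongr : EqOn (fun z => P.eval (cay a z)) (fun z => (∑ i, c i * (pole a i - z)⁻¹) *
      (kap a (pole a 1) * kap a (pole a 2)).eval (cay a z)) (region A a p) := by
    intro z hz
    have n0 := hne 0 z hz
    have n1 := hne 1 z hz
    have n2 := hne 2 z hz
    simp only [hP, eval_mul, eval_X, eval_add, eval_C, eval_kap n0, Fin.sum_univ_three]
    rw [cay]
    field_simp
  refine ⟨(h.elem_mul_eval hel _).congr h hcongr, ?_⟩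
  rw [h.cauchyOp_congr hcongr, h.cauchyOp_mul_eval hel, e1, Fin.sum_univ_three, hP]
  have hcomm := (Commute.all (kap a (pole a 1)) (kap a (pole a 2))).map (aeval (res A (pole a 0)))
  simp only [map_mul, map_add, aeval_X, aeval_C, Algebra.algebraMap_eq_smul_one, add_mul, mul_add,
    smul_mul_assoc, mul_smul_comm, one_mul]
  congr 2
  · rw [← mul_assoc (res A (pole a 1)), hk 1]
  · rw [hcomm.eq, ← mul_assoc (res A (pole a 2)), hk 2]

/-- The values of the coordinate `cay a` on the Riemann sphere. -/
noncomputable def val (a : ℝ) (d : OnePoint ℂ) : ℂ := d.elim 0 (cay a)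

open Classical in
/-- The points `a`, `-a`, `∞`. -/
noncomputable def pts (a : ℝ) : Finset (OnePoint ℂ) :=
  {((-a : ℂ) : OnePoint ℂ), ((a : ℂ) : OnePoint ℂ), infty}

lemma mem_pts : d ∈ pts a ↔
    d = ((-a : ℂ) : OnePoint ℂ) ∨ d = ((a : ℂ) : OnePoint ℂ) ∨ d = infty := by
  simp [pts]

lemma pole_sub_ne_zero_of_pts (ha : 0 ≤ a) {d : ℂ} (hd : (d : OnePoint ℂ) ∈ pts a) :
    pole a 0 - d ≠ 0 := by
  have h : ∀ x : ℝ, x ≤ a → pole a 0 - (x : ℂ) ≠ 0 := fun x hx => by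
    rw [pole, ← Complex.ofReal_sub, Complex.ofReal_ne_zero]
    simp only [Fin.val_zero, Nat.cast_zero, add_zero]
    linarith
  rcases mem_pts.1 hd with h1 | h1 | h1
  · rw [coe_eq_coe] at h1
    rw [h1, ← Complex.ofReal_neg]
    exact h _ (by linarith)
  · rw [coe_eq_coe] at h1
    rw [h1]
    exact h _ le_rfl
  · exact absurd h1 (coe_ne_infty d)

lemma injOn_val (ha : 0 ≤ a) : InjOn (val a) (pts a) := by
  intro x hx y hy hxy
  induction x using OnePoint.rec with
  | infty =>
    induction y using OnePoint.rec with
    | infty => rfl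
    | coe y => exact absurd hxy.symm (inv_ne_zero (pole_sub_ne_zero_of_pts ha hy))
  | coe x =>
    induction y using OnePoint.rec with
    | infty => exact absurd hxy (inv_ne_zero (pole_sub_ne_zero_of_pts ha hx))
    | coe y =>
      have h1 : (pole a 0 - x)⁻¹ = (pole a 0 - y)⁻¹ := hxy
      rw [inv_inj] at h1
      rw [sub_right_injective h1]

open Classical in
lemma prod_pts {M : Type*} [CommMonoid M] (F : OnePoint ℂ → M) : ∏ d ∈ pts a, F d =
    if a = 0 then F ((a : ℂ) : OnePoint ℂ) * F infty
    else F ((-a : ℂ) : OnePoint ℂ) * (F ((a : ℂ) : OnePoint ℂ) * F infty) := by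
  have h1 : ((a : ℂ) : OnePoint ℂ) ∉ ({infty} : Finset (OnePoint ℂ)) := by simp
  rw [pts]
  split_ifs with h0
  · have : ((-a : ℂ) : OnePoint ℂ) = ((a : ℂ) : OnePoint ℂ) := by rw [h0]; simp
    rw [this, Finset.insert_eq_of_mem (by simp), Finset.prod_insert h1, Finset.prod_singleton]
  · have h2 : ((-a : ℂ) : OnePoint ℂ) ∉
        ({((a : ℂ) : OnePoint ℂ), infty} : Finset (OnePoint ℂ)) := by
      simp only [Finset.mem_insert, coe_eq_coe, Finset.mem_singleton, coe_ne_infty,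
        or_false]
      exact_mod_cast (show -a ≠ a from fun h => h0 (by linarith))
    rw [Finset.prod_insert h2, Finset.prod_insert h1, Finset.prod_singleton]

lemma pole_sub_pole (i : Fin 3) : pole a i - pole a 0 = ((i : ℕ) : ℂ) := by
  simp only [pole]; push_cast; simp

lemma Pair.exists_cauchyOp_eval [CompleteSpace X] [Nontrivial X] (h : Pair A ω a p q) :
    ∃ σ : ℂ[X], Function.Injective (aeval (res A (pole a 0)) σ) ∧
      Elem A a p q (fun z => (nodal (pts a) (val a) * σ).eval (cay a z)) ∧
      (cauchyOp A a q fun z => (nodal (pts a) (val a) * σ).eval (cay a z)) =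
        aeval (res A (pole a 0)) (nodal (pts a) (val a) * σ) := by
  have ha := h.setup.ha
  have k1 : kap a (pole a 1) = 1 + Polynomial.X := by rw [kap, pole_sub_pole]; simp
  have k2 : kap a (pole a 2) = 1 + C 2 * Polynomial.X := by rw [kap, pole_sub_pole]; simp
  have va : val a ((a : ℂ) : OnePoint ℂ) = 1 := by simp [val, cay, pole]
  have vi : val a infty = 0 := rfl
  rw [nodal, prod_pts]
  by_cases h0 : a = 0
  · subst h0
    refine ⟨-kap 0 (pole 0 2), ?_, h.cauchyOp_eval_of_psi (c := ![-1, 2, 0]) ?_ ?_⟩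
    · rw [map_neg]
      intro x y hxy
      exact injective_aeval_kap (h.setup.pole_mem 0) (h.setup.pole_mem 2) (neg_injective hxy)
    · intro r hr
      refine ⟨((1 + ‖pole 0 0‖) / r + 1) * ((1 + ‖pole 0 1‖) / r + 1), by positivity, fun z hz => ?_⟩
      have n := fun i => norm_pos_iff.1 (norm_sub_rev z _ ▸ hr.trans_le (hz i))
      have n0 := n 0
      have n1 := n 1
      have e : ∑ i, (![-1, 2, 0] : Fin 3 → ℂ) i * (pole 0 i - z)⁻¹ =
          -z * ((pole 0 0 - z)⁻¹ * (pole 0 1 - z)⁻¹) := by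
        simp [Fin.sum_univ_three]
        field_simp
        simp [pole]
        ring
      rw [e, norm_mul, norm_mul, norm_neg]
      have hv : vdist 0 z = ‖z‖ := by simp [vdist]
      rw [hv]
      calc _ ≤ ‖z‖ * ((((1 + ‖pole 0 0‖) / r + 1) * (1 + ‖z‖)⁻¹) *
            (((1 + ‖pole 0 1‖) / r + 1) * (1 + ‖z‖)⁻¹)) := by
            gcongr <;> exact norm_inv_sub_le hr (hz _)
        _ = _ := by rw [← inv_pow]; ring
    · rw [if_pos rfl, va, vi, k1, k2]
      refine Polynomial.funext fun x => ?_
      simp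
      ring
  · have hc : ((2 * a + 1 : ℝ) : ℂ) ≠ 0 := by exact_mod_cast (by positivity : (2 * a + 1 : ℝ) ≠ 0)
    have vb : val a ((-a : ℂ) : OnePoint ℂ) = ((2 * a + 1 : ℝ) : ℂ)⁻¹ := by
      rw [val, elim_some, cay, pole]
      push_cast
      congr 1
      simp
      ring
    refine ⟨C ((2 * a + 1 : ℝ) : ℂ), ?_, h.cauchyOp_eval_of_psi
      (c := ![((2 * a + 1) / 2 : ℝ), (-4 * (a + 1) : ℝ), (3 * (2 * a + 3) / 2 : ℝ)]) ?_ ?_⟩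
    · rw [aeval_C, Algebra.algebraMap_eq_smul_one]
      intro x y hxy
      exact smul_right_injective X hc (by simpa using hxy)
    · intro r hr
      refine ⟨((1 + ‖pole a 0‖) / r + 1) * ((1 + ‖pole a 1‖) / r + 1) *
        ((1 + ‖pole a 2‖) / r + 1) * (1 + a), by positivity, fun z hz => ?_⟩
      have n := fun i => norm_pos_iff.1 (norm_sub_rev z _ ▸ hr.trans_le (hz i))
      have n0 := n 0
      have n1 := n 1
      have n2 := n 2
      have e : ∑ i, (![((2 * a + 1) / 2 : ℝ), (-4 * (a + 1) : ℝ), (3 * (2 * a + 3) / 2 : ℝ)] :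
          Fin 3 → ℂ) i * (pole a i - z)⁻¹ = ((a : ℂ) - z) * (-(a : ℂ) - z) *
            ((pole a 0 - z)⁻¹ * (pole a 1 - z)⁻¹ * (pole a 2 - z)⁻¹) := by
        simp only [Fin.sum_univ_three, Matrix.cons_val]
        field_simp
        simp [pole]
        ring
      rw [e, norm_mul, norm_mul (_ * _) (pole a 2 - z)⁻¹, norm_mul (pole a 0 - z)⁻¹]
      have hv := vdist_nonneg a z
      have hz0 : 1 + ‖z‖ ≠ 0 := by positivity
      calc _ ≤ vdist a z * ((1 + a) * (1 + ‖z‖)) * ((((1 + ‖pole a 0‖) / r + 1) * (1 + ‖z‖)⁻¹) *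
            (((1 + ‖pole a 1‖) / r + 1) * (1 + ‖z‖)⁻¹) *
            (((1 + ‖pole a 2‖) / r + 1) * (1 + ‖z‖)⁻¹)) := by
            gcongr
            exacts [norm_loc_mul_le ha z, norm_inv_sub_le hr (hz _), norm_inv_sub_le hr (hz _),
              norm_inv_sub_le hr (hz _)]
        _ = _ := by field_simp
    · rw [if_neg h0, va, vb, vi, k1, k2]
      have e1 : (Polynomial.X - C ((2 * a + 1 : ℝ) : ℂ)⁻¹) * C ((2 * a + 1 : ℝ) : ℂ) =
          C ((2 * a + 1 : ℝ) : ℂ) * Polynomial.X - 1 := by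
        rw [sub_mul, ← C_mul, inv_mul_cancel₀ hc, C_1, mul_comm]
      rw [mul_right_comm, e1]
      refine Polynomial.funext fun x => ?_
      simp
      ring

end Base

open Classical in
/-- The points of `M_A` as a finite set. -/
noncomputable def sing (A : X →ₗ.[ℂ] X) (a : ℝ) : Finset (OnePoint ℂ) :=
  (pts a).filter (· ∈ singPts A a)

lemma singPts_subset_pts (h : d ∈ singPts A a) : d ∈ pts a := mem_pts.2 h.1

lemma mem_sing : d ∈ sing A a ↔ d ∈ singPts A a := by
  simp only [sing, Finset.mem_filter, and_iff_right_iff_imp]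
  exact singPts_subset_pts

lemma towards_coe (d : ℂ) (Ω : Set ℂ) : towards (d : OnePoint ℂ) Ω = 𝓝 d ⊓ 𝓟 Ω := by
  rw [towards, OnePoint.comap_coe_nhds]

lemma towards_infty (Ω : Set ℂ) : towards infty Ω = cocompact ℂ ⊓ 𝓟 Ω := by
  rw [towards, OnePoint.comap_coe_nhds_infty, coclosedCompact_eq_cocompact]

lemma towards_mono {Ω Ω' : Set ℂ} (h : Ω ⊆ Ω') : towards d Ω ≤ towards d Ω' :=
  inf_le_inf_left _ (principal_mono.2 h)

lemma eventually_mem_towards (d : OnePoint ℂ) (Ω : Set ℂ) : ∀ᶠ z in towards d Ω, z ∈ Ω :=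
  mem_inf_of_right (mem_principal_self Ω)

lemma tendsto_cay (ha : 0 ≤ a) (hd : d ∈ pts a) (Ω : Set ℂ) :
    Tendsto (cay a) (towards d Ω) (𝓝 (val a d)) := by
  induction d using OnePoint.rec with
  | infty =>
    rw [towards_infty]
    refine Tendsto.mono_left ?_ inf_le_left
    refine tendsto_inv₀_cobounded.comp ?_
    rw [← cobounded_eq_cocompact]
    exact tendsto_const_sub_cobounded _
  | coe d =>
    rw [towards_coe]
    refine Tendsto.mono_left ?_ inf_le_left
    have h : ContinuousAt (cay a) d :=
      ContinuousAt.inv₀ (f := fun z => pole a 0 - z) (by fun_prop) (pole_sub_ne_zero_of_pts ha hd)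
    exact h

lemma neBot_towards (hS : Setup A ω a) (hp : Admissible A ω a p)
    (hd : d ∈ singPts A a) : (towards d (region A a p)).NeBot := by
  obtain ⟨θ, h1, h2⟩ := exists_between (hS.lt_pi_div_two hp)
  have hb : ∀ (s τ : ℤˣ) {t : ℝ}, 0 < t → ray a θ s τ t ∈ bisector p.φ a := fun s τ t ht =>
    ray_mem_bisector hS.ha hp.1.1 h1 h2 s τ ht
  rcases mem_pts.1 (singPts_subset_pts hd) with h | h | h
  case inr.inr =>
    subst h
    have ht : Tendsto (ray a θ 1 1) atTop (cocompact ℂ) := by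
      rw [← cobounded_eq_cocompact, ← tendsto_norm_atTop_iff_cobounded]
      refine tendsto_atTop_mono' _ (f₁ := fun t : ℝ => t - a) ?_
        (tendsto_atTop_add_const_right _ _ tendsto_id)
      filter_upwards [eventually_ge_atTop 0] with t ht
      have := norm_loc_le hS.ha 1 (ray a θ 1 1 t)
      rw [norm_loc_ray a θ 1 1 ht] at this
      linarith
    have : Tendsto (ray a θ 1 1) atTop (towards infty (region A a p)) := by
      rw [towards_infty, tendsto_inf, tendsto_principal]
      refine ⟨ht, ?_⟩
      have hd2 : ∀ d : ℂ, ∀ᶠ t in atTop, p.ε < ‖ray a θ 1 1 t - d‖ := fun d => by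
        have := (tendsto_sub_const_cobounded d).comp
          (by rw [cobounded_eq_cocompact]; exact ht)
        exact (tendsto_norm_cobounded_atTop.comp this).eventually_gt_atTop p.ε
      filter_upwards [eventually_gt_atTop 0, (removedPts A a).eventually_all.2 fun d _ => hd2 d]
        with t h3 h4
      exact ⟨hb 1 1 h3, mem_offDiscs_iff.2 h4, fun h => absurd hd h⟩
    exact this.neBot
  all_goals
    obtain ⟨s, hs⟩ : ∃ s : ℤˣ, d = (((s : ℤ) : ℂ) * (a : ℂ) : ℂ) := by
      first
        | refine ⟨-1, ?_⟩; rw [h]; simp; done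
        | refine ⟨1, ?_⟩; rw [h]; simp
    subst hs
    have hc : Tendsto (ray a θ s 1) (𝓝[>] 0) (𝓝 (((s : ℤ) : ℂ) * a)) := by
      have : Continuous (ray a θ s 1) := by unfold ray; fun_prop
      have h3 := this.tendsto 0
      rw [ray] at h3
      simp only [ofReal_zero, zero_mul, add_zero] at h3
      exact h3.mono_left nhdsWithin_le_nhds
    have : Tendsto (ray a θ s 1) (𝓝[>] 0) (towards (((s : ℤ) : ℂ) * a : ℂ) (region A a p)) := by
      rw [towards_coe, tendsto_inf, tendsto_principal]
      refine ⟨hc, ?_⟩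
      have hn : ‖((s : ℤ) : ℂ) * a‖ = a := by
        rw [norm_mul, norm_unit, one_mul, norm_real, norm_of_nonneg hS.ha]
      have hoff : ((s : ℤ) : ℂ) * a ∈ offDiscs A a p.ε := by
        rw [mem_offDiscs_iff]
        intro d' hd'
        rw [mem_removedPts] at hd'
        have hne : d' ≠ ((s : ℤ) : ℂ) * a := fun h => hd'.2 (by rw [h]; exact hd)
        have h3 : d' = -(((s : ℤ) : ℂ) * a) := by
          rcases unit_eq_or_eq_neg s 1 with rfl | rfl <;> rcases hd'.1 with h4 | h4 <;>
            first | (rw [h4]; simp; done) | (exfalso; apply hne; rw [h4]; simp)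
        have h0 : 0 < a := lt_of_le_of_ne hS.ha fun h0 => hne (by rw [h3, ← h0]; simp)
        rw [h3, sub_neg_eq_add, ← two_mul, norm_mul, hn, Complex.norm_two]
        linarith [hp.2.1.2.1 h0]
      have hin : ((s : ℤ) : ℂ) * a ∈ inDisc A a p.R := fun _ => by rw [hn]; exact hp.2.2.1
      filter_upwards [self_mem_nhdsWithin, hc.eventually ((isOpen_offDiscs A a p.ε).mem_nhds hoff),
        hc.eventually ((isOpen_inDisc A a p.R).mem_nhds hin)] with t h3 h4 h5
      exact ⟨hb s 1 h3, h4, h5⟩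
    exact this.neBot

section Calculus

open Polynomial

lemma injective_aeval_nodal (hS : Setup A ω a) {s : Finset (OnePoint ℂ)}
    (hs : ∀ d ∈ s, d ∈ pts a ∧ d ∉ singPts A a) :
    Function.Injective (aeval (res A (pole a 0)) (nodal s (val a))) := by
  rw [nodal]
  refine Finset.prod_induction (fun d => Polynomial.X - C (val a d))
    (fun P => Function.Injective (aeval (res A (pole a 0)) P)) (fun P Q hP hQ => ?_) ?_ fun d hd => ?_
  · rw [map_mul]
    exact hP.comp hQ
  · rw [map_one]
    exact Function.injective_id
  · obtain ⟨h1, h2⟩ := hs d hd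
    induction d using OnePoint.rec with
    | infty =>
      simp only [val, elim_infty, map_zero, sub_zero, aeval_X]
      exact res_injective (hS.pole_mem 0)
    | coe d =>
      have hρ : d ∈ resolventSet A := by
        by_contra hc
        exact h2 ⟨mem_pts.1 h1, .inl ⟨d, hc, rfl⟩⟩
      have hk := injective_aeval_kap (hS.pole_mem 0) hρ
      have hne := pole_sub_ne_zero_of_pts hS.ha h1
      have e : kap a d = C (d - pole a 0) * (Polynomial.X - C (val a d)) := by
        rw [mul_sub, ← C_mul, val, elim_some, cay, ← neg_sub (pole a 0), neg_mul,
          mul_inv_cancel₀ hne, kap, ← neg_sub (pole a 0)]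
        simp [add_comm]
      rw [e, map_mul] at hk
      exact Function.Injective.of_comp (f := aeval (res A (pole a 0)) (C (d - pole a 0))) hk

lemma norm_sub_val_le (hS : Setup A ω a) (hp : Admissible A ω a p)
    (hd : d ∈ pts a) : ∃ K, 0 ≤ K ∧ ∀ z ∈ region A a p, (d ∈ singPts A a → ‖cay a z - val a d‖ ≤
      K * (d.elim 1 (fun d => ‖z - d‖) * (1 + ‖z‖)⁻¹)) ∧
      (d ∉ singPts A a → 1 ≤ K * (d.elim 1 (fun d => ‖z - d‖) * (1 + ‖z‖)⁻¹)) := by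
  have hsin := hS.sin_pos hp
  have hcay : ∀ z ∈ region A a p,
      ‖cay a z‖ ≤ ((1 + ‖pole a 0‖) / sin p.φ + 1) * (1 + ‖z‖)⁻¹ := fun z hz =>
    norm_inv_sub_le hsin (hS.sin_le_norm_sub_pole hp 0 hz)
  have hK0 : 0 ≤ (1 + ‖pole a 0‖) / sin p.φ + 1 := by positivity
  induction d using OnePoint.rec with
  | infty =>
    simp only [val, elim_infty, sub_zero, one_mul]
    refine ⟨max ((1 + ‖pole a 0‖) / sin p.φ + 1) (1 + |p.R|), le_max_of_le_left hK0,
      fun z hz => ⟨fun _ => (hcay z hz).trans ?_, fun hi => ?_⟩⟩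
    · gcongr
      exact le_max_left _ _
    · rw [← div_eq_mul_inv, le_div_iff₀ (by positivity), one_mul]
      exact le_max_of_le_right (by linarith [hz.2.2 hi, le_abs_self p.R])
  | coe d =>
    have hne := pole_sub_ne_zero_of_pts hS.ha hd
    simp only [val, elim_some]
    refine ⟨max (‖(pole a 0 - d)⁻¹‖ * ((1 + ‖pole a 0‖) / sin p.φ + 1))
      ((1 + ‖d‖) / p.ε + 1), le_max_of_le_left (by positivity), fun z hz => ⟨fun _ => ?_, fun hs => ?_⟩⟩
    · have e : cay a z - cay a d = (pole a 0 - d)⁻¹ * ((z - d) * cay a z) := by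
        have := hS.pole_sub_ne_zero hp 0 hz
        rw [cay, cay]
        field_simp
        ring
      rw [e, norm_mul, norm_mul]
      calc _ ≤ ‖(pole a 0 - d)⁻¹‖ * (‖z - d‖ *
            (((1 + ‖pole a 0‖) / sin p.φ + 1) * (1 + ‖z‖)⁻¹)) := by
            gcongr; exact hcay z hz
        _ = ‖(pole a 0 - d)⁻¹‖ * ((1 + ‖pole a 0‖) / sin p.φ + 1) *
            (‖z - d‖ * (1 + ‖z‖)⁻¹) := by ring
        _ ≤ _ := by
          gcongr
          exact le_max_left _ _
    · have hd' : d ∈ removedPts A a := by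
        refine mem_removedPts.2 ⟨?_, hs⟩
        rcases mem_pts.1 hd with h | h | h
        · exact .inr (OnePoint.coe_injective h)
        · exact .inl (OnePoint.coe_injective h)
        · exact absurd h (coe_ne_infty d)
      have h1 := one_add_norm_le hp.2.1.1 (mem_offDiscs_iff.1 hz.2.1 d hd').le
      rw [← mul_assoc, ← div_eq_mul_inv, le_div_iff₀ (by positivity), one_mul]
      refine h1.trans ?_
      gcongr
      exact le_max_right _ _

open Classical in
lemma psi_nodal (hS : Setup A ω a) (hp : Admissible A ω a p) :
    Psi A a p 2 fun z => (nodal (sing A a) (val a)).eval (cay a z) := by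
  refine ⟨differentiableOn_eval_cay hS hp _, ?_⟩
  have h1 : ∀ d : OnePoint ℂ, ∃ K, 0 ≤ K ∧ (d ∈ pts a → ∀ z ∈ region A a p,
      ‖if d ∈ singPts A a then cay a z - val a d else 1‖ ≤
        K * (d.elim 1 (fun d => ‖z - d‖) * (1 + ‖z‖)⁻¹)) := fun d => by
    by_cases hd : d ∈ pts a
    · obtain ⟨K, hK0, hK⟩ := norm_sub_val_le hS hp hd
      refine ⟨K, hK0, fun _ z hz => ?_⟩
      split_ifs with h
      · exact (hK z hz).1 h
      · rw [norm_one]; exact (hK z hz).2 h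
    · exact ⟨0, le_rfl, fun h => absurd h hd⟩
  choose K hK0 hK using h1
  refine ⟨(∏ d ∈ pts a, K d) * (1 + a), mul_nonneg (Finset.prod_nonneg fun d _ => hK0 d)
    (by linarith [hS.ha]), fun z hz => ?_⟩
  have hv := vdist_nonneg a z
  have ha := hS.ha
  rw [nodal, eval_prod, sing, Finset.prod_filter, norm_prod]
  calc _ ≤ ∏ d ∈ pts a, (K d * (d.elim 1 (fun d => ‖z - d‖) * (1 + ‖z‖)⁻¹)) := by
        refine Finset.prod_le_prod (fun _ _ => norm_nonneg _) fun d hd => ?_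
        have := hK d hd z hz
        simpa only [eval_sub, eval_X, eval_C] using this
    _ = (∏ d ∈ pts a, K d) * ∏ d ∈ pts a, (d.elim 1 (fun d => ‖z - d‖) * (1 + ‖z‖)⁻¹) :=
      Finset.prod_mul_distrib
    _ ≤ (∏ d ∈ pts a, K d) * ((1 + a) * (vdist a z * ((1 + ‖z‖) ^ 2)⁻¹)) := by
      refine mul_le_mul_of_nonneg_left ?_ (Finset.prod_nonneg fun d _ => hK0 d)
      rw [prod_pts]
      simp only [elim_some, elim_infty, one_mul]
      split_ifs with h0
      · subst h0
        have : vdist 0 z = ‖z‖ := by simp [vdist]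
        rw [this]
        simp
        refine le_of_eq ?_
        rw [← inv_pow]; ring
      · have h2 := norm_loc_mul_le ha z
        rw [norm_mul, norm_sub_rev, norm_sub_rev (-(a : ℂ))] at h2
        calc _ = (‖z - a‖ * ‖z - -(a : ℂ)‖) * ((1 + ‖z‖) ^ 3)⁻¹ := by rw [← inv_pow]; ring
          _ ≤ (vdist a z * ((1 + a) * (1 + ‖z‖))) * ((1 + ‖z‖) ^ 3)⁻¹ := by gcongr
          _ = _ := by field_simp
    _ = _ := by ring

/-- Functions of the class `Elem` that tend to `0` at the points of `M_A`. -/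
structure Elem0 (A : X →ₗ.[ℂ] X) (a : ℝ) (p q : Params) (f : ℂ → ℂ) : Prop extends
    Elem A a p q f where
  lim : ∀ d ∈ singPts A a, Tendsto f (towards d (region A a p)) (𝓝 0)

lemma Elem0.mul_bounded (h : Pair A ω a p q) {g : ℂ → ℂ} (hf : Elem0 A a p q f)
    (hg : DifferentiableOn ℂ g (region A a p)) (hgb : ∃ C : ℝ, ∀ z ∈ region A a p, ‖g z‖ ≤ C) :
    Elem0 A a p q fun z => g z * f z := by
  refine ⟨hf.toElem.mul_bounded h hg hgb, fun d hd => ?_⟩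
  obtain ⟨C, hC⟩ := hgb
  refine isBoundedUnder_le_mul_tendsto_zero (isBoundedUnder_of_eventually_le (a := C) ?_) (hf.lim d hd)
  filter_upwards [eventually_mem_towards d (region A a p)] with z hz using hC z hz

lemma Elem0.add (h : Pair A ω a p q) {g : ℂ → ℂ} (hf : Elem0 A a p q f) (hg : Elem0 A a p q g) :
    Elem0 A a p q fun z => f z + g z :=
  ⟨hf.toElem.add h hg.toElem, fun d hd => by simpa using (hf.lim d hd).add (hg.lim d hd)⟩

variable [CompleteSpace X] [Nontrivial X]

open Classical in
lemma Pair.cauchyOp_nodal (h : Pair A ω a p q) :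
    Elem0 A a p q (fun z => (nodal (sing A a) (val a)).eval (cay a z)) ∧
    (cauchyOp A a q fun z => (nodal (sing A a) (val a)).eval (cay a z)) =
      aeval (res A (pole a 0)) (nodal (sing A a) (val a)) := by
  have hel := (psi_nodal h.setup h.outer).elem h
  refine ⟨⟨hel, fun d hd => ?_⟩, ?_⟩
  · have h1 := ((nodal (sing A a) (val a)).continuous.tendsto _).comp
      (tendsto_cay h.setup.ha (singPts_subset_pts hd) (region A a p))
    rwa [Lagrange.eval_nodal_at_node (mem_sing.2 hd)] at h1
  · obtain ⟨σ, hσ, hΦ, hC⟩ := h.exists_cauchyOp_eval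
    have e : nodal (pts a) (val a) = nodal (sing A a) (val a) *
        nodal ((pts a).filter (· ∉ singPts A a)) (val a) :=
      (Finset.prod_filter_mul_prod_filter_not _ _ _).symm
    obtain ⟨τ, hτ⟩ : ∃ τ, τ = nodal ((pts a).filter (· ∉ singPts A a)) (val a) * σ :=
      ⟨_, rfl⟩
    have hinj : Function.Injective (aeval (res A (pole a 0)) τ) := by
      rw [hτ, map_mul]
      exact (injective_aeval_nodal h.setup fun d hd => Finset.mem_filter.1 hd).comp hσ
    have h2 := h.cauchyOp_mul_eval hel τ
    simp_rw [← eval_mul] at h2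
    rw [e, mul_assoc, ← hτ, h2, map_mul, ← (h.commute_aeval hel τ).eq,
      ((Commute.all (nodal (sing A a) (val a)) τ).map (aeval (res A (pole a 0)))).eq] at hC
    refine ContinuousLinearMap.ext fun x => hinj ?_
    exact DFunLike.congr_fun hC x

end Calculus

section Calc

open Polynomial

variable {f F G : ℂ → ℂ} {T S : X →L[ℂ] X}

/-- The calculus generated by `Elem0` and the polynomials in a fixed resolvent. -/
def Calc (A : X →ₗ.[ℂ] X) (a : ℝ) (p q : Params) (F : ℂ → ℂ) (T : X →L[ℂ] X) : Prop :=
  ∃ (P : ℂ[X]) (f : ℂ → ℂ), Elem0 A a p q f ∧ (∀ z ∈ region A a p, F z = P.eval (cay a z) + f z) ∧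
    T = aeval (res A (pole a 0)) P + cauchyOp A a q f

lemma Calc.congr (hF : Calc A a p q F T) (h : EqOn G F (region A a p)) : Calc A a p q G T := by
  obtain ⟨P, f, hf, hP, hT⟩ := hF
  exact ⟨P, f, hf, fun z hz => (h hz).trans (hP z hz), hT⟩

variable [CompleteSpace X] [Nontrivial X]

lemma Elem0.mul_const (h : Pair A ω a p q) (hf : Elem0 A a p q f) (c : ℂ) :
    Elem0 A a p q fun z => c * f z :=
  hf.mul_bounded h (differentiableOn_const c) ⟨‖c‖, fun _ _ => le_rfl⟩

lemma Pair.elem0_mul_eval (h : Pair A ω a p q) (hf : Elem0 A a p q f) (P : ℂ[X]) :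
    Elem0 A a p q fun z => f z * P.eval (cay a z) := by
  simp_rw [mul_comm (f _)]
  exact hf.mul_bounded h (differentiableOn_eval_cay h.setup h.outer P)
    (exists_norm_eval_cay_le h.setup h.outer P)

lemma Pair.elem0_zero (h : Pair A ω a p q) : Elem0 A a p q fun _ => 0 := by
  have := h.cauchyOp_nodal.1.mul_const h 0
  simpa using this

lemma Pair.cauchyOp_zero (h : Pair A ω a p q) : (cauchyOp A a q fun _ => 0) = 0 := by
  have := h.cauchyOp_smul h.elem0_zero.toElem 0
  simpa using this

lemma Elem0.calc (hf : Elem0 A a p q f) : Calc A a p q f (cauchyOp A a q f) :=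
  ⟨0, f, hf, by simp, by simp⟩

lemma Pair.calc_eval (h : Pair A ω a p q) (P : ℂ[X]) :
    Calc A a p q (fun z => P.eval (cay a z)) (aeval (res A (pole a 0)) P) :=
  ⟨P, _, h.elem0_zero, by simp, by rw [h.cauchyOp_zero, add_zero]⟩

lemma Calc.add (h : Pair A ω a p q) (hF : Calc A a p q F T) (hG : Calc A a p q G S) :
    Calc A a p q (fun z => F z + G z) (T + S) := by
  obtain ⟨P, f, hf, hP, rfl⟩ := hF
  obtain ⟨Q, g, hg, hQ, rfl⟩ := hG
  refine ⟨P + Q, _, hf.add h hg, fun z hz => ?_, ?_⟩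
  · simp only [hP z hz, hQ z hz, eval_add]; ring
  · rw [h.cauchyOp_add hf.toElem hg.toElem, map_add]; abel

lemma Calc.const_mul (h : Pair A ω a p q) (hF : Calc A a p q F T) (c : ℂ) :
    Calc A a p q (fun z => c * F z) (c • T) := by
  obtain ⟨P, f, hf, hP, rfl⟩ := hF
  refine ⟨C c * P, _, hf.mul_const h c, fun z hz => ?_, ?_⟩
  · simp only [hP z hz, eval_mul, eval_C, mul_add]
  · rw [h.cauchyOp_smul hf.toElem, map_mul, aeval_C, Algebra.algebraMap_eq_smul_one,
      smul_mul_assoc, one_mul, smul_add]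

lemma Calc.mul (h : Pair A ω a p q) (hF : Calc A a p q F T) (hG : Calc A a p q G S) :
    Calc A a p q (fun z => F z * G z) (T * S) := by
  obtain ⟨P, f, hf, hP, rfl⟩ := hF
  obtain ⟨Q, g, hg, hQ, rfl⟩ := hG
  have e1 := h.elem0_mul_eval hf Q
  have e2 := h.elem0_mul_eval hg P
  have e3 := hg.mul_bounded h hf.holo hf.bdd
  refine ⟨P * Q, _, (e1.add h e2).add h e3, fun z hz => ?_, ?_⟩
  · simp only [hP z hz, hQ z hz, eval_mul]; ring
  · rw [h.cauchyOp_add (e1.add h e2).toElem e3.toElem, h.cauchyOp_add e1.toElem e2.toElem,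
      h.cauchyOp_mul_eval hf.toElem, h.cauchyOp_mul_eval hg.toElem,
      ← h.cauchyOp_mul hf.toElem hg.toElem, map_mul, ← (h.commute_aeval hg.toElem P).eq]
    noncomm_ring

lemma Calc.sub (h : Pair A ω a p q) (hF : Calc A a p q F T) (hG : Calc A a p q G S) :
    Calc A a p q (fun z => F z - G z) (T - S) := by
  have := hF.add h (hG.const_mul h (-1))
  simpa [sub_eq_add_neg] using this

lemma Calc.eq_zero (h : Pair A ω a p q) (hF : Calc A a p q F T)
    (h0 : ∀ z ∈ region A a p, F z = 0) : T = 0 := by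
  obtain ⟨P, f, hf, hP, rfl⟩ := hF
  have hfe : EqOn f (fun z => -1 * P.eval (cay a z)) (region A a p) := fun z hz => by
    have := hP z hz
    rw [h0 z hz] at this
    simp only
    linear_combination -this
  have hroot : ∀ d ∈ sing A a, P.eval (val a d) = 0 := fun d hd => by
    rw [mem_sing] at hd
    have := neBot_towards h.setup h.outer hd
    have h1 := (P.continuous.tendsto _).comp
      (tendsto_cay h.setup.ha (singPts_subset_pts hd) (region A a p))
    have h2 := h1.add (hf.lim d hd)
    have h3 : Tendsto (fun z => (eval (cay a z) P) + f z) (towards d (region A a p)) (𝓝 0) := by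
      refine tendsto_const_nhds.congr' ?_
      filter_upwards [eventually_mem_towards d (region A a p)] with z hz
      rw [← hP z hz, h0 z hz]
    simpa using tendsto_nhds_unique h2 h3
  have hdvd : nodal (sing A a) (val a) ∣ P := by
    refine Finset.prod_dvd_of_coprime (fun d hd e he hne => ?_)
      fun d hd => dvd_iff_isRoot.2 (hroot d hd)
    refine isCoprime_X_sub_C_of_isUnit_sub (IsUnit.mk0 _ (sub_ne_zero.2 fun hv => hne ?_))
    exact injOn_val h.setup.ha (singPts_subset_pts (mem_sing.1 hd))
      (singPts_subset_pts (mem_sing.1 he)) hv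
  obtain ⟨Q, rfl⟩ := hdvd
  obtain ⟨n1, n2⟩ := h.cauchyOp_nodal
  have h3 := h.cauchyOp_mul_eval n1.toElem Q
  rw [h.cauchyOp_congr hfe]
  simp_rw [eval_mul]
  rw [h.cauchyOp_smul (h.elem_mul_eval n1.toElem Q), h3, n2, map_mul, neg_one_smul, add_neg_cancel]

lemma Calc.unique (h : Pair A ω a p q) (hF : Calc A a p q F T) (hG : Calc A a p q G S)
    (hFG : EqOn F G (region A a p)) : T = S :=
  sub_eq_zero.1 ((hF.sub h hG).eq_zero h fun _ hz => sub_eq_zero.2 (hFG hz))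

lemma Pair.isCoprime_kap_nodal (h : Pair A ω a p q) {b : ℂ} (hb : b ∈ resolventSet A) :
    IsCoprime (kap a b) (nodal (sing A a) (val a)) := by
  refine IsCoprime.prod_right fun d hd => ?_
  rw [mem_sing] at hd
  have hv : (kap a b).eval (val a d) ≠ 0 := by
    induction d using OnePoint.rec with
    | infty => simp [kap, val]
    | coe d =>
      have h1 := pole_sub_ne_zero_of_pts h.setup.ha (singPts_subset_pts hd)
      rw [val, elim_some, eval_kap h1]
      refine mul_ne_zero (sub_ne_zero.2 ?_) (inv_ne_zero h1)
      rintro rfl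
      rcases hd.2 with ⟨z, hz, hzd⟩ | h2
      · rw [coe_eq_coe] at hzd
        exact hz (hzd ▸ hb)
      · exact coe_ne_infty _ h2.1
  set v := val a d
  set k := (kap a b).eval v with hk
  refine ⟨C k⁻¹, -C (k⁻¹ * (b - pole a 0)), ?_⟩
  refine Polynomial.funext fun x => ?_
  simp only [kap, eval_add, eval_one, eval_mul, eval_C, eval_X] at hk
  simp only [kap, eval_add, eval_mul, eval_C, eval_X, eval_one, eval_neg, eval_sub]
  field_simp
  rw [hk]
  ring

lemma Pair.calc_res (h : Pair A ω a p q) (s : ℤˣ) {b : ℝ} (hb : a < b) :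
    Calc A a p q (fun z => (((s : ℤ) : ℂ) * b - z)⁻¹) (res A (((s : ℤ) : ℂ) * b)) := by
  have hρ := h.setup.mem_resolventSet_of_lt s hb
  have hη : 0 < sin p.φ * (b - a) := mul_pos (h.setup.sin_pos h.outer) (sub_pos.2 hb)
  have hle := fun z hz => h.setup.le_norm_sub h.outer s hb (z := z) hz
  set b' : ℂ := ((s : ℤ) : ℂ) * b
  have hne : ∀ z ∈ region A a p, b' - z ≠ 0 := fun z hz h0 => by
    have := hle z hz
    rw [← norm_neg, neg_sub, h0, norm_zero] at this
    linarith
  obtain ⟨u, v, huv⟩ := h.isCoprime_kap_nodal hρ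
  obtain ⟨n1, n2⟩ := h.cauchyOp_nodal
  have n3 := h.elem0_mul_eval n1 v
  have e1 := (h.cauchyOp_mul_res n3.toElem hρ hη hle).1
  refine ⟨Polynomial.X * u, _, n3.mul_bounded h (g := fun z => (b' - z)⁻¹)
    (DifferentiableOn.inv (by fun_prop) hne) ⟨(sin p.φ * (b - a))⁻¹, fun z hz => ?_⟩, fun z hz => ?_, ?_⟩
  · rw [norm_inv, norm_sub_rev]
    exact inv_anti₀ hη (hle z hz)
  · have h1 := congrArg (eval (cay a z)) huv
    have h2 := h.setup.pole_sub_ne_zero h.outer 0 hz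
    simp only [eval_add, eval_mul, eval_kap h2, eval_one] at h1
    have h3 := hne z hz
    rw [eval_mul, eval_X]
    field_simp
    linear_combination -h1
  · simp_rw [mul_comm (b' - _)⁻¹]
    rw [← e1, h.cauchyOp_mul_eval n1.toElem, n2]
    have h4 := congrArg (aeval (res A (pole a 0))) huv
    have h5 := res_mul_kap (h.setup.pole_mem 0) hρ
    have h6 : ∀ P : ℂ[X], Commute (res A b') (aeval (res A (pole a 0)) P) := fun P => by
      induction P using Polynomial.induction_on with
      | C c => rw [aeval_C]; exact (Algebra.commutes _ _).symm
      | add P Q hP hQ => rw [map_add]; exact hP.add_right hQ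
      | monomial n c hn =>
        rw [pow_succ, ← mul_assoc, map_mul, aeval_X]; exact hn.mul_right (res_mul_comm A _ _)
    calc res A b' = res A b' * aeval (res A (pole a 0)) (u * kap a b' +
          v * nodal (sing A a) (val a)) := by rw [h4, map_one, mul_one]
      _ = _ := by
        rw [map_add, mul_add, mul_comm u, map_mul, ← mul_assoc, h5, map_mul _ Polynomial.X, aeval_X,
          (h6 _).eq, mul_comm v, map_mul]

lemma MemE0.elem0 (h : Pair A ω a p q) (hf : MemE0 A a p f) : Elem0 A a p q f where
  holo := hf.holo
  bdd := hf.bdd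
  lim := hf.lim
  int s τ := (hf.int q.φ ⟨h.below.φ, (h.setup.lt_pi_div_two h.inner).le⟩ s τ).mono_set
    fun t ht => ⟨ht.1, h.contour_subset (.inl ⟨s, τ, t, ht.1, rfl, ht.2⟩)⟩

lemma Elem0.mono {p' : Params} (hf : Elem0 A a p q f) (h : region A a p' ⊆ region A a p) :
    Elem0 A a p' q f where
  holo := hf.holo.mono h
  bdd := let ⟨C, hC⟩ := hf.bdd; ⟨C, fun z hz => hC z (h hz)⟩
  lim d hd := (hf.lim d hd).mono_left (towards_mono h)
  int := hf.int

lemma IsPrimary.calc {p' : Params} (h : Pair A ω a p' q) (hp : Admissible A ω a p)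
    (hpq : p.Below q) (hpp : region A a p' ⊆ region A a p) {e : ℂ → ℂ}
    (he : IsPrimary A ω a p e T) : Calc A a p' q e T := by
  obtain ⟨f₀, c₁, c₂, b, q', hf, hb, hef, hq', hφ, hε, hR, rfl⟩ := he
  have h1 : Pair A ω a p q := ⟨h.setup, hp, h.inner, hpq⟩
  have h2 : Pair A ω a p q' := ⟨h.setup, hp, hq', ⟨hφ, hε, hR⟩⟩
  rw [h2.cauchyOp_eq h1 (hf.elem0 h2).toElem (hf.elem0 h1).toElem]
  have k1 := (h.calc_res (-1) hb).const_mul h (-c₁)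
  have k2 := (h.calc_res 1 hb).const_mul h c₂
  have k3 := (((hf.elem0 h1).mono hpp).calc.add h k1).add h k2
  simp only [Units.val_neg, Units.val_one, Int.cast_neg, Int.cast_one, neg_mul, one_mul,
    neg_smul] at k3
  rw [smul_neg]
  refine k3.congr fun z hz => ?_
  rw [hef z (hpp hz)]
  have : (-(b : ℂ) - z)⁻¹ = -((b : ℂ) + z)⁻¹ := by rw [← inv_neg]; congr 1; ring
  simp only [this]
  ring

end Calc

section Codiscrete

variable {U W D : Set ℂ}

lemma countable_diff_of_mem_codiscreteWithin (h : D ∈ codiscreteWithin U) : (U \ D).Countable := by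
  have h1 : IsDiscrete (Dᶜ ∩ U) := isDiscrete_of_codiscreteWithin (by rwa [compl_compl])
  have := h1.to_subtype
  rw [diff_eq, inter_comm]
  exact countable_coe_iff.1 (TopologicalSpace.separableSpace_iff_countable.1 inferInstance)

lemma eventually_nhdsNE_of_mem_codiscreteWithin (h : D ∈ codiscreteWithin U) (hW : IsOpen W)
    (hWU : W ⊆ U) (hz : z ∈ W) : ∀ᶠ w in 𝓝[≠] z, w ∈ W ∩ D := by
  filter_upwards [mem_codiscreteWithin_iff_forall_mem_nhdsNE.1 h z (hWU hz),
    mem_nhdsWithin_of_mem_nhds (hW.mem_nhds hz)] with w h1 h2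
  exact ⟨h2, h1.resolve_right fun h3 => h3 (hWU h2)⟩

lemma le_of_mem_codiscreteWithin (h : D ∈ codiscreteWithin U) (hW : IsOpen W) (hWU : W ⊆ U)
    {f b : ℂ → ℝ} (hf : ContinuousOn f W) (hb : ContinuousOn b W) (hle : ∀ z ∈ W ∩ D, f z ≤ b z) :
    ∀ z ∈ W, f z ≤ b z := fun z hz =>
  le_of_tendsto_of_tendsto
    ((hf.continuousAt (hW.mem_nhds hz)).tendsto.mono_left (nhdsWithin_le_nhds (s := {z}ᶜ)))
    ((hb.continuousAt (hW.mem_nhds hz)).tendsto.mono_left nhdsWithin_le_nhds)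
    ((eventually_nhdsNE_of_mem_codiscreteWithin h hW hWU hz).mono hle)

lemma frequently_mem_of_mem_codiscreteWithin (h : D ∈ codiscreteWithin U) (hU : IsOpen U)
    (d : OnePoint ℂ) [(towards d U).NeBot] : ∃ᶠ z in towards d U, z ∈ U ∩ D := by
  rw [towards, frequently_inf_principal]
  intro hev
  obtain ⟨V, hV, hVU⟩ := mem_comap.1 hev
  obtain ⟨V', hV', hVo, hdV⟩ := mem_nhds_iff.1 hV
  have ho : IsOpen ((fun z : ℂ => (z : OnePoint ℂ)) ⁻¹' V' ∩ U) :=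
    (hVo.preimage OnePoint.continuous_coe).inter hU
  have hne : ((fun z : ℂ => (z : OnePoint ℂ)) ⁻¹' V' ∩ U).Nonempty :=
    nonempty_of_mem (f := towards d U) (inter_mem (mem_inf_of_left
      (preimage_mem_comap (hVo.mem_nhds hdV))) (eventually_mem_towards d U))
  obtain ⟨z, hz⟩ := hne
  obtain ⟨w, hw, hwD⟩ := (eventually_nhdsNE_of_mem_codiscreteWithin h ho inter_subset_right hz).exists
  exact hVU (hV' hw.1) ⟨hw.2, hw.2, hwD⟩

lemma exists_differentiableOn_extension {g : ℂ → ℂ} (hg : MeromorphicOn g U) {lam : ℂ} {κ : ℝ}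
    (hU : IsOpen U) (hκ : 0 < κ) (hl : lam ≠ 0)
    (h : ∀ z ∈ U, AnalyticAt ℂ g z → κ * ‖lam‖ ≤ ‖lam - g z‖) :
    ∃ F, DifferentiableOn ℂ F U ∧ ∀ z ∈ U, AnalyticAt ℂ g z → F z = lam / (lam - g z) := by
  obtain ⟨f, hf⟩ : ∃ f : ℂ → ℂ, f = fun z => lam / (lam - g z) := ⟨_, rfl⟩
  have hfm : MeromorphicOn f U := fun z hz => by
    rw [hf]
    exact (MeromorphicAt.const lam z).div ((MeromorphicAt.const lam z).sub (hg z hz))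
  have hne : ∀ z ∈ U, AnalyticAt ℂ g z → lam - g z ≠ 0 := fun z hz ha h0 => by
    have h1 := h z hz ha
    rw [h0, norm_zero] at h1
    exact absurd h1 (not_le.2 (mul_pos hκ (norm_pos_iff.2 hl)))
  have hNF := meromorphicNFOn_toMeromorphicNFOn f U
  refine ⟨toMeromorphicNFOn f U, fun z hz => ?_, fun z hz ha => ?_⟩
  · have hb : ∀ᶠ w in 𝓝[≠] z, ‖toMeromorphicNFOn f U w‖ ≤ κ⁻¹ := by
      filter_upwards [hfm.toMeromorphicNFOn_eq_self_on_nhdsNE hz, (hg z hz).eventually_analyticAt,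
        mem_nhdsWithin_of_mem_nhds (hU.mem_nhds hz)] with w h1 h2 h3
      rw [h1, hf, norm_div, div_le_iff₀ (norm_pos_iff.2 (hne w h3 h2)), inv_mul_eq_div,
        le_div_iff₀ hκ, mul_comm]
      exact h w h3 h2
    have ho : 0 ≤ meromorphicOrderAt (toMeromorphicNFOn f U) z := by
      by_contra hc
      have h1 := (tendsto_cobounded_iff_meromorphicOrderAt_neg (hNF hz).meromorphicAt).2 (not_le.1 hc)
      have h2 := (tendsto_norm_cobounded_atTop.comp h1).eventually_gt_atTop κ⁻¹
      obtain ⟨w, h3, h4⟩ := (hb.and h2).exists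
      exact absurd h3 (not_le.2 h4)
    exact ((hNF hz).meromorphicOrderAt_nonneg_iff_analyticAt.1 ho).differentiableAt.differentiableWithinAt
  · have h1 : AnalyticAt ℂ f z := by
      rw [hf]
      exact analyticAt_const.div (analyticAt_const.sub ha) (hne z hz ha)
    rw [toMeromorphicNFOn_eq_toMeromorphicNFAt hfm hz, toMeromorphicNFAt_eq_self.2 h1.meromorphicNFAt,
      hf]

end Codiscrete

/-- A gauge for the distance of `z` from the point `d` of the Riemann sphere. -/
noncomputable def gap (d : OnePoint ℂ) (z : ℂ) : ℝ := d.elim (1 + ‖z‖)⁻¹ fun d' => ‖z - d'‖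

lemma gap_nonneg (d : OnePoint ℂ) (z : ℂ) : 0 ≤ gap d z := by
  induction d using OnePoint.rec with
  | infty => exact inv_nonneg.2 (by positivity)
  | coe d => exact norm_nonneg _

lemma continuous_gap (d : OnePoint ℂ) : Continuous (gap d) := by
  induction d using OnePoint.rec with
  | infty => exact Continuous.inv₀ (f := fun z : ℂ => 1 + ‖z‖) (by fun_prop) fun z => by positivity
  | coe d => exact (continuous_id.sub continuous_const).norm

lemma towards_eq_comap_gap (d : OnePoint ℂ) (Ω : Set ℂ) :
    towards d Ω = comap (gap d) (𝓝 0) ⊓ 𝓟 Ω := by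
  induction d using OnePoint.rec with
  | infty =>
    rw [towards_infty, ← cobounded_eq_cocompact, ← comap_norm_atTop]
    congr 1
    have e : gap infty = (fun x : ℝ => (1 + x)⁻¹) ∘ fun z : ℂ => ‖z‖ := rfl
    refine le_antisymm ?_ ?_
    · rw [← tendsto_iff_comap, e]
      exact (tendsto_inv_atTop_zero.comp (tendsto_atTop_add_const_left _ 1 tendsto_id)).comp
        tendsto_comap
    · rw [← tendsto_iff_comap]
      have h1 : Tendsto (gap infty) (comap (gap infty) (𝓝 0)) (𝓝[>] 0) := by
        refine tendsto_nhdsWithin_iff.2 ⟨tendsto_comap, Eventually.of_forall fun z => ?_⟩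
        exact (show (0 : ℝ) < (1 + ‖z‖)⁻¹ by positivity)
      have h2 := tendsto_atTop_add_const_right _ (-1 : ℝ) ((tendsto_inv_nhdsGT_zero (𝕜 := ℝ)).comp h1)
      refine h2.congr fun z => ?_
      simp [gap]
  | coe d =>
    rw [towards_coe]
    congr 1
    rw [show gap (d : OnePoint ℂ) = fun z => dist z d from funext fun z => (dist_eq_norm z d).symm]
    exact (nhds_comap_dist d).symm

lemma eventually_towards_iff {Ω : Set ℂ} {P : ℂ → Prop} :
    (∀ᶠ z in towards d Ω, P z) ↔ ∃ r > 0, ∀ z ∈ Ω, gap d z < r → P z := by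
  rw [towards_eq_comap_gap, eventually_inf_principal,
    (Metric.nhds_basis_ball.comap (gap d)).eventually_iff]
  refine exists_congr fun r => and_congr_right fun _ => forall_congr' fun z => ?_
  simp only [mem_preimage, mem_ball, dist_zero_right, norm_of_nonneg (gap_nonneg d z)]
  tauto

lemma tendsto_gap (d : OnePoint ℂ) (Ω : Set ℂ) : Tendsto (gap d) (towards d Ω) (𝓝 0) := by
  rw [towards_eq_comap_gap]
  exact tendsto_comap.mono_left inf_le_left

lemma exists_eq_of_mem_pts (hd : d ∈ pts a) :
    d = infty ∨ ∃ s : ℤˣ, d = ((((s : ℤ) : ℂ) * a : ℂ) : OnePoint ℂ) := by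
  rcases mem_pts.1 hd with h | h | h
  · exact .inr ⟨-1, by rw [h]; simp⟩
  · exact .inr ⟨1, by rw [h]; simp⟩
  · exact .inl h

lemma gap_unit_mul (a : ℝ) (s : ℤˣ) (z : ℂ) :
    gap ((((s : ℤ) : ℂ) * a : ℂ) : OnePoint ℂ) z = ‖loc a s z‖ := by
  have : loc a s z = ((s : ℤ) : ℂ) * (z - ((s : ℤ) : ℂ) * a) := by
    rw [loc, mul_sub, ← mul_assoc, unit_sq, one_mul]
  rw [this, norm_mul, norm_unit, one_mul]
  rfl

/-- The comparison of `gap` with the distance from the vertices and with the parameters of the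
rays, near a point of `{a, -a, ∞}`. -/
lemma exists_gap_compare (ha : 0 ≤ a) (hd : d ∈ pts a) : ∃ r > 0, r ≤ 1 ∧ ∃ K, 1 ≤ K ∧
    (∀ z, gap d z < r → absAt d z ≤ K * vdist a z ∧
      d.elim 1 (fun d' => ‖z - d'‖) * (1 + ‖z‖)⁻¹ ≤ K * (vdist a z * ((1 + ‖z‖) ^ 2)⁻¹)) ∧
    (∀ s z, gap d z < r → gap d z ≠ 0 → d = infty →
      1 ≤ K * (gap d z * ‖loc a s z‖) ∧ gap d z * ‖loc a s z‖ ≤ K) ∧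
    ∀ θ (s τ : ℤˣ) t, |θ| < π / 2 → 0 < t → gap d (ray a θ s τ t) < r →
      t ≤ K * vdist a (ray a θ s τ t) ∧
      ((d ≠ infty ∧ gap d (ray a θ s τ t) = t) ∨ d = infty) := by
  rcases exists_eq_of_mem_pts hd with rfl | ⟨s₀, rfl⟩
  · have key : ∀ z : ℂ, gap infty z < (2 * a + 2)⁻¹ → ∀ s, (1 + ‖z‖) / 2 ≤ ‖loc a s z‖ := by
      intro z hz s
      have h1 : 2 * a + 2 < 1 + ‖z‖ := (inv_lt_inv₀ (by positivity) (by positivity)).1 hz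
      have h2 := norm_sub_norm_le (((s : ℤ) : ℂ) * z) (a : ℂ)
      rw [norm_mul, norm_unit, one_mul, norm_real, norm_of_nonneg ha] at h2
      change _ ≤ ‖loc a s z‖ at h2
      linarith
    have keyv : ∀ z : ℂ, gap infty z < (2 * a + 2)⁻¹ → (1 + ‖z‖) / 2 ≤ vdist a z := by
      intro z hz
      obtain ⟨s, hs⟩ := exists_vdist_eq a z
      rw [hs]; exact key z hz s
    have hle : ∀ s z, ‖loc a s z‖ ≤ (1 + a) * (1 + ‖z‖) := fun s z => by
      have := norm_loc_le ha s z
      nlinarith [norm_nonneg z]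
    refine ⟨(2 * a + 2)⁻¹, by positivity, inv_le_one_of_one_le₀ (by linarith), 2 * (1 + a),
      by linarith, fun z hz => ⟨?_, ?_⟩, fun s z hz _ _ => ?_, fun θ s τ t _ ht hz => ⟨?_, .inr rfl⟩⟩
    · have h1 := keyv z hz
      have h2 := vdist_nonneg a z
      change ‖z‖ ≤ _
      nlinarith [norm_nonneg z]
    · have h1 := keyv z hz
      have h2 := vdist_nonneg a z
      rw [elim_infty, one_mul, ← mul_assoc, ← div_eq_mul_inv, le_div_iff₀ (by positivity)]
      have : (1 + ‖z‖)⁻¹ * (1 + ‖z‖) ^ 2 = 1 + ‖z‖ := by field_simp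
      rw [this]
      nlinarith
    · have h1 := key z hz s
      have h2 := hle s z
      have h0 : 0 < 1 + ‖z‖ := by positivity
      have e : gap infty z * ‖loc a s z‖ = ‖loc a s z‖ / (1 + ‖z‖) := by
        rw [div_eq_inv_mul]; rfl
      rw [e, div_le_iff₀ h0, ← mul_div_assoc, le_div_iff₀ h0]
      constructor <;> nlinarith
    · have h1 := keyv _ hz
      have h2 := hle s (ray a θ s τ t)
      rw [norm_loc_ray a θ s τ ht.le] at h2
      have h3 := mul_le_mul_of_nonneg_left h1 (show 0 ≤ 2 * (1 + a) by positivity)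
      linarith
  · obtain ⟨r, hr0, hr1, hra⟩ : ∃ r > 0, r ≤ 1 ∧ (0 < a → r ≤ a) := by
      rcases eq_or_lt_of_le ha with h0 | h0
      · exact ⟨1, one_pos, le_rfl, fun h => absurd h0 h.ne⟩
      · exact ⟨min 1 a, by positivity, min_le_left _ _, fun _ => min_le_right _ _⟩
    have keyv : ∀ z : ℂ, ‖loc a s₀ z‖ < r → vdist a z = ‖loc a s₀ z‖ := by
      intro z hz
      refine le_antisymm (vdist_le_norm_loc a s₀ z) ?_
      obtain ⟨s, hs⟩ := exists_vdist_eq a z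
      rcases unit_eq_or_eq_neg s s₀ with rfl | rfl
      · exact hs.ge
      · rw [hs]
        rcases eq_or_lt_of_le ha with h0 | h0
        · rw [← h0]; simp [loc]
        · have h1 := re_loc_neg a s₀ z
          have h2 := Complex.abs_re_le_norm (loc a (-s₀) z)
          have h3 := Complex.abs_re_le_norm (loc a s₀ z)
          have h4 := hra h0
          rw [abs_le] at h2 h3
          linarith
    refine ⟨r, hr0, hr1, 1 + a + 1, by linarith, fun z hz => ?_, fun s z _ _ h =>
      absurd h (coe_ne_infty _), fun θ s τ t hθ ht hz => ?_⟩
    · rw [gap_unit_mul] at hz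
      have e : ‖z - ((s₀ : ℤ) : ℂ) * a‖ = vdist a z := by rw [keyv z hz, ← gap_unit_mul]; rfl
      have h2 := vdist_nonneg a z
      have h3 : ‖z‖ ≤ vdist a z + a := by
        have := norm_add_le (z - ((s₀ : ℤ) : ℂ) * a) (((s₀ : ℤ) : ℂ) * a)
        rwa [sub_add_cancel, e, norm_mul, norm_unit, one_mul, norm_real,
          norm_of_nonneg ha] at this
      have h4 : vdist a z ≤ 1 := by rw [keyv z hz]; linarith
      constructor
      · change ‖z - ((s₀ : ℤ) : ℂ) * a‖ ≤ _
        rw [e]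
        nlinarith
      · rw [elim_some, e, ← mul_assoc, ← div_eq_mul_inv, ← div_eq_mul_inv,
          div_le_div_iff₀ (by positivity) (by positivity)]
        have : 1 + ‖z‖ ≤ 1 + a + 1 := by linarith
        calc _ = vdist a z * (1 + ‖z‖) * (1 + ‖z‖) := by ring
          _ ≤ vdist a z * (1 + a + 1) * (1 + ‖z‖) := by gcongr
          _ = _ := by ring
    · rw [gap_unit_mul] at hz
      have hs : ‖loc a s₀ (ray a θ s τ t)‖ = t := by
        rcases unit_eq_or_eq_neg s s₀ with rfl | rfl
        · exact norm_loc_ray a θ _ τ ht.le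
        · have hn := norm_loc_ray a θ (-s₀) τ ht.le
          have hre : 0 ≤ (loc a (-s₀) (ray a θ (-s₀) τ t)).re := by
            rw [loc_ray, Complex.re_ofReal_mul]
            refine mul_nonneg ht.le ?_
            rw [Complex.exp_re]
            refine mul_nonneg (Real.exp_pos _).le (Real.cos_nonneg_of_mem_Icc ?_)
            rw [abs_lt] at hθ
            rcases units_eq_one_or τ with rfl | rfl <;> simp <;> constructor <;> linarith
          rcases eq_or_lt_of_le ha with h0 | h0
          · have e : ∀ w, ‖loc a s₀ w‖ = ‖loc a (-s₀) w‖ := fun w => by rw [← h0]; simp [loc]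
            rw [e, hn]
          · exfalso
            have h1 := re_loc_neg a s₀ (ray a θ (-s₀) τ t)
            have h3 := Complex.abs_re_le_norm (loc a s₀ (ray a θ (-s₀) τ t))
            have h4 := hra h0
            rw [abs_le] at h3
            linarith
      rw [keyv _ hz, gap_unit_mul, hs]
      exact ⟨by nlinarith, .inl ⟨coe_ne_infty _, rfl⟩⟩

/-- The region is bounded and bounded away from the vertices, off the points of `M_A`. -/
lemma exists_one_le_of_le_gap (A : X →ₗ.[ℂ] X) (a : ℝ) (hε : 0 < p.ε) {r : ℝ}
    (hr : 0 < r) : ∃ C, 0 ≤ C ∧ ∀ z ∈ region A a p, (∀ d ∈ sing A a, r ≤ gap d z) →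
      1 ≤ C * (vdist a z * ((1 + ‖z‖) ^ 2)⁻¹) := by
  have h0 : 0 < min r p.ε := lt_min hr hε
  refine ⟨(max r⁻¹ (1 + |p.R|)) ^ 2 / min r p.ε, by positivity, fun z hz h => ?_⟩
  have h1 : 1 + ‖z‖ ≤ max r⁻¹ (1 + |p.R|) := by
    by_cases hi : infty ∈ singPts A a
    · exact le_max_of_le_left ((le_inv_comm₀ hr (by positivity)).1 (h _ (mem_sing.2 hi)))
    · exact le_max_of_le_right (by linarith [hz.2.2 hi, le_abs_self p.R])
  have h2 : min r p.ε ≤ vdist a z := by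
    have key : ∀ d : ℂ, (d = a ∨ d = -a) → min r p.ε ≤ ‖z - d‖ := fun d hd => by
      by_cases hs : (d : OnePoint ℂ) ∈ singPts A a
      · exact (min_le_left _ _).trans (h _ (mem_sing.2 hs))
      · exact (min_le_right _ _).trans (mem_offDiscs_iff.1 hz.2.1 d (mem_removedPts.2 ⟨hd, hs⟩)).le
    refine le_min (key a (.inl rfl)) ?_
    have := key (-a) (.inr rfl)
    rwa [sub_neg_eq_add] at this
  have h3 : (1 + ‖z‖) ^ 2 ≤ (max r⁻¹ (1 + |p.R|)) ^ 2 := by gcongr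
  rw [← mul_assoc, ← div_eq_mul_inv, le_div_iff₀ (by positivity), one_mul, div_mul_eq_mul_div,
    le_div_iff₀ h0]
  exact mul_le_mul h3 h2 h0.le (by positivity)

lemma integrableOn_min_rpow_div {α : ℝ} (hα : 0 < α) :
    IntegrableOn (fun t : ℝ => min (t ^ α) (t ^ (-α)) / t) (Ioi 0) := by
  have hm : Measurable fun t : ℝ => min (t ^ α) (t ^ (-α)) / t := by fun_prop
  have hn : ∀ t : ℝ, 0 < t → ‖min (t ^ α) (t ^ (-α)) / t‖ = min (t ^ α) (t ^ (-α)) / t :=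
    fun t ht => norm_of_nonneg (by positivity)
  rw [← Ioc_union_Ioi_eq_Ioi zero_le_one, integrableOn_union]
  constructor
  · have h1 : IntegrableOn (fun t : ℝ => t ^ (α - 1)) (Ioc 0 1) :=
      (intervalIntegrable_iff_integrableOn_Ioc_of_le zero_le_one).1
        (intervalIntegral.intervalIntegrable_rpow' (by linarith))
    refine Integrable.mono' h1 hm.aestronglyMeasurable ?_
    filter_upwards [ae_restrict_mem measurableSet_Ioc] with t ht
    rw [hn t ht.1, Real.rpow_sub_one ht.1.ne']
    have := ht.1
    gcongr
    exact min_le_left _ _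
  · have h1 := integrableOn_Ioi_rpow_of_lt (a := -α - 1) (by linarith) one_pos
    refine Integrable.mono' h1 hm.aestronglyMeasurable ?_
    filter_upwards [ae_restrict_mem measurableSet_Ioi] with t ht
    have h0 : (0 : ℝ) < t := one_pos.trans ht
    rw [hn t h0, Real.rpow_sub_one h0.ne']
    gcongr
    exact min_le_right _ _

lemma integral_min_rpow_div_scale {α ν : ℝ} (hα : 0 < α) (hν : 0 < ν) :
    IntegrableOn (fun t : ℝ => min ((ν * t) ^ α) ((ν * t) ^ (-α)) / t) (Ioi 0) ∧
    ∫ t in Ioi (0 : ℝ), min ((ν * t) ^ α) ((ν * t) ^ (-α)) / t =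
      ∫ t in Ioi (0 : ℝ), min (t ^ α) (t ^ (-α)) / t := by
  have e : (fun t : ℝ => min ((ν * t) ^ α) ((ν * t) ^ (-α)) / t) = fun t =>
      ν * (fun t : ℝ => min (t ^ α) (t ^ (-α)) / t) (ν * t) := by
    funext t
    simp only
    rw [mul_div_assoc', mul_div_mul_left _ _ hν.ne']
  constructor
  · rw [e]
    have h1 := (integrableOn_Ioi_comp_mul_left_iff (fun t : ℝ => min (t ^ α) (t ^ (-α)) / t) 0 hν).2
      (by rw [mul_zero]; exact integrableOn_min_rpow_div hα)
    exact Integrable.const_mul h1 ν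
  · rw [e, integral_const_mul, integral_comp_mul_left_Ioi
      (fun t : ℝ => min (t ^ α) (t ^ (-α)) / t) 0 hν, mul_zero, smul_eq_mul, ← mul_assoc,
      mul_inv_cancel₀ hν.ne', one_mul]

section Assembly

open Polynomial

lemma Finset.exists_pos_le {ι : Type*} (s : Finset ι) (f : ι → ℝ) (hf : ∀ i, 0 < f i) {r : ℝ}
    (hr : 0 < r) : ∃ r₀ > 0, r₀ ≤ r ∧ ∀ i ∈ s, r₀ ≤ f i := by
  have h1 : ∀ x : ℝ, 0 < x → ∀ᶠ y in 𝓝[>] (0 : ℝ), y ≤ x := fun x hx =>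
    mem_of_superset (Ioc_mem_nhdsGT hx) fun y hy => hy.2
  obtain ⟨y, h2, h3, h4⟩ := ((s.eventually_all.2 fun i _ => h1 _ (hf i)).and
    ((h1 r hr).and self_mem_nhdsWithin)).exists
  exact ⟨y, h4, h3, h2⟩

variable {F : ℂ → ℂ} {T : X →L[ℂ] X}

/-- Near `d`, the function `F` is approximated in a controlled way by a function of the calculus. -/
def Near (A : X →ₗ.[ℂ] X) (a : ℝ) (p q : Params) (d : OnePoint ℂ) (r C : ℝ) (F : ℂ → ℂ) : Prop :=
  ∃ (u : ℂ → ℂ) (U : X →L[ℂ] X), Calc A a p q u U ∧ ‖U‖ ≤ C ∧ (∀ z ∈ region A a p, ‖u z‖ ≤ C) ∧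
    Tendsto (fun z => F z - u z) (towards d (region A a p)) (𝓝 0) ∧
    ∀ s τ : ℤˣ, ∃ m : ℝ → ℝ, IntegrableOn m (Ioi 0) ∧ ∫ t in Ioi (0 : ℝ), m t ≤ C ∧
      (∀ t, 0 < t → 0 ≤ m t) ∧ ∀ᵐ t ∂volume.restrict (raySet A a q s τ),
        gap d (ray a q.φ s τ t) < r →
        ‖F (ray a q.φ s τ t) - u (ray a q.φ s τ t)‖ / vdist a (ray a q.φ s τ t) ≤ m t

lemma Near.mono {r r' C C' : ℝ} (h : Near A a p q d r C F) (hr : r' ≤ r) (hC : C ≤ C') :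
    Near A a p q d r' C' F := by
  obtain ⟨u, U, h1, h2, h3, h4, h5⟩ := h
  refine ⟨u, U, h1, h2.trans hC, fun z hz => (h3 z hz).trans hC, h4, fun s τ => ?_⟩
  obtain ⟨m, h6, h7, h8, h9⟩ := h5 s τ
  exact ⟨m, h6, h7.trans hC, h8, h9.mono fun t ht hg => ht (hg.trans_le hr)⟩

lemma Calc.differentiableOn (hS : Setup A ω a) (hp : Admissible A ω a p)
    (hF : Calc A a p q F T) : DifferentiableOn ℂ F (region A a p) := by
  obtain ⟨P, f, hf, hP, -⟩ := hF
  exact ((differentiableOn_eval_cay hS hp P).add hf.holo).congr hP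

lemma exists_norm_eval_cay_le_mul (hS : Setup A ω a) (hp : Admissible A ω a p) {P : ℂ[X]} {x : ℂ}
    (hx : P.eval x = 0) : ∃ L, 0 ≤ L ∧ ∀ z ∈ region A a p, ‖P.eval (cay a z)‖ ≤ L * ‖cay a z - x‖ := by
  obtain ⟨Q, rfl⟩ := dvd_iff_isRoot.2 hx
  obtain ⟨L, hL⟩ := exists_norm_eval_cay_le hS hp Q
  refine ⟨|L|, abs_nonneg _, fun z hz => ?_⟩
  rw [eval_mul, norm_mul, eval_sub, eval_X, eval_C, mul_comm]
  gcongr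
  exact (hL z hz).trans (le_abs_self L)

variable [CompleteSpace X] [Nontrivial X]

lemma Calc.sum (h : Pair A ω a p q) {ι : Type*} (s : Finset ι) {F : ι → ℂ → ℂ} {T : ι → X →L[ℂ] X}
    (hF : ∀ i ∈ s, Calc A a p q (F i) (T i)) :
    Calc A a p q (fun z => ∑ i ∈ s, F i z) (∑ i ∈ s, T i) := by
  classical
  induction s using Finset.induction_on with
  | empty => simpa using h.calc_eval 0
  | insert i s hi ih =>
    simp_rw [Finset.sum_insert hi]
    exact (hF i (Finset.mem_insert_self i s)).add h
      (ih fun j hj => hF j (Finset.mem_insert_of_mem hj))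

open Classical in
lemma Near.one_sub (h : Pair A ω a p q) {r C : ℝ} (hF : Near A a p q d r C fun z => 1 - F z) :
    Near A a p q d r (C + 1) F := by
  obtain ⟨u, U, h1, h2, h3, h4, h5⟩ := hF
  have e : ∀ z, F z - (1 - u z) = -(1 - F z - u z) := fun z => by ring
  refine ⟨fun z => 1 - u z, 1 - U, ?_, ?_, fun z hz => ?_, ?_, fun s τ => ?_⟩
  · have := (h.calc_eval 1).sub h h1
    simpa using this
  · exact (norm_sub_le _ _).trans (by rw [norm_one]; linarith)
  · exact (norm_sub_le _ _).trans (by rw [norm_one]; linarith [h3 z hz])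
  · simp_rw [e]
    simpa using h4.neg
  · obtain ⟨m, h6, h7, h8, h9⟩ := h5 s τ
    refine ⟨m, h6, by linarith, h8, h9.mono fun t ht hg => ?_⟩
    rw [e, norm_neg]
    exact ht hg

open Classical in
lemma Pair.exists_calc_of_near (h : Pair A ω a p q) {r C : ℝ} (hr : 0 < r) (hC : 0 ≤ C) :
    ∃ M, ∀ F, DifferentiableOn ℂ F (region A a p) → (∀ z ∈ region A a p, ‖F z‖ ≤ C) →
      (∀ d ∈ sing A a, Near A a p q d r C F) → ∃ T, Calc A a p q F T ∧ ‖T‖ ≤ M := by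
  have ha := h.setup.ha
  obtain ⟨ξ, hξ⟩ : ∃ ξ : OnePoint ℂ → ℂ[X], ξ = fun d => Lagrange.basis (sing A a) (val a) d :=
    ⟨_, rfl⟩
  have hinj : InjOn (val a) (sing A a) := (injOn_val ha).mono fun d hd =>
    singPts_subset_pts (mem_sing.1 hd)
  have hroot : ∀ d ∈ sing A a, ∀ d' ∈ sing A a,
      (Polynomial.C (if d' = d then 1 else 0) - ξ d' : ℂ[X]).eval (val a d) = 0 := fun d hd d' hd' => by
    rw [eval_sub, eval_C, hξ]
    split_ifs with e
    · subst e
      rw [Lagrange.eval_basis_self hinj hd, sub_self]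
    · rw [Lagrange.eval_basis_of_ne e hd, sub_zero]
  have hL : ∀ d d', ∃ L, 0 ≤ L ∧ (d ∈ sing A a → d' ∈ sing A a → ∀ z ∈ region A a p,
      ‖(if d' = d then 1 else 0) - (ξ d').eval (cay a z)‖ ≤ L * ‖cay a z - val a d‖) := fun d d' => by
    by_cases hd : d ∈ sing A a ∧ d' ∈ sing A a
    · obtain ⟨L, h0, h1⟩ := exists_norm_eval_cay_le_mul h.setup h.outer (hroot d hd.1 d' hd.2)
      refine ⟨L, h0, fun _ _ z hz => ?_⟩
      have := h1 z hz
      rwa [eval_sub, eval_C] at this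
    · exact ⟨0, le_rfl, fun h1 h2 => absurd ⟨h1, h2⟩ hd⟩
  choose L hL0 hL using hL
  have hB : ∀ d, ∃ B, ∀ z ∈ region A a p, ‖(ξ d).eval (cay a z)‖ ≤ B := fun d =>
    exists_norm_eval_cay_le h.setup h.outer _
  choose B hB using hB
  have hW : ∀ d, ∃ r₁ > 0, ∃ K, 0 ≤ K ∧ (d ∈ sing A a → ∀ z ∈ region A a p, gap d z < r₁ →
      ‖cay a z - val a d‖ ≤ K * (vdist a z * ((1 + ‖z‖) ^ 2)⁻¹)) := fun d => by
    by_cases hd : d ∈ sing A a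
    · have hs := mem_sing.1 hd
      obtain ⟨r₁, h1, -, K, hK, h2, -⟩ := exists_gap_compare ha (singPts_subset_pts hs)
      obtain ⟨K', hK', h3⟩ := norm_sub_val_le h.setup h.outer (singPts_subset_pts hs)
      refine ⟨r₁, h1, K' * K, by positivity, fun _ z hz hg => ((h3 z hz).1 hs).trans ?_⟩
      rw [mul_assoc]
      exact mul_le_mul_of_nonneg_left (h2 z hg).2 hK'
    · exact ⟨1, one_pos, 0, le_rfl, fun h => absurd h hd⟩
  choose r₁ hr₁ K hK0 hK using hW
  obtain ⟨r₀, hr₀, hrr, hr₀₁⟩ := Finset.exists_pos_le (sing A a) r₁ hr₁ hr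
  obtain ⟨D, hD0, hD⟩ := exists_one_le_of_le_gap A a (p := p) h.outer.2.1.1 hr₀
  obtain ⟨C', hcau⟩ := h.exists_norm_cauchyOp_le
  obtain ⟨E, hE⟩ : ∃ E, E = C + ∑ d ∈ sing A a, C * |B d| := ⟨_, rfl⟩
  have hE0 : 0 ≤ E := by rw [hE]; positivity
  obtain ⟨N, hN⟩ : ∃ N, N = ∑ d ∈ sing A a, (∑ d' ∈ sing A a, C * L d d') * K d + E * D := ⟨_, rfl⟩
  have hN0 : 0 ≤ N := by
    rw [hN]
    refine add_nonneg (sum_nonneg fun d _ => mul_nonneg (sum_nonneg fun d' _ =>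
      mul_nonneg hC (hL0 d d')) (hK0 d)) (by positivity)
  obtain ⟨J, hJ⟩ : ∃ J, J = ∫ t in Ioi (0 : ℝ), N * (1 + a) ^ 2 * ((1 + t) ^ 2)⁻¹ := ⟨_, rfl⟩
  have hJi : IntegrableOn (fun t : ℝ => N * (1 + a) ^ 2 * ((1 + t) ^ 2)⁻¹) (Ioi 0) :=
    Integrable.const_mul integrableOn_inv_one_add_sq _
  refine ⟨C' * max E (∑ d ∈ sing A a, C + J) +
    ∑ d ∈ sing A a, C * ‖aeval (res A (pole a 0)) (ξ d)‖, fun F hF hFC hnear => ?_⟩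
  choose! u U hu hU huC hlim hm using hnear
  obtain ⟨f, hf⟩ : ∃ f : ℂ → ℂ, f = fun z => F z - ∑ d ∈ sing A a, u d z * (ξ d).eval (cay a z) :=
    ⟨_, rfl⟩
  have hsum : Calc A a p q (fun z => ∑ d ∈ sing A a, u d z * (ξ d).eval (cay a z))
      (∑ d ∈ sing A a, U d * aeval (res A (pole a 0)) (ξ d)) :=
    Calc.sum h _ fun d hd => (hu d hd).mul h (h.calc_eval _)
  have hfE : ∀ z ∈ region A a p, ‖f z‖ ≤ E := fun z hz => by
    rw [hf, hE]
    refine (norm_sub_le _ _).trans (add_le_add (hFC z hz) ((norm_sum_le _ _).trans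
      (sum_le_sum fun d hd => ?_)))
    rw [norm_mul]
    exact mul_le_mul (huC d hd z hz) ((hB d z hz).trans (le_abs_self _)) (norm_nonneg _) hC
  have hfd : ∀ d ∈ sing A a, ∀ z ∈ region A a p,
      ‖f z - (F z - u d z)‖ ≤ (∑ d' ∈ sing A a, C * L d d') * ‖cay a z - val a d‖ := by
    intro d hd z hz
    have e : f z - (F z - u d z) = ∑ d' ∈ sing A a,
        u d' z * ((if d' = d then 1 else 0) - (ξ d').eval (cay a z)) := by
      simp_rw [mul_sub, Finset.sum_sub_distrib, mul_ite, mul_one, mul_zero]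
      rw [Finset.sum_ite_eq' _ d, if_pos hd, hf]
      ring
    rw [e, sum_mul]
    refine (norm_sum_le _ _).trans (sum_le_sum fun d' hd' => ?_)
    rw [norm_mul, mul_assoc]
    exact mul_le_mul (huC d' hd' z hz) (hL d d' hd hd' z hz) (norm_nonneg _) hC
  have hmain : ∀ z ∈ region A a p, ‖f z‖ ≤
      ∑ d ∈ sing A a, (if gap d z < r₀ then ‖F z - u d z‖ else 0) +
        N * (vdist a z * ((1 + ‖z‖) ^ 2)⁻¹) := by
    intro z hz
    have hw : 0 ≤ vdist a z * ((1 + ‖z‖) ^ 2)⁻¹ := mul_nonneg (vdist_nonneg a z) (by positivity)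
    have hnn : ∀ d ∈ sing A a, (0 : ℝ) ≤ if gap d z < r₀ then ‖F z - u d z‖ else 0 := fun d _ => by
      split_ifs <;> positivity
    have hnn' : ∀ d ∈ sing A a, 0 ≤ (∑ d' ∈ sing A a, C * L d d') * K d := fun d _ =>
      mul_nonneg (sum_nonneg fun d' _ => mul_nonneg hC (hL0 d d')) (hK0 d)
    by_cases hex : ∃ d ∈ sing A a, gap d z < r₀
    · obtain ⟨d, hd, hg⟩ := hex
      have h1 : ‖f z‖ ≤ ‖F z - u d z‖ + ‖f z - (F z - u d z)‖ := by
        have := norm_add_le (F z - u d z) (f z - (F z - u d z))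
        rwa [add_sub_cancel] at this
      refine h1.trans (add_le_add ?_ ((hfd d hd z hz).trans ?_))
      · have := single_le_sum hnn hd
        rwa [if_pos hg] at this
      · calc _ ≤ (∑ d' ∈ sing A a, C * L d d') * (K d * (vdist a z * ((1 + ‖z‖) ^ 2)⁻¹)) :=
            mul_le_mul_of_nonneg_left (hK d hd z hz (hg.trans_le (hr₀₁ d hd)))
              (sum_nonneg fun d' _ => mul_nonneg hC (hL0 d d'))
          _ = (∑ d' ∈ sing A a, C * L d d') * K d * (vdist a z * ((1 + ‖z‖) ^ 2)⁻¹) := by ring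
          _ ≤ _ := by
            refine mul_le_mul_of_nonneg_right ?_ hw
            rw [hN]
            exact le_add_of_le_of_nonneg (single_le_sum hnn' hd) (by positivity)
    · push Not at hex
      refine le_add_of_nonneg_of_le (sum_nonneg hnn) ((hfE z hz).trans ?_)
      have h1 := mul_le_mul_of_nonneg_left (hD z hz hex) hE0
      rw [mul_one, ← mul_assoc] at h1
      refine h1.trans (mul_le_mul_of_nonneg_right ?_ hw)
      rw [hN]
      exact le_add_of_nonneg_left (sum_nonneg hnn')
  have hfh : DifferentiableOn ℂ f (region A a p) := by
    rw [hf]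
    exact hF.sub (hsum.differentiableOn h.setup h.outer)
  have hmaj : ∀ s τ : ℤˣ, IntegrableOn (fun t => ‖f (ray a q.φ s τ t)‖ / vdist a (ray a q.φ s τ t))
      (raySet A a q s τ) ∧ ∫ t in raySet A a q s τ,
        ‖f (ray a q.φ s τ t)‖ / vdist a (ray a q.φ s τ t) ≤ ∑ d ∈ sing A a, C + J := by
    intro s τ
    have hm' := fun d hd => hm d hd s τ
    choose! m hm1 hm2 hm3 hm4 using hm'
    obtain ⟨G, hG⟩ : ∃ G : ℝ → ℝ, G = fun t =>
      ∑ d ∈ sing A a, m d t + N * (1 + a) ^ 2 * ((1 + t) ^ 2)⁻¹ := ⟨_, rfl⟩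
    have hsub : raySet A a q s τ ⊆ Ioi 0 := fun t ht => ht.1
    have hsi : IntegrableOn (fun t => ∑ d ∈ sing A a, m d t) (Ioi 0) :=
      integrable_finsetSum _ fun d hd => hm1 d hd
    have hGi : IntegrableOn G (Ioi 0) := by
      rw [hG]
      exact Integrable.add hsi hJi
    have hGn : ∀ t, 0 < t → 0 ≤ G t := fun t ht => by
      rw [hG]
      exact add_nonneg (sum_nonneg fun d hd => hm3 d hd t ht) (by positivity)
    have hGle : ∫ t in Ioi (0 : ℝ), G t ≤ ∑ d ∈ sing A a, C + J := by
      rw [hG, integral_add hsi hJi, integral_finsetSum _ fun d hd => hm1 d hd, ← hJ]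
      gcongr with d hd
      exact hm2 d hd
    have hle : ∀ᵐ t ∂volume.restrict (raySet A a q s τ),
        ‖f (ray a q.φ s τ t)‖ / vdist a (ray a q.φ s τ t) ≤ G t := by
      filter_upwards [h.ae_ray s τ, (sing A a).eventually_all.2 fun d hd => hm4 d hd]
        with t ⟨ht0, hz, hv⟩ ht4
      have h2 := inv_sq_ray_le ha q.φ s τ ht0
      rw [div_le_iff₀ hv, hG]
      refine (hmain _ hz).trans ?_
      rw [add_mul, sum_mul]
      refine add_le_add (sum_le_sum fun d hd => ?_) ?_
      · split_ifs with hg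
        · exact (div_le_iff₀ hv).1 (ht4 d hd (hg.trans_le hrr))
        · exact mul_nonneg (hm3 d hd t ht0) hv.le
      · calc _ ≤ N * (vdist a (ray a q.φ s τ t) * ((1 + a) ^ 2 * ((1 + t) ^ 2)⁻¹)) := by gcongr
          _ = _ := by ring
    have hint := h.integrableOn_ray hfh.continuousOn s τ (hGi.mono_set hsub) hle
    refine ⟨hint, ?_⟩
    calc _ ≤ ∫ t in raySet A a q s τ, G t := integral_mono_ae hint (hGi.mono_set hsub) hle
      _ ≤ ∫ t in Ioi (0 : ℝ), G t := setIntegral_mono_set hGi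
          ((ae_restrict_mem measurableSet_Ioi).mono fun t ht => hGn t ht) hsub.eventuallyLE
      _ ≤ _ := hGle
  have hf0 : Elem0 A a p q f := by
    refine ⟨⟨hfh, ⟨E, hfE⟩, fun s τ => (hmaj s τ).1⟩, fun d hd => ?_⟩
    have hd' := mem_sing.2 hd
    have h1 : Tendsto (fun z => f z - (F z - u d z)) (towards d (region A a p)) (𝓝 0) := by
      have h2 := ((tendsto_cay ha (singPts_subset_pts hd) (region A a p)).sub_const
        (val a d)).norm.const_mul (∑ d' ∈ sing A a, C * L d d')
      rw [sub_self, norm_zero, mul_zero] at h2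
      refine squeeze_zero_norm' ?_ h2
      filter_upwards [eventually_mem_towards d (region A a p)] with z hz using hfd d hd' z hz
    simpa using h1.add (hlim d hd')
  refine ⟨_, (hf0.calc.add h hsum).congr fun z _ => ?_, ?_⟩
  · simp only [hf]
    ring
  · refine (norm_add_le _ _).trans (add_le_add ?_ ((norm_sum_le _ _).trans
      (sum_le_sum fun d hd => (norm_mul_le _ _).trans
        (mul_le_mul_of_nonneg_right (hU d hd) (norm_nonneg _)))))
    exact hcau f hf0.toElem _ (fun z hz => (hfE z hz).trans (le_max_left _ _))
      fun s τ => (hmaj s τ).2.trans (le_max_right _ _)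

end Assembly

section LocalModels

open Polynomial

lemma gap_pos (hS : Setup A ω a) (hp : Admissible A ω a p) (hd : d ∈ pts a)
    (hz : z ∈ region A a p) : 0 < gap d z := by
  rcases exists_eq_of_mem_pts hd with rfl | ⟨s, rfl⟩
  · exact (show (0 : ℝ) < (1 + ‖z‖)⁻¹ by positivity)
  · rw [gap_unit_mul]
    exact norm_pos_iff.2 (offVertices_of_mem_region hS hp hz s)

lemma le_mul_rpow {C x y α β : ℝ} (hα : 0 < α) (hαβ : α ≤ β) (hC : 0 ≤ C) (hx : 0 < x)
    (h1 : y ≤ C) (h2 : y ≤ C * x ^ β) : y ≤ C * x ^ α := by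
  rcases le_total x 1 with h | h
  · exact h2.trans (mul_le_mul_of_nonneg_left (Real.rpow_le_rpow_of_exponent_ge hx h hαβ) hC)
  · exact h1.trans (le_mul_of_one_le_right hC (Real.one_le_rpow h hα.le))

lemma Pair.ae_ray_mem (h : Pair A ω a p q) {D : Set ℂ} (hD : D ∈ codiscreteWithin (region A a p))
    (s τ : ℤˣ) : ∀ᵐ t ∂volume.restrict (raySet A a q s τ), ray a q.φ s τ t ∈ D := by
  rw [ae_restrict_iff' (measurableSet_ray _ (isOpen_cutoffs A a q) q.φ s τ (a := a)), ae_iff]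
  have h1 : (Ioi (0 : ℝ) ∩ ray a q.φ s τ ⁻¹' (region A a p \ D)).Countable := by
    refine MapsTo.countable_of_injOn (f := ray a q.φ s τ) (fun t ht => ht.2) (fun x hx y hy hxy => ?_)
      (countable_diff_of_mem_codiscreteWithin hD)
    rw [← norm_loc_ray a q.φ s τ (le_of_lt hx.1), hxy, norm_loc_ray a q.φ s τ (le_of_lt hy.1)]
  refine measure_mono_null (fun t ht => ?_) (h1.measure_zero _)
  obtain ⟨ht1, ht2⟩ := Classical.not_imp.1 ht
  exact ⟨ht1.1, h.contour_subset (.inl ⟨s, τ, t, ht1.1, rfl, ht1.2⟩), ht2⟩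

variable [CompleteSpace X] [Nontrivial X]

lemma Pair.exists_simple_bump (h : Pair A ω a p q) : ∃ C, 1 ≤ C ∧ ∀ (s : ℤˣ) (μ : ℝ), 0 < μ →
    ∃ (u : ℂ → ℂ) (U : X →L[ℂ] X), Calc A a p q u U ∧ ‖U‖ ≤ C ∧ ∀ z ∈ region A a p,
      ‖u z‖ ≤ C ∧ ‖1 - u z‖ ≤ C ∧ ‖u z‖ * ‖loc a s z‖ ≤ C * μ ∧ ‖1 - u z‖ * μ ≤ C * ‖loc a s z‖ := by
  have hsin := h.setup.sin_pos h.outer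
  obtain ⟨M, hM0, hM⟩ := h.setup.exists_norm_loc_mul_norm_res_le h.outer.1.1 h.outer.1.2
  have hC : (sin p.φ)⁻¹ ≤ max ((sin p.φ)⁻¹) M := le_max_left _ _
  have h1 : 1 ≤ (sin p.φ)⁻¹ := (one_le_inv₀ hsin).2 (Real.sin_le_one _)
  refine ⟨max ((sin p.φ)⁻¹) M, h1.trans hC, fun s μ hμ => ?_⟩
  have hu : ((s : ℤ) : ℂ) * ((s : ℤ) : ℂ) = 1 := unit_sq s
  have hloc : loc a s (((s : ℤ) : ℂ) * ((a + μ : ℝ) : ℂ)) = (μ : ℂ) := by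
    rw [loc, ← mul_assoc, hu]; push_cast; ring
  refine ⟨fun z => ((s : ℤ) : ℂ) * μ * (((s : ℤ) : ℂ) * ((a + μ : ℝ) : ℂ) - z)⁻¹, _,
    (h.calc_res s (b := a + μ) (by linarith)).const_mul h (((s : ℤ) : ℂ) * μ), ?_, fun z hz => ?_⟩
  · have := hM s (((s : ℤ) : ℂ) * ((a + μ : ℝ) : ℂ)) (by rw [hloc]; exact_mod_cast hμ.ne')
      (by rw [hloc, arg_ofReal_of_nonneg hμ.le, abs_zero]; exact h.outer.1.1)
    rw [hloc] at this
    rw [norm_smul, norm_mul, norm_unit, one_mul]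
    exact this.trans (le_max_right _ _)
  · obtain ⟨k1, k2⟩ := sin_mul_le_norm_loc_sub h.outer.1.1 (h.setup.lt_pi_div_two h.outer) hz.1 s hμ.le
    have hpos : 0 < ‖loc a s z - μ‖ := (mul_pos hsin hμ).trans_le k1
    have hne : loc a s z - μ ≠ 0 := norm_pos_iff.1 hpos
    have e0 : ((s : ℤ) : ℂ) * ((a + μ : ℝ) : ℂ) - z = -(((s : ℤ) : ℂ) * (loc a s z - μ)) := by
      rw [loc, mul_sub, mul_sub, ← mul_assoc, hu]; push_cast; ring
    have hs0 : ((s : ℤ) : ℂ) ≠ 0 := left_ne_zero_of_mul_eq_one hu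
    have e1 : ((s : ℤ) : ℂ) * μ * (((s : ℤ) : ℂ) * ((a + μ : ℝ) : ℂ) - z)⁻¹ =
        -(μ / (loc a s z - μ)) := by
      rw [e0]; field_simp
    have e2 : 1 - -((μ : ℂ) / (loc a s z - μ)) = loc a s z / (loc a s z - μ) := by field_simp; ring
    have n1 : ‖-((μ : ℂ) / (loc a s z - μ))‖ = μ / ‖loc a s z - μ‖ := by
      rw [norm_neg, norm_div, norm_real, norm_of_nonneg hμ.le]
    simp only [e1, e2, n1, norm_div]
    have hl := norm_nonneg (loc a s z)
    have g1 : μ / ‖loc a s z - μ‖ ≤ (sin p.φ)⁻¹ := by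
      rw [div_le_iff₀ hpos, inv_mul_eq_div, le_div_iff₀ hsin, mul_comm]; exact k1
    have g2 : ‖loc a s z‖ / ‖loc a s z - μ‖ ≤ (sin p.φ)⁻¹ := by
      rw [div_le_iff₀ hpos, inv_mul_eq_div, le_div_iff₀ hsin, mul_comm]; exact k2
    refine ⟨g1.trans hC, g2.trans hC, ?_, ?_⟩
    · rw [div_mul_eq_mul_div, mul_comm μ, ← div_mul_eq_mul_div]
      simp_all
    · rw [div_mul_eq_mul_div, mul_comm _ μ, ← div_mul_eq_mul_div]
      exact mul_le_mul_of_nonneg_right (g1.trans hC) hl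

lemma Pair.exists_bump (h : Pair A ω a p q) (hd : d ∈ pts a) : ∃ r > 0, ∃ C, 1 ≤ C ∧
    ∀ μ, 0 < μ → ∃ (u : ℂ → ℂ) (U : X →L[ℂ] X), Calc A a p q u U ∧ ‖U‖ ≤ C ∧
      ∀ z ∈ region A a p, ‖u z‖ ≤ C ∧ ‖1 - u z‖ ≤ C ∧ (gap d z < r →
        ‖u z‖ ≤ C * (μ / gap d z) ∧ ‖1 - u z‖ ≤ C * (gap d z / μ)) := by
  obtain ⟨C, hC1, hC⟩ := h.exists_simple_bump
  have hd' := hd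
  rcases exists_eq_of_mem_pts hd with rfl | ⟨s, rfl⟩
  · obtain ⟨r, hr, -, K, hK1, -, hK, -⟩ := exists_gap_compare h.setup.ha hd
    refine ⟨r, hr, C * K + 1, by nlinarith, fun μ hμ => ?_⟩
    obtain ⟨u, U, h1, h2, h3⟩ := hC 1 μ⁻¹ (inv_pos.2 hμ)
    have hCK : C ≤ C * K := le_mul_of_one_le_right (by linarith) hK1
    refine ⟨fun z => 1 - u z, 1 - U, ?_, ?_, fun z hz => ?_⟩
    · have := (h.calc_eval 1).sub h h1
      simpa using this
    · exact (norm_sub_le _ _).trans (by rw [norm_one]; linarith)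
    · obtain ⟨k1, k2, k3, k4⟩ := h3 z hz
      have hg := gap_pos h.setup h.outer hd' hz
      obtain ⟨j1, j2⟩ : (gap infty z < r → _) ∧ (gap infty z < r → _) :=
        ⟨fun hgr => (hK 1 z hgr hg.ne' rfl).1, fun hgr => (hK 1 z hgr hg.ne' rfl).2⟩
      rw [sub_sub_cancel]
      refine ⟨by linarith, by linarith, fun hgr => ?_⟩
      have j1 := j1 hgr
      have j2 := j2 hgr
      constructor
      · rw [mul_div_assoc', le_div_iff₀ hg]
        have k5 : ‖1 - u z‖ ≤ C * ‖loc a 1 z‖ * μ := by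
          have := mul_le_mul_of_nonneg_right k4 hμ.le
          rwa [mul_assoc, inv_mul_cancel₀ hμ.ne', mul_one] at this
        calc _ ≤ C * ‖loc a 1 z‖ * μ * gap infty z := by gcongr
          _ = C * (gap infty z * ‖loc a 1 z‖) * μ := by ring
          _ ≤ C * K * μ := by gcongr
          _ ≤ _ := by nlinarith
      · rw [mul_div_assoc', le_div_iff₀ hμ]
        have k5 : ‖u z‖ * ‖loc a 1 z‖ * μ ≤ C := by
          have := mul_le_mul_of_nonneg_right k3 hμ.le
          rwa [mul_assoc C, inv_mul_cancel₀ hμ.ne', mul_one] at this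
        calc ‖u z‖ * μ = ‖u z‖ * μ * 1 := (mul_one _).symm
          _ ≤ ‖u z‖ * μ * (K * (gap infty z * ‖loc a 1 z‖)) := by gcongr
          _ = ‖u z‖ * ‖loc a 1 z‖ * μ * (K * gap infty z) := by ring
          _ ≤ C * (K * gap infty z) := by gcongr
          _ ≤ _ := by nlinarith
  · refine ⟨1, one_pos, C, hC1, fun μ hμ => ?_⟩
    obtain ⟨u, U, h1, h2, h3⟩ := hC s μ hμ
    refine ⟨u, U, h1, h2, fun z hz => ?_⟩
    obtain ⟨k1, k2, k3, k4⟩ := h3 z hz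
    have hg := gap_pos h.setup h.outer hd' hz
    rw [← gap_unit_mul] at k3 k4
    refine ⟨k1, k2, fun _ => ⟨?_, ?_⟩⟩
    · rwa [mul_div_assoc', le_div_iff₀ hg]
    · rwa [mul_div_assoc', le_div_iff₀ hμ]

lemma Pair.exists_near_of_decay (h : Pair A ω a p q) (hd : d ∈ pts a) {α r₀ K : ℝ}
    (hα : 0 < α) (hα1 : α ≤ 1) (hr₀ : 0 < r₀) (hK : 0 ≤ K) : ∃ r > 0, ∃ C, ∀ μ, 0 < μ → ∀ Q : ℂ → ℂ,
      (∀ z ∈ region A a p, gap d z < r₀ →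
        ‖1 - Q z‖ ≤ K * (gap d z / μ) ^ α ∧ ‖Q z‖ ≤ K * (μ / gap d z) ^ α) →
      Near A a p q d r C Q := by
  obtain ⟨r₁, hr₁, C₁, hC₁, hb⟩ := h.exists_bump hd
  obtain ⟨r₂, hr₂, -, K₂, hK₂, -, hg1, hg2⟩ := exists_gap_compare h.setup.ha hd
  obtain ⟨J, hJ⟩ : ∃ J : ℝ, J = ∫ t in Ioi (0 : ℝ), min (t ^ α) (t ^ (-α)) / t := ⟨_, rfl⟩
  obtain ⟨E, hE⟩ : ∃ E, E = K + C₁ := ⟨_, rfl⟩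
  have hE0 : 0 ≤ E := by linarith
  refine ⟨min r₀ (min r₁ r₂), by positivity, max C₁ (E * K₂ * K₂ * J), fun μ hμ Q hQ => ?_⟩
  obtain ⟨u, U, h1, h2, h3⟩ := hb μ hμ
  have hQu : ∀ z ∈ region A a p, gap d z < min r₀ (min r₁ r₂) →
      ‖Q z - u z‖ ≤ E * (gap d z / μ) ^ α ∧ ‖Q z - u z‖ ≤ E * (μ / gap d z) ^ α := by
    intro z hz hr
    obtain ⟨k1, k2, k3⟩ := h3 z hz
    obtain ⟨k4, k5⟩ := k3 (hr.trans_le ((min_le_right _ _).trans (min_le_left _ _)))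
    have hg := gap_pos h.setup h.outer hd hz
    obtain ⟨k6, k7⟩ := hQ z hz (hr.trans_le (min_le_left _ _))
    have k8 := le_mul_rpow (x := μ / gap d z) hα hα1 (by linarith) (by positivity) k1 (by simpa using k4)
    have k9 := le_mul_rpow (x := gap d z / μ) hα hα1 (by linarith) (by positivity) k2 (by simpa using k5)
    rw [hE, add_mul, add_mul]
    constructor
    · have : Q z - u z = (1 - u z) - (1 - Q z) := by ring
      rw [this, add_comm]
      exact (norm_sub_le _ _).trans (add_le_add k9 k6)
    · exact (norm_sub_le _ _).trans (add_le_add k7 k8)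
  refine ⟨u, U, h1, h2.trans (le_max_left _ _), fun z hz => (h3 z hz).1.trans (le_max_left _ _), ?_,
    fun s τ => ?_⟩
  · have ht : Tendsto (fun z => E * (gap d z / μ) ^ α) (towards d (region A a p)) (𝓝 0) := by
      have := (((tendsto_gap d (region A a p)).div_const μ).rpow_const (.inr hα.le)).const_mul E
      rwa [zero_div, Real.zero_rpow hα.ne', mul_zero] at this
    refine squeeze_zero_norm' ?_ ht
    exact eventually_towards_iff.2 ⟨_, by positivity, fun z hz hr => (hQu z hz hr).1⟩
  · obtain ⟨ν, hν, hcmp⟩ : ∃ ν > 0, ∀ z ∈ region A a p, ∀ t, 0 < t → gap d z < min r₀ (min r₁ r₂) →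
        z = ray a q.φ s τ t → ‖Q z - u z‖ ≤ E * K₂ * min ((ν * t) ^ α) ((ν * t) ^ (-α)) := by
      have hθ : |q.φ| < π / 2 := by rw [abs_of_pos h.inner.1.1]; exact h.setup.lt_pi_div_two h.inner
      have hKα : K₂ ^ α ≤ K₂ := by simpa using Real.rpow_le_rpow_of_exponent_le hK₂ hα1
      have hEK : E ≤ E * K₂ := le_mul_of_one_le_right hE0 hK₂
      have hE1 : ∀ x y : ℝ, 0 < x → 0 < y → x ≤ K₂ * y → E * x ^ α ≤ E * K₂ * y ^ α := by
        intro x y hx hy hxy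
        rw [mul_assoc]
        refine mul_le_mul_of_nonneg_left ?_ hE0
        calc x ^ α ≤ (K₂ * y) ^ α := Real.rpow_le_rpow hx.le hxy hα.le
          _ = K₂ ^ α * y ^ α := Real.mul_rpow (by linarith) hy.le
          _ ≤ _ := by gcongr
      by_cases hi : d = infty
      · refine ⟨μ, hμ, fun z hz t ht hr e => ?_⟩
        have hg := gap_pos h.setup h.outer hd hz
        obtain ⟨k1, k2⟩ := hQu z hz hr
        obtain ⟨k3, k4⟩ := hg1 s z (hr.trans_le ((min_le_right _ _).trans (min_le_right _ _))) hg.ne' hi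
        have e2 : ‖loc a s z‖ = t := by rw [e, norm_loc_ray a q.φ s τ ht.le]
        rw [e2] at k3 k4
        rw [mul_min_of_nonneg _ _ (by positivity), rpow_neg (by positivity),
          ← inv_rpow (by positivity)]
        refine le_min (k2.trans (hE1 _ _ (by positivity) (by positivity) ?_))
          (k1.trans (hE1 _ _ (by positivity) (by positivity) ?_))
        · rw [div_le_iff₀ hg]
          calc μ = μ * 1 := (mul_one _).symm
            _ ≤ μ * (K₂ * (gap d z * t)) := by gcongr
            _ = _ := by ring
        · rw [div_le_iff₀ hμ, mul_inv, mul_assoc, mul_assoc, mul_comm t⁻¹, ← mul_assoc μ⁻¹,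
            inv_mul_cancel₀ hμ.ne', one_mul, ← div_eq_mul_inv, le_div_iff₀ ht]
          exact k4
      · refine ⟨μ⁻¹, inv_pos.2 hμ, fun z hz t ht hr e => ?_⟩
        obtain ⟨k1, k2⟩ := hQu z hz hr
        have hg := gap_pos h.setup h.outer hd hz
        have k3 := (hg2 q.φ s τ t hθ ht (by
          rw [← e]; exact hr.trans_le ((min_le_right _ _).trans (min_le_right _ _)))).2
        rcases k3 with ⟨-, k4⟩ | k4
        swap
        · exact absurd k4 hi
        rw [← e] at k4
        rw [k4] at k1 k2
        rw [mul_min_of_nonneg _ _ (by positivity), rpow_neg (by positivity),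
          ← inv_rpow (by positivity), mul_inv, inv_inv, ← div_eq_inv_mul, ← div_eq_mul_inv]
        exact le_min (k1.trans (by gcongr)) (k2.trans (by gcongr))
    obtain ⟨j1, j2⟩ := integral_min_rpow_div_scale hα hν
    refine ⟨fun t => E * K₂ * K₂ * (min ((ν * t) ^ α) ((ν * t) ^ (-α)) / t), Integrable.const_mul j1 _,
      ?_, fun t ht => by positivity, ?_⟩
    · rw [integral_const_mul, j2, ← hJ]
      exact le_max_right _ _
    · filter_upwards [ae_restrict_mem
        (measurableSet_ray _ (isOpen_cutoffs A a q) q.φ s τ (a := a))] with t ht hr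
      have hz := h.contour_subset (.inl ⟨s, τ, t, ht.1, rfl, ht.2⟩)
      have hv := vdist_pos (offVertices_of_mem_region h.setup h.outer hz)
      have ht0 : (0 : ℝ) < t := ht.1
      have k1 := hcmp _ hz t ht0 hr rfl
      have hθ : |q.φ| < π / 2 := by rw [abs_of_pos h.inner.1.1]; exact h.setup.lt_pi_div_two h.inner
      have k2 := (hg2 q.φ s τ t hθ ht0
        (hr.trans_le ((min_le_right _ _).trans (min_le_right _ _)))).1
      rw [div_le_iff₀ hv]
      refine k1.trans ?_
      have k3 : 1 ≤ K₂ * vdist a (ray a q.φ s τ t) / t := by rwa [le_div_iff₀ ht0, one_mul]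
      calc _ = E * K₂ * min ((ν * t) ^ α) ((ν * t) ^ (-α)) * 1 := (mul_one _).symm
        _ ≤ E * K₂ * min ((ν * t) ^ α) ((ν * t) ^ (-α)) *
            (K₂ * vdist a (ray a q.φ s τ t) / t) := by gcongr
        _ = _ := by ring

lemma Pair.exists_near_of_regular (h : Pair A ω a p q) (hd : d ∈ singPts A a) {D : Set ℂ}
    (hD : D ∈ codiscreteWithin (region A a p)) {g : ℂ → ℂ} {c : ℂ}
    (hg : Tendsto g (towards d (region A a p)) (𝓝 c)) {V : Set ℂ}
    (hV : V ∈ comap (fun z : ℂ => (z : OnePoint ℂ)) (𝓝 d)) (hint : ∀ s τ : ℤˣ, IntegrableOn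
      (fun t => ‖g (ray a q.φ s τ t) - c‖ / absAt d (ray a q.φ s τ t))
      {t : ℝ | 0 < t ∧ ray a q.φ s τ t ∈ V}) {K : ℝ} (hK : 0 < K) :
    ∃ r > 0, ∃ C, ∀ (F : ℂ → ℂ) (c' : ℂ), ContinuousOn F (region A a p) → ‖c'‖ ≤ K →
      (∀ z ∈ region A a p ∩ D, ‖F z - c'‖ ≤ K * ‖g z - c‖) → Near A a p q d r C F := by
  have hdp := singPts_subset_pts hd
  obtain ⟨r₁, hr₁, hr₁1, K₁, hK₁, hcmp, -, -⟩ := exists_gap_compare h.setup.ha hdp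
  obtain ⟨r₂, hr₂, hr₂V⟩ : ∃ r > 0, ∀ z, gap d z < r → z ∈ V := by
    have h1 : ∀ᶠ z in towards d univ, z ∈ V := by rw [towards, principal_univ, inf_top_eq]; exact hV
    obtain ⟨r, hr, hrV⟩ := eventually_towards_iff.1 h1
    grind
  obtain ⟨r, hr⟩ : ∃ r, r = min r₁ r₂ := ⟨_, rfl⟩
  have hr0 : 0 < r := by rw [hr]; positivity
  have hrr₁ : r ≤ r₁ := by rw [hr]; exact min_le_left _ _
  have hrr₂ : r ≤ r₂ := by rw [hr]; exact min_le_right _ _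
  obtain ⟨I, hI⟩ : ∃ I : ℤˣ → ℤˣ → ℝ, I = fun s τ => ∫ t in {t : ℝ | 0 < t ∧
      ray a q.φ s τ t ∈ {z | gap d z < r}}, K * K₁ *
        (‖g (ray a q.φ s τ t) - c‖ / absAt d (ray a q.φ s τ t)) := ⟨_, rfl⟩
  obtain ⟨C, hC⟩ : ∃ C, C = max (K * ‖(1 : X →L[ℂ] X)‖) (max K (∑ s, ∑ τ, |I s τ|)) := ⟨_, rfl⟩
  have hKC : K ≤ C := by rw [hC]; exact le_max_of_le_right (le_max_left _ _)
  refine ⟨r, hr0, C, fun F c' hF hc' hFg => ?_⟩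
  have hopen : IsOpen {z | gap d z < r} := isOpen_lt (continuous_gap d) continuous_const
  refine ⟨fun _ => c', c' • 1, ?_, ?_, fun z _ => hc'.trans hKC, ?_, fun s τ => ?_⟩
  · have := (h.calc_eval 1).const_mul h c'
    simpa using this
  · simp_all
  · rw [Metric.tendsto_nhds]
    intro ε hε
    have h1 := Metric.tendsto_nhds.1 hg (ε / 2 / K) (by positivity)
    obtain ⟨r', hr', h2⟩ := eventually_towards_iff.1 h1
    refine eventually_towards_iff.2 ⟨r', hr', fun z hz hgz => ?_⟩
    have h3 := le_of_mem_codiscreteWithin (W := region A a p ∩ {z | gap d z < r'}) hD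
      (h.isOpen.inter (isOpen_lt (continuous_gap d) continuous_const)) inter_subset_left
      (f := fun z => ‖F z - c'‖) (b := fun _ => ε / 2)
      ((hF.mono inter_subset_left).sub continuousOn_const).norm continuousOn_const
      (fun w hw => (hFg w ⟨hw.1.1, hw.2⟩).trans ?_) z ⟨hz, hgz⟩
    · rw [dist_zero_right]
      exact h3.trans_lt (by linarith)
    · have h4 := h2 w hw.1.1 hw.1.2
      rw [dist_eq_norm, lt_div_iff₀ hK] at h4
      linarith
  · have hms := measurableSet_ray _ hopen q.φ s τ (a := a)
    have hi : IntegrableOn (fun t => K * K₁ *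
        (‖g (ray a q.φ s τ t) - c‖ / absAt d (ray a q.φ s τ t)))
        {t : ℝ | 0 < t ∧ ray a q.φ s τ t ∈ {z | gap d z < r}} :=
      Integrable.const_mul (IntegrableOn.mono_set (hint s τ) fun t ht =>
        ⟨ht.1, hr₂V _ (ht.2.trans_le hrr₂)⟩) _
    have hsub : {t : ℝ | 0 < t ∧ ray a q.φ s τ t ∈ {z | gap d z < r}} ⊆ Ioi 0 := fun t ht => ht.1
    refine ⟨indicator {t : ℝ | 0 < t ∧ ray a q.φ s τ t ∈ {z | gap d z < r}} fun t => K * K₁ *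
        (‖g (ray a q.φ s τ t) - c‖ / absAt d (ray a q.φ s τ t)), ?_, ?_, fun t ht => ?_, ?_⟩
    · exact ((integrable_indicator_iff hms).2 hi).integrableOn
    · rw [setIntegral_indicator hms, inter_eq_right.2 hsub]
      have e1 := congrFun (congrFun hI s) τ
      refine e1.ge.trans ?_
      rw [hC]
      refine le_max_of_le_right (le_max_of_le_right ((le_abs_self _).trans ?_))
      exact (single_le_sum (f := fun τ => |I s τ|) (fun _ _ => abs_nonneg _)
        (Finset.mem_univ τ)).trans (single_le_sum (f := fun s => ∑ τ, |I s τ|)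
          (fun _ _ => sum_nonneg fun _ _ => abs_nonneg _) (Finset.mem_univ s))
    · refine indicator_nonneg (fun t _ => ?_) t
      have : 0 ≤ absAt d (ray a q.φ s τ t) := by
        induction d using OnePoint.rec <;> exact norm_nonneg _
      positivity
    · filter_upwards [ae_restrict_mem
        (measurableSet_ray _ (isOpen_cutoffs A a q) q.φ s τ (a := a)), h.ae_ray_mem hD s τ]
        with t ht htD hgr
      have hz := h.contour_subset (.inl ⟨s, τ, t, ht.1, rfl, ht.2⟩)
      have hv := vdist_pos (offVertices_of_mem_region h.setup h.outer hz)
      have hgp := gap_pos h.setup h.outer hdp hz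
      have habs : 0 < absAt d (ray a q.φ s τ t) := by
        rcases exists_eq_of_mem_pts hdp with rfl | ⟨s', rfl⟩
        · refine lt_of_le_of_ne (norm_nonneg _) fun h0 => ?_
          have h1 : gap infty (ray a q.φ s τ t) = 1 := by
            change (1 + ‖ray a q.φ s τ t‖)⁻¹ = 1
            change 0 = ‖ray a q.φ s τ t‖ at h0
            rw [← h0]; simp
          linarith
        · exact hgp
      rw [indicator_of_mem (show t ∈ {t : ℝ | 0 < t ∧ gap d (ray a q.φ s τ t) < r} from
        ⟨ht.1, hgr⟩), div_le_iff₀ hv]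
      refine (hFg _ ⟨hz, htD⟩).trans ?_
      have k3 : 1 ≤ K₁ * vdist a (ray a q.φ s τ t) / absAt d (ray a q.φ s τ t) := by
        rw [le_div_iff₀ habs, one_mul]; exact (hcmp _ (hgr.trans_le hrr₁)).1
      calc _ = K * ‖g (ray a q.φ s τ t) - c‖ * 1 := (mul_one _).symm
        _ ≤ K * ‖g (ray a q.φ s τ t) - c‖ *
            (K₁ * vdist a (ray a q.φ s τ t) / absAt d (ray a q.φ s τ t)) := by gcongr
        _ = _ := by ring

end LocalModels

lemma abs_arg_le_of_mem_closure {γ : ℝ} (h0 : 0 < γ) (hπ : γ ≤ π) {w : ℂ}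
    (hw : w ∈ closure (sector γ)) : |w.arg| ≤ γ := by
  have h1 : closure (sector γ) ⊆ {w | ‖w‖ * cos γ ≤ w.re} := by
    refine closure_minimal (fun w hw => ?_) (isClosed_le (by fun_prop) continuous_re)
    rcases hw with h | h
    · exact absurd h.1 h0.ne'
    · exact (abs_arg_le_iff h0.le hπ w).1 h.2.2.le
  exact (abs_arg_le_iff h0.le hπ w).2 (h1 hw)

lemma mem_closure_sector {β : ℝ} (h0 : 0 ≤ β) {w : ℂ} (hw : w = 0 ∨ |w.arg| ≤ β) :
    w ∈ closure (sector β) := by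
  have hreal : ∀ t : ℝ, 0 < t → (t : ℂ) ∈ sector β := fun t ht => by
    rcases h0.eq_or_lt with h | h
    · exact .inl ⟨h.symm, by simpa using ht, by simp⟩
    · refine .inr ⟨h.ne', by exact_mod_cast ht.ne', ?_⟩
      rwa [arg_ofReal_of_nonneg ht.le, abs_zero]
  by_cases hw0 : w = 0
  · have h1 : Tendsto (fun t : ℝ => (t : ℂ)) (𝓝[>] 0) (𝓝 w) := by
      rw [hw0]
      exact (Complex.continuous_ofReal.tendsto' 0 0 (by simp)).mono_left nhdsWithin_le_nhds
    exact mem_closure_of_tendsto h1 (eventually_mem_nhdsWithin.mono hreal)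
  have hβ := hw.resolve_left hw0
  have hn : 0 < ‖w‖ := norm_pos_iff.2 hw0
  rcases eq_or_ne w.arg 0 with ha | ha
  · have : w = (‖w‖ : ℂ) := by
      have := Complex.norm_mul_exp_arg_mul_I w
      simp_all
    rw [this]
    exact subset_closure (hreal _ hn)
  · have h1 : Tendsto (fun t : ℝ => (‖w‖ : ℂ) * exp ((t * w.arg : ℝ) * I))
        (𝓝[<] 1) (𝓝 w) := by
      have : Continuous fun t : ℝ => (‖w‖ : ℂ) * exp ((t * w.arg : ℝ) * I) := by
        fun_prop
      refine (this.tendsto' 1 w ?_).mono_left nhdsWithin_le_nhds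
      simp_all
    refine mem_closure_of_tendsto h1 ?_
    filter_upwards [Ioo_mem_nhdsLT (zero_lt_one (α := ℝ))] with t ht
    have ha' := abs_pos.2 ha
    have h2 : |t * w.arg| < |w.arg| := by rw [abs_mul, abs_of_pos ht.1]; nlinarith [ht.2]
    have h3 : t * w.arg ∈ Ioc (-π) π := by
      have := abs_lt.1 (h2.trans_le (abs_arg_le_pi w))
      exact ⟨this.1, this.2.le⟩
    refine .inr ⟨(ha'.trans_le hβ).ne', ?_, ?_⟩
    · simp_all
    · rw [exp_mul_I, Complex.arg_mul_cos_add_sin_mul_I hn h3]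
      exact h2.trans_le hβ

lemma exists_sector_gap {γ φ : ℝ} (hγ : γ < φ) : ∃ κ > 0, ∀ lam w : ℂ,
    φ ≤ |lam.arg| → |w.arg| ≤ γ → κ * ‖lam‖ ≤ ‖lam - w‖ ∧ κ * ‖w‖ ≤ ‖lam - w‖ := by
  have hπ := pi_pos
  have h1 : γ < min φ (γ + π / 2) := lt_min hγ (by linarith)
  have h2 : min φ (γ + π / 2) - γ ≤ π / 2 := by linarith [min_le_right φ (γ + π / 2)]
  refine ⟨sin (min φ (γ + π / 2) - γ),
    sin_pos_of_pos_of_lt_pi (by linarith) (by linarith), fun lam w hl hw => ?_⟩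
  have := sin_mul_norm_le_norm_sub h1 hw ((min_le_left _ _).trans hl)
  rw [norm_sub_rev w] at this
  exact this.symm

section Parameters

variable {p' : Params}

lemma region_mono (h0 : 0 < p.φ) (hφ : p.φ ≤ p'.φ) (hφ' : p'.φ < π / 2) (hε : p.ε ≤ p'.ε)
    (hR : p'.R ≤ p.R) : region A a p' ⊆ region A a p := fun _ hz =>
  ⟨bisector_mono h0 hφ hφ' hz.1, fun d hd hs => hε.trans_lt (hz.2.1 d hd hs),
    fun hi => (hz.2.2 hi).trans_le hR⟩

lemma Admissible.sup (hp : Admissible A ω a p) (hp' : Admissible A ω a p') {ψ : ℝ} (hψ : ψ < ω) :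
    Admissible A ω a ⟨max (max p.φ p'.φ) ψ, max p.ε p'.ε, min p.R p'.R⟩ := by
  refine ⟨⟨lt_max_of_lt_left (lt_max_of_lt_left hp.1.1), max_lt (max_lt hp.1.2 hp'.1.2) hψ⟩,
    ⟨lt_max_of_lt_left hp.2.1.1, fun h => max_lt (hp.2.1.2.1 h) (hp'.2.1.2.1 h), fun d hd hs => ?_⟩,
    lt_min hp.2.2.1 hp'.2.2.1, fun hi => ?_⟩
  · rcases max_choice p.ε p'.ε with h | h
    · simp only [h]; exact hp.2.1.2.2 d hd hs
    · simp only [h]; exact hp'.2.1.2.2 d hd hs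
  · rcases min_choice p.R p'.R with h | h
    · simp only [h]; exact hp.2.2.2 hi
    · simp only [h]; exact hp'.2.2.2 hi

end Parameters

section LocalForms

open Asymptotics

/-- The possible behaviours of `g` at `d`, within `BS_{ψ,a}`: either `g` or `1/g` is regular with a
limit other than `0`, or one of them tends to `0` exactly polynomially. -/
def LocalForm (g : ℂ → ℂ) (a : ℝ) (d : OnePoint ℂ) (ψ : ℝ) : Prop :=
  (∃ f, (f = g ∨ f = g⁻¹) ∧ ∃ c ≠ 0, Tendsto f (towards d (bisector ψ a)) (𝓝 c) ∧
    ∃ V ∈ comap (fun z : ℂ => (z : OnePoint ℂ)) (𝓝 d), ∀ θ ∈ Ioo ψ (π / 2), ∀ s τ : ℤˣ,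
      IntegrableOn (fun t => ‖f (ray a θ s τ t) - c‖ / absAt d (ray a θ s τ t))
        {t : ℝ | 0 < t ∧ ray a θ s τ t ∈ V}) ∨
  ∃ f, (f = g ∨ f = g⁻¹) ∧ ∃ α > (0 : ℝ), f =Θ[towards d (bisector ψ a)] fun z => gap d z ^ α

variable {g : ℂ → ℂ}

lemma LocalForm.mono {ψ ψ' : ℝ} (h : LocalForm g a d ψ) (h0 : 0 < ψ) (hψ : ψ ≤ ψ')
    (hψ' : ψ' < π / 2) : LocalForm g a d ψ' := by
  have hle := towards_mono (d := d) (bisector_mono (a := a) h0 hψ hψ')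
  rcases h with ⟨f, hf, c, hc, ht, V, hV, hi⟩ | ⟨f, hf, α, hα, h1⟩
  · exact .inl ⟨f, hf, c, hc, ht.mono_left hle, V, hV, fun θ hθ => hi θ ⟨hψ.trans_lt hθ.1, hθ.2⟩⟩
  · exact .inr ⟨f, hf, α, hα, h1.mono hle⟩

lemma isTheta_gap (d : OnePoint ℂ) (Ω : Set ℂ) {α : ℝ} (hα : 0 < α) :
    (fun z => d.elim (‖z‖ ^ (-α)) fun d' => ‖z - d'‖ ^ α) =Θ[towards d Ω] fun z => gap d z ^ α := by
  induction d using OnePoint.rec with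
  | infty =>
    have hev : ∀ᶠ z in towards infty Ω, 1 ≤ ‖z‖ := by
      refine eventually_towards_iff.2 ⟨2⁻¹, by positivity, fun z _ hg => ?_⟩
      have h1 : (1 + ‖z‖)⁻¹ < 2⁻¹ := hg
      have := (inv_lt_inv₀ (by positivity) two_pos).1 h1
      linarith
    constructor
    · refine IsBigO.of_bound (2 ^ α) (hev.mono fun z hz => ?_)
      have h0 : 0 < ‖z‖ := by linarith
      change ‖‖z‖ ^ (-α)‖ ≤ 2 ^ α * ‖(1 + ‖z‖)⁻¹ ^ α‖
      rw [norm_of_nonneg (by positivity), norm_of_nonneg (by positivity),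
        rpow_neg h0.le, ← inv_rpow h0.le, ← Real.mul_rpow two_pos.le (by positivity)]
      refine Real.rpow_le_rpow (by positivity) ?_ hα.le
      rw [← div_eq_mul_inv, le_div_iff₀ (by positivity), inv_mul_le_iff₀ h0]
      linarith
    · refine IsBigO.of_bound 1 (hev.mono fun z hz => ?_)
      have h0 : 0 < ‖z‖ := by linarith
      change ‖(1 + ‖z‖)⁻¹ ^ α‖ ≤ 1 * ‖‖z‖ ^ (-α)‖
      rw [norm_of_nonneg (by positivity), norm_of_nonneg (by positivity),
        rpow_neg h0.le, ← inv_rpow h0.le, one_mul]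
      exact Real.rpow_le_rpow (by positivity) (inv_anti₀ h0 (by linarith)) hα.le
  | coe d => exact isTheta_refl _ _

lemma exists_localForm (hω : ω ≤ π / 2) (h_quasi : QuasiRegularAt g ω a d)
    (h_poly : (TendsAt g ω a d 0 → ExactPolyZeroAt g ω a d) ∧
      (TendsAt g⁻¹ ω a d 0 → ExactPolyZeroAt g⁻¹ ω a d)) :
    ∃ ψ ∈ Ioo 0 ω, LocalForm g a d ψ := by
  have key : ∀ f, (f = g ∨ f = g⁻¹) → RegularAt f ω a d →
      (TendsAt f ω a d 0 → ExactPolyZeroAt f ω a d) → ∃ ψ ∈ Ioo 0 ω, LocalForm g a d ψ := by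
    rintro f hf ⟨c, hc, φ₂, hφ₂, V, hV, hi⟩ hp
    by_cases hc0 : c = 0
    · subst hc0
      obtain ⟨φ, hφ, α, hα, h1⟩ := hp hc
      exact ⟨φ, hφ, .inr ⟨f, hf, α, hα, h1.trans (isTheta_gap d _ hα)⟩⟩
    · obtain ⟨φ₁, hφ₁, ht⟩ := hc
      refine ⟨max φ₁ φ₂, ⟨lt_max_of_lt_left hφ₁.1, max_lt hφ₁.2 hφ₂.2⟩, .inl ⟨f, hf, c, hc0,
        ht.mono_left (towards_mono (bisector_mono hφ₁.1 (le_max_left _ _)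
          ((max_lt hφ₁.2 hφ₂.2).trans_le hω))), V, hV, fun θ hθ =>
          hi θ ⟨(le_max_right _ _).trans_lt hθ.1, hθ.2⟩⟩⟩
  rcases h_quasi with h | h
  · exact key g (.inl rfl) h h_poly.1
  · simp_all

variable [CompleteSpace X] [Nontrivial X]

lemma Pair.exists_near_of_poly (h : Pair A ω a p q) (hd : d ∈ pts a) {D : Set ℂ}
    (hD : D ∈ codiscreteWithin (region A a p)) {α r₀ K : ℝ} (hα : 0 < α) (hr₀ : 0 < r₀)
    (hK : 0 ≤ K) : ∃ r > 0, ∃ C, ∀ L, 0 < L → ∀ Q : ℂ → ℂ, ContinuousOn Q (region A a p) →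
      (∀ z ∈ region A a p ∩ D, gap d z < r₀ → (‖1 - Q z‖ ≤ K ∧ ‖Q z‖ ≤ K) ∧
        ‖1 - Q z‖ * L ≤ K * gap d z ^ α ∧ ‖Q z‖ * gap d z ^ α ≤ K * L) → Near A a p q d r C Q := by
  obtain ⟨r, hr, C, hC⟩ := h.exists_near_of_decay hd (α := min α 1) (r₀ := r₀) (K := K)
    (lt_min hα one_pos) (min_le_right _ _) hr₀ hK
  refine ⟨r, hr, C, fun L hL Q hQ hb => hC (L ^ α⁻¹) (by positivity) Q fun z hz hg => ?_⟩
  have hμ : (L ^ α⁻¹) ^ α = L := Real.rpow_inv_rpow hL.le hα.ne'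
  have hmin : 0 < min α 1 := lt_min hα one_pos
  have ho : IsOpen (region A a p ∩ {z | gap d z < r₀}) :=
    h.isOpen.inter (isOpen_lt (continuous_gap d) continuous_const)
  have hQ' := hQ.mono (inter_subset_left (t := {z | gap d z < r₀}))
  have hgp : ∀ w ∈ region A a p, 0 < gap d w := fun w hw => gap_pos h.setup h.outer hd hw
  constructor
  · refine le_of_mem_codiscreteWithin hD ho inter_subset_left
      (f := fun z => ‖1 - Q z‖) (b := fun z => K * (gap d z / L ^ α⁻¹) ^ min α 1)
      (continuousOn_const.sub hQ').norm ?_ (fun w hw => ?_) z ⟨hz, hg⟩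
    · exact (continuous_const.mul (((continuous_gap d).div_const _).rpow_const
        fun _ => .inr hmin.le)).continuousOn
    · obtain ⟨⟨k1, -⟩, k2, -⟩ := hb w ⟨hw.1.1, hw.2⟩ hw.1.2
      have hgw := hgp w hw.1.1
      refine le_mul_rpow hmin (min_le_left _ _) hK (by positivity) k1 ?_
      rw [Real.div_rpow hgw.le (by positivity), hμ, mul_div_assoc', le_div_iff₀ hL]
      exact k2
  · refine le_of_mem_codiscreteWithin hD ho inter_subset_left
      (f := fun z => ‖Q z‖) (b := fun z => K * (L ^ α⁻¹ / gap d z) ^ min α 1)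
      hQ'.norm ?_ (fun w hw => ?_) z ⟨hz, hg⟩
    · exact continuousOn_const.mul ((continuousOn_const.div (continuous_gap d).continuousOn
        fun w hw => (hgp w hw.1).ne').rpow_const fun _ _ => .inr hmin.le)
    · obtain ⟨⟨-, k1⟩, -, k2⟩ := hb w ⟨hw.1.1, hw.2⟩ hw.1.2
      have hgw := hgp w hw.1.1
      refine le_mul_rpow hmin (min_le_left _ _) hK (by positivity) k1 ?_
      rw [Real.div_rpow (by positivity) hgw.le, hμ, mul_div_assoc', le_div_iff₀ (by positivity)]
      exact k2

lemma Pair.exists_near (h : Pair A ω a p q) (hd : d ∈ singPts A a) {D : Set ℂ}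
    (hD : D ∈ codiscreteWithin (region A a p)) {γ κ : ℝ} (h0 : 0 < γ) (hπ : γ ≤ π) (hκ : 0 < κ)
    {Λ : Set ℂ} (hΛ0 : ∀ lam ∈ Λ, lam ≠ 0)
    (hΛ : ∀ lam ∈ Λ, ∀ w : ℂ, |w.arg| ≤ γ → κ * ‖lam‖ ≤ ‖lam - w‖ ∧ κ * ‖w‖ ≤ ‖lam - w‖)
    (hgD : ∀ z ∈ region A a p ∩ D, |(g z).arg| ≤ γ) (hloc : LocalForm g a d p.φ) :
    ∃ r > 0, ∃ C, ∀ lam ∈ Λ, ∀ F : ℂ → ℂ, ContinuousOn F (region A a p) →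
      (∀ z ∈ region A a p ∩ D, F z = lam / (lam - g z)) → Near A a p q d r C F := by
  have hne := neBot_towards h.setup h.outer hd
  have hle := towards_mono (d := d) (show region A a p ⊆ bisector p.φ a from inter_subset_left)
  have hpos : ∀ lam ∈ Λ, ∀ w : ℂ, |w.arg| ≤ γ → 0 < ‖lam - w‖ := fun lam hl w hw =>
    (mul_pos hκ (norm_pos_iff.2 (hΛ0 lam hl))).trans_le (hΛ lam hl w hw).1
  have hb1 : ∀ lam ∈ Λ, ∀ w : ℂ, |w.arg| ≤ γ → ‖lam‖ / ‖lam - w‖ ≤ κ⁻¹ ∧ ‖w‖ / ‖lam - w‖ ≤ κ⁻¹ :=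
    fun lam hl w hw => by
      have h1 := hpos lam hl w hw
      obtain ⟨h2, h3⟩ := hΛ lam hl w hw
      constructor <;> rw [div_le_iff₀ h1, inv_mul_eq_div, le_div_iff₀ hκ, mul_comm] <;> assumption
  rcases hloc with ⟨f, hf, c, hc, ht, V, hV, hi⟩ | ⟨f, hf, α, hα, hΘ⟩
  · have ht' := ht.mono_left hle
    have hlim : ∀ c₀, Tendsto g (towards d (region A a p)) (𝓝 c₀) → |c₀.arg| ≤ γ := fun c₀ hc₀ => by
      rw [abs_arg_le_iff h0.le hπ]
      have hcl : IsClosed {w : ℂ | ‖w‖ * cos γ ≤ w.re} :=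
        isClosed_le (by fun_prop) continuous_re
      refine hcl.mem_of_frequently_of_tendsto
        ((frequently_mem_of_mem_codiscreteWithin hD h.isOpen d).mono fun z hz => ?_) hc₀
      exact (abs_arg_le_iff h0.le hπ _).1 (hgD z hz)
    have hi' := hi q.φ ⟨h.below.φ, h.setup.lt_pi_div_two h.inner⟩
    have hK : 0 < max κ⁻¹ (κ⁻¹ * κ⁻¹ * ‖c‖⁻¹) := by positivity
    obtain ⟨r, hr, C, hC⟩ := h.exists_near_of_regular hd hD ht' hV hi' hK
    refine ⟨r, hr, C, fun lam hl F hF hFD => ?_⟩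
    have hmain : ∀ c₀, |c₀.arg| ≤ γ → (∀ z ∈ region A a p ∩ D,
        ‖lam / (lam - g z) - lam / (lam - c₀)‖ ≤ κ⁻¹ * κ⁻¹ * ‖c‖⁻¹ * ‖f z - c‖) →
        Near A a p q d r C F := fun c₀ hc₀ hle => by
      refine hC F (lam / (lam - c₀)) hF ?_ fun z hz => ?_
      · rw [norm_div]
        exact (hb1 lam hl c₀ hc₀).1.trans (le_max_left _ _)
      · rw [hFD z hz]
        exact (hle z hz).trans (mul_le_mul_of_nonneg_right (le_max_right _ _) (norm_nonneg _))
    have hl0 := hΛ0 lam hl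
    rcases hf with rfl | rfl
    · have hc₀ := hlim c ht'
      refine hmain c hc₀ fun z hz => ?_
      have h1 := hpos lam hl c hc₀
      have h2 := hpos lam hl _ (hgD z hz)
      have n1 := norm_pos_iff.1 h1
      have n2 := norm_pos_iff.1 h2
      have e : lam / (lam - f z) - lam / (lam - c) =
          lam / (lam - f z) * (c / (lam - c)) * c⁻¹ * (f z - c) := by
        field_simp
        ring
      rw [e, norm_mul, norm_mul, norm_mul, norm_div, norm_div, norm_inv]
      have := (hb1 lam hl c hc₀).2
      have := (hb1 lam hl _ (hgD z hz)).1
      gcongr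
    · have hg : Tendsto g (towards d (region A a p)) (𝓝 c⁻¹) := by simpa using ht'.inv₀ hc
      have hc₀ := hlim _ hg
      refine hmain c⁻¹ hc₀ fun z hz => ?_
      have h1 := hpos lam hl _ hc₀
      have h2 := hpos lam hl _ (hgD z hz)
      have n1 := norm_pos_iff.1 h1
      have n2 := norm_pos_iff.1 h2
      have hb2 := hb1 lam hl _ (hgD z hz)
      have hb3 := hb1 lam hl _ hc₀
      rw [Pi.inv_apply]
      by_cases hgz : g z = 0
      · have e : lam / (lam - g z) - lam / (lam - c⁻¹) =
            lam / (lam - g z) * (c⁻¹ / (lam - c⁻¹)) * c⁻¹ * ((g z)⁻¹ - c) := by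
          grind
        rw [e, norm_mul, norm_mul, norm_mul, norm_div, norm_div, norm_inv c]
        have := hb2.1
        have := hb3.2
        rw [norm_inv c] at this
        gcongr
      · have e : lam / (lam - g z) - lam / (lam - c⁻¹) =
            g z / (lam - g z) * (lam / (lam - c⁻¹)) * c⁻¹ * (c - (g z)⁻¹) := by
          grind
        rw [e, norm_mul, norm_mul, norm_mul, norm_div, norm_div, norm_inv c, norm_sub_rev c]
        have := hb2.2
        have := hb3.1
        gcongr
  · have hΘ' := hΘ.mono hle
    obtain ⟨C₁, hC₁⟩ := hΘ'.1.bound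
    obtain ⟨C₂, hC₂⟩ := hΘ'.2.bound
    obtain ⟨r₀, hr₀, hb⟩ := eventually_towards_iff.1 (hC₁.and hC₂)
    have hdp := singPts_subset_pts hd
    obtain ⟨K, hK⟩ : ∃ K, K = κ⁻¹ * max 1 (max C₁ C₂) := ⟨_, rfl⟩
    have hK0 : 0 ≤ K := by rw [hK]; positivity
    have hKκ : κ⁻¹ ≤ K := by rw [hK]; exact le_mul_of_one_le_right (by positivity) (le_max_left _ _)
    obtain ⟨r, hr, C, hC⟩ := h.exists_near_of_poly hdp hD hα hr₀ hK0
    refine ⟨r, hr, C + 1, fun lam hl F hF hFD => ?_⟩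
    have hln : 0 < ‖lam‖ := norm_pos_iff.2 (hΛ0 lam hl)
    have hfb : ∀ z ∈ region A a p, gap d z < r₀ → 0 < gap d z ^ α ∧
        κ⁻¹ * ‖f z‖ ≤ K * gap d z ^ α ∧ κ⁻¹ * gap d z ^ α ≤ K * ‖f z‖ := fun z hz hg => by
      have h1 := gap_pos h.setup h.outer hdp hz
      obtain ⟨k1, k2⟩ := hb z hz hg
      rw [norm_of_nonneg (by positivity)] at k1 k2
      rw [hK, mul_assoc, mul_assoc]
      refine ⟨by positivity, ?_, ?_⟩ <;> refine mul_le_mul_of_nonneg_left ?_ (by positivity)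
      · exact k1.trans (mul_le_mul_of_nonneg_right
          ((le_max_left _ _).trans (le_max_right _ _)) (by positivity))
      · exact k2.trans (mul_le_mul_of_nonneg_right
          ((le_max_right _ _).trans (le_max_right _ _)) (by positivity))
    have hF1 : ∀ z ∈ region A a p ∩ D, ‖F z‖ = ‖lam‖ / ‖lam - g z‖ ∧
        ‖1 - F z‖ = ‖g z‖ / ‖lam - g z‖ := fun z hz => by
      have n2 := norm_pos_iff.1 (hpos lam hl _ (hgD z hz))
      have e : 1 - lam / (lam - g z) = -(g z / (lam - g z)) := by field_simp; ring
      rw [hFD z hz, e, norm_neg, norm_div, norm_div]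
      exact ⟨rfl, rfl⟩
    rcases hf with rfl | rfl
    · refine (hC ‖lam‖ hln F hF fun z hz hg => ?_).mono le_rfl (by linarith)
      obtain ⟨e1, e2⟩ := hF1 z hz
      obtain ⟨b1, b2⟩ := hb1 lam hl _ (hgD z hz)
      obtain ⟨k0, k1, k2⟩ := hfb z hz.1 hg
      refine ⟨⟨?_, ?_⟩, ?_, ?_⟩
      · rw [e2]; exact b2.trans hKκ
      · rw [e1]; exact b1.trans hKκ
      · rw [e2, div_mul_eq_mul_div, mul_comm ‖f z‖, ← div_mul_eq_mul_div]
        exact (mul_le_mul_of_nonneg_right b1 (norm_nonneg _)).trans k1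
      · have k3 : gap d z ^ α ≤ κ * (K * ‖f z‖) := by rwa [inv_mul_le_iff₀ hκ] at k2
        rw [e1]
        calc _ ≤ ‖lam‖ / ‖lam - f z‖ * (κ * (K * ‖f z‖)) := by gcongr
          _ = κ * K * ‖lam‖ * (‖f z‖ / ‖lam - f z‖) := by ring
          _ ≤ κ * K * ‖lam‖ * κ⁻¹ := by gcongr
          _ = K * ‖lam‖ := by field_simp
    · refine ((hC ‖lam‖⁻¹ (inv_pos.2 hln) (fun z => 1 - F z) (continuousOn_const.sub hF)
        fun z hz hg => ?_).one_sub h)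
      obtain ⟨e1, e2⟩ := hF1 z hz
      obtain ⟨b1, b2⟩ := hb1 lam hl _ (hgD z hz)
      obtain ⟨k0, k1, k2⟩ := hfb z hz.1 hg
      rw [Pi.inv_apply, norm_inv] at k1 k2
      have hn := hpos lam hl _ (hgD z hz)
      have hg0 : 0 < ‖g z‖ := by
        refine norm_pos_iff.2 fun h0 => ?_
        rw [h0, norm_zero, inv_zero, mul_zero] at k2
        exact absurd k2 (not_le.2 (by positivity))
      rw [sub_sub_cancel]
      refine ⟨⟨?_, ?_⟩, ?_, ?_⟩
      · rw [e1]; exact b1.trans hKκ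
      · rw [e2]; exact b2.trans hKκ
      · rw [e1]
        refine le_trans (le_of_eq ?_) ((mul_le_mul_of_nonneg_right b2
          (inv_nonneg.2 (norm_nonneg (g z)))).trans k1)
        field_simp
      · have k3 : gap d z ^ α ≤ κ * (K * ‖g z‖⁻¹) := by rwa [inv_mul_le_iff₀ hκ] at k2
        rw [e2]
        calc _ ≤ ‖g z‖ / ‖lam - g z‖ * (κ * (K * ‖g z‖⁻¹)) := by gcongr
          _ = κ * K * ‖lam‖⁻¹ * (‖lam‖ / ‖lam - g z‖) := by field_simp
          _ ≤ κ * K * ‖lam‖⁻¹ * κ⁻¹ := by gcongr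
          _ = K * ‖lam‖⁻¹ := by field_simp

end LocalForms

section Main

variable {g : ℂ → ℂ}

lemma isClosed_invComp {T S : X →L[ℂ] X} (hT : Function.Injective T) : (invComp T S).IsClosed := by
  have e : ((invComp T S).graph : Set (X × X)) = {v | T v.2 = S v.1} := by
    ext ⟨x, y⟩
    exact mem_graph_invComp hT x y
  rw [LinearPMap.IsClosed, e]
  exact isClosed_eq (by fun_prop) (by fun_prop)

lemma isResolventAt_invComp {T S W : X →L[ℂ] X} (hT : Function.Injective T) {lam : ℂ}
    (hl : lam ≠ 0) (h1 : (lam • T - S) * W = lam • T) (hWT : Commute W T) (hWS : Commute W S) :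
    IsResolventAt (invComp T S) lam (lam⁻¹ • W) := by
  have h2 : ∀ y, lam • T (W y) - S (W y) = lam • T y := fun y => DFunLike.congr_fun h1 y
  have h3 : ∀ y, W (T y) = T (W y) := fun y => DFunLike.congr_fun hWT.eq y
  have h4 : ∀ y, W (S y) = S (W y) := fun y => DFunLike.congr_fun hWS.eq y
  constructor
  · intro y
    have hy : ((lam⁻¹ • W) y, W y - y) ∈ (invComp T S).graph := by
      rw [mem_graph_invComp hT, ContinuousLinearMap.smul_apply, map_smul, map_sub]
      have := h2 y
      rw [sub_eq_iff_eq_add] at this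
      rw [sub_eq_iff_eq_add, eq_comm, ← smul_right_inj hl, smul_add, smul_inv_smul₀ hl, this]
      abel
    obtain ⟨v, hv1, hv2⟩ := (LinearPMap.mem_graph_iff _).1 hy
    simp only at hv1 hv2
    have hd : (lam⁻¹ • W) y ∈ (invComp T S).domain := hv1 ▸ v.2
    refine ⟨hd, ?_⟩
    have hv : (⟨(lam⁻¹ • W) y, hd⟩ : (invComp T S).domain) = v := Subtype.ext hv1.symm
    rw [hv, hv2, ContinuousLinearMap.smul_apply, smul_inv_smul₀ hl]
    abel
  · intro x
    have hx := (mem_graph_invComp hT (x : X) (invComp T S x)).1 (LinearPMap.mem_graph _ x)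
    apply hT
    rw [ContinuousLinearMap.smul_apply, map_smul, ← h3, map_sub, map_smul, hx, map_sub, map_smul,
      h3, h4, h2, inv_smul_smul₀ hl]

variable [CompleteSpace X]

lemma exists_norm_resolvent_le [Nontrivial X] (hS : Setup A ω a) {B : X →ₗ.[ℂ] X}
    (hgB : IsNFC A ω a g B) {γ φ : ℝ} (h0 : 0 < γ) (hπ : γ ≤ π) (hγφ : γ < φ) {p₁ : Params}
    (hp₁ : Admissible A ω a p₁)
    (hg₁ : ∀ z ∈ region A a p₁, AnalyticAt ℂ g z → g z ∈ closure (sector γ))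
    (hloc : ∀ d ∈ singPts A a, ∃ ψ ∈ Ioo 0 ω, LocalForm g a d ψ) :
    ∃ M, ∀ lam : ℂ, lam ≠ 0 → φ ≤ |lam.arg| → lam ∈ resolventSet B ∧ ‖lam • res B lam‖ ≤ M := by
  obtain ⟨p₀, hp₀, hgm, e, k, T, S, he, hk, hT, hek, rfl⟩ := hgB
  have hω := hS.hω
  obtain ⟨ψ, hψ, hψl⟩ : ∃ ψ < ω, ∀ d ∈ sing A a, ∃ ψ' ≤ ψ, 0 < ψ' ∧ LocalForm g a d ψ' := by
    have h1 : ∀ d, ∃ ψ ∈ Ioo 0 ω, d ∈ sing A a → LocalForm g a d ψ := fun d => by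
      by_cases hd : d ∈ sing A a
      · obtain ⟨ψ, hψ, h2⟩ := hloc d (mem_sing.1 hd)
        exact ⟨ψ, hψ, fun _ => h2⟩
      · exact ⟨ω / 2, ⟨by linarith [hω.1], by linarith [hω.1]⟩, fun h => absurd h hd⟩
    choose f hf hfl using h1
    obtain ⟨r, hr, hrω, hrf⟩ := Finset.exists_pos_le (sing A a) (fun d => ω - f d)
      (fun d => sub_pos.2 (hf d).2) hω.1
    exact ⟨ω - r, by linarith, fun d hd => ⟨f d, by linarith [hrf d hd], (hf d).1, hfl d hd⟩⟩
  obtain ⟨p, hpdef⟩ : ∃ p : Params, p = ⟨max (max p₀.φ p₁.φ) ψ, max p₀.ε p₁.ε, min p₀.R p₁.R⟩ :=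
    ⟨_, rfl⟩
  have hp : Admissible A ω a p := by rw [hpdef]; exact hp₀.sup hp₁ hψ
  have hpφ := hS.lt_pi_div_two hp
  have c1 : p₀.φ ≤ p.φ := by rw [hpdef]; exact (le_max_left _ _).trans (le_max_left _ _)
  have c2 : p₁.φ ≤ p.φ := by rw [hpdef]; exact (le_max_right _ _).trans (le_max_left _ _)
  have c3 : p₀.ε ≤ p.ε := by rw [hpdef]; exact le_max_left _ _
  have c4 : p₁.ε ≤ p.ε := by rw [hpdef]; exact le_max_right _ _
  have c5 : p.R ≤ p₀.R := by rw [hpdef]; exact min_le_left _ _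
  have c6 : p.R ≤ p₁.R := by rw [hpdef]; exact min_le_right _ _
  have c7 : ψ ≤ p.φ := by rw [hpdef]; exact le_max_right _ _
  have s₀ : region A a p ⊆ region A a p₀ := region_mono hp₀.1.1 c1 hpφ c3 c5
  have s₁ : region A a p ⊆ region A a p₁ := region_mono hp₁.1.1 c2 hpφ c4 c6
  obtain ⟨δ, hδ, hδq⟩ := hp.mono_shift
  have hq := hδq δ hδ.le le_rfl
  have h : Pair A ω a p (p.shift δ) := ⟨hS, hp, hq, ⟨lt_add_of_pos_right _ hδ,
    lt_add_of_pos_right _ hδ, sub_lt_self _ hδ⟩⟩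
  have hbelow : p₀.Below (p.shift δ) := ⟨c1.trans_lt h.below.φ, c3.trans_lt h.below.ε,
    h.below.R.trans_le c5⟩
  have ce := he.calc h hp₀ hbelow s₀
  have ck := hk.calc h hp₀ hbelow s₀
  obtain ⟨D, hDdef⟩ : ∃ D : Set ℂ, D = {z | AnalyticAt ℂ g z ∧ k z = e z * g z} := ⟨_, rfl⟩
  have hD : D ∈ codiscreteWithin (region A a p) := by
    rw [hDdef]
    refine Filter.codiscreteWithin_mono s₀ ?_
    filter_upwards [hgm.analyticAt_mem_codiscreteWithin, hek] with z h1 h2 using ⟨h1, h2⟩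
  have hgD : ∀ z ∈ region A a p, AnalyticAt ℂ g z → |(g z).arg| ≤ γ := fun z hz hza =>
    abs_arg_le_of_mem_closure h0 hπ (hg₁ z (s₁ hz) hza)
  obtain ⟨κ, hκ, hκe⟩ := exists_sector_gap hγφ
  obtain ⟨Λ, hΛ⟩ : ∃ Λ : Set ℂ, Λ = {lam | lam ≠ 0 ∧ φ ≤ |lam.arg|} := ⟨_, rfl⟩
  have hnear : ∀ d, ∃ r > 0, ∃ C, 0 ≤ C ∧ (d ∈ sing A a → ∀ lam ∈ Λ, ∀ F : ℂ → ℂ,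
      ContinuousOn F (region A a p) → (∀ z ∈ region A a p ∩ D, F z = lam / (lam - g z)) →
      Near A a p (p.shift δ) d r C F) := fun d => by
    by_cases hd : d ∈ sing A a
    · obtain ⟨ψ', hψ', h1, h2⟩ := hψl d hd
      obtain ⟨r, hr, C, hC⟩ := h.exists_near (mem_sing.1 hd) hD h0 hπ hκ (Λ := Λ)
        (fun lam hl => by rw [hΛ] at hl; exact hl.1)
        (fun lam hl w hw => by rw [hΛ] at hl; exact hκe lam w hl.2 hw)
        (fun z hz => hgD z hz.1 (by have := hz.2; rw [hDdef] at this; exact this.1))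
        (h2.mono h1 (hψ'.trans c7) hpφ)
      exact ⟨r, hr, max C 0, le_max_right _ _, fun _ lam hl F hF hFD =>
        (hC lam hl F hF hFD).mono le_rfl (le_max_left _ _)⟩
    · exact ⟨1, one_pos, 0, le_rfl, fun h => absurd h hd⟩
  choose r hr C hC0 hC using hnear
  obtain ⟨r₀, hr₀, -, hrr⟩ := Finset.exists_pos_le (sing A a) r hr one_pos
  have hsum : 0 ≤ ∑ d ∈ sing A a, C d := sum_nonneg fun d _ => hC0 d
  obtain ⟨M, hM⟩ := h.exists_calc_of_near (C := κ⁻¹ + ∑ d ∈ sing A a, C d) hr₀ (by positivity)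
  refine ⟨M, fun lam hl hlφ => ?_⟩
  have hκg : ∀ z ∈ region A a p, AnalyticAt ℂ g z → κ * ‖lam‖ ≤ ‖lam - g z‖ := fun z hz hza =>
    (hκe lam _ hlφ (hgD z hz hza)).1
  obtain ⟨F, hF, hFg⟩ := exists_differentiableOn_extension (fun z hz => hgm z (s₀ hz)) h.isOpen hκ hl hκg
  have hDa : ∀ z ∈ region A a p ∩ D, AnalyticAt ℂ g z ∧ k z = e z * g z := fun z hz => by
    have := hz.2
    rwa [hDdef] at this
  have hFD : ∀ z ∈ region A a p ∩ D, F z = lam / (lam - g z) := fun z hz => hFg z hz.1 (hDa z hz).1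
  have hne : ∀ z ∈ region A a p ∩ D, 0 < ‖lam - g z‖ := fun z hz =>
    (mul_pos hκ (norm_pos_iff.2 hl)).trans_le (hκg z hz.1 (hDa z hz).1)
  have hFb : ∀ z ∈ region A a p, ‖F z‖ ≤ κ⁻¹ :=
    le_of_mem_codiscreteWithin hD h.isOpen subset_rfl (f := fun z => ‖F z‖) (b := fun _ => κ⁻¹)
      hF.continuousOn.norm continuousOn_const fun z hz => by
        rw [hFD z hz, norm_div, div_le_iff₀ (hne z hz), inv_mul_eq_div, le_div_iff₀ hκ, mul_comm]
        exact hκg z hz.1 (hDa z hz).1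
  obtain ⟨W, cW, hW⟩ := hM F hF (fun z hz => (hFb z hz).trans (le_add_of_nonneg_right hsum))
    fun d hd => (hC d hd lam (by rw [hΛ]; exact ⟨hl, hlφ⟩) F hF.continuousOn hFD).mono (hrr d hd)
      (le_add_of_nonneg_of_le (by positivity) (single_le_sum (fun d _ => hC0 d) hd))
  have hce := (ce.differentiableOn hS hp).continuousOn
  have hck := (ck.differentiableOn hS hp).continuousOn
  have hid : EqOn (fun z => (lam * e z - k z) * F z) (fun z => lam * e z) (region A a p) := by
    have h1 := le_of_mem_codiscreteWithin hD h.isOpen subset_rfl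
      (f := fun z => ‖(lam * e z - k z) * F z - lam * e z‖) (b := fun _ => 0)
      ((((continuousOn_const.mul hce).sub hck).mul hF.continuousOn).sub
        (continuousOn_const.mul hce)).norm continuousOn_const fun z hz => by
          have hn := norm_pos_iff.1 (hne z hz)
          rw [hFD z hz, (hDa z hz).2]
          refine le_of_eq (norm_eq_zero.2 ?_)
          field_simp
          ring
    exact fun z hz => sub_eq_zero.1 (norm_le_zero_iff.1 (h1 z hz))
  have e1 := Calc.unique h (((ce.const_mul h lam).sub h ck).mul h cW) (ce.const_mul h lam) hid
  have e2 : Commute W T := Calc.unique h (cW.mul h ce) (ce.mul h cW) fun z _ => mul_comm _ _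
  have e3 : Commute W S := Calc.unique h (cW.mul h ck) (ck.mul h cW) fun z _ => mul_comm _ _
  have hR := isResolventAt_invComp hT hl e1 e2 e3
  refine ⟨⟨_, hR⟩, ?_⟩
  rw [hR.res_eq, smul_inv_smul₀ hl]
  exact hW

lemma isSectorial_of_subsingleton [Subsingleton X] (B : X →ₗ.[ℂ] X) (β : ℝ) : IsSectorial B β := by
  have hR : ∀ lam, lam ∈ resolventSet B := fun lam => by
    refine ⟨0, fun y => ⟨?_, Subsingleton.elim _ _⟩, fun x => Subsingleton.elim _ _⟩
    rw [ContinuousLinearMap.zero_apply]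
    exact B.domain.zero_mem
  refine ⟨(Set.subsingleton_of_subsingleton).isClosed, fun lam hl => absurd (hR lam) hl,
    fun φ _ => ⟨1, one_pos, fun lam _ => ?_⟩⟩
  have : lam • res B lam = 0 := ContinuousLinearMap.ext fun x => Subsingleton.elim _ _
  rw [this, norm_zero]
  exact zero_le_one

end Main

end BisectorialNFC

open BisectorialNFC
theorem mainTheorem1 {X : Type*} [NormedAddCommGroup X] [NormedSpace ℂ X] [CompleteSpace X]
    (ω a β : ℝ) (hω : ω ∈ Ioc 0 (Real.pi / 2)) (ha : 0 ≤ a) (hβ : β ∈ Ico 0 Real.pi)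
    (A : X →ₗ.[ℂ] X) (hA : IsBisectorial A ω a) (g : ℂ → ℂ) (B : X →ₗ.[ℂ] X) (hgB : IsNFC A ω a g B)
    (h_sector : ∀ γ ∈ Ioo β Real.pi, ∃ p : Params, Admissible A ω a p ∧
      ∀ z ∈ region A a p, AnalyticAt ℂ g z → g z ∈ closure (sector γ))
    (h_quasi : ∀ d ∈ singPts A a, QuasiRegularAt g ω a d)
    (h_poly : ∀ d ∈ singPts A a, (TendsAt g ω a d 0 → ExactPolyZeroAt g ω a d) ∧
      (TendsAt g⁻¹ ω a d 0 → ExactPolyZeroAt g⁻¹ ω a d)) :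
    IsSectorial B β := by
  rcases subsingleton_or_nontrivial X with hX | hX
  · exact isSectorial_of_subsingleton B β
  have hS : Setup A ω a := ⟨hω, ha, hA⟩
  have key : ∀ φ, β < φ → φ ≤ Real.pi → ∃ M, ∀ lam : ℂ, lam ≠ 0 → φ ≤ |lam.arg| →
      lam ∈ resolventSet B ∧ ‖lam • res B lam‖ ≤ M := fun φ h1 h2 => by
    have h3 : (β + φ) / 2 ∈ Ioo β Real.pi := ⟨by linarith, by linarith [hβ.2]⟩
    obtain ⟨p, hp, hpg⟩ := h_sector _ h3
    exact exists_norm_resolvent_le hS hgB (by linarith [hβ.1]) h3.2.le (by linarith) hp hpg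
      fun d hd => exists_localForm hω.2 (h_quasi d hd) (h_poly d hd)
  refine ⟨?_, fun lam hl => ?_, fun φ hφ => ?_⟩
  · obtain ⟨_, _, _, _, _, _, _, _, _, hT, _, rfl⟩ := hgB
    exact isClosed_invComp hT
  · by_contra hc
    have h0 : lam ≠ 0 := fun h => hc (mem_closure_sector hβ.1 (Or.inl h))
    have h1 : β < |lam.arg| := not_le.1 fun h => hc (mem_closure_sector hβ.1 (Or.inr h))
    obtain ⟨M, hM⟩ := key _ h1 (Complex.abs_arg_le_pi lam)
    exact hl (hM lam h0 le_rfl).1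
  · obtain ⟨M, hM⟩ := key φ hφ.1 hφ.2.le
    refine ⟨max M 1, by positivity, fun lam hl => ?_⟩
    rcases eq_or_ne lam 0 with rfl | h0
    · rw [zero_smul, norm_zero]; positivity
    · have h1 : φ ≤ |lam.arg| := not_lt.1 fun h => hl (Or.inr ⟨(hβ.1.trans_lt hφ.1).ne', h0, h⟩)
      exact (hM lam h0 h1).2.trans (le_max_left _ _)
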